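/- Let $k$ be a commutative ring and $\mathscr{T}$ a small dg category over $k$ all of whose hom complexes $\mathscr{T}(x,y)$ are cofibrant complexes of $k$-modules (automatic if $k$ is a field). Modules are right dg $\mathscr{T}$-modules; "cofibrant" refers to the projective model structures (on modules, bimodules and 2-fold bimodules). A module is *perfect* if it is cofibrant and compact in the homotopy category of modules; $\mathscr{T}_{pe}$ is the dg category of perfect modules. For a $\mathscr{T}$-bimodule $\Phi$ write $X\otimes\Phi$ for the module $X\otimes_{\mathscr{T}}\Phi$. For a 2-fold bimodule $\Gamma$ (two left actions and one right action of $\mathscr{T}$) write $\Gamma(X,Y)=X\otimes_{\mathscr{T}}Y\otimes_{\mathscr{T}}\Gamma$. "Natural" means dg natural in all modules $X,Y,Z,W$ involved, i.e. for morphisms of all degrees with the Koszul sign rule. Equivalently, the family comes from a morphism of the corresponding multi-fold bimodules. A *pseudo dg-tensor structure* $(\Gamma,U,\alpha,\ell,r,c)$ consists of a 2-fold bimodule $\Gamma$, a module $U$, and natural closed degree-$0$ morphisms $$\alpha_{X,Y,Z}:\Gamma(X,\Gamma(Y,Z))\to\Gamma(\Gamma(X,Y),Z),\quad \ell_X:\Gamma(U,X)\to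 X,\quad r_X:\Gamma(X,U)\to X,\quad c_{X,Y}:\Gamma(X,Y)\to\Gamma(Y,X),$$ which are quasi-isomorphisms for cofibrant $X,Y,Z$, such that $c_{Y,X}\circ c_{X,Y}$ is homotopic to the identity for cofibrant $X,Y$, and such that there exist natural degree $-1$ morphisms $\eta,\mu,\kappa,\lambda$ with $$\alpha_{\Gamma(X,Y),Z,W}\circ\alpha_{X,Y,\Gamma(Z,W)}-\Gamma(\alpha_{X,Y,Z},W)\circ\alpha_{X,\Gamma(Y,Z),W}\circ\Gamma(X,\alpha_{Y,Z,W})=d(\eta),$$ $$\Gamma(r_X,Y)\circ\alpha_{X,U,Y}-\Gamma(X,\ell_Y)=d(\mu),\qquad \ell_X\circ c_{X,U}-r_X=d(\kappa),$$ $$\alpha_{X,Y,Z}\circ c_{\Gamma(Y,Z),X}\circ\alpha_{Y,Z,X}\circ\Gamma(Y,c_{X,Z})-\Gamma(c_{Y,X},Z)\circ\alpha_{Y,X,Z}=d(\lambda).$$ It is *perfect* if $\Gamma$ is cofibrant, and $U$ and all $\Gamma(X,Y)$ with $X,Y$ perfect are quasi-isomorphic to perfect modules. Let $\Gamma$ and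 $\Lambda$ be perfect pseudo dg-tensor structures with units $U_\Gamma$ and $U_\Lambda$. A *pseudo dg-tensor functor* from $\Gamma$ to $\Lambda$ consists of a cofibrant bimodule $\Phi$ such that $X\otimes\Phi$ is quasi-isomorphic to a perfect module for all perfect $X$, a quasi-isomorphism $u:U_\Lambda\to U_\Gamma\otimes\Phi$, and natural closed degree-$0$ morphisms $$f_{X,Y}:\Lambda(X\otimes\Phi,Y\otimes\Phi)\to\Gamma(X,Y)\otimes\Phi,$$ quasi-isomorphisms for cofibrant $X,Y$, such that the following pairs of natural morphisms differ by the differential of a natural degree $-1$ morphism: 1. $(\ell^\Gamma_X\otimes\Phi)\circ f_{U_\Gamma,X}\circ\Lambda(u,X\otimes\Phi)$ and $\ell^\Lambda_{X\otimes\Phi}$; 2. $(c^\Gamma_{X,Y}\otimes\Phi)\circ f_{X,Y}$ and $f_{Y,X}\circ c^\Lambda_{X\otimes\Phi,Y\otimes\Phi}$; 3. $f_{\Gamma(X,Y),Z}\circ\Lambda(f_{X,Y},Z\otimes\Phi)\circ\alpha^\Lambda_{X\otimes\Phi,Y\otimes\Phi,Z\otimes\Phi}$ and $(\alpha^\Gamma_{X,Y,Z}\otimes\Phi)\circ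 f_{X,\Gamma(Y,Z)}\circ\Lambda(X\otimes\Phi,f_{Y,Z})$. **Lemma.** Each of $\Gamma$ and $\Lambda$ induces a tensor triangulated structure on $H^0(\mathscr{T}_{pe})$: with the mapping cone triangles, $H^0(\mathscr{T}_{pe})$ is a triangulated category, and it carries a $k$-linear symmetric monoidal structure, exact in each variable, whose tensor product, unit, associator, unitors and braiding are identified, through quasi-isomorphisms $X\boxtimes Y\to\Gamma(X,Y)$ (natural in the homotopy category) and $\mathbf 1\to U_\Gamma$, with $\Gamma(X,Y)$, $U_\Gamma$, $\alpha,\ell,r,c$; likewise for $\Lambda$. Moreover, for every such choice of induced tensor triangulated categories $H^0(\mathscr{T}_{pe},\Gamma)$ and $H^0(\mathscr{T}_{pe},\Lambda)$, a pseudo dg-tensor functor $(\Phi,u,f)$ from $\Gamma$ to $\Lambda$ induces a tensor triangulated functor $$\mathscr{F}_\Phi:H^0(\mathscr{T}_{pe},\Gamma)\to H^0(\mathscr{T}_{pe},\Lambda),$$ i.e. a $k$-linear exact strong symmetric monoidal functor, together with quasi-isomorphisms $\mathscr{F}_\Phi(X)\to X\otimes\Phi$, natural in the homotopy category, that identify its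 monoidal structure maps $\mathscr{F}_\Phi(X)\boxtimes\mathscr{F}_\Phi(Y)\to\mathscr{F}_\Phi(X\boxtimes Y)$ and $\mathbf 1\to\mathscr{F}_\Phi(\mathbf 1)$ with $f$ and $u$. -/

import Mathlib

open CategoryTheory CochainComplex.HomComplex

universe u

namespace DG

noncomputable section

abbrev Cplx (k : Type u) [CommRing k] := CochainComplex (ModuleCat.{u} k) ℤ

/-- Small dg categories over `k`. Here `comp f g` is `f` followed by `g`, that is, `g ∘ f`. -/
class DGCategory (k : Type u) [CommRing k] (T : Type u) where
  hom : T → T → Cplx k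
  id (x : T) : (hom x x).X 0
  comp {x y z : T} {p q n : ℤ} (h : p + q = n) :
    (hom x y).X p →ₗ[k] (hom y z).X q →ₗ[k] (hom x z).X n
  id_comp {x y : T} {p : ℤ} (f : (hom x y).X p) : comp (zero_add p) (id x) f = f
  comp_id {x y : T} {p : ℤ} (f : (hom x y).X p) : comp (add_zero p) f (id y) = f
  assoc {w x y z : T} {p q r a b n : ℤ} (ha : p + q = a) (hb : q + r = b) (hn : a + r = n)
    (hn' : p + b = n) (f : (hom w x).X p) (g : (hom x y).X q) (h : (hom y z).X r) :
    comp hn (comp ha f g) h = comp hn' f (comp hb g h)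
  d_id (x : T) : ((hom x x).d 0 1).hom (id x) = 0
  d_comp {x y z : T} {p q p' q' n n' : ℤ} (hp : p + 1 = p') (hq : q + 1 = q') (hn : n + 1 = n')
    (h : p + q = n) (f : (hom x y).X p) (g : (hom y z).X q) :
    ((hom x z).d n n').hom (comp h f g) =
      comp (show p + q' = n' by lia) f (((hom y z).d q q').hom g) +
        q.negOnePow • comp (show p' + q = n' by lia) (((hom x y).d p p').hom f) g

/-- Right dg modules over `T`. -/
structure DGMod (k : Type u) [CommRing k] (T : Type u) [DGCategory k T] where
  obj : T → Cplx k
  act {x y : T} {p q n : ℤ} (h : p + q = n) :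
    (obj y).X p →ₗ[k] (DGCategory.hom (k := k) x y).X q →ₗ[k] (obj x).X n
  act_id {x : T} {p : ℤ} (m : (obj x).X p) : act (add_zero p) m (DGCategory.id x) = m
  act_act {x y z : T} {p q r a b n : ℤ} (ha : p + q = a) (hb : r + q = b) (hn : a + r = n)
    (hn' : p + b = n) (m : (obj z).X p) (g : (DGCategory.hom (k := k) y z).X q)
    (f : (DGCategory.hom (k := k) x y).X r) :
    act hn (act ha m g) f = act hn' m (DGCategory.comp hb f g)
  d_act {x y : T} {p q p' q' n n' : ℤ} (hp : p + 1 = p') (hq : q + 1 = q') (hn : n + 1 = n')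
    (h : p + q = n) (m : (obj y).X p) (f : (DGCategory.hom (k := k) x y).X q) :
    ((obj x).d n n').hom (act h m f) =
      act (show p' + q = n' by lia) (((obj y).d p p').hom m) f +
        p.negOnePow • act (show p + q' = n' by lia) m (((DGCategory.hom x y).d q q').hom f)

variable {k : Type u} [CommRing k] {T : Type u} [DGCategory k T]

/-- The graded module morphisms of degree `n`. -/
def dgHom (n : ℤ) (M N : DGMod k T) : Submodule k (∀ t, Cochain (M.obj t) (N.obj t) n) where
  carrier := {φ | ∀ ⦃x y : T⦄ ⦃p q a b c : ℤ⦄ (ha : p + q = a) (hb : p + n = b) (hc : a + n = c)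
    (hc' : b + q = c) (m : (M.obj y).X p) (f : (DGCategory.hom (k := k) x y).X q),
    ((φ x).v a c hc).hom (M.act ha m f) = N.act hc' (((φ y).v p b hb).hom m) f}
  add_mem' {φ ψ} hφ hψ x y p q a b c ha hb hc hc' m f := by
    simp [hφ ha hb hc hc' m f, hψ ha hb hc hc' m f]
  zero_mem' x y p q a b c ha hb hc hc' m f := by simp
  smul_mem' r φ hφ x y p q a b c ha hb hc hc' m f := by
    simp [hφ ha hb hc hc' m f]

abbrev DGHom (n : ℤ) (M N : DGMod k T) : Type u := dgHom n M N

namespace DGHom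

variable {M N P : DGMod k T}

lemma map_act {n : ℤ} (φ : DGHom n M N) {x y : T} {p q a b c : ℤ} (ha : p + q = a)
    (hb : p + n = b) (hc : a + n = c) (hc' : b + q = c) (m : (M.obj y).X p)
    (f : (DGCategory.hom (k := k) x y).X q) :
    ((φ.1 x).v a c hc).hom (M.act ha m f) = N.act hc' (((φ.1 y).v p b hb).hom m) f :=
  φ.2 ha hb hc hc' m f

def id (M : DGMod k T) : DGHom 0 M M :=
  ⟨fun t => Cochain.ofHom (𝟙 (M.obj t)), fun x y p q a b c ha hb hc hc' m f => by
    obtain rfl : b = p := by lia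
    obtain rfl : c = a := by lia
    simp⟩

def comp {p q n : ℤ} (φ : DGHom p M N) (ψ : DGHom q N P) (h : p + q = n) : DGHom n M P :=
  ⟨fun t => (φ.1 t).comp (ψ.1 t) h, fun x y i j a b c ha hb hc hc' m f => by
    rw [Cochain.comp_v _ _ h a (a + p) c rfl (by lia),
      Cochain.comp_v _ _ h i (i + p) b rfl (by lia)]
    simp only [ModuleCat.hom_comp, LinearMap.comp_apply]
    rw [φ.map_act ha rfl rfl (by lia), ψ.map_act _ (b := b) (by lia) _ hc']⟩

def δ (n m : ℤ) (φ : DGHom n M N) : DGHom m M N :=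
  ⟨fun t => CochainComplex.HomComplex.δ n m (φ.1 t), fun x y i j a b c ha hb hc hc' e f => by
    by_cases h : n + 1 = m
    · rw [δ_v n m h _ a c hc (a + n) (a + 1) (by lia) rfl,
        δ_v n m h _ i b hb (i + n) (i + 1) (by lia) rfl]
      simp
      rw [φ.map_act ha rfl rfl (by lia), M.d_act rfl rfl rfl, N.d_act (p' := b) (by lia) rfl (by lia)]
      simp
      rw [φ.map_act (b := b) (p := i+1) (by lia) (by lia) (by lia) hc', φ.map_act (b := i+n) (q := j+1) (by lia) (by lia) (by lia) (by lia)]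
      subst h
      simp only [smul_smul, Int.negOnePow_add, Int.negOnePow_one, mul_neg, mul_one, neg_mul, Units.neg_smul,
        mul_comm i.negOnePow]
      abel
    · simp [δ_shape n m h]⟩


lemma ext_apply {n : ℤ} {φ ψ : DGHom n M N} (h : ∀ (t : T) (p q : ℤ) (hpq : p + n = q)
    (m : (M.obj t).X p), ((φ.1 t).v p q hpq).hom m = ((ψ.1 t).v p q hpq).hom m) : φ = ψ := by
  apply Subtype.ext
  funext t
  ext p q hpq m
  exact h t p q hpq m

@[simp] lemma id_v (t : T) (p q : ℤ) (h : p + 0 = q) :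
    ((DGHom.id M).1 t).v p q h = (HomologicalComplex.XIsoOfEq (M.obj t) (by lia : p = q)).hom := by
  obtain rfl : q = p := by lia
  simp [DGHom.id]

lemma comp_apply {p q n : ℤ} (φ : DGHom p M N) (ψ : DGHom q N P) (h : p + q = n) (t : T)
    {a b c : ℤ} (hab : a + p = b) (hbc : b + q = c) (hac : a + n = c) (m : (M.obj t).X a) :
    (((φ.comp ψ h).1 t).v a c hac).hom m =
      ((ψ.1 t).v b c hbc).hom (((φ.1 t).v a b hab).hom m) := by
  simp [DGHom.comp, Cochain.comp_v _ _ h a b c hab hbc]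

lemma δ_apply {n n' : ℤ} (hn : n + 1 = n') (φ : DGHom n M N) (t : T) {a a' b c : ℤ}
    (ha : a + 1 = a') (hb : a + n = b) (hc : a + n' = c) (m : (M.obj t).X a) :
    (((φ.δ n n').1 t).v a c hc).hom m = ((N.obj t).d b c).hom (((φ.1 t).v a b hb).hom m) +
      n'.negOnePow • ((φ.1 t).v a' c (by lia)).hom (((M.obj t).d a a').hom m) := by
  simp [DGHom.δ, δ_v n n' hn _ a c hc b a' (by lia) ha]

lemma add_comp {p q n : ℤ} (φ φ' : DGHom p M N) (ψ : DGHom q N P) (h : p + q = n) :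
    (φ + φ').comp ψ h = φ.comp ψ h + φ'.comp ψ h :=
  Subtype.ext (funext fun _ => Cochain.add_comp _ _ _ h)

lemma comp_add {p q n : ℤ} (φ : DGHom p M N) (ψ ψ' : DGHom q N P) (h : p + q = n) :
    φ.comp (ψ + ψ') h = φ.comp ψ h + φ.comp ψ' h :=
  Subtype.ext (funext fun _ => Cochain.comp_add _ _ _ h)

lemma smul_comp {p q n : ℤ} (r : k) (φ : DGHom p M N) (ψ : DGHom q N P) (h : p + q = n) :
    (r • φ).comp ψ h = r • φ.comp ψ h :=
  Subtype.ext (funext fun _ => Cochain.smul_comp _ _ _ h)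

lemma comp_smul {p q n : ℤ} (φ : DGHom p M N) (r : k) (ψ : DGHom q N P) (h : p + q = n) :
    φ.comp (r • ψ) h = r • φ.comp ψ h :=
  Subtype.ext (funext fun _ => Cochain.comp_smul _ _ _ h)

lemma zero_comp {p q n : ℤ} (ψ : DGHom q N P) (h : p + q = n) :
    (0 : DGHom p M N).comp ψ h = 0 :=
  Subtype.ext (funext fun _ => Cochain.zero_comp _ h)

lemma comp_zero {p q n : ℤ} (φ : DGHom p M N) (h : p + q = n) :
    φ.comp (0 : DGHom q N P) h = 0 :=
  Subtype.ext (funext fun _ => Cochain.comp_zero _ h)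

@[simp] lemma units_smul_v {n : ℤ} (r : ℤˣ) (φ : DGHom n M N) (t : T) (p q : ℤ) (h : p + n = q) :
    ((r • φ).1 t).v p q h = r • (φ.1 t).v p q h := by
  rcases Int.units_eq_one_or r with rfl | rfl <;> simp

end DGHom

/-- Closed morphisms of degree `0`. -/
def homSubmodule (M N : DGMod k T) : Submodule k (∀ t, M.obj t ⟶ N.obj t) where
  carrier := {φ | ∀ ⦃x y : T⦄ ⦃p q n : ℤ⦄ (h : p + q = n) (m : (M.obj y).X p)
    (f : (DGCategory.hom (k := k) x y).X q),
    ((φ x).f n).hom (M.act h m f) = N.act h (((φ y).f p).hom m) f}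
  add_mem' {φ ψ} hφ hψ x y p q n h m f := by simp [hφ h m f, hψ h m f]
  zero_mem' x y p q n h m f := by simp
  smul_mem' r φ hφ x y p q n h m f := by simp [hφ h m f]

instance : Category.{u} (DGMod k T) where
  Hom M N := homSubmodule M N
  id M := ⟨fun t => 𝟙 _, fun x y p q n h m f => by simp⟩
  comp φ ψ := ⟨fun t => φ.1 t ≫ ψ.1 t, fun x y p q n h m f => by
    simp [φ.2 h m f, ψ.2 h _ f]⟩

instance : Preadditive (DGMod k T) where
  homGroup M N := inferInstanceAs (AddCommGroup (homSubmodule M N))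
  add_comp M N P φ φ' ψ := by apply Subtype.ext; funext t; exact Preadditive.add_comp _ _ _ _ _ _
  comp_add M N P φ ψ ψ' := by apply Subtype.ext; funext t; exact Preadditive.comp_add _ _ _ _ _ _

instance : Linear k (DGMod k T) where
  homModule M N := inferInstanceAs (Module k (homSubmodule M N))
  smul_comp M N P r φ ψ := by apply Subtype.ext; funext t; exact Linear.smul_comp (R := k) (C := Cplx k) _ _ _ _ _ _
  comp_smul M N P φ r ψ := by apply Subtype.ext; funext t; exact Linear.comp_smul (R := k) (C := Cplx k) _ _ _ _ _ _

namespace DGMod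

def app {M N : DGMod k T} (φ : M ⟶ N) (t : T) : M.obj t ⟶ N.obj t := φ.1 t

@[simp] lemma comp_app {M N P : DGMod k T} (φ : M ⟶ N) (ψ : N ⟶ P) (t : T) :
    app (φ ≫ ψ) t = app φ t ≫ app ψ t := rfl

@[simp] lemma id_app (M : DGMod k T) (t : T) : app (𝟙 M) t = 𝟙 (M.obj t) := rfl

end DGMod

def DGHom.ofHom {M N : DGMod k T} : (M ⟶ N) →ₗ[k] DGHom 0 M N where
  toFun φ := ⟨fun t => Cochain.ofHom (φ.1 t), fun x y p q a b c ha hb hc hc' m f => by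
    obtain rfl : b = p := by lia
    obtain rfl : c = a := by lia
    simpa using φ.2 ha m f⟩
  map_add' φ ψ := by apply Subtype.ext; funext t; exact Cochain.ofHom_add _ _
  map_smul' r φ := by
    apply Subtype.ext; funext t
    ext p
    simp; rfl

/-- Bimodules: dg functors from `T` to right dg modules, so a left and a right action of `T`. -/
structure Bimod (k : Type u) [CommRing k] (T : Type u) [DGCategory k T] where
  obj : T → DGMod k T
  map {x y : T} {n : ℤ} : (DGCategory.hom (k := k) x y).X n →ₗ[k] DGHom n (obj x) (obj y)
  map_id (x : T) : map (DGCategory.id x) = DGHom.id (obj x)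
  map_comp {x y z : T} {p q n : ℤ} (h : p + q = n) (f : (DGCategory.hom (k := k) x y).X p)
    (g : (DGCategory.hom (k := k) y z).X q) :
    map (DGCategory.comp h f g) = (map f).comp (map g) h
  map_d {x y : T} {n n' : ℤ} (h : n + 1 = n') (f : (DGCategory.hom (k := k) x y).X n) :
    map (((DGCategory.hom x y).d n n').hom f) = (map f).δ n n'

/-- The graded bimodule morphisms of degree `n`. -/
def bimodHom (n : ℤ) (B C : Bimod k T) : Submodule k (∀ s, DGHom n (B.obj s) (C.obj s)) where
  carrier := {β | ∀ ⦃x y : T⦄ ⦃q m : ℤ⦄ (h : q + n = m) (f : (DGCategory.hom (k := k) x y).X q),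
    (B.map f).comp (β y) h = (n * q).negOnePow • (β x).comp (C.map f) (show n + q = m by lia)}
  add_mem' {β γ} hβ hγ x y q m h f := by
    simp [DGHom.add_comp, DGHom.comp_add, hβ h f, hγ h f]
  zero_mem' x y q m h f := by simp [DGHom.zero_comp, DGHom.comp_zero]
  smul_mem' r β hβ x y q m h f := by
    simp only [Pi.smul_apply, DGHom.smul_comp, DGHom.comp_smul, hβ h f]
    exact smul_comm _ _ _

abbrev BimodHom (n : ℤ) (B C : Bimod k T) : Type u := bimodHom n B C

/-! ### Tensor products over `T` -/

section

variable (X : DGMod k T) (B : Bimod k T)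

abbrev TensorIdx (T : Type u) (n : ℤ) : Type u := {i : T × ℤ × ℤ // i.2.1 + i.2.2 = n}

open Classical TensorProduct

abbrev TensorGen (t : T) (n : ℤ) : Type u :=
  DirectSum (TensorIdx T n) fun i => (X.obj i.1.1).X i.1.2.1 ⊗[k] ((B.obj i.1.1).obj t).X i.1.2.2

def TensorGen.tmul {t : T} {n : ℤ} {s : T} {p q : ℤ} (h : p + q = n) (x : (X.obj s).X p)
    (b : ((B.obj s).obj t).X q) : TensorGen X B t n :=
  DirectSum.lof k (TensorIdx T n)
    (fun i => (X.obj i.1.1).X i.1.2.1 ⊗[k] ((B.obj i.1.1).obj t).X i.1.2.2) ⟨(s, p, q), h⟩ (x ⊗ₜ b)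

def tensorRel (t : T) (n : ℤ) : Submodule k (TensorGen X B t n) :=
  Submodule.span k {z | ∃ (s s' : T) (p q r a b : ℤ) (ha : p + q = a) (hb : r + q = b)
    (hn : a + r = n) (hn' : p + b = n) (x : (X.obj s').X p)
    (f : (DGCategory.hom (k := k) s s').X q) (m : ((B.obj s).obj t).X r),
    z = TensorGen.tmul X B hn (X.act ha x f) m -
      TensorGen.tmul X B hn' x ((((B.map f).1 t).v r b hb).hom m)}

def TensorX (t : T) (n : ℤ) : Type u := TensorGen X B t n ⧸ tensorRel X B t n

instance (t : T) (n : ℤ) : AddCommGroup (TensorX X B t n) :=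
  inferInstanceAs (AddCommGroup (TensorGen X B t n ⧸ tensorRel X B t n))

instance (t : T) (n : ℤ) : Module k (TensorX X B t n) :=
  inferInstanceAs (Module k (TensorGen X B t n ⧸ tensorRel X B t n))

variable {X B}

def tmk {t : T} {n : ℤ} {s : T} {p q : ℤ} (h : p + q = n) :
    (X.obj s).X p →ₗ[k] ((B.obj s).obj t).X q →ₗ[k] TensorX X B t n :=
  LinearMap.compr₂ (TensorProduct.mk k _ _)
    ((tensorRel X B t n).mkQ ∘ₗ DirectSum.lof k (TensorIdx T n)
      (fun i => (X.obj i.1.1).X i.1.2.1 ⊗[k] ((B.obj i.1.1).obj t).X i.1.2.2) ⟨(s, p, q), h⟩)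

lemma tmk_act {t : T} {s s' : T} {p q r a b n : ℤ} (ha : p + q = a) (hb : r + q = b)
    (hn : a + r = n) (hn' : p + b = n) (x : (X.obj s').X p)
    (f : (DGCategory.hom (k := k) s s').X q) (m : ((B.obj s).obj t).X r) :
    tmk (B := B) hn (X.act ha x f) m = tmk hn' x ((((B.map f).1 t).v r b hb).hom m) := by
  refine (Submodule.Quotient.eq _).2 (Submodule.subset_span ?_)
  exact ⟨s, s', p, q, r, a, b, ha, hb, hn, hn', x, f, m, rfl⟩

lemma tensor_ext {t : T} {n : ℤ} {N : Type*} [AddCommGroup N] [Module k N]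
    {φ ψ : TensorX X B t n →ₗ[k] N}
    (h : ∀ (s : T) (p q : ℤ) (hn : p + q = n) (x : (X.obj s).X p) (m : ((B.obj s).obj t).X q),
      φ (tmk hn x m) = ψ (tmk hn x m)) : φ = ψ := by
  apply Submodule.linearMap_qext
  apply DirectSum.linearMap_ext
  rintro ⟨⟨s, p, q⟩, hn⟩
  apply TensorProduct.ext'
  intro x m
  exact h s p q hn x m

lemma tensorRel_le {t : T} {n : ℤ} {N : Type u} [AddCommGroup N] [Module k N]
    (β : ∀ (s : T) (p q : ℤ), p + q = n →
      ((X.obj s).X p →ₗ[k] ((B.obj s).obj t).X q →ₗ[k] N))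
    (hβ : ∀ (s s' : T) (p q r a b : ℤ) (ha : p + q = a) (hb : r + q = b)
      (hn : a + r = n) (hn' : p + b = n) (x : (X.obj s').X p)
      (f : (DGCategory.hom (k := k) s s').X q) (m : ((B.obj s).obj t).X r),
      β s a r hn (X.act ha x f) m = β s' p b hn' x ((((B.map f).1 t).v r b hb).hom m)) :
    tensorRel X B t n ≤ LinearMap.ker (DirectSum.toModule k (TensorIdx T n) N fun i =>
      TensorProduct.lift (β i.1.1 i.1.2.1 i.1.2.2 i.2)) := by
  refine Submodule.span_le.2 ?_
  rintro _ ⟨s, s', p, q, r, a, b, ha, hb, hn, hn', x, f, m, rfl⟩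
  simp only [SetLike.mem_coe, LinearMap.mem_ker, map_sub, TensorGen.tmul]
  erw [DirectSum.toModule_lof, DirectSum.toModule_lof]
  simp [hβ s s' p q r a b ha hb hn hn' x f m]

def tlift {t : T} {n : ℤ} {N : Type u} [AddCommGroup N] [Module k N]
    (β : ∀ (s : T) (p q : ℤ), p + q = n →
      ((X.obj s).X p →ₗ[k] ((B.obj s).obj t).X q →ₗ[k] N))
    (hβ : ∀ (s s' : T) (p q r a b : ℤ) (ha : p + q = a) (hb : r + q = b)
      (hn : a + r = n) (hn' : p + b = n) (x : (X.obj s').X p)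
      (f : (DGCategory.hom (k := k) s s').X q) (m : ((B.obj s).obj t).X r),
      β s a r hn (X.act ha x f) m = β s' p b hn' x ((((B.map f).1 t).v r b hb).hom m)) :
    TensorX X B t n →ₗ[k] N :=
  (tensorRel X B t n).liftQ
    (DirectSum.toModule k (TensorIdx T n) N fun i =>
      TensorProduct.lift (β i.1.1 i.1.2.1 i.1.2.2 i.2))
    (tensorRel_le β hβ)

@[simp] lemma tlift_tmk {t : T} {n : ℤ} {N : Type u} [AddCommGroup N] [Module k N]
    (β : ∀ (s : T) (p q : ℤ), p + q = n →
      ((X.obj s).X p →ₗ[k] ((B.obj s).obj t).X q →ₗ[k] N)) (hβ)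
    {s : T} {p q : ℤ} (h : p + q = n) (x : (X.obj s).X p) (m : ((B.obj s).obj t).X q) :
    tlift β hβ (tmk h x m) = β s p q h x m := by
  have : tlift β hβ (tmk h x m) = DirectSum.toModule k (TensorIdx T n) N
      (fun i => TensorProduct.lift (β i.1.1 i.1.2.1 i.1.2.2 i.2)) (DirectSum.lof k (TensorIdx T n)
      (fun i => (X.obj i.1.1).X i.1.2.1 ⊗[k] ((B.obj i.1.1).obj t).X i.1.2.2) ⟨(s, p, q), h⟩
      (x ⊗ₜ m)) := rfl
  rw [this]
  erw [DirectSum.toModule_lof]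
  simp

end

lemma d_d_apply (K : Cplx k) (i j l : ℤ) (x : K.X i) :
    (K.d j l).hom ((K.d i j).hom x) = 0 := by
  have := K.d_comp_d i j l
  exact LinearMap.congr_fun (congrArg ModuleCat.Hom.hom this) x

section
variable {X : DGMod k T} {B : Bimod k T}

def tensorD {t : T} {n n' : ℤ} (hn : n + 1 = n') : TensorX X B t n →ₗ[k] TensorX X B t n' :=
  tlift (fun s p q h =>
      (tmk (show p + 1 + q = n' by lia)).comp ((X.obj s).d p (p + 1)).hom +
        p.negOnePow • (tmk (show p + (q + 1) = n' by lia)).compl₂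
          (((B.obj s).obj t).d q (q + 1)).hom) (by
    intro s s' p q r a b ha hb hn₁ hn₂ x f m
    have h1 : ((((B.map f).1 t).v (r + 1) (b + 1) (by lia)).hom
        ((((B.obj s).obj t).d r (r + 1)).hom m)) = q.negOnePow •
          ((((B.obj s').obj t).d b (b + 1)).hom ((((B.map f).1 t).v r b hb).hom m) -
          (((B.map (((DGCategory.hom s s').d q (q + 1)).hom f)).1 t).v r (b + 1) (by lia)).hom m) := by
      rw [B.map_d rfl, DGHom.δ_apply rfl (B.map f) t rfl hb (by lia) m]
      simp [Int.negOnePow_add, smul_smul]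
    simp only [LinearMap.add_apply, LinearMap.smul_apply, LinearMap.comp_apply,
      LinearMap.compl₂_apply]
    rw [X.d_act rfl rfl rfl ha x f, map_add, LinearMap.add_apply,
      tmk_act (b := b) (by lia) hb _ (by lia), tmk_act (b := b + 1) (by lia) (by lia) _ (by lia), h1]
    rw [show a.negOnePow = p.negOnePow * q.negOnePow by rw [← ha, Int.negOnePow_add]]
    simp only [map_sub, smul_sub, smul_smul, mul_assoc, Int.units_mul_self, mul_one,
      LinearMap.map_smul_of_tower, LinearMap.smul_apply]
    rw [tmk_act (a := a + 1) (b := b + 1) (by lia) (by lia) (by lia) (by lia)]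
    abel)

@[simp] lemma tensorD_tmk {t : T} {n n' : ℤ} (hn : n + 1 = n') {s : T} {p q p' q' : ℤ}
    (hp : p + 1 = p') (hq : q + 1 = q') (h : p + q = n)
    (x : (X.obj s).X p) (m : ((B.obj s).obj t).X q) :
    tensorD hn (tmk h x m) = tmk (show p' + q = n' by lia) (((X.obj s).d p p').hom x) m +
      p.negOnePow • tmk (show p + q' = n' by lia) x ((((B.obj s).obj t).d q q').hom m) := by
  subst hp hq
  simp [tensorD]

def tensorAct {t t' : T} {p q n : ℤ} (h : p + q = n) :
    TensorX X B t p →ₗ[k] (DGCategory.hom (k := k) t' t).X q →ₗ[k] TensorX X B t' n :=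
  tlift (fun s a b hab => LinearMap.mk₂ k
      (fun x m => tmk (show a + (b + q) = n by lia) x ∘ₗ (B.obj s).act (p := b) rfl m)
      (fun _ _ _ => by ext; simp) (fun _ _ _ => by ext; simp)
      (fun _ _ _ => by ext; simp) (fun _ _ _ => by ext; simp)) (by
    intro s s' i j r a b ha hb hn₁ hn₂ x f m
    ext g
    simp only [LinearMap.mk₂_apply, LinearMap.comp_apply]
    rw [tmk_act (b := b + q) ha (by lia) _ (by lia),
      (B.map f).map_act (b := b) rfl hb (by lia) rfl])

@[simp] lemma tensorAct_tmk {t t' : T} {p q n : ℤ} (h : p + q = n) {s : T} {a b c : ℤ}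
    (hab : a + b = p) (hc : b + q = c) (x : (X.obj s).X a) (m : ((B.obj s).obj t).X b)
    (f : (DGCategory.hom (k := k) t' t).X q) :
    tensorAct h (tmk hab x m) f = tmk (show a + c = n by lia) x ((B.obj s).act hc m f) := by
  subst hc
  simp [tensorAct]

variable (X B) in
/-- The right dg module `X ⊗_T B` of a right dg module `X` and a bimodule `B`. -/
def tensor : DGMod k T where
  obj t :=
    { X := fun n => ModuleCat.of k (TensorX X B t n)
      d := fun i j => if h : i + 1 = j then ModuleCat.ofHom (tensorD h) else 0
      shape := fun i j h => dif_neg h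
      d_comp_d' := by
        rintro i j l rfl rfl
        simp only [dif_pos]
        rw [← ModuleCat.ofHom_comp, ← ModuleCat.ofHom_zero]
        congr 1
        apply tensor_ext
        intro s p q hn x m
        simp only [LinearMap.comp_apply]
        rw [tensorD_tmk rfl rfl rfl, map_add, LinearMap.map_smul_of_tower,
          tensorD_tmk (q' := q + 1) rfl rfl rfl, tensorD_tmk (q' := q + 1 + 1) rfl rfl rfl]
        simp [d_d_apply, Int.negOnePow_add] }
  act h := tensorAct h
  act_id {x p} m := by
    have : (tensorAct (X := X) (B := B) (add_zero p)).flip (DGCategory.id x) = LinearMap.id := by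
      apply tensor_ext
      intro s a b hab y m
      simp only [LinearMap.flip_apply, LinearMap.id_apply]
      rw [tensorAct_tmk _ _ (add_zero b), DGMod.act_id]
    exact LinearMap.congr_fun this m
  act_act {_ _ _ p q r a b n} ha hb hn hn' m g f := by
    have : (tensorAct (X := X) (B := B) hn).flip f ∘ₗ (tensorAct ha).flip g =
        (tensorAct hn').flip (DGCategory.comp hb f g) := by
      apply tensor_ext
      intro s i j hij y m
      simp only [LinearMap.flip_apply, LinearMap.comp_apply]
      rw [tensorAct_tmk (c := j + q) _ _ rfl, tensorAct_tmk (c := j + b) _ _ (by lia),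
        tensorAct_tmk (c := j + b) _ _ rfl, (B.obj s).act_act rfl hb (by lia) rfl]
    exact LinearMap.congr_fun this m
  d_act {x y p q p' q' n n'} hp hq hn h m f := by
    subst hp hq hn
    simp only [dif_pos, ModuleCat.hom_ofHom]
    have : tensorD (X := X) (B := B) rfl ∘ₗ (tensorAct h).flip f =
        (tensorAct (show p + 1 + q = n + 1 by lia)).flip f ∘ₗ tensorD rfl +
          p.negOnePow • (tensorAct (show p + (q + 1) = n + 1 by lia)).flip
            (((DGCategory.hom x y).d q (q + 1)).hom f) := by
      apply tensor_ext
      intro s i j hij z m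
      simp only [LinearMap.flip_apply, LinearMap.comp_apply, LinearMap.add_apply,
        LinearMap.smul_apply]
      rw [tensorAct_tmk (c := j + q) _ hij rfl _ _ f, tensorD_tmk rfl rfl rfl,
        tensorD_tmk rfl rfl rfl, map_add, LinearMap.add_apply, LinearMap.map_smul_of_tower,
        LinearMap.smul_apply, tensorAct_tmk (c := j + q) _ _ rfl _ _ f,
        tensorAct_tmk (c := j + q + 1) _ _ (by lia) _ _ f,
        tensorAct_tmk (c := j + q + 1) _ _ (by lia), (B.obj s).d_act (p' := j + 1) rfl rfl rfl]
      rw [show p.negOnePow = i.negOnePow * j.negOnePow by rw [← hij, Int.negOnePow_add]]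
      simp only [map_add, LinearMap.map_smul_of_tower, smul_add, smul_smul]
      exact (add_assoc (G := TensorX X B x (n + 1)) _ _ _).symm
    exact LinearMap.congr_fun this m
end

section
variable {X X' : DGMod k T} {B B' : Bimod k T}

/-- The class `x ⊗ m` in `X ⊗ B`. -/
def tin {t : T} {n : ℤ} {s : T} {p q : ℤ} (h : p + q = n) :
    (X.obj s).X p →ₗ[k] ((B.obj s).obj t).X q →ₗ[k] ((tensor X B).obj t).X n :=
  tmk h

lemma tin_act {t : T} {s s' : T} {p q r a b n : ℤ} (ha : p + q = a) (hb : r + q = b)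
    (hn : a + r = n) (hn' : p + b = n) (x : (X.obj s').X p)
    (f : (DGCategory.hom (k := k) s s').X q) (m : ((B.obj s).obj t).X r) :
    tin (B := B) hn (X.act ha x f) m = tin hn' x ((((B.map f).1 t).v r b hb).hom m) :=
  tmk_act ha hb hn hn' x f m

lemma tensor_hom_ext {n : ℤ} {N : DGMod k T} {φ ψ : DGHom n (tensor X B) N}
    (h : ∀ (t s : T) (p q a b : ℤ) (hpq : p + n = q) (hab : a + b = p) (x : (X.obj s).X a)
      (m : ((B.obj s).obj t).X b), ((φ.1 t).v p q hpq).hom (tin hab x m) =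
        ((ψ.1 t).v p q hpq).hom (tin hab x m)) : φ = ψ := by
  apply DGHom.ext_apply
  intro t p q hpq
  exact LinearMap.congr_fun (tensor_ext fun s a b hab x m => h t s p q a b hpq hab x m)

lemma tin_d {t : T} {n n' : ℤ} (hn : n + 1 = n') {s : T} {p q p' q' : ℤ}
    (hp : p + 1 = p') (hq : q + 1 = q') (h : p + q = n)
    (x : (X.obj s).X p) (m : ((B.obj s).obj t).X q) :
    (((tensor X B).obj t).d n n').hom (tin h x m) =
      tin (show p' + q = n' by lia) (((X.obj s).d p p').hom x) m +
      p.negOnePow • tin (show p + q' = n' by lia) x ((((B.obj s).obj t).d q q').hom m) := by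
  have h1 : ((tensor X B).obj t).d n n' = ModuleCat.ofHom (tensorD hn) := dif_pos hn
  have h2 := tensorD_tmk hn hp hq h x m
  rw [h1]
  exact h2

lemma act_tin {t t' : T} {p q n : ℤ} (h : p + q = n) {s : T} {a b c : ℤ}
    (hab : a + b = p) (hc : b + q = c) (x : (X.obj s).X a) (m : ((B.obj s).obj t).X b)
    (f : (DGCategory.hom (k := k) t' t).X q) :
    (tensor X B).act h (tin hab x m) f =
      tin (show a + c = n by lia) x ((B.obj s).act hc m f) :=
  tensorAct_tmk h hab hc x m f

def tensorLift {n : ℤ} {N : DGMod k T}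
    (β : ∀ (t s : T) (a b q : ℤ), a + b + n = q →
      ((X.obj s).X a →ₗ[k] ((B.obj s).obj t).X b →ₗ[k] (N.obj t).X q))
    (hβ : ∀ (t s s' : T) (p q r a b c : ℤ) (ha : p + q = a) (hb : r + q = b)
      (hc : a + r + n = c) (hc' : p + b + n = c) (x : (X.obj s').X p)
      (f : (DGCategory.hom (k := k) s s').X q) (m : ((B.obj s).obj t).X r),
      β t s a r c hc (X.act ha x f) m = β t s' p b c hc' x ((((B.map f).1 t).v r b hb).hom m))
    (hact : ∀ (t t' s : T) (a b q b' c c' : ℤ) (hb : b + q = b') (hc : a + b + n = c)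
      (hc' : a + b' + n = c') (x : (X.obj s).X a) (m : ((B.obj s).obj t).X b)
      (f : (DGCategory.hom (k := k) t' t).X q),
      β t' s a b' c' hc' x ((B.obj s).act hb m f) =
        N.act (show c + q = c' by lia) (β t s a b c hc x m) f) :
    DGHom n (tensor X B) N :=
  ⟨fun t => Cochain.mk fun p q h => ModuleCat.ofHom
    (tlift (fun s a b hab => β t s a b q (by lia))
      fun s s' _ _ _ _ _ ha hb _ _ x f m => hβ t s s' _ _ _ _ _ _ ha hb _ _ x f m :
        TensorX X B t p →ₗ[k] (N.obj t).X q), by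
    intro t t' p q a b c ha hb hc hc' m f
    refine LinearMap.congr_fun (f := LinearMap.comp (tlift (fun s i j hij => β t s i j c (by lia))
      fun s s' _ _ _ _ _ ha hb _ _ x f m => hβ t s s' _ _ _ _ _ _ ha hb _ _ x f m)
      ((tensorAct (X := X) (B := B) ha).flip f)) (g := LinearMap.comp ((N.act hc').flip f)
      (tlift (fun s i j hij => β t' s i j b (by lia))
        fun s s' _ _ _ _ _ ha hb _ _ x f m => hβ t' s s' _ _ _ _ _ _ ha hb _ _ x f m)) ?_ m
    apply tensor_ext
    intro s i j hij x m
    simp only [LinearMap.comp_apply, LinearMap.flip_apply]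
    rw [tensorAct_tmk _ _ rfl]
    simp only [tlift_tmk]
    exact hact _ _ _ _ _ _ _ _ _ rfl _ _ _ _ _⟩

lemma tensorLift_tin {n : ℤ} {N : DGMod k T}
    (β : ∀ (t s : T) (a b q : ℤ), a + b + n = q →
      ((X.obj s).X a →ₗ[k] ((B.obj s).obj t).X b →ₗ[k] (N.obj t).X q)) (hβ) (hact)
    {t s : T} {a b p q : ℤ} (hab : a + b = p) (h : p + n = q) (x : (X.obj s).X a)
    (m : ((B.obj s).obj t).X b) :
    (((tensorLift (B := B) β hβ hact).1 t).v p q h).hom (tin hab x m) =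
      β t s a b q (by lia) x m :=
  tlift_tmk (X := X) (B := B) (t := t) (n := p) (N := (N.obj t).X q)
    (fun s a b hab => β t s a b q (by lia))
    (fun s s' _ _ _ _ _ ha hb _ _ x f m => hβ t s s' _ _ _ _ _ _ ha hb _ _ x f m) hab x m

variable (B) in
/-- The functoriality of `X ⊗ B` in `X`: `(φ ⊗ B)(x ⊗ m) = φ(x) ⊗ m`. -/
def tensorMapLeft {n : ℤ} (φ : DGHom n X X') : DGHom n (tensor X B) (tensor X' B) :=
  tensorLift (fun t s a b q h =>
      (tin (show a + n + b = q by lia)).comp ((φ.1 s).v a (a + n) rfl).hom)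
    (by
      intro t s s' p q r a b c ha hb hc hc' x f m
      simp only [LinearMap.comp_apply]
      rw [φ.map_act ha rfl rfl (by lia), tin_act _ hb _ (by lia)])
    (by
      intro t t' s a b q b' c c' hb hc hc' x m f
      simp only [LinearMap.comp_apply]
      rw [act_tin _ _ hb])

lemma tensorMapLeft_tin {n : ℤ} (φ : DGHom n X X') {t s : T} {p q a b c : ℤ} (h : p + n = q)
    (hab : a + b = p) (hc : a + n = c) (x : (X.obj s).X a) (m : ((B.obj s).obj t).X b) :
    (((tensorMapLeft B φ).1 t).v p q h).hom (tin hab x m) =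
      tin (show c + b = q by lia) (((φ.1 s).v a c hc).hom x) m := by
  subst hc
  simp only [tensorMapLeft]
  rw [tensorLift_tin]
  rfl

lemma tensorMapLeft_add {n : ℤ} (φ ψ : DGHom n X X') :
    tensorMapLeft B (φ + ψ) = tensorMapLeft B φ + tensorMapLeft B ψ := by
  apply tensor_hom_ext
  intro t s p q a b hpq hab x m
  simp [tensorMapLeft_tin _ _ _ rfl]

lemma tensorMapLeft_smul {n : ℤ} (r : k) (φ : DGHom n X X') :
    tensorMapLeft B (r • φ) = r • tensorMapLeft B φ := by
  apply tensor_hom_ext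
  intro t s p q a b hpq hab x m
  simp [tensorMapLeft_tin _ _ _ rfl]

lemma tensorMapLeft_id : tensorMapLeft B (DGHom.id X) = DGHom.id (tensor X B) := by
  apply tensor_hom_ext
  intro t s p q a b hpq hab x m
  obtain rfl : q = p := by lia
  rw [tensorMapLeft_tin _ _ _ (add_zero a)]
  simp

lemma tensorMapLeft_comp {X'' : DGMod k T} {p q n : ℤ} (φ : DGHom p X X') (ψ : DGHom q X' X'')
    (h : p + q = n) :
    tensorMapLeft B (φ.comp ψ h) = (tensorMapLeft B φ).comp (tensorMapLeft B ψ) h := by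
  apply tensor_hom_ext
  intro t s i j a b hij hab x m
  rw [tensorMapLeft_tin _ _ _ rfl, DGHom.comp_apply _ _ _ _ rfl (show i + p + q = j by lia),
    DGHom.comp_apply _ _ _ _ rfl (show a + p + q = a + n by lia),
    tensorMapLeft_tin _ _ _ rfl, tensorMapLeft_tin (c := a + n) _ _ _ (by lia)]

lemma tensorMapLeft_δ {n n' : ℤ} (h : n + 1 = n') (φ : DGHom n X X') :
    tensorMapLeft B (φ.δ n n') = (tensorMapLeft B φ).δ n n' := by
  apply tensor_hom_ext
  intro t s i j a b hij hab x m
  rw [tensorMapLeft_tin _ _ _ rfl, DGHom.δ_apply h _ _ rfl rfl,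
    DGHom.δ_apply h _ _ rfl rfl, tensorMapLeft_tin (c := a + n) _ _ _ rfl,
    tin_d (p' := a + n') (by lia) (by lia) rfl, tin_d rfl rfl rfl]
  simp only [map_add, LinearMap.map_smul_of_tower]
  rw [tensorMapLeft_tin _ _ _ (show a + 1 + n = a + n' by lia), tensorMapLeft_tin _ _ _ rfl]
  simp only [LinearMap.add_apply, LinearMap.map_smul_of_tower, LinearMap.smul_apply, smul_add,
    smul_smul]
  have : n'.negOnePow * a.negOnePow = -(a + n).negOnePow := by
    rw [← h, Int.negOnePow_add, Int.negOnePow_add, Int.negOnePow_one]; simp [mul_comm]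
  rw [this, Units.neg_smul]
  abel

/-- The functoriality of `X ⊗ B` in `B`: `(X ⊗ β)(x ⊗ m) = (-1)^(|β||x|) x ⊗ β(m)`. -/
def tensorMapRight (X : DGMod k T) {n : ℤ} (β : BimodHom n B B') :
    DGHom n (tensor X B) (tensor X B') :=
  tensorLift (fun t s a b q h => (n * a).negOnePow •
    (tin (show a + (b + n) = q by lia)).compl₂ (((β.1 s).1 t).v b (b + n) rfl).hom)
    (by
      intro t s s' p q r a b c ha hb hc hc' x f m
      have h1 := congrArg (fun φ : DGHom (q + n) _ _ => ((φ.1 t).v r (b + n) (by lia)).hom m)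
        (β.2 rfl f)
      simp only [DGHom.units_smul_v] at h1
      rw [DGHom.comp_apply _ _ _ _ hb rfl] at h1
      simp only [LinearMap.smul_apply, LinearMap.compl₂_apply]
      rw [h1]
      simp
      rw [DGHom.comp_apply _ _ _ _ rfl (show r + n + q = b + n by lia),
        tin_act (b := b + n) ha (by lia) _ (by lia), smul_smul]
      congr 1
      rw [← ha, mul_add, Int.negOnePow_add])
    (by
      intro t t' s a b q b' c c' hb hc hc' x m f
      simp only [LinearMap.smul_apply, LinearMap.compl₂_apply]
      rw [(β.1 s).map_act hb rfl rfl (by lia), LinearMap.map_smul_of_tower, LinearMap.smul_apply,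
        act_tin (c := b' + n) _ _ (by lia)])

lemma tensorMapRight_tin {n : ℤ} (β : BimodHom n B B') {t s : T} {p q a b c : ℤ} (h : p + n = q)
    (hab : a + b = p) (hc : b + n = c) (x : (X.obj s).X a) (m : ((B.obj s).obj t).X b) :
    (((tensorMapRight X β).1 t).v p q h).hom (tin hab x m) =
      (n * a).negOnePow • tin (show a + c = q by lia) x ((((β.1 s).1 t).v b c hc).hom m) := by
  subst hc
  simp only [tensorMapRight]
  rw [tensorLift_tin]
  rfl

lemma tensorMapRight_add {n : ℤ} (β γ : BimodHom n B B') :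
    tensorMapRight X (β + γ) = tensorMapRight X β + tensorMapRight X γ := by
  apply tensor_hom_ext
  intro t s p q a b hpq hab x m
  simp [tensorMapRight_tin _ _ _ rfl]

lemma tensorMapRight_smul {n : ℤ} (r : k) (β : BimodHom n B B') :
    tensorMapRight X (r • β) = r • tensorMapRight X β := by
  apply tensor_hom_ext
  intro t s p q a b hpq hab x m
  simp [tensorMapRight_tin _ _ _ rfl]
  exact smul_comm _ _ _

lemma tensorMapLeft_comp_right {p q n : ℤ} (φ : DGHom p X X') (β : BimodHom q B B')
    (h : q + p = n) :
    (tensorMapRight X β).comp (tensorMapLeft B' φ) h =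
      (q * p).negOnePow • (tensorMapLeft B φ).comp (tensorMapRight X' β) (by lia) := by
  apply tensor_hom_ext
  intro t s i j a b hij hab x m
  rw [DGHom.units_smul_v]
  simp only [ModuleCat.hom_smul]
  rw [DGHom.comp_apply _ _ _ _ rfl (show i + q + p = j by lia), tensorMapRight_tin _ _ _ rfl]
  simp
  rw [DGHom.comp_apply _ _ _ _ rfl (show i + p + q = j by lia), tensorMapLeft_tin _ _ _ rfl,
    tensorMapLeft_tin _ _ _ rfl, tensorMapRight_tin _ _ _ rfl, smul_smul, ← Int.negOnePow_add]
  congr 1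
  rw [Int.negOnePow_eq_iff]
  exact ⟨- q * p, by ring⟩
end

lemma DGHom.δ_comp {M N P : DGMod k T} {p q n p' q' n' : ℤ} (φ : DGHom p M N) (ψ : DGHom q N P)
    (h : p + q = n) (hp : p + 1 = p') (hq : q + 1 = q') (hn : n + 1 = n') :
    (φ.comp ψ h).δ n n' = φ.comp (ψ.δ q q') (by lia) +
      q.negOnePow • (φ.δ p p').comp ψ (by lia) := by
  apply Subtype.ext
  funext t
  have := CochainComplex.HomComplex.δ_comp (φ.1 t) (ψ.1 t) h p' q' n' hn hp hq
  refine this.trans ?_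
  rcases Int.units_eq_one_or q.negOnePow with h | h <;> rw [h] <;> simp <;> rfl

lemma DGHom.δ_units_smul {M N : DGMod k T} {n n' : ℤ} (r : ℤˣ) (φ : DGHom n M N) :
    (r • φ).δ n n' = r • φ.δ n n' := by
  apply Subtype.ext
  funext t
  rcases Int.units_eq_one_or r with h | h
  · simp [h]
  · simp only [h, Units.neg_smul, one_smul]
    exact CochainComplex.HomComplex.δ_neg n n' (φ.1 t)

lemma DGHom.units_smul_comp {M N P : DGMod k T} {p q n : ℤ} (r : ℤˣ) (φ : DGHom p M N)
    (ψ : DGHom q N P) (h : p + q = n) : (r • φ).comp ψ h = r • φ.comp ψ h :=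
  DGHom.ext_apply fun t a b hab m => by
    rw [DGHom.comp_apply _ _ _ _ rfl (show a + p + q = b by lia), DGHom.units_smul_v,
      DGHom.units_smul_v]
    simp
    rw [DGHom.comp_apply _ _ _ _ rfl (show a + p + q = b by lia)]

lemma DGHom.comp_units_smul {M N P : DGMod k T} {p q n : ℤ} (r : ℤˣ) (φ : DGHom p M N)
    (ψ : DGHom q N P) (h : p + q = n) : φ.comp (r • ψ) h = r • φ.comp ψ h :=
  DGHom.ext_apply fun t a b hab m => by
    rw [DGHom.comp_apply _ _ _ _ rfl (show a + p + q = b by lia), DGHom.units_smul_v,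
      DGHom.units_smul_v]
    simp
    rw [DGHom.comp_apply _ _ _ _ rfl (show a + p + q = b by lia)]

lemma DGHom.comp_assoc {M N P Q : DGMod k T} {p q r a b n : ℤ} (φ : DGHom p M N) (ψ : DGHom q N P)
    (χ : DGHom r P Q) (ha : p + q = a) (hb : q + r = b) (hn : a + r = n) (hn' : p + b = n) :
    (φ.comp ψ ha).comp χ hn = φ.comp (ψ.comp χ hb) hn' :=
  Subtype.ext (funext fun _ => Cochain.comp_assoc _ _ _ ha hb (by lia))

lemma DGHom.id_comp {M N : DGMod k T} {n : ℤ} (φ : DGHom n M N) :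
    (DGHom.id M).comp φ (zero_add n) = φ :=
  Subtype.ext (funext fun _ => Cochain.id_comp _)

lemma DGHom.comp_id {M N : DGMod k T} {n : ℤ} (φ : DGHom n M N) :
    φ.comp (DGHom.id N) (add_zero n) = φ :=
  Subtype.ext (funext fun _ => Cochain.comp_id _)

namespace BimodHom

variable {B C D : Bimod k T}

def id (B : Bimod k T) : BimodHom 0 B B :=
  ⟨fun s => DGHom.id (B.obj s), fun x y q m h f => by
    obtain rfl : m = q := by lia
    rw [DGHom.comp_id, DGHom.id_comp]
    simp⟩

def comp {p q n : ℤ} (β : BimodHom p B C) (γ : BimodHom q C D) (h : p + q = n) :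
    BimodHom n B D :=
  ⟨fun s => (β.1 s).comp (γ.1 s) h, fun x y i m hm f => by
    rw [← DGHom.comp_assoc (a := i + p) _ _ _ rfl h (by lia), β.2 rfl f, DGHom.units_smul_comp,
      DGHom.comp_assoc (b := i + q) _ _ _ _ rfl _ (by lia), γ.2 rfl f, DGHom.comp_units_smul,
      ← DGHom.comp_assoc (a := n) _ _ _ h (by lia) (by lia), smul_smul, ← Int.negOnePow_add]
    congr 2
    rw [← h]; ring⟩

def δ (n m : ℤ) (β : BimodHom n B C) : BimodHom m B C :=
  ⟨fun s => (β.1 s).δ n m, fun x y q l h f => by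
    by_cases hm : n + 1 = m
    · have h1 := congrArg (DGHom.δ (q + n) l) (β.2 rfl f)
      rw [DGHom.δ_units_smul, DGHom.δ_comp _ _ _ rfl hm (by lia),
        DGHom.δ_comp _ _ _ hm rfl (by lia), ← B.map_d rfl, ← C.map_d rfl,
        β.2 (show q + 1 + n = l by lia)] at h1
      rw [eq_sub_of_add_eq h1, smul_add, smul_smul, smul_smul, ← Int.negOnePow_add,
        ← Int.negOnePow_add, show n + n * (q + 1) = n * q + 2 * n by ring,
        Int.negOnePow_add (n * q) (2 * n), Int.negOnePow_even (2 * n) (even_two_mul n),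
        show m * q = n * q + q by rw [← hm]; ring]
      simp
    · have : ∀ s, (β.1 s).δ n m = 0 := fun s => Subtype.ext (funext fun t => δ_shape n m hm _)
      simp only [this]
      rw [DGHom.comp_zero, DGHom.zero_comp, smul_zero]⟩

end BimodHom

/-- 2-fold bimodules: two left actions (the outer index is the first one) and a right action. -/
structure Bimod2 (k : Type u) [CommRing k] (T : Type u) [DGCategory k T] where
  obj : T → Bimod k T
  map {x y : T} {n : ℤ} : (DGCategory.hom (k := k) x y).X n →ₗ[k] BimodHom n (obj x) (obj y)
  map_id (x : T) : map (DGCategory.id x) = BimodHom.id (obj x)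
  map_comp {x y z : T} {p q n : ℤ} (h : p + q = n) (f : (DGCategory.hom (k := k) x y).X p)
    (g : (DGCategory.hom (k := k) y z).X q) :
    map (DGCategory.comp h f g) = (map f).comp (map g) h
  map_d {x y : T} {n n' : ℤ} (h : n + 1 = n') (f : (DGCategory.hom (k := k) x y).X n) :
    map (((DGCategory.hom x y).d n n').hom f) = (map f).δ n n'

section
variable {X : DGMod k T} {B B' B'' : Bimod k T}

lemma tensorMapRight_id : tensorMapRight X (BimodHom.id B) = DGHom.id (tensor X B) := by
  apply tensor_hom_ext
  intro t s p q a b hpq hab x m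
  obtain rfl : q = p := by lia
  rw [tensorMapRight_tin _ _ _ (add_zero b)]
  simp [BimodHom.id]

lemma tensorMapRight_comp {p q n : ℤ} (β : BimodHom p B B') (γ : BimodHom q B' B'')
    (h : p + q = n) :
    tensorMapRight X (β.comp γ h) = (tensorMapRight X β).comp (tensorMapRight X γ) h := by
  apply tensor_hom_ext
  intro t s i j a b hij hab x m
  rw [tensorMapRight_tin _ _ _ rfl, DGHom.comp_apply _ _ _ _ rfl (show i + p + q = j by lia)]
  simp only [BimodHom.comp]
  rw [DGHom.comp_apply _ _ _ _ rfl (show b + p + q = b + n by lia),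
    tensorMapRight_tin _ _ _ rfl, LinearMap.map_smul_of_tower,
    tensorMapRight_tin (c := b + n) _ _ _ (by lia), smul_smul, ← Int.negOnePow_add]
  congr 2
  rw [← h]; ring

lemma tensorMapRight_δ {n n' : ℤ} (h : n + 1 = n') (β : BimodHom n B B') :
    tensorMapRight X (β.δ n n') = (tensorMapRight X β).δ n n' := by
  apply tensor_hom_ext
  intro t s i j a b hij hab x m
  rw [tensorMapRight_tin _ _ _ rfl]
  simp only [BimodHom.δ]
  rw [DGHom.δ_apply h _ _ rfl rfl,
    DGHom.δ_apply h _ _ rfl rfl, tensorMapRight_tin (c := b + n) _ _ _ rfl,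
    tin_d rfl rfl rfl]
  simp only [map_add, LinearMap.map_smul_of_tower]
  rw [tin_d (n := i + n) (q' := b + n') (by lia) rfl (by lia) (by lia),
    tensorMapRight_tin (c := b + n) _ _ _ rfl,
    tensorMapRight_tin (c := b + n') _ _ _ (by lia)]
  simp only [smul_add, smul_smul, ← Int.negOnePow_add]
  rw [show n' * a = n * a + a by rw [← h]; ring,
    show n' + n * (a + 1) = n * a + 2 * n + 1 by rw [← h]; ring,
    show n' + (a + n * a) = n * a + a + n' by ring]
  simp only [Int.negOnePow_add, Int.negOnePow_even (2 * n) (even_two_mul n), Int.negOnePow_one]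
  simp only [mul_one, mul_neg, Units.neg_smul]
  abel

end

section
variable (Γ : Bimod2 k T)

/-- The bimodule `x ↦ Y ⊗ Γ(x, -)`. -/
def tensSnd (Y : DGMod k T) : Bimod k T where
  obj x := tensor Y (Γ.obj x)
  map :=
    { toFun := fun f => tensorMapRight Y (Γ.map f)
      map_add' := fun f g => by rw [map_add, tensorMapRight_add]
      map_smul' := fun r f => by rw [map_smul, tensorMapRight_smul]; rfl }
  map_id x := by simp [Γ.map_id, tensorMapRight_id]
  map_comp h f g := by simp [Γ.map_comp, tensorMapRight_comp]
  map_d h f := by simp [Γ.map_d h, tensorMapRight_δ h]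

def tensSndMap {Y Y' : DGMod k T} {n : ℤ} (ψ : DGHom n Y Y') :
    BimodHom n (tensSnd Γ Y) (tensSnd Γ Y') :=
  ⟨fun s => tensorMapLeft (Γ.obj s) ψ, fun _ _ _ _ h f =>
    (tensorMapLeft_comp_right ψ (Γ.map f) h).trans (by rw [mul_comm]; rfl)⟩

end

/-- A dg functor from the dg category of right dg modules to itself. -/
structure DGFunctor (k : Type u) [CommRing k] (T : Type u) [DGCategory k T] where
  obj : DGMod k T → DGMod k T
  map {X Y : DGMod k T} {n : ℤ} (φ : DGHom n X Y) : DGHom n (obj X) (obj Y)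
  map_add {X Y : DGMod k T} {n : ℤ} (φ ψ : DGHom n X Y) : map (φ + ψ) = map φ + map ψ
  map_smul {X Y : DGMod k T} {n : ℤ} (r : k) (φ : DGHom n X Y) : map (r • φ) = r • map φ
  map_id (X : DGMod k T) : map (DGHom.id X) = DGHom.id (obj X)
  map_comp {X Y Z : DGMod k T} {p q n : ℤ} (φ : DGHom p X Y) (ψ : DGHom q Y Z) (h : p + q = n) :
    map (φ.comp ψ h) = (map φ).comp (map ψ) h
  map_δ {X Y : DGMod k T} {n n' : ℤ} (h : n + 1 = n') (φ : DGHom n X Y) :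
    map (φ.δ n n') = (map φ).δ n n'

namespace DGFunctor

def id : DGFunctor k T where
  obj X := X
  map φ := φ
  map_add _ _ := rfl
  map_smul _ _ := rfl
  map_id _ := rfl
  map_comp _ _ _ := rfl
  map_δ _ _ := rfl

def comp (F G : DGFunctor k T) : DGFunctor k T where
  obj X := G.obj (F.obj X)
  map φ := G.map (F.map φ)
  map_add φ ψ := by rw [F.map_add, G.map_add]
  map_smul r φ := by rw [F.map_smul, G.map_smul]
  map_id X := by rw [F.map_id, G.map_id]
  map_comp φ ψ h := by rw [F.map_comp, G.map_comp]
  map_δ h φ := by rw [F.map_δ h, G.map_δ h]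

end DGFunctor

/-- The dg functor `X ↦ X ⊗ B`. -/
def tens (B : Bimod k T) : DGFunctor k T where
  obj X := tensor X B
  map φ := tensorMapLeft B φ
  map_add := tensorMapLeft_add
  map_smul := tensorMapLeft_smul
  map_id _ := tensorMapLeft_id
  map_comp := tensorMapLeft_comp
  map_δ := tensorMapLeft_δ

namespace Bimod2
variable (Γ : Bimod2 k T)

/-- The product `Γ(X, Y) = X ⊗ Y ⊗ Γ`. -/
def prod (X Y : DGMod k T) : DGMod k T := tensor X (tensSnd Γ Y)

def prodL (Y : DGMod k T) : DGFunctor k T := tens (tensSnd Γ Y)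

def prodR (X : DGMod k T) : DGFunctor k T where
  obj Y := Γ.prod X Y
  map ψ := tensorMapRight X (tensSndMap Γ ψ)
  map_add φ ψ := (congrArg (tensorMapRight X) (Subtype.ext (funext fun _ =>
    tensorMapLeft_add φ ψ) : tensSndMap Γ (φ + ψ) = tensSndMap Γ φ + tensSndMap Γ ψ)).trans
    (tensorMapRight_add _ _)
  map_smul r φ := (congrArg (tensorMapRight X) (Subtype.ext (funext fun _ =>
    tensorMapLeft_smul r φ) : tensSndMap Γ (r • φ) = r • tensSndMap Γ φ)).trans
    (tensorMapRight_smul _ _)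
  map_id Y := (congrArg (tensorMapRight X) (Subtype.ext (funext fun _ =>
    tensorMapLeft_id) : tensSndMap Γ (DGHom.id Y) = BimodHom.id _)).trans tensorMapRight_id
  map_comp φ ψ h := (congrArg (tensorMapRight X) (Subtype.ext (funext fun _ =>
    tensorMapLeft_comp φ ψ h) : tensSndMap Γ (φ.comp ψ h) =
      (tensSndMap Γ φ).comp (tensSndMap Γ ψ) h)).trans (tensorMapRight_comp _ _ h)
  map_δ h φ := (congrArg (tensorMapRight X) (Subtype.ext (funext fun _ =>
    tensorMapLeft_δ h φ) : tensSndMap Γ (φ.δ _ _) = (tensSndMap Γ φ).δ _ _)).trans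
    (tensorMapRight_δ h _)

end Bimod2

/-- Dg naturality of a family of graded maps of degree `m`. -/
def DGNatural (m : ℤ) (F G : DGFunctor k T) (η : ∀ X, DGHom m (F.obj X) (G.obj X)) : Prop :=
  ∀ ⦃X Y : DGMod k T⦄ ⦃n l : ℤ⦄ (h : n + m = l) (φ : DGHom n X Y),
    (F.map φ).comp (η Y) h = (m * n).negOnePow • (η X).comp (G.map φ) (by lia)

lemma DGHom.ofHom_δ {M N : DGMod k T} (φ : M ⟶ N) : (DGHom.ofHom φ).δ 0 1 = 0 :=
  Subtype.ext (funext fun _ => δ_ofHom _)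

def DGHom.toHom {M N : DGMod k T} (φ : DGHom 0 M N) (h : φ.δ 0 1 = 0) : M ⟶ N :=
  ⟨fun t => Cocycle.homOf (Cocycle.mk (φ.1 t) 1 (zero_add 1)
      (congrFun (congrArg Subtype.val h) t)), fun _ _ _ _ _ h m f => φ.2 h _ _ h m f⟩

lemma DGHom.ofHom_toHom {M N : DGMod k T} (φ : DGHom 0 M N) (h : φ.δ 0 1 = 0) :
    DGHom.ofHom (φ.toHom h) = φ :=
  Subtype.ext (funext fun t => Cocycle.cochain_ofHom_homOf_eq_coe
    (Cocycle.mk (φ.1 t) 1 (zero_add 1) (congrFun (congrArg Subtype.val h) t)))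

lemma DGHom.ofHom_injective {M N : DGMod k T} {φ ψ : M ⟶ N}
    (h : DGHom.ofHom φ = DGHom.ofHom ψ) : φ = ψ :=
  Subtype.ext (funext fun t => Cochain.ofHom_injective (congrFun (congrArg Subtype.val h) t))

lemma DGHom.ofHom_comp {M N P : DGMod k T} (φ : M ⟶ N) (ψ : N ⟶ P) :
    DGHom.ofHom (φ ≫ ψ) = (DGHom.ofHom φ).comp (DGHom.ofHom ψ) (add_zero 0) :=
  Subtype.ext (funext fun _ => Cochain.ofHom_comp _ _)

lemma DGHom.ofHom_id (M : DGMod k T) : DGHom.ofHom (𝟙 M) = DGHom.id M := rfl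

lemma DGFunctor.map_ofHom_δ (F : DGFunctor k T) {X Y : DGMod k T} (φ : X ⟶ Y) :
    (F.map (DGHom.ofHom φ)).δ 0 1 = 0 := by
  rw [← F.map_δ (zero_add 1), DGHom.ofHom_δ]
  simpa using F.map_smul (n := 1) (0 : k) (0 : DGHom 1 X Y)

/-- The functor on strict morphisms induced by a dg functor. -/
def DGFunctor.toFunctor (F : DGFunctor k T) : DGMod k T ⥤ DGMod k T where
  obj := F.obj
  map φ := (F.map (DGHom.ofHom φ)).toHom (F.map_ofHom_δ φ)
  map_id X := DGHom.ofHom_injective (by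
    rw [DGHom.ofHom_toHom, DGHom.ofHom_id, F.map_id, DGHom.ofHom_id])
  map_comp φ ψ := DGHom.ofHom_injective (by
    rw [DGHom.ofHom_toHom, DGHom.ofHom_comp, F.map_comp, DGHom.ofHom_comp, DGHom.ofHom_toHom,
      DGHom.ofHom_toHom])

/-! ### The homotopy category -/

/-- `f - g = d(h)`. -/
def IsHomotopy {M N : DGMod k T} (h : DGHom (-1) M N) (f g : M ⟶ N) : Prop :=
  DGHom.ofHom f - DGHom.ofHom g = h.δ (-1) 0

def homotopic : HomRel (DGMod k T) := fun M N f g => ∃ h : DGHom (-1) M N, IsHomotopy h f g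

lemma DGHom.δ_add {M N : DGMod k T} {n n' : ℤ} (φ ψ : DGHom n M N) :
    (φ + ψ).δ n n' = φ.δ n n' + ψ.δ n n' :=
  Subtype.ext (funext fun _ => CochainComplex.HomComplex.δ_add _ _ _ _)

lemma DGHom.δ_smul {M N : DGMod k T} {n n' : ℤ} (r : k) (φ : DGHom n M N) :
    (r • φ).δ n n' = r • φ.δ n n' :=
  Subtype.ext (funext fun _ => CochainComplex.HomComplex.δ_smul _ _ _ _)

lemma DGHom.δ_neg {M N : DGMod k T} {n n' : ℤ} (φ : DGHom n M N) : (-φ).δ n n' = -φ.δ n n' :=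
  Subtype.ext (funext fun _ => CochainComplex.HomComplex.δ_neg _ _ _)

lemma homotopic_smul (r : k) ⦃M N : DGMod k T⦄ (f g : M ⟶ N) (h : homotopic f g) :
    homotopic (r • f) (r • g) := by
  obtain ⟨h, hh⟩ := h
  exact ⟨r • h, by rw [IsHomotopy, DGHom.δ_smul, ← hh, smul_sub, map_smul, map_smul]⟩

lemma homotopic_add ⦃M N : DGMod k T⦄ (f f' g g' : M ⟶ N) (h : homotopic f f')
    (h' : homotopic g g') : homotopic (f + g) (f' + g') := by
  obtain ⟨h, hh⟩ := h
  obtain ⟨h', hh'⟩ := h'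
  exact ⟨h + h', by rw [IsHomotopy, DGHom.δ_add, ← hh, ← hh', map_add, map_add]; abel⟩

lemma homotopic_refl {M N : DGMod k T} (f : M ⟶ N) : homotopic f f :=
  ⟨(0 : k) • 0, by rw [IsHomotopy, DGHom.δ_smul, zero_smul, sub_self]⟩

instance : Congruence (homotopic (k := k) (T := T)) where
  equivalence {M N} :=
    { refl := homotopic_refl
      symm := by
        rintro f g ⟨h, hh⟩
        exact ⟨-h, by rw [IsHomotopy, DGHom.δ_neg, ← hh, neg_sub]⟩
      trans := by
        rintro f g g' ⟨h, hh⟩ ⟨h', hh'⟩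
        exact ⟨h + h', by rw [IsHomotopy, DGHom.δ_add, ← hh, ← hh']; abel⟩ }
  comp_left {M N P} f {g g'} := by
    rintro ⟨h, hh⟩
    refine ⟨(DGHom.ofHom f).comp h (zero_add (-1)), ?_⟩
    rw [IsHomotopy, DGHom.δ_comp (q' := 0) _ _ _ (zero_add 1) (by lia) (by lia), DGHom.ofHom_δ, DGHom.zero_comp,
      smul_zero, add_zero, ← hh, DGHom.ofHom_comp, DGHom.ofHom_comp]
    exact Subtype.ext (funext fun _ => (Cochain.comp_sub _ _ _ (add_zero 0)).symm)
  comp_right {M N P f g} g' := by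
    rintro ⟨h, hh⟩
    refine ⟨h.comp (DGHom.ofHom g') (add_zero (-1)), ?_⟩
    rw [IsHomotopy, DGHom.δ_comp (p' := 0) _ _ _ (by lia) (zero_add 1) (by lia), DGHom.ofHom_δ, DGHom.comp_zero,
      Int.negOnePow_zero, one_smul, zero_add, ← hh, DGHom.ofHom_comp, DGHom.ofHom_comp]
    exact Subtype.ext (funext fun _ => (Cochain.sub_comp _ _ _ (add_zero 0)).symm)

lemma DGMod.act_XIsoOfEq (M : DGMod k T) {x y : T} {p q n p' n' : ℤ} (h : p + q = n)
    (hp : p = p') (hn : n = n') (m : (M.obj y).X p) (f : (DGCategory.hom (k := k) x y).X q) :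
    ((M.obj x).XIsoOfEq hn).hom.hom (M.act h m f) =
      M.act (show p' + q = n' by lia) (((M.obj y).XIsoOfEq hp).hom.hom m) f := by
  subst hp hn
  simp

/-- Unchanged right action; the differential is multiplied by `(-1)^n`. -/
def DGMod.shift (n : ℤ) (M : DGMod k T) : DGMod k T where
  obj t := (M.obj t)⟦n⟧
  act {x y p q l} h := M.act (show p + n + q = l + n by lia)
  act_id {x p} m := M.act_id (p := p + n) m
  act_act ha hb hn hn' m g f := M.act_act _ hb _ _ m g f
  d_act {x y p q p' q' l l'} hp hq hl h m f := by
    have h1 := M.d_act (show p + n + 1 = p' + n by lia) hq (show l + n + 1 = l' + n by lia)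
      (show p + n + q = l + n by lia) m f
    have h2 : n.negOnePow • ((M.obj x).d (l + n) (l' + n)).hom
          (M.act (p := p + n) (n := l + n) (by lia) m f) =
        M.act (p := p' + n) (n := l' + n) (by lia)
            (n.negOnePow • ((M.obj y).d (p + n) (p' + n)).hom m) f +
          p.negOnePow • M.act (p := p + n) (q := q') (n := l' + n) (by lia) m
            (((DGCategory.hom x y).d q q').hom f) := by
      rw [h1, smul_add, smul_smul, Int.negOnePow_add, mul_comm p.negOnePow, ← mul_assoc,
        Int.units_mul_self, one_mul, LinearMap.map_smul_of_tower, LinearMap.smul_apply]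
    have h3 : ∀ (K : Cplx k) (i j : ℤ) (z : K.X (i + n)), ((K⟦n⟧).d i j).hom z =
      n.negOnePow • (K.d (i + n) (j + n)).hom z := fun K i j z => by
        rw [CochainComplex.shiftFunctor_obj_d']
        rcases Int.units_eq_one_or n.negOnePow with h | h <;> rw [h] <;> simp <;> rfl
    refine (h3 _ _ _ _).trans (h2.trans ?_)
    congr 2

def DGMod.shiftFunctor (n : ℤ) : DGMod k T ⥤ DGMod k T where
  obj M := M.shift n
  map φ := ⟨fun t => (φ.1 t)⟦n⟧', fun x y p q l h m f => φ.2 (show p + n + q = l + n by lia) m f⟩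
  map_id M := Subtype.ext (funext fun t => (CategoryTheory.shiftFunctor (Cplx k) n).map_id _)
  map_comp φ ψ := Subtype.ext (funext fun t => (CategoryTheory.shiftFunctor (Cplx k) n).map_comp _ _)

lemma XIsoOfEq_hom_trans_apply (K : Cplx k) {a b c : ℤ} (h : a = b) (h' : b = c) (x : K.X a) :
    (K.XIsoOfEq h').hom.hom ((K.XIsoOfEq h).hom.hom x) = (K.XIsoOfEq (h.trans h')).hom.hom x := by
  subst h h'; simp

lemma DGMod.eqToHom_app {M N : DGMod k T} (h : M = N) (t : T) :
    DGMod.app (eqToHom h) t = eqToHom (by rw [h]) := by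
  subst h; rfl

def DGMod.isoMk {M N : DGMod k T} (e : ∀ t, M.obj t ≅ N.obj t)
    (he : ∀ ⦃x y : T⦄ ⦃p q n : ℤ⦄ (h : p + q = n) (m : (M.obj y).X p)
      (f : (DGCategory.hom (k := k) x y).X q),
      ((e x).hom.f n).hom (M.act h m f) = N.act h (((e y).hom.f p).hom m) f) : M ≅ N where
  hom := ⟨fun t => (e t).hom, he⟩
  inv := ⟨fun t => (e t).inv, fun x y p q n h m f => by
    have h1 : ∀ (t : T) (i : ℤ) (a : (M.obj t).X i),
        ((e t).inv.f i).hom (((e t).hom.f i).hom a) = a := fun t i a =>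
      LinearMap.congr_fun (congrArg ModuleCat.Hom.hom
        (congrArg (fun φ : M.obj t ⟶ M.obj t => φ.f i) (e t).hom_inv_id)) a
    have h2 : ∀ (t : T) (i : ℤ) (a : (N.obj t).X i),
        ((e t).hom.f i).hom (((e t).inv.f i).hom a) = a := fun t i a =>
      LinearMap.congr_fun (congrArg ModuleCat.Hom.hom
        (congrArg (fun φ : N.obj t ⟶ N.obj t => φ.f i) (e t).inv_hom_id)) a
    have h3 := congrArg ((e x).inv.f n).hom (he h (((e y).inv.f p).hom m) f)
    rw [h1, h2] at h3
    exact h3.symm⟩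
  hom_inv_id := Subtype.ext (funext fun t => (e t).hom_inv_id)
  inv_hom_id := Subtype.ext (funext fun t => (e t).inv_hom_id)

def DGMod.shiftZero : DGMod.shiftFunctor (k := k) (T := T) 0 ≅ 𝟭 _ :=
  NatIso.ofComponents (fun M => DGMod.isoMk
    (fun t => (CategoryTheory.shiftFunctorZero (Cplx k) ℤ).app (M.obj t))
    (fun x y p q n h m f => by
      simp only [Iso.app_hom, CochainComplex.shiftFunctorZero_hom_app_f]
      exact M.act_XIsoOfEq _ _ _ _ _))
    (fun φ => Subtype.ext (funext fun t =>
      (CategoryTheory.shiftFunctorZero (Cplx k) ℤ).hom.naturality (φ.1 t)))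

def DGMod.shiftAdd (a b : ℤ) : DGMod.shiftFunctor (k := k) (T := T) (a + b) ≅
    DGMod.shiftFunctor a ⋙ DGMod.shiftFunctor b :=
  NatIso.ofComponents (fun M => DGMod.isoMk
    (fun t => (CategoryTheory.shiftFunctorAdd (Cplx k) a b).app (M.obj t))
    (fun x y p q n h m f => by
      simp only [Iso.app_hom, CochainComplex.shiftFunctorAdd_hom_app_f]
      exact M.act_XIsoOfEq _ _ _ _ _))
    (fun φ => Subtype.ext (funext fun t =>
      (CategoryTheory.shiftFunctorAdd (Cplx k) a b).hom.naturality (φ.1 t)))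

instance : HasShift (DGMod k T) ℤ := hasShiftMk _ _
  { F := DGMod.shiftFunctor
    zero := DGMod.shiftZero
    add := DGMod.shiftAdd
    assoc_hom_app := fun a b c M => Subtype.ext (funext fun t => by
      refine (shiftFunctorAdd_assoc_hom_app a b c (M.obj t)).trans (Eq.symm ?_)
      refine (congrArg (· ≫ (shiftFunctorAdd (Cplx k) a (b + c)).hom.app (M.obj t) ≫
        (shiftFunctorAdd (Cplx k) b c).hom.app ((M.obj t)⟦a⟧))
        (DGMod.eqToHom_app (M := M.shift (a + b + c)) (N := M.shift (a + (b + c)))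
          (by rw [add_assoc]) t)).trans ?_
      simp [shiftFunctorAdd']
      rfl)
    zero_add_hom_app := fun a M => Subtype.ext (funext fun t => by
      refine (shiftFunctorAdd_zero_add_hom_app a (M.obj t)).trans (Eq.symm ?_)
      exact congrArg (· ≫ ((shiftFunctorZero (Cplx k) ℤ).inv.app (M.obj t))⟦a⟧')
        (DGMod.eqToHom_app (M := M.shift (0 + a)) (N := M.shift a) (by rw [zero_add]) t))
    add_zero_hom_app := fun a M => Subtype.ext (funext fun t => by
      refine (shiftFunctorAdd_add_zero_hom_app a (M.obj t)).trans (Eq.symm ?_)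
      exact congrArg (· ≫ (shiftFunctorZero (Cplx k) ℤ).inv.app ((M.obj t)⟦a⟧))
        (DGMod.eqToHom_app (M := M.shift (a + 0)) (N := M.shift a) (by rw [add_zero]) t)) }

instance (n : ℤ) : (shiftFunctor (DGMod k T) n).Additive where
  map_add := rfl

instance (n : ℤ) : (shiftFunctor (DGMod k T) n).Linear k where
  map_smul _ _ := rfl

def DGHom.shift {M N : DGMod k T} {m : ℤ} (n : ℤ) (φ : DGHom m M N) :
    DGHom m (M⟦n⟧) (N⟦n⟧) :=
  ⟨fun t => (φ.1 t).shift n, fun x y p q a b c ha hb hc hc' e f => by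
    exact φ.map_act (show p + n + q = a + n by lia) (by lia) (by lia)
      (show b + n + q = c + n by lia) e f⟩

lemma DGHom.δ_shift {M N : DGMod k T} {m m' : ℤ} (n : ℤ) (φ : DGHom m M N) :
    (φ.shift n).δ m m' = n.negOnePow • (φ.δ m m').shift n := by
  apply Subtype.ext
  funext t
  refine (Cochain.δ_shift (φ.1 t) n m').trans ?_
  rcases Int.units_eq_one_or n.negOnePow with h | h <;> rw [h] <;> simp <;> rfl

lemma DGHom.shift_units_smul {M N : DGMod k T} {m : ℤ} (n : ℤ) (r : ℤˣ) (φ : DGHom m M N) :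
    (r • φ).shift n = r • φ.shift n := by
  apply Subtype.ext
  funext t
  rcases Int.units_eq_one_or r with h | h <;> rw [h]
  · simp
  · simp only [Units.neg_smul, one_smul]
    exact Cochain.shift_neg (φ.1 t) n

instance : (homotopic (k := k) (T := T)).IsCompatibleWithShift ℤ where
  condition n M N f g := by
    rintro ⟨h, hh⟩
    refine ⟨n.negOnePow • h.shift n, ?_⟩
    rw [IsHomotopy, DGHom.δ_units_smul, DGHom.δ_shift, smul_smul, Int.units_mul_self, one_smul, ← hh]
    apply DGHom.ext_apply
    intro t p q hpq m
    obtain rfl : q = p := by lia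
    rfl

variable (k T) in
/-- The homotopy category `H⁰` of the dg category of right dg modules. -/
abbrev HoMod : Type _ := Quotient (homotopic (k := k) (T := T))

instance : Preadditive (HoMod k T) := Quotient.preadditive _ fun _ _ _ _ _ _ h h' =>
  homotopic_add _ _ _ _ h h'

variable (k T) in
abbrev toHo : DGMod k T ⥤ HoMod k T := Quotient.functor _

instance : (toHo k T).Additive := Quotient.functor_additive _ fun _ _ _ _ _ _ h h' =>
  homotopic_add _ _ _ _ h h'

instance : Linear k (HoMod k T) := Quotient.linear k _ homotopic_smul

instance : (toHo k T).Linear k := Quotient.linear_functor k _ homotopic_smul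

instance (n : ℤ) : (shiftFunctor (HoMod k T) n).Additive := by
  have : (toHo k T ⋙ shiftFunctor _ n).Additive :=
    Functor.additive_of_iso ((toHo k T).commShiftIso n)
  exact Functor.additive_of_full_essSurj_comp (toHo k T) _

/-! ### Quasi-isomorphisms, cofibrant and perfect modules -/

/-- A morphism that induces isomorphisms on the cohomology of all values. -/
def IsQuasiIso {M N : DGMod k T} (φ : M ⟶ N) : Prop := ∀ t, QuasiIso (DGMod.app φ t)

/-- The trivial fibrations of the projective model structure. -/
def IsTrivFib {M N : DGMod k T} (φ : M ⟶ N) : Prop :=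
  IsQuasiIso φ ∧ ∀ t n, Function.Surjective ((DGMod.app φ t).f n).hom

/-- Cofibrant in the projective model structure. -/
def IsCofibrant (M : DGMod k T) : Prop :=
  ∀ ⦃N N' : DGMod k T⦄ (p : N ⟶ N'), IsTrivFib p → ∀ f : M ⟶ N', ∃ g : M ⟶ N, g ≫ p = f

def IsCompactObj {C : Type*} [Category* C] [Preadditive C] (X : C) : Prop :=
  ∀ ⦃ι : Type u⦄ (N : ι → C) (c : Limits.Cofan N) (_ : Limits.IsColimit c) (f : X ⟶ c.pt),
    ∃ (S : Finset ι) (g : ∀ i, X ⟶ N i), f = ∑ i ∈ S, g i ≫ c.inj i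
lemma IsTrivFib.shift {M N : DGMod k T} {φ : M ⟶ N} (h : IsTrivFib φ) (n : ℤ) :
    IsTrivFib (φ⟦n⟧') :=
  ⟨fun t => (CochainComplex.quasiIso_shift_iff (DGMod.app φ t) n).2 (h.1 t),
    fun t i => h.2 t (i + n)⟩

lemma IsCofibrant.shift {M : DGMod k T} (h : IsCofibrant M) (n : ℤ) : IsCofibrant (M⟦n⟧) := by
  intro N N' p hp f
  let adj : shiftFunctor (DGMod k T) n ⊣ shiftFunctor (DGMod k T) (-n) :=
    (shiftEquiv (DGMod k T) n).toAdjunction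
  obtain ⟨g, hg⟩ := h _ (hp.shift (-n)) (adj.homEquiv M N' f)
  refine ⟨(adj.homEquiv M N).symm g, (adj.homEquiv M N').injective ?_⟩
  rw [adj.homEquiv_naturality_right, Equiv.apply_symm_apply]
  exact hg

lemma IsCompactObj.shift {C : Type*} [Category* C] [Preadditive C] [HasShift C ℤ]
    [∀ n : ℤ, (shiftFunctor C n).Additive] {X : C} (h : IsCompactObj.{u} X) (n : ℤ) :
    IsCompactObj.{u} (X⟦n⟧) := by
  intro ι N c hc f
  let adj : shiftFunctor C n ⊣ shiftFunctor C (-n) := (shiftEquiv C n).toAdjunction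
  have hc' := Limits.isColimitCofanMkObjOfIsColimit (shiftFunctor C (-n)) N c.inj
    (hc.ofIsoColimit (Limits.Cofan.ext (Iso.refl _) (fun _ => by simp [Limits.Cofan.inj])))
  obtain ⟨S, g, hg⟩ := h _ _ hc' (adj.homEquiv X c.pt f)
  refine ⟨S, fun i => (adj.homEquiv X (N i)).symm (g i), (adj.homEquiv X c.pt).injective ?_⟩
  rw [hg, adj.homEquiv_unit, Functor.map_sum, Preadditive.comp_sum]
  refine Finset.sum_congr rfl fun i _ => ?_
  rw [← adj.homEquiv_unit, adj.homEquiv_naturality_right, Equiv.apply_symm_apply]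
  rfl

/-- The objects of `𝒯_pe`: cofibrant modules that are compact in the homotopy category (maps out
of a cofibrant module are the same in the homotopy and in the derived category). -/
def IsPerfectMod (M : DGMod k T) : Prop := IsCofibrant M ∧ IsCompactObj.{u} ((toHo k T).obj M)

variable (k T) in
def perf : ObjectProperty (HoMod k T) := fun X => IsPerfectMod X.as

instance : (perf k T).IsStableUnderShift ℤ where
  isStableUnderShiftBy n :=
    { le_shift := fun X hX => ⟨by
        have : (X⟦n⟧).as = X.as⟦n⟧ :=
          congrArg Quotient.as (Quotient.functor_obj_shift (homotopic (k := k) (T := T)) ℤ X.as n)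
        rw [this]
        exact hX.1.shift n, hX.2.shift n⟩ }

variable (k T) in
def zeroMod : DGMod k T where
  obj _ :=
    { X := fun _ => ModuleCat.of k PUnit
      d := fun _ _ => 0 }
  act _ := 0
  act_id _ := rfl
  act_act _ _ _ _ _ _ _ := rfl
  d_act _ _ _ _ _ _ := rfl

lemma zeroMod_hom_ext {M : DGMod k T} (f g : zeroMod k T ⟶ M) : f = g := by
  apply Subtype.ext
  funext t
  ext i x
  have : x = 0 := Subsingleton.elim (α := PUnit) _ _
  rw [this, map_zero, map_zero]

instance : (perf k T).ContainsZero where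
  exists_zero := by
    have h : ∀ (M : HoMod k T) (f g : (toHo k T).obj (zeroMod k T) ⟶ M), f = g := by
      intro M f g
      obtain ⟨f, rfl⟩ := (toHo k T).map_surjective (Y := M.as) f
      obtain ⟨g, rfl⟩ := (toHo k T).map_surjective (Y := M.as) g
      rw [zeroMod_hom_ext f g]
    refine ⟨(toHo k T).obj (zeroMod k T), (Limits.IsZero.iff_id_eq_zero _).2 (h _ _ _), ?_, ?_⟩
    · intro N N' p _ f
      exact ⟨0, zeroMod_hom_ext _ _⟩
    · intro ι N c hc f
      exact ⟨∅, fun _ => 0, h _ _ _⟩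

variable (k T) in
/-- `H⁰(𝒯_pe)` -/
abbrev H0pe : Type _ := (perf k T).FullSubcategory


variable (k T) in
/-- All complexes `hom x y` are cofibrant in the projective model structure on complexes of
`k`-modules (automatic if `k` is a field, or if the dg category is cofibrant). -/
def IsLocallyCofibrant : Prop :=
  ∀ (x y : T) ⦃K L : Cplx k⦄ (p : K ⟶ L), QuasiIso p →
    (∀ n, Function.Surjective (p.f n).hom) → ∀ f : DGCategory.hom (k := k) x y ⟶ L,
      ∃ g : DGCategory.hom x y ⟶ K, g ≫ p = f

/-- Strict morphisms of bimodules. -/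
structure Bimod.Hom (B C : Bimod k T) where
  app (s : T) : B.obj s ⟶ C.obj s
  naturality ⦃x y : T⦄ ⦃q : ℤ⦄ (f : (DGCategory.hom (k := k) x y).X q) :
    (B.map f).comp (DGHom.ofHom (app y)) (add_zero q) =
      (DGHom.ofHom (app x)).comp (C.map f) (zero_add q)

def Bimod.IsCofibrant (B : Bimod k T) : Prop :=
  ∀ ⦃C C' : Bimod k T⦄ (p : Bimod.Hom C C'), (∀ s, IsTrivFib (p.app s)) →
    ∀ f : Bimod.Hom B C', ∃ g : Bimod.Hom B C, ∀ s, g.app s ≫ p.app s = f.app s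

/-- Strict morphisms of 2-fold bimodules. -/
structure Bimod2.Hom (Γ Δ : Bimod2 k T) where
  app (s : T) : Bimod.Hom (Γ.obj s) (Δ.obj s)
  naturality ⦃x y : T⦄ ⦃q : ℤ⦄ (f : (DGCategory.hom (k := k) x y).X q) (t : T) :
    ((Γ.map f).1 t).comp (DGHom.ofHom ((app y).app t)) (add_zero q) =
      (DGHom.ofHom ((app x).app t)).comp ((Δ.map f).1 t) (zero_add q)

def Bimod2.IsCofibrant (Γ : Bimod2 k T) : Prop :=
  ∀ ⦃Δ Δ' : Bimod2 k T⦄ (p : Bimod2.Hom Δ Δ'), (∀ s t, IsTrivFib ((p.app s).app t)) →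
    ∀ f : Bimod2.Hom Γ Δ', ∃ g : Bimod2.Hom Γ Δ,
      ∀ s t, (g.app s).app t ≫ (p.app s).app t = (f.app s).app t

namespace H0pe

/-- The underlying dg module. -/
def mod (X : H0pe k T) : DGMod k T := X.obj.as

/-- The homotopy class of module morphisms underlying a morphism. -/
def cls {X Y : H0pe k T} (f : X ⟶ Y) : (toHo k T).obj X.mod ⟶ (toHo k T).obj Y.mod :=
  (perf k T).ι.map f

end H0pe

namespace DGFunctor

lemma homotopic_map (F : DGFunctor k T) ⦃X Y : DGMod k T⦄ (f g : X ⟶ Y) (h : homotopic f g) :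
    homotopic (F.toFunctor.map f) (F.toFunctor.map g) := by
  obtain ⟨h, hh⟩ := h
  have h1 : F.map (DGHom.ofHom f) - F.map (DGHom.ofHom g) = (F.map h).δ (-1) 0 := by
    rw [← F.map_δ (by lia), ← hh, sub_eq_iff_eq_add, ← F.map_add, sub_add_cancel]
  refine ⟨F.map h, Eq.trans ?_ h1⟩
  exact congrArg₂ (· - ·) (DGHom.ofHom_toHom _ (F.map_ofHom_δ f))
    (DGHom.ofHom_toHom _ (F.map_ofHom_δ g))

/-- The functor on the homotopy category induced by a dg functor. -/
def onHo (F : DGFunctor k T) : HoMod k T ⥤ HoMod k T :=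
  CategoryTheory.Quotient.lift _ (F.toFunctor ⋙ toHo k T) fun _ _ f g h =>
    CategoryTheory.Quotient.sound _ (F.homotopic_map f g h)

end DGFunctor

/-! ### Triangles -/

/-- `Z` is a mapping cone of `f`. -/
structure ConeData {X Y Z : DGMod k T} (f : X ⟶ Y) (g : Y ⟶ Z) (h : Z ⟶ X⟦(1 : ℤ)⟧) where
  inl : DGHom (-1) X Z
  fst : DGHom 1 Z X
  snd : DGHom 0 Z Y
  inl_fst : inl.comp fst (neg_add_cancel 1) = DGHom.id X
  inl_snd : inl.comp snd (add_zero _) = 0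
  inr_fst : (DGHom.ofHom g).comp fst (zero_add 1) = 0
  inr_snd : (DGHom.ofHom g).comp snd (zero_add 0) = DGHom.id Y
  total : fst.comp inl (add_neg_cancel 1) + snd.comp (DGHom.ofHom g) (add_zero 0) = DGHom.id Z
  δ_inl : inl.δ (-1) 0 = DGHom.ofHom (f ≫ g)
  δ_fst : fst.δ 1 2 = 0
  δ_snd : snd.δ 0 1 = -fst.comp (DGHom.ofHom f) (add_zero 1)
  h_eq (t : T) (n m : ℤ) (hm : n + 1 = m) (z : (Z.obj t).X n) :
    ((X.obj t).XIsoOfEq hm).hom.hom (((DGMod.app h t).f n).hom z) =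
      -((fst.1 t).v n m hm).hom z

open Pretriangulated in
variable (k T) in
/-- The triangles in the homotopy category isomorphic to the triangle of a mapping cone. -/
def coneTriangles : Set (Triangle (HoMod k T)) :=
  {τ | ∃ (X Y Z : DGMod k T) (f : X ⟶ Y) (g : Y ⟶ Z) (h : Z ⟶ X⟦(1 : ℤ)⟧),
    Nonempty (ConeData f g h) ∧
    Nonempty (τ ≅ Triangle.mk ((toHo k T).map f) ((toHo k T).map g)
      ((toHo k T).map h ≫ ((toHo k T).commShiftIso (1 : ℤ)).hom.app X))}

open Pretriangulated in
variable (k T) in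
def coneTrianglesPe : Set (Triangle (H0pe k T)) :=
  {τ | (perf k T).ι.mapTriangle.obj τ ∈ coneTriangles k T}

/-! ### Pseudo dg tensor structures and functors -/

/-- A family of strict morphisms that is natural for graded morphisms of all degrees. -/
def IsNat (F G : DGFunctor k T) (η : ∀ X, F.obj X ⟶ G.obj X) : Prop :=
  DGNatural 0 F G fun X => DGHom.ofHom (η X)

/-- A morphism of `n`-fold bimodules is given by the maps that it induces on the tensor products
with all right modules `X`, `Y`, …, natural in each of them for graded morphisms of all degrees. -/
structure PseudoDGTensorStructure (k : Type u) [CommRing k] (T : Type u) [DGCategory k T] where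
  Γ : Bimod2 k T
  U : DGMod k T
  α (X Y Z : DGMod k T) : Γ.prod X (Γ.prod Y Z) ⟶ Γ.prod (Γ.prod X Y) Z
  α_nat₁ (Y Z : DGMod k T) : IsNat (Γ.prodL (Γ.prod Y Z)) ((Γ.prodL Y).comp (Γ.prodL Z))
    fun X => α X Y Z
  α_nat₂ (X Z : DGMod k T) : IsNat ((Γ.prodL Z).comp (Γ.prodR X)) ((Γ.prodR X).comp (Γ.prodL Z))
    fun Y => α X Y Z
  α_nat₃ (X Y : DGMod k T) : IsNat ((Γ.prodR Y).comp (Γ.prodR X)) (Γ.prodR (Γ.prod X Y))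
    fun Z => α X Y Z
  ℓ (X : DGMod k T) : Γ.prod U X ⟶ X
  ℓ_nat : IsNat (Γ.prodR U) DGFunctor.id ℓ
  r (X : DGMod k T) : Γ.prod X U ⟶ X
  r_nat : IsNat (Γ.prodL U) DGFunctor.id r
  c (X Y : DGMod k T) : Γ.prod X Y ⟶ Γ.prod Y X
  c_nat₁ (Y : DGMod k T) : IsNat (Γ.prodL Y) (Γ.prodR Y) fun X => c X Y
  c_nat₂ (X : DGMod k T) : IsNat (Γ.prodR X) (Γ.prodL X) fun Y => c X Y
  α_iso (X Y Z : DGMod k T) : IsCofibrant X → IsCofibrant Y → IsCofibrant Z → IsQuasiIso (α X Y Z)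
  ℓ_iso (X : DGMod k T) : IsCofibrant X → IsQuasiIso (ℓ X)
  r_iso (X : DGMod k T) : IsCofibrant X → IsQuasiIso (r X)
  c_iso (X Y : DGMod k T) : IsCofibrant X → IsCofibrant Y → IsQuasiIso (c X Y)
  pentagon : ∃ η : ∀ X Y Z W : DGMod k T, DGHom (-1) (Γ.prod X (Γ.prod Y (Γ.prod Z W)))
      (Γ.prod (Γ.prod (Γ.prod X Y) Z) W),
    (∀ Y Z W, DGNatural (-1) (Γ.prodL (Γ.prod Y (Γ.prod Z W)))
      (((Γ.prodL Y).comp (Γ.prodL Z)).comp (Γ.prodL W)) fun X => η X Y Z W) ∧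
    (∀ X Z W, DGNatural (-1) ((Γ.prodL (Γ.prod Z W)).comp (Γ.prodR X))
      (((Γ.prodR X).comp (Γ.prodL Z)).comp (Γ.prodL W)) fun Y => η X Y Z W) ∧
    (∀ X Y W, DGNatural (-1) (((Γ.prodL W).comp (Γ.prodR Y)).comp (Γ.prodR X))
      ((Γ.prodR (Γ.prod X Y)).comp (Γ.prodL W)) fun Z => η X Y Z W) ∧
    (∀ X Y Z, DGNatural (-1) (((Γ.prodR Z).comp (Γ.prodR Y)).comp (Γ.prodR X))
      (Γ.prodR (Γ.prod (Γ.prod X Y) Z)) fun W => η X Y Z W) ∧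
    ∀ X Y Z W, IsHomotopy (η X Y Z W)
      (α X Y (Γ.prod Z W) ≫ α (Γ.prod X Y) Z W)
      ((Γ.prodR X).toFunctor.map (α Y Z W) ≫ α X (Γ.prod Y Z) W ≫
        (Γ.prodL W).toFunctor.map (α X Y Z))
  triangle : ∃ μ : ∀ X Y : DGMod k T, DGHom (-1) (Γ.prod X (Γ.prod U Y)) (Γ.prod X Y),
    (∀ Y, DGNatural (-1) (Γ.prodL (Γ.prod U Y)) (Γ.prodL Y) fun X => μ X Y) ∧
    (∀ X, DGNatural (-1) ((Γ.prodR U).comp (Γ.prodR X)) (Γ.prodR X) fun Y => μ X Y) ∧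
    ∀ X Y, IsHomotopy (μ X Y)
      (α X U Y ≫ (Γ.prodL Y).toFunctor.map (r X))
      ((Γ.prodR X).toFunctor.map (ℓ Y))
  symmetry (X Y : DGMod k T) : IsCofibrant X → IsCofibrant Y →
    homotopic (c X Y ≫ c Y X) (𝟙 (Γ.prod X Y))
  unit_symmetry : ∃ κ : ∀ X : DGMod k T, DGHom (-1) (Γ.prod X U) X,
    DGNatural (-1) (Γ.prodL U) DGFunctor.id κ ∧
    ∀ X, IsHomotopy (κ X)
      (c X U ≫ ℓ X)
      (r X)
  hexagon : ∃ lam : ∀ X Y Z : DGMod k T,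
      DGHom (-1) (Γ.prod Y (Γ.prod X Z)) (Γ.prod (Γ.prod X Y) Z),
    (∀ Y Z, DGNatural (-1) ((Γ.prodL Z).comp (Γ.prodR Y)) ((Γ.prodL Y).comp (Γ.prodL Z))
      fun X => lam X Y Z) ∧
    (∀ X Z, DGNatural (-1) (Γ.prodL (Γ.prod X Z)) ((Γ.prodR X).comp (Γ.prodL Z))
      fun Y => lam X Y Z) ∧
    (∀ X Y, DGNatural (-1) ((Γ.prodR X).comp (Γ.prodR Y)) (Γ.prodR (Γ.prod X Y))
      fun Z => lam X Y Z) ∧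
    ∀ X Y Z, IsHomotopy (lam X Y Z)
      ((Γ.prodR Y).toFunctor.map (c X Z) ≫ α Y Z X ≫ c (Γ.prod Y Z) X ≫
      α X Y Z)
      (α Y X Z ≫ (Γ.prodL Z).toFunctor.map (c Y X))

namespace PseudoDGTensorStructure

/-- `Γ` is cofibrant, and the unit and the products of perfect modules are quasi-isomorphic to
perfect modules. -/
structure IsPerfect (S : PseudoDGTensorStructure k T) : Prop where
  cofibrant : S.Γ.IsCofibrant
  unit : ∃ (P : DGMod k T) (φ : P ⟶ S.U), IsPerfectMod P ∧ IsQuasiIso φ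
  prod (X Y : DGMod k T) : IsPerfectMod X → IsPerfectMod Y →
    ∃ (P : DGMod k T) (φ : P ⟶ S.Γ.prod X Y), IsPerfectMod P ∧ IsQuasiIso φ

end PseudoDGTensorStructure

/-- A pseudo dg tensor functor from `S` to `S'`. The bimodule `Φ` is cofibrant and `X ↦ X ⊗ Φ`
preserves perfect modules up to quasi-isomorphism, that is, `Φ` is a quasi-functor from `𝒯_pe`
to `𝒯_pe`. -/
structure PseudoDGTensorFunctor (S S' : PseudoDGTensorStructure k T) where
  Φ : Bimod k T
  cofibrant : Φ.IsCofibrant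
  perfect (X : DGMod k T) : IsPerfectMod X →
    ∃ (P : DGMod k T) (φ : P ⟶ tensor X Φ), IsPerfectMod P ∧ IsQuasiIso φ
  u : S'.U ⟶ tensor S.U Φ
  f (X Y : DGMod k T) : S'.Γ.prod (tensor X Φ) (tensor Y Φ) ⟶ tensor (S.Γ.prod X Y) Φ
  f_nat₁ (Y : DGMod k T) : IsNat ((tens Φ).comp (S'.Γ.prodL (tensor Y Φ)))
    ((S.Γ.prodL Y).comp (tens Φ)) fun X => f X Y
  f_nat₂ (X : DGMod k T) : IsNat ((tens Φ).comp (S'.Γ.prodR (tensor X Φ)))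
    ((S.Γ.prodR X).comp (tens Φ)) fun Y => f X Y
  u_iso : IsQuasiIso u
  f_iso (X Y : DGMod k T) : IsCofibrant X → IsCofibrant Y → IsQuasiIso (f X Y)
  unit : ∃ w : ∀ X : DGMod k T, DGHom (-1) (S'.Γ.prod S'.U (tensor X Φ)) (tensor X Φ),
    DGNatural (-1) ((tens Φ).comp (S'.Γ.prodR S'.U)) (tens Φ) w ∧
    ∀ X, IsHomotopy (w X)
      ((S'.Γ.prodL (tensor X Φ)).toFunctor.map u ≫ f S.U X ≫
      (tens Φ).toFunctor.map (S.ℓ X))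
      (S'.ℓ (tensor X Φ))
  symmetry : ∃ e : ∀ X Y : DGMod k T,
      DGHom (-1) (S'.Γ.prod (tensor X Φ) (tensor Y Φ)) (tensor (S.Γ.prod Y X) Φ),
    (∀ Y, DGNatural (-1) ((tens Φ).comp (S'.Γ.prodL (tensor Y Φ)))
      ((S.Γ.prodR Y).comp (tens Φ)) fun X => e X Y) ∧
    (∀ X, DGNatural (-1) ((tens Φ).comp (S'.Γ.prodR (tensor X Φ)))
      ((S.Γ.prodL X).comp (tens Φ)) fun Y => e X Y) ∧
    ∀ X Y, IsHomotopy (e X Y)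
      (f X Y ≫ (tens Φ).toFunctor.map (S.c X Y))
      (S'.c (tensor X Φ) (tensor Y Φ) ≫ f Y X)
  associativity : ∃ a : ∀ X Y Z : DGMod k T,
      DGHom (-1) (S'.Γ.prod (tensor X Φ) (S'.Γ.prod (tensor Y Φ) (tensor Z Φ)))
        (tensor (S.Γ.prod (S.Γ.prod X Y) Z) Φ),
    (∀ Y Z, DGNatural (-1) ((tens Φ).comp (S'.Γ.prodL (S'.Γ.prod (tensor Y Φ) (tensor Z Φ))))
      (((S.Γ.prodL Y).comp (S.Γ.prodL Z)).comp (tens Φ)) fun X => a X Y Z) ∧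
    (∀ X Z, DGNatural (-1)
      (((tens Φ).comp (S'.Γ.prodL (tensor Z Φ))).comp (S'.Γ.prodR (tensor X Φ)))
      (((S.Γ.prodR X).comp (S.Γ.prodL Z)).comp (tens Φ)) fun Y => a X Y Z) ∧
    (∀ X Y, DGNatural (-1)
      (((tens Φ).comp (S'.Γ.prodR (tensor Y Φ))).comp (S'.Γ.prodR (tensor X Φ)))
      ((S.Γ.prodR (S.Γ.prod X Y)).comp (tens Φ)) fun Z => a X Y Z) ∧
    ∀ X Y Z, IsHomotopy (a X Y Z)
      (S'.α (tensor X Φ) (tensor Y Φ) (tensor Z Φ) ≫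
      (S'.Γ.prodL (tensor Z Φ)).toFunctor.map (f X Y) ≫ f (S.Γ.prod X Y) Z)
      ((S'.Γ.prodR (tensor X Φ)).toFunctor.map (f Y Z) ≫ f X (S.Γ.prod Y Z) ≫
        (tens Φ).toFunctor.map (S.α X Y Z))

/-! ### Induced tensor triangulated categories and functors -/

/-- A tensor triangulated structure on `H⁰(𝒯_pe)` induced by `S`: the triangles are the mapping
cone triangles, and the tensor product, the unit, the associator, the unitors and the braiding are
identified by quasi-isomorphisms with `Γ`, `U`, `α`, `ℓ`, `r` and `c`. -/
structure InducedTTC (S : PseudoDGTensorStructure k T) where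
  pretri : Pretriangulated (H0pe k T)
  distinguished_eq : pretri.distinguishedTriangles = coneTrianglesPe k T
  isTriangulated : IsTriangulated (H0pe k T)
  monoidal : MonoidalCategory (H0pe k T)
  symmetric : SymmetricCategory (H0pe k T)
  preadditive : MonoidalPreadditive (H0pe k T)
  linear : MonoidalLinear k (H0pe k T)
  exact_left (X : H0pe k T) :
    ∃ _ : (MonoidalCategory.tensorLeft X).CommShift ℤ, (MonoidalCategory.tensorLeft X).IsTriangulated
  exact_right (X : H0pe k T) :
    ∃ _ : (MonoidalCategory.tensorRight X).CommShift ℤ,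
      (MonoidalCategory.tensorRight X).IsTriangulated
  κ (X Y : H0pe k T) : (monoidal.tensorObj X Y).mod ⟶ S.Γ.prod X.mod Y.mod
  κ_iso (X Y : H0pe k T) : IsQuasiIso (κ X Y)
  κ_nat₁ {X X' : H0pe k T} (φ : X ⟶ X') (Y : H0pe k T) :
    (toHo k T).map (κ X Y) ≫ (S.Γ.prodL Y.mod).onHo.map (H0pe.cls φ) =
      H0pe.cls (monoidal.whiskerRight φ Y) ≫ (toHo k T).map (κ X' Y)
  κ_nat₂ (X : H0pe k T) {Y Y' : H0pe k T} (ψ : Y ⟶ Y') :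
    (toHo k T).map (κ X Y) ≫ (S.Γ.prodR X.mod).onHo.map (H0pe.cls ψ) =
      H0pe.cls (monoidal.whiskerLeft X ψ) ≫ (toHo k T).map (κ X Y')
  κ₁ : (monoidal.tensorUnit).mod ⟶ S.U
  κ₁_iso : IsQuasiIso κ₁
  associator_eq (X Y Z : H0pe k T) :
    (toHo k T).map (κ X (monoidal.tensorObj Y Z) ≫ (S.Γ.prodR X.mod).toFunctor.map (κ Y Z) ≫
      S.α X.mod Y.mod Z.mod) =
    H0pe.cls (monoidal.associator X Y Z).inv ≫
      (toHo k T).map (κ (monoidal.tensorObj X Y) Z ≫ (S.Γ.prodL Z.mod).toFunctor.map (κ X Y))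
  leftUnitor_eq (X : H0pe k T) :
    (toHo k T).map (κ monoidal.tensorUnit X ≫ (S.Γ.prodL X.mod).toFunctor.map κ₁ ≫ S.ℓ X.mod) =
      H0pe.cls (monoidal.leftUnitor X).hom
  rightUnitor_eq (X : H0pe k T) :
    (toHo k T).map (κ X monoidal.tensorUnit ≫ (S.Γ.prodR X.mod).toFunctor.map κ₁ ≫ S.r X.mod) =
      H0pe.cls (monoidal.rightUnitor X).hom
  braiding_eq (X Y : H0pe k T) :
    (toHo k T).map (κ X Y ≫ S.c X.mod Y.mod) =
      H0pe.cls (symmetric.braiding X Y).hom ≫ (toHo k T).map (κ Y X)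

namespace InducedTTC

variable {S S' : PseudoDGTensorStructure k T}

/-- The tensor triangulated category `H⁰(𝒯_pe, S)`. -/
def Cat (_ : InducedTTC S) : Type _ := H0pe k T

variable (A : InducedTTC S)

instance : Category A.Cat := inferInstanceAs (Category (H0pe k T))
instance : Preadditive A.Cat := inferInstanceAs (Preadditive (H0pe k T))
instance : Linear k A.Cat := inferInstanceAs (Linear k (H0pe k T))
instance : Limits.HasZeroObject A.Cat := inferInstanceAs (Limits.HasZeroObject (H0pe k T))
instance : HasShift A.Cat ℤ := inferInstanceAs (HasShift (H0pe k T) ℤ)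
instance (n : ℤ) : (shiftFunctor A.Cat n).Additive :=
  inferInstanceAs (shiftFunctor (H0pe k T) n).Additive
instance : Pretriangulated A.Cat := A.pretri
instance : MonoidalCategory A.Cat := A.monoidal
instance : SymmetricCategory A.Cat := A.symmetric

variable {A} in
def Cat.mod (X : A.Cat) : DGMod k T := H0pe.mod X

variable {A} in
def Cat.cls {X Y : A.Cat} (f : X ⟶ Y) : (toHo k T).obj X.mod ⟶ (toHo k T).obj Y.mod := H0pe.cls f

end InducedTTC

open MonoidalCategory in
/-- A tensor triangulated functor induced by `F`: its underlying functor is identified with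
`X ↦ X ⊗ Φ`, and its monoidal structure with `f` and `u`. -/
structure InducedTTFunctor {S S' : PseudoDGTensorStructure k T} (F : PseudoDGTensorFunctor S S')
    (A : InducedTTC S) (B : InducedTTC S') where
  functor : A.Cat ⥤ B.Cat
  additive : functor.Additive
  linear : functor.Linear k
  commShift : functor.CommShift ℤ
  isTriangulated : functor.IsTriangulated
  braided : functor.Braided
  θ (X : A.Cat) : (functor.obj X).mod ⟶ tensor X.mod F.Φ
  θ_iso (X : A.Cat) : IsQuasiIso (θ X)
  θ_nat {X Y : A.Cat} (φ : X ⟶ Y) :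
    (toHo k T).map (θ X) ≫ (tens F.Φ).onHo.map (InducedTTC.Cat.cls φ) =
      InducedTTC.Cat.cls (functor.map φ) ≫ (toHo k T).map (θ Y)
  μ_eq (X Y : A.Cat) :
    (toHo k T).map (B.κ (functor.obj X) (functor.obj Y) ≫
      (S'.Γ.prodL (functor.obj Y).mod).toFunctor.map (θ X) ≫
      (S'.Γ.prodR (tensor X.mod F.Φ)).toFunctor.map (θ Y) ≫ F.f X.mod Y.mod) =
    InducedTTC.Cat.cls (Functor.LaxMonoidal.μ functor X Y) ≫
      (toHo k T).map (θ (X ⊗ Y) ≫ (tens F.Φ).toFunctor.map (A.κ X Y))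
  ε_eq :
    (toHo k T).map (B.κ₁ ≫ F.u) =
    InducedTTC.Cat.cls (Functor.LaxMonoidal.ε functor) ≫
      (toHo k T).map (θ (𝟙_ A.Cat) ≫ (tens F.Φ).toFunctor.map A.κ₁)

end

end DG

/-! The homotopy category `HoMod` of all modules, with the mapping cone triangles, is triangulated.
A dg functor preserves shifts and cones, since both are described by graded maps subject to
equations. Hence `Γ(X, -)`, `Γ(-, Y)` and `- ⊗ Φ` induce `k`-linear exact endofunctors of `HoMod`.
Maps that differ by the differential of a degree `-1` map become equal there, so the homotopies of a
pseudo dg tensor structure turn into strict coherence equations: `HoMod` carries a tensor product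
that satisfies every axiom of a symmetric monoidal category except that its coherence maps need not
be invertible (`LaxTensor`).

Invertibility is recovered on cofibrant modules. A quasi-isomorphism between cofibrant modules is
invertible in `HoMod` (`isIso_toHo_map_of_isQuasiIso`), because every map from a cofibrant module to
an acyclic one is null-homotopic. Two properties of tensor products are then needed. Cofibrant
modules must be closed under them (`IsCofibrant.tensor`, `Bimod2.IsCofibrant.prod`). This follows
from the adjunction between tensor products and `Hom` over `k`, once the values of cofibrant modules
are known to be cofibrant complexes (`IsCofibrant.isCofCplx`); that is where the local cofibrancy of
`𝒯` enters, through coinduced modules. Moreover, tensoring with a cofibrant bimodule must preserve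
quasi-isomorphisms (`Bimod.IsCofibrant.isQuasiIso_map`), so that the possibly non-cofibrant units
`U` can be replaced by perfect modules. By the long exact sequence this amounts to preserving
acyclicity, which is tested by maps into injective `k`-modules.

The cofibrant modules thus form a symmetric monoidal category (`LaxTensor.Core`). Perfect modules
form a triangulated subcategory of `HoMod`, and the product of two of them is isomorphic in `HoMod`
to a perfect one, so the structure can be pulled back along the fully faithful inclusion
(`TensorReplacement`). Its tensor functors are restrictions of the exact functors `Γ(X, -)` and
`Γ(-, Y)` up to isomorphism, hence are exact. This gives `ttc`.

For the functor, both induced structures are arbitrary, and only their identifications with the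
given data may be used (`Realization`). Choosing perfect resolutions of the `X ⊗ Φ` gives a functor
isomorphic to the restriction of `- ⊗ Φ`, hence exact. Its structure map is `f`, conjugated by these
identifications, and the coherence of `f` in `HoMod` gives the monoidal axioms
(`TensorFunctor.braided`). The unit map is obtained by comparing two perfect resolutions of `U ⊗ Φ`
(`exists_unitIso`). This gives `ttFunctor`. -/

namespace DG

noncomputable section

variable {k : Type u} [CommRing k] {T : Type u} [DGCategory k T]

/-! ### Complexes of modules, elementwise -/

section Complexes

variable {K L : Cplx k}

lemma d_f_apply (f : K ⟶ L) (i j : ℤ) (x : K.X i) :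
    (L.d i j).hom ((f.f i).hom x) = (f.f j).hom ((K.d i j).hom x) :=
  LinearMap.congr_fun (congrArg ModuleCat.Hom.hom (f.comm i j)) x

lemma exactAt_iff_elements (K : Cplx k) {i j l : ℤ} (hij : i + 1 = j) (hjl : j + 1 = l) :
    K.ExactAt j ↔ ∀ z : K.X j, (K.d j l).hom z = 0 → ∃ w : K.X i, (K.d i j).hom w = z := by
  rw [K.exactAt_iff' i j l (by simp [← hij]) (by simp [hjl]),
    ShortComplex.moduleCat_exact_iff]
  rfl

lemma acyclic_iff_elements (K : Cplx k) :
    K.Acyclic ↔ ∀ ⦃i j l : ℤ⦄, i + 1 = j → j + 1 = l → ∀ z : K.X j, (K.d j l).hom z = 0 →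
      ∃ w : K.X i, (K.d i j).hom w = z := by
  constructor
  · intro h i j l hij hjl
    exact (exactAt_iff_elements K hij hjl).1 (h j)
  · intro h j
    exact (exactAt_iff_elements K (sub_add_cancel j 1) rfl).2 (h (sub_add_cancel j 1) rfl)

lemma exists_cycle_homologyπ (K : Cplx k) {j l : ℤ} (hjl : j + 1 = l) (h : K.homology j) :
    ∃ c : K.cycles j, (K.homologyπ j).hom c = h ∧
      (K.d j l).hom ((K.iCycles j).hom c) = 0 := by
  obtain ⟨c, rfl⟩ := (ModuleCat.epi_iff_surjective (K.homologyπ j)).1 inferInstance h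
  refine ⟨c, rfl, ?_⟩
  exact LinearMap.congr_fun (congrArg ModuleCat.Hom.hom (K.iCycles_d j l)) c

lemma exists_cycles_of_d_eq_zero (K : Cplx k) {j l : ℤ} (hjl : j + 1 = l) (z : K.X j)
    (hz : (K.d j l).hom z = 0) : ∃ c : K.cycles j, (K.iCycles j).hom c = z := by
  have h := (ShortComplex.moduleCat_exact_iff _).1 (ShortComplex.exact_of_f_is_kernel
    (ShortComplex.mk (K.iCycles j) (K.d j l) (K.iCycles_d j l))
    (K.cyclesIsKernel j l (by simp [hjl])))
  exact h z hz

lemma homologyπ_eq_zero_iff (K : Cplx k) {i j : ℤ} (hij : i + 1 = j) (c : K.cycles j) :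
    (K.homologyπ j).hom c = 0 ↔ ∃ w : K.X i, (K.d i j).hom w = (K.iCycles j).hom c := by
  have hi : ∀ w : K.X i, (K.iCycles j).hom ((K.toCycles i j).hom w) = (K.d i j).hom w :=
    fun w => LinearMap.congr_fun (congrArg ModuleCat.Hom.hom (K.toCycles_i i j)) w
  have h := (ShortComplex.moduleCat_exact_iff _).1 (ShortComplex.exact_of_g_is_cokernel
    (ShortComplex.mk (K.toCycles i j) (K.homologyπ j) (K.toCycles_comp_homologyπ i j))
    (K.homologyIsCokernel i j (by simp [← hij])))
  constructor
  · intro hc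
    obtain ⟨w, hw⟩ := h c hc
    exact ⟨w, by rw [← hi w]; exact congrArg (K.iCycles j).hom hw⟩
  · rintro ⟨w, hw⟩
    rw [← hi w] at hw
    rw [← (ModuleCat.mono_iff_injective (K.iCycles j)).1 inferInstance hw]
    exact LinearMap.congr_fun (congrArg ModuleCat.Hom.hom (K.toCycles_comp_homologyπ i j)) w

/-- Quasi-isomorphisms are bijective on cocycles modulo coboundaries. -/
lemma quasiIso_iff_elements (f : K ⟶ L) : QuasiIso f ↔
    ∀ ⦃i j l : ℤ⦄, i + 1 = j → j + 1 = l →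
      (∀ (z : K.X j) (w : L.X i), (K.d j l).hom z = 0 → (f.f j).hom z = (L.d i j).hom w →
        ∃ z' : K.X i, (K.d i j).hom z' = z) ∧
      (∀ w : L.X j, (L.d j l).hom w = 0 → ∃ (z : K.X j) (v : L.X i),
        (K.d j l).hom z = 0 ∧ w = (f.f j).hom z + (L.d i j).hom v) := by
  have hc : ∀ (j : ℤ) (c : K.cycles j), (L.iCycles j).hom
      ((HomologicalComplex.cyclesMap f j).hom c) = (f.f j).hom ((K.iCycles j).hom c) :=
    fun j c => LinearMap.congr_fun (congrArg ModuleCat.Hom.hom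
      (HomologicalComplex.cyclesMap_i f j)) c
  have hp : ∀ (j : ℤ) (c : K.cycles j), (L.homologyπ j).hom
      ((HomologicalComplex.cyclesMap f j).hom c) =
        (HomologicalComplex.homologyMap f j).hom ((K.homologyπ j).hom c) :=
    fun j c => (LinearMap.congr_fun (congrArg ModuleCat.Hom.hom
      (HomologicalComplex.homologyπ_naturality f j)) c).symm
  have hinj : ∀ j (c c' : L.cycles j), (L.iCycles j).hom c = (L.iCycles j).hom c' → c = c' :=
    fun j => (ModuleCat.mono_iff_injective (L.iCycles j)).1 inferInstance
  constructor
  · intro hf i j l hij hjl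
    have hb : Function.Bijective (HomologicalComplex.homologyMap f j).hom :=
      (ConcreteCategory.isIso_iff_bijective (HomologicalComplex.homologyMap f j)).1 inferInstance
    constructor
    · intro z w hz hw
      obtain ⟨c, rfl⟩ := exists_cycles_of_d_eq_zero K hjl z hz
      rw [← homologyπ_eq_zero_iff K hij]
      apply hb.1
      rw [← hp, map_zero, homologyπ_eq_zero_iff L hij, hc]
      exact ⟨w, hw.symm⟩
    · intro w hw
      obtain ⟨c, rfl⟩ := exists_cycles_of_d_eq_zero L hjl w hw
      obtain ⟨h, hh⟩ := hb.2 ((L.homologyπ j).hom c)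
      obtain ⟨c', rfl, hc'⟩ := exists_cycle_homologyπ K hjl h
      have h0 : (L.homologyπ j).hom (c - (HomologicalComplex.cyclesMap f j).hom c') = 0 := by
        rw [map_sub, hp, hh, sub_self]
      obtain ⟨v, hv⟩ := (homologyπ_eq_zero_iff L hij _).1 h0
      refine ⟨_, v, hc', ?_⟩
      rw [hv, map_sub, hc]
      abel
  · intro h
    rw [quasiIso_iff]
    intro j
    rw [quasiIsoAt_iff_isIso_homologyMap, ConcreteCategory.isIso_iff_bijective]
    obtain ⟨h1, h2⟩ := h (sub_add_cancel j 1) rfl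
    constructor
    · refine (injective_iff_map_eq_zero (HomologicalComplex.homologyMap f j).hom).2 ?_
      intro a ha
      obtain ⟨c, rfl, hc'⟩ := exists_cycle_homologyπ K (rfl : j + 1 = _) a
      rw [← hp, homologyπ_eq_zero_iff L (sub_add_cancel j 1), hc] at ha
      obtain ⟨w, hw⟩ := ha
      rw [homologyπ_eq_zero_iff K (sub_add_cancel j 1)]
      exact h1 _ w hc' hw.symm
    · intro a
      obtain ⟨c, rfl, hc'⟩ := exists_cycle_homologyπ L (rfl : j + 1 = _) a
      obtain ⟨z, v, hz, hv⟩ := h2 _ hc'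
      obtain ⟨c', rfl⟩ := exists_cycles_of_d_eq_zero K rfl z hz
      refine ⟨(K.homologyπ j).hom c', ?_⟩
      refine (hp j c').symm.trans ?_
      rw [eq_comm, ← sub_eq_zero, ← map_sub, homologyπ_eq_zero_iff L (sub_add_cancel j 1)]
      exact ⟨v, by rw [map_sub, hc, hv]; abel⟩

/-- A quasi-isomorphism that is surjective in all degrees. -/
def IsTrivFibCplx (p : K ⟶ L) : Prop :=
  QuasiIso p ∧ ∀ n, Function.Surjective (p.f n).hom

/-- The right-hand side is the lifting property against the inclusions of spheres into disks. It
states a lifting problem in terms of two elements, which is what makes it possible to transport it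
through `Hom` complexes. -/
lemma isTrivFibCplx_iff (p : K ⟶ L) : IsTrivFibCplx p ↔
    ∀ ⦃i j l : ℤ⦄, i + 1 = j → j + 1 = l → ∀ (y : L.X i) (z : K.X j), (K.d j l).hom z = 0 →
      (p.f j).hom z = (L.d i j).hom y → ∃ x : K.X i, (K.d i j).hom x = z ∧ (p.f i).hom x = y := by
  constructor
  · rintro ⟨hq, hs⟩ i j l hij hjl y z hz hzy
    rw [quasiIso_iff_elements] at hq
    obtain ⟨x₀, rfl⟩ := (hq hij hjl).1 z y hz hzy
    -- The preimage `x₀` has the right differential but maps to `y` only up to a cocycle. That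
    -- cocycle is the image of a cocycle plus a boundary, and the boundary lifts by surjectivity, so
    -- `x₀` can be corrected.
    obtain ⟨c, v, hc, hv⟩ := (hq (sub_add_cancel i 1) hij).2 ((p.f i).hom x₀ - y)
      (by rw [map_sub, d_f_apply, hzy, sub_self])
    obtain ⟨v', rfl⟩ := hs _ v
    refine ⟨x₀ - c - (K.d _ _).hom v', ?_, ?_⟩
    · simp [hc, d_d_apply]
    · rw [map_sub, map_sub, ← d_f_apply, sub_sub, ← hv]
      abel
  · intro h
    constructor
    · rw [quasiIso_iff_elements]
      intro i j l hij hjl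
      constructor
      · intro z w hz hw
        obtain ⟨x, hx, -⟩ := h hij hjl w z hz hw
        exact ⟨x, hx⟩
      · intro w hw
        obtain ⟨x, hx, hx'⟩ := h hjl rfl w 0 (by simp) (by simp [hw])
        exact ⟨x, 0, hx, by simp [hx']⟩
    · intro n y
      -- Surjectivity takes two lifts: first of `d y`, to a cocycle, and then of `y` itself with
      -- this cocycle as differential.
      obtain ⟨z, hz, hz'⟩ := h rfl rfl ((L.d n (n + 1)).hom y) 0 (by simp) (by simp [d_d_apply])
      obtain ⟨x, -, hx⟩ := h rfl rfl y z hz hz'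
      exact ⟨x, hx⟩

lemma IsTrivFibCplx.shift {p : K ⟶ L} (h : IsTrivFibCplx p) (n : ℤ) :
    IsTrivFibCplx (p⟦n⟧') :=
  ⟨(CochainComplex.quasiIso_shift_iff p n).2 h.1, fun i => h.2 (i + n)⟩

lemma quasiIso_of_acyclic (f : K ⟶ L) (hK : K.Acyclic) (hL : L.Acyclic) : QuasiIso f := by
  rw [acyclic_iff_elements] at hK hL
  rw [quasiIso_iff_elements]
  intro i j l hij hjl
  constructor
  · intro z w hz _
    exact hK hij hjl z hz
  · intro w hw
    obtain ⟨v, rfl⟩ := hL hij hjl w hw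
    exact ⟨0, v, by simp, by simp⟩

end Complexes

lemma isTrivFib_iff {M N : DGMod k T} (p : M ⟶ N) :
    IsTrivFib p ↔ ∀ t, IsTrivFibCplx (DGMod.app p t) :=
  ⟨fun h t => ⟨h.1 t, h.2 t⟩, fun h => ⟨fun t => (h t).1, fun t => (h t).2⟩⟩

/-! ### Constructors for morphisms of modules, elementwise -/

section Constructors

variable {M N P : DGMod k T}

def DGHom.mkLin {n : ℤ} (φ : ∀ (t : T) (p q : ℤ), p + n = q → ((M.obj t).X p →ₗ[k] (N.obj t).X q))
    (h : ∀ ⦃x y : T⦄ ⦃p q a b c : ℤ⦄ (ha : p + q = a) (hb : p + n = b) (hc : a + n = c)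
      (hc' : b + q = c) (m : (M.obj y).X p) (f : (DGCategory.hom (k := k) x y).X q),
      φ x a c hc (M.act ha m f) = N.act hc' (φ y p b hb m) f) : DGHom n M N :=
  ⟨fun t => Cochain.mk fun p q hpq => ModuleCat.ofHom (φ t p q hpq),
    fun _ _ _ _ _ _ _ ha hb hc hc' m f => h ha hb hc hc' m f⟩

@[simp] lemma DGHom.mkLin_v {n : ℤ}
    (φ : ∀ (t : T) (p q : ℤ), p + n = q → ((M.obj t).X p →ₗ[k] (N.obj t).X q)) (h) (t : T)
    (p q : ℤ) (hpq : p + n = q) :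
    ((DGHom.mkLin φ h).1 t).v p q hpq = ModuleCat.ofHom (φ t p q hpq) := rfl

def DGMod.homMk (φ : ∀ (t : T) (n : ℤ), (M.obj t).X n →ₗ[k] (N.obj t).X n)
    (hd : ∀ (t : T) (i j : ℤ), i + 1 = j → ∀ x : (M.obj t).X i,
      ((N.obj t).d i j).hom (φ t i x) = φ t j (((M.obj t).d i j).hom x))
    (h : ∀ ⦃x y : T⦄ ⦃p q n : ℤ⦄ (h : p + q = n) (m : (M.obj y).X p)
      (f : (DGCategory.hom (k := k) x y).X q), φ x n (M.act h m f) = N.act h (φ y p m) f) :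
    M ⟶ N :=
  ⟨fun t => { f := fun n => ModuleCat.ofHom (φ t n)
              comm' := fun i j hij => ModuleCat.hom_ext (LinearMap.ext (hd t i j hij)) },
    fun _ _ _ _ _ hn m f => h hn m f⟩

@[simp] lemma DGMod.homMk_app_f (φ : ∀ (t : T) (n : ℤ), (M.obj t).X n →ₗ[k] (N.obj t).X n)
    (hd) (h) (t : T) (n : ℤ) :
    (DGMod.app (DGMod.homMk (M := M) (N := N) φ hd h) t).f n = ModuleCat.ofHom (φ t n) := rfl

lemma DGMod.hom_ext {φ ψ : M ⟶ N} (h : ∀ (t : T) (n : ℤ) (x : (M.obj t).X n),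
    ((DGMod.app φ t).f n).hom x = ((DGMod.app ψ t).f n).hom x) : φ = ψ := by
  apply Subtype.ext
  funext t
  ext n x
  exact h t n x

lemma DGMod.app_act (φ : M ⟶ N) {x y : T} {p q n : ℤ} (h : p + q = n) (m : (M.obj y).X p)
    (f : (DGCategory.hom (k := k) x y).X q) :
    ((DGMod.app φ x).f n).hom (M.act h m f) = N.act h (((DGMod.app φ y).f p).hom m) f :=
  φ.2 h m f

@[simp] lemma DGMod.add_app (φ ψ : M ⟶ N) (t : T) :
    DGMod.app (φ + ψ) t = DGMod.app φ t + DGMod.app ψ t := rfl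

@[simp] lemma DGMod.neg_app (φ : M ⟶ N) (t : T) : DGMod.app (-φ) t = -DGMod.app φ t := rfl

@[simp] lemma DGMod.zero_app (t : T) : DGMod.app (0 : M ⟶ N) t = 0 := rfl

@[simp] lemma DGHom.ofHom_v (φ : M ⟶ N) (t : T) (p : ℤ) (h : p + 0 = p) :
    ((DGHom.ofHom φ).1 t).v p p h = (DGMod.app φ t).f p :=
  Cochain.ofHom_v _ _

/-- Homotopies, elementwise. -/
lemma homotopic_of_lin {f g : M ⟶ N}
    (φ : ∀ (t : T) (p q : ℤ), p + 1 = q → ((M.obj t).X q →ₗ[k] (N.obj t).X p))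
    (hact : ∀ ⦃x y : T⦄ ⦃p p' q a a' : ℤ⦄ (hp : p + 1 = p') (ha : a + 1 = a') (h : p' + q = a')
      (h' : p + q = a) (m : (M.obj y).X p') (e : (DGCategory.hom (k := k) x y).X q),
      φ x a a' ha (M.act h m e) = N.act h' (φ y p p' hp m) e)
    (h : ∀ (t : T) (i j l : ℤ) (hij : i + 1 = j) (hjl : j + 1 = l) (x : (M.obj t).X j),
      ((DGMod.app f t).f j).hom x = ((DGMod.app g t).f j).hom x +
        (((N.obj t).d i j).hom (φ t i j hij x) + φ t j l hjl (((M.obj t).d j l).hom x))) :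
    homotopic f g := by
  refine ⟨DGHom.mkLin (fun t p q hpq => φ t q p (by lia))
    (fun x y p q a b c ha hb hc hc' m e => hact _ _ _ _ m e), ?_⟩
  apply DGHom.ext_apply
  intro t p q hpq x
  obtain rfl : q = p := by lia
  rw [DGHom.δ_apply (by lia) _ t rfl (show q + -1 = q - 1 by lia)]
  have := h t (q - 1) q (q + 1) (by lia) rfl x
  simp [this]

lemma toHo_map_eq {f g : M ⟶ N} (h : homotopic f g) :
    (toHo k T).map f = (toHo k T).map g :=
  CategoryTheory.Quotient.sound _ h

lemma toHo_map_eq_iff {f g : M ⟶ N} :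
    (toHo k T).map f = (toHo k T).map g ↔ homotopic f g :=
  CategoryTheory.Quotient.functor_map_eq_iff _ f g

end Constructors

/-! ### Mapping cones of complexes as pairs -/

section ConeCplx

variable {K L : Cplx k} (f : K ⟶ L)

/-- Elements are literal pairs, so every identity in a cone can be checked on two components. -/
def coneCplx : Cplx k where
  X n := ModuleCat.of k (K.X (n + 1) × L.X n)
  d i j := if h : i + 1 = j then ModuleCat.ofHom (LinearMap.prod
      (-(K.d (i + 1) (j + 1)).hom ∘ₗ LinearMap.fst k _ _)
      ((f.f j).hom ∘ₗ (K.XIsoOfEq h).hom.hom ∘ₗ LinearMap.fst k _ _ +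
        (L.d i j).hom ∘ₗ LinearMap.snd k _ _)) else 0
  shape i j h := dif_neg h
  d_comp_d' := by
    rintro i j l rfl rfl
    rw [dif_pos rfl, dif_pos rfl, ← ModuleCat.ofHom_comp]
    apply ModuleCat.hom_ext
    apply LinearMap.ext
    rintro ⟨x, y⟩
    refine Prod.ext ?_ ?_
    · simp [d_d_apply]
    · simp [d_d_apply, d_f_apply]

variable {f}

namespace coneCplx

/-- The target degree comes with an equation, so that changes of index are absorbed here and no
transport appears in later formulas. -/
def fst {n m : ℤ} (h : n + 1 = m) : (coneCplx f).X n →ₗ[k] K.X m :=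
  (K.XIsoOfEq h).hom.hom ∘ₗ LinearMap.fst k (K.X (n + 1)) (L.X n)

def snd (n : ℤ) : (coneCplx f).X n →ₗ[k] L.X n := LinearMap.snd k (K.X (n + 1)) (L.X n)

def inl {n m : ℤ} (h : n + 1 = m) : K.X m →ₗ[k] (coneCplx f).X n :=
  LinearMap.inl k (K.X (n + 1)) (L.X n) ∘ₗ (K.XIsoOfEq h).inv.hom

def inr (n : ℤ) : L.X n →ₗ[k] (coneCplx f).X n := LinearMap.inr k (K.X (n + 1)) (L.X n)

lemma ext {n m : ℤ} (h : n + 1 = m) {z z' : (coneCplx f).X n} (h₁ : fst h z = fst h z')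
    (h₂ : snd n z = snd n z') : z = z' := by
  subst h
  exact Prod.ext h₁ h₂

@[simp] lemma fst_inl {n m : ℤ} (h : n + 1 = m) (x : K.X m) :
    fst h (inl (f := f) h x) = x := by
  subst h; rfl

@[simp] lemma snd_inl {n m : ℤ} (h : n + 1 = m) (x : K.X m) : snd n (inl (f := f) h x) = 0 := rfl

@[simp] lemma fst_inr {n m : ℤ} (h : n + 1 = m) (y : L.X n) :
    fst h (inr (f := f) n y) = 0 := by
  subst h; rfl

@[simp] lemma snd_inr (n : ℤ) (y : L.X n) : snd n (inr (f := f) n y) = y := rfl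

lemma d_eq (i : ℤ) (z : (coneCplx f).X i) : ((coneCplx f).d i (i + 1)).hom z =
    ((-(K.d (i + 1) (i + 1 + 1)).hom (fst rfl z), (f.f (i + 1)).hom (fst rfl z) +
      (L.d i (i + 1)).hom (snd i z)) : K.X (i + 1 + 1) × L.X (i + 1)) := by
  have h : (coneCplx f).d i (i + 1) = ModuleCat.ofHom (LinearMap.prod
      (-(K.d (i + 1) (i + 1 + 1)).hom ∘ₗ LinearMap.fst k _ _)
      ((f.f (i + 1)).hom ∘ₗ (K.XIsoOfEq rfl).hom.hom ∘ₗ LinearMap.fst k _ _ +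
        (L.d i (i + 1)).hom ∘ₗ LinearMap.snd k _ _)) := dif_pos rfl
  rw [h]
  rfl

lemma fst_d {i j l : ℤ} (h : i + 1 = j) (h' : j + 1 = l) (z : (coneCplx f).X i) :
    fst h' (((coneCplx f).d i j).hom z) = -(K.d j l).hom (fst h z) := by
  subst h h'
  rw [d_eq]; rfl

lemma snd_d {i j : ℤ} (h : i + 1 = j) (z : (coneCplx f).X i) :
    snd j (((coneCplx f).d i j).hom z) = (f.f j).hom (fst h z) + (L.d i j).hom (snd i z) := by
  subst h
  rw [d_eq]; rfl

lemma total {n m : ℤ} (h : n + 1 = m) (z : (coneCplx f).X n) :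
    inl h (fst h z) + inr n (snd n z) = z :=
  ext h (by simp) (by simp)

lemma d_inl {i j l : ℤ} (h : i + 1 = j) (h' : j + 1 = l) (x : K.X j) :
    ((coneCplx f).d i j).hom (inl h x) = inl h' (-(K.d j l).hom x) + inr j ((f.f j).hom x) :=
  ext h' (by simp [fst_d h h']) (by simp [snd_d h])

lemma d_inr {i j : ℤ} (h : i + 1 = j) (y : L.X i) :
    ((coneCplx f).d i j).hom (inr i y) = inr j ((L.d i j).hom y) :=
  ext rfl (by simp [fst_d h rfl]) (by simp [snd_d h])

/-- A pair `(z, -w)` is a cocycle exactly if `z` is a cocycle and `f z = d w`. Thus exactness of the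
cone, read on components, is injectivity and surjectivity of `f` on cohomology. -/
lemma acyclic_iff : (coneCplx f).Acyclic ↔ QuasiIso f := by
  rw [acyclic_iff_elements, quasiIso_iff_elements]
  constructor
  · intro h i j l hij hjl
    constructor
    · intro z w hz hw
      obtain ⟨i, rfl⟩ : ∃ i', i' + 1 = i := ⟨i - 1, by lia⟩
      obtain ⟨v, hv⟩ := h rfl hij (inl hij z - inr _ w) (by
        rw [map_sub, d_inl hij hjl, d_inr hij, hz, hw]; simp)
      refine ⟨-fst rfl v, ?_⟩
      have := congrArg (fst hij) hv
      rw [fst_d rfl hij] at this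
      simpa using this
    · intro w hw
      obtain ⟨v, hv⟩ := h hij hjl (inr _ w) (by rw [d_inr hjl, hw, map_zero])
      refine ⟨fst hij v, snd i v, ?_, ?_⟩
      · have := congrArg (fst hjl) hv
        rw [fst_d hij hjl] at this
        simpa using this
      · have := congrArg (snd _) hv
        rw [snd_d hij] at this
        simpa using this.symm
  · intro h i j l hij hjl z hz
    have h₁ := congrArg (fst (rfl : l + 1 = _)) hz
    have h₂ := congrArg (snd _) hz
    rw [fst_d hjl] at h₁
    rw [snd_d hjl] at h₂
    simp only [map_zero, neg_eq_zero] at h₁ h₂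
    obtain ⟨x, hx⟩ := (h hjl rfl).1 (fst hjl z) (-snd j z) h₁ (by
      rw [map_neg]; exact eq_neg_of_add_eq_zero_left h₂)
    obtain ⟨c, v, hc, hv⟩ := (h hij hjl).2 (snd j z + (f.f j).hom x) (by
      rw [map_add, d_f_apply, hx, add_comm, h₂])
    refine ⟨inl hij (c - x) + inr i v, ?_⟩
    rw [map_add, d_inl hij hjl, d_inr hij]
    refine ext hjl ?_ ?_
    · simp [hc, hx]
    · simp only [map_add, snd_inl, snd_inr, map_sub, zero_add]
      rw [sub_add_eq_add_sub, ← hv, add_sub_cancel_right]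

end coneCplx

end ConeCplx

/-! ### Mapping cones of modules -/

section Cone

variable {X Y Z W : DGMod k T} (f : X ⟶ Y)

/-- No signs occur: the shift leaves the right action unchanged. -/
def coneAct {x y : T} {p q n : ℤ} (h : p + q = n) : (coneCplx (DGMod.app f y)).X p →ₗ[k]
    (DGCategory.hom (k := k) x y).X q →ₗ[k] (coneCplx (DGMod.app f x)).X n :=
  LinearMap.mk₂ k
    (fun z e => coneCplx.inl rfl (X.act (show p + 1 + q = n + 1 by lia) (coneCplx.fst rfl z) e) +
      coneCplx.inr n (Y.act h (coneCplx.snd p z) e))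
    (fun z z' e => by simp only [map_add, LinearMap.add_apply]; abel)
    (fun r z e => by simp only [map_smul, LinearMap.smul_apply, smul_add])
    (fun z e e' => by simp only [map_add]; abel)
    (fun r z e => by simp only [map_smul, smul_add])

lemma fst_coneAct {x y : T} {p q n p' n' : ℤ} (h : p + q = n) (hp : p + 1 = p') (hn : n + 1 = n')
    (z : (coneCplx (DGMod.app f y)).X p) (e : (DGCategory.hom (k := k) x y).X q) :
    coneCplx.fst hn (coneAct f h z e) =
      X.act (show p' + q = n' by lia) (coneCplx.fst hp z) e := by
  subst hp hn
  simp [coneAct]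

lemma snd_coneAct {x y : T} {p q n : ℤ} (h : p + q = n)
    (z : (coneCplx (DGMod.app f y)).X p) (e : (DGCategory.hom (k := k) x y).X q) :
    coneCplx.snd n (coneAct f h z e) = Y.act h (coneCplx.snd p z) e := by
  simp [coneAct]

def cone : DGMod k T where
  obj t := coneCplx (DGMod.app f t)
  act h := coneAct f h
  act_id {x p} z := by
    refine coneCplx.ext rfl ?_ ?_
    · rw [fst_coneAct f _ rfl, X.act_id]
    · rw [snd_coneAct, Y.act_id]
  act_act {x y z p q r a b n} ha hb hn hn' m g e := by
    refine coneCplx.ext rfl ?_ ?_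
    · rw [fst_coneAct f _ rfl, fst_coneAct f _ rfl, fst_coneAct f _ rfl]
      exact X.act_act _ hb _ _ _ _ _
    · rw [snd_coneAct, snd_coneAct, snd_coneAct]
      exact Y.act_act _ hb _ _ _ _ _
  d_act {x y p q p' q' n n'} hp hq hn h m e := by
    subst hp hq hn
    refine coneCplx.ext rfl ?_ ?_
    · rw [coneCplx.fst_d rfl rfl, map_add, LinearMap.map_smul_of_tower, fst_coneAct f _ rfl,
        fst_coneAct f _ rfl, fst_coneAct f _ rfl, coneCplx.fst_d rfl rfl, X.d_act rfl rfl rfl]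
      simp [Int.negOnePow_add]
      abel
    · rw [coneCplx.snd_d rfl, map_add, LinearMap.map_smul_of_tower, fst_coneAct f _ rfl,
        snd_coneAct, snd_coneAct, snd_coneAct, coneCplx.snd_d rfl, Y.d_act rfl rfl rfl,
        DGMod.app_act]
      simp only [map_add, LinearMap.add_apply]
      abel

variable {f}

namespace cone

def fst {t : T} {n m : ℤ} (h : n + 1 = m) : ((cone f).obj t).X n →ₗ[k] (X.obj t).X m :=
  coneCplx.fst h

def snd (t : T) (n : ℤ) : ((cone f).obj t).X n →ₗ[k] (Y.obj t).X n := coneCplx.snd n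

def inl {t : T} {n m : ℤ} (h : n + 1 = m) : (X.obj t).X m →ₗ[k] ((cone f).obj t).X n :=
  coneCplx.inl h

def inr (t : T) (n : ℤ) : (Y.obj t).X n →ₗ[k] ((cone f).obj t).X n := coneCplx.inr n

lemma ext {t : T} {n m : ℤ} (h : n + 1 = m) {z z' : ((cone f).obj t).X n}
    (h₁ : fst h z = fst h z') (h₂ : snd t n z = snd t n z') : z = z' :=
  coneCplx.ext h h₁ h₂

@[simp] lemma fst_inl {t : T} {n m : ℤ} (h : n + 1 = m) (x : (X.obj t).X m) :
    fst h (inl (f := f) h x) = x :=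
  coneCplx.fst_inl h x

@[simp] lemma snd_inl {t : T} {n m : ℤ} (h : n + 1 = m) (x : (X.obj t).X m) :
    snd t n (inl (f := f) h x) = 0 := rfl

@[simp] lemma fst_inr {t : T} {n m : ℤ} (h : n + 1 = m) (y : (Y.obj t).X n) :
    fst h (inr (f := f) t n y) = 0 :=
  coneCplx.fst_inr h y

@[simp] lemma snd_inr (t : T) (n : ℤ) (y : (Y.obj t).X n) : snd t n (inr (f := f) t n y) = y := rfl

lemma fst_d {t : T} {i j l : ℤ} (h : i + 1 = j) (h' : j + 1 = l) (z : ((cone f).obj t).X i) :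
    fst h' ((((cone f).obj t).d i j).hom z) = -((X.obj t).d j l).hom (fst h z) :=
  coneCplx.fst_d h h' z

lemma snd_d {t : T} {i j : ℤ} (h : i + 1 = j) (z : ((cone f).obj t).X i) :
    snd t j ((((cone f).obj t).d i j).hom z) =
      ((DGMod.app f t).f j).hom (fst h z) + ((Y.obj t).d i j).hom (snd t i z) :=
  coneCplx.snd_d h z

lemma total {t : T} {n m : ℤ} (h : n + 1 = m) (z : ((cone f).obj t).X n) :
    inl h (fst h z) + inr t n (snd t n z) = z :=
  coneCplx.total h z

lemma d_inl {t : T} {i j l : ℤ} (h : i + 1 = j) (h' : j + 1 = l) (x : (X.obj t).X j) :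
    (((cone f).obj t).d i j).hom (inl h x) =
      inl h' (-((X.obj t).d j l).hom x) + inr t j (((DGMod.app f t).f j).hom x) :=
  coneCplx.d_inl h h' x

lemma d_inr {t : T} {i j : ℤ} (h : i + 1 = j) (y : (Y.obj t).X i) :
    (((cone f).obj t).d i j).hom (inr t i y) = inr t j (((Y.obj t).d i j).hom y) :=
  coneCplx.d_inr h y

lemma fst_act {x y : T} {p q n p' n' : ℤ} (h : p + q = n) (hp : p + 1 = p') (hn : n + 1 = n')
    (z : ((cone f).obj y).X p) (e : (DGCategory.hom (k := k) x y).X q) :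
    fst hn ((cone f).act h z e) = X.act (show p' + q = n' by lia) (fst hp z) e :=
  fst_coneAct f h hp hn z e

lemma snd_act {x y : T} {p q n : ℤ} (h : p + q = n)
    (z : ((cone f).obj y).X p) (e : (DGCategory.hom (k := k) x y).X q) :
    snd x n ((cone f).act h z e) = Y.act h (snd y p z) e :=
  snd_coneAct f h z e

lemma act_inl {x y : T} {p q n p' n' : ℤ} (h : p + q = n) (hp : p + 1 = p') (hn : n + 1 = n')
    (z : (X.obj y).X p') (e : (DGCategory.hom (k := k) x y).X q) :
    (cone f).act h (inl hp z) e = inl hn (X.act (show p' + q = n' by lia) z e) :=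
  ext hn (by rw [fst_act h hp hn]; simp) (by rw [snd_act h]; simp)

lemma act_inr {x y : T} {p q n : ℤ} (h : p + q = n)
    (z : (Y.obj y).X p) (e : (DGCategory.hom (k := k) x y).X q) :
    (cone f).act h (inr y p z) e = inr x n (Y.act h z e) :=
  ext rfl (by rw [fst_act h rfl rfl]; simp) (by rw [snd_act h]; simp)

variable (f) in
def inrHom : Y ⟶ cone f :=
  DGMod.homMk (fun t n => inr t n) (fun _ _ _ hij x => d_inr hij x)
    (fun _ _ _ _ _ h m e => (act_inr h m e).symm)

@[simp] lemma inrHom_apply (t : T) (n : ℤ) (y : (Y.obj t).X n) :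
    ((DGMod.app (inrHom f) t).f n).hom y = inr t n y := rfl

end cone

end Cone

/-! ### Shifts, elementwise -/

section Shift

variable {X Y : DGMod k T}

/-- Together with `shiftOut` this only relabels degrees; the sign of a shift is entirely in its
differential. -/
def shiftIn (X : DGMod k T) {a n m : ℤ} (h : n + a = m) (t : T) :
    (X.obj t).X m →ₗ[k] ((X⟦a⟧).obj t).X n :=
  ((X.obj t).XIsoOfEq h).inv.hom

def shiftOut (X : DGMod k T) {a n m : ℤ} (h : n + a = m) (t : T) :
    ((X⟦a⟧).obj t).X n →ₗ[k] (X.obj t).X m :=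
  ((X.obj t).XIsoOfEq h).hom.hom

@[simp] lemma shiftOut_shiftIn {a n m : ℤ} (h : n + a = m) {t : T} (x : (X.obj t).X m) :
    shiftOut X h t (shiftIn X h t x) = x := by
  subst h; rfl

@[simp] lemma shiftIn_shiftOut {a n m : ℤ} (h : n + a = m) {t : T} (x : ((X⟦a⟧).obj t).X n) :
    shiftIn X h t (shiftOut X h t x) = x := by
  subst h; rfl

lemma shiftOut_injective {a n m : ℤ} (h : n + a = m) {t : T} {x y : ((X⟦a⟧).obj t).X n}
    (hxy : shiftOut X h t x = shiftOut X h t y) : x = y := by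
  rw [← shiftIn_shiftOut h x, hxy, shiftIn_shiftOut]

lemma shiftOut_d {a n m n' m' : ℤ} (h : n + a = m) (h' : n' + a = m') {t : T}
    (x : ((X⟦a⟧).obj t).X n) : shiftOut X h' t ((((X⟦a⟧).obj t).d n n').hom x) =
      a.negOnePow • ((X.obj t).d m m').hom (shiftOut X h t x) := by
  subst h h'
  change ((((X.obj t)⟦a⟧).d n n').hom x) = a.negOnePow • ((X.obj t).d _ _).hom _
  rw [CochainComplex.shiftFunctor_obj_d']
  rcases Int.units_eq_one_or a.negOnePow with h | h <;> rw [h] <;> simp <;> rfl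

lemma shiftOut_act {a n m n' m' q : ℤ} (h : n + a = m) (h' : n' + a = m') (hq : n + q = n')
    {s t : T} (x : ((X⟦a⟧).obj t).X n) (e : (DGCategory.hom (k := k) s t).X q) :
    shiftOut X h' s ((X⟦a⟧).act hq x e) =
      X.act (show m + q = m' by lia) (shiftOut X h t x) e := by
  subst h h'; rfl

lemma shiftOut_map (f : X ⟶ Y) {a n m : ℤ} (h : n + a = m) {t : T} (x : ((X⟦a⟧).obj t).X n) :
    shiftOut Y h t (((DGMod.app (f⟦a⟧') t).f n).hom x) =
      ((DGMod.app f t).f m).hom (shiftOut X h t x) := by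
  subst h; rfl

lemma shiftIn_d {a n m n' m' : ℤ} (h : n + a = m) (h' : n' + a = m') {t : T}
    (x : (X.obj t).X m) : (((X⟦a⟧).obj t).d n n').hom (shiftIn X h t x) =
      shiftIn X h' t (a.negOnePow • ((X.obj t).d m m').hom x) :=
  shiftOut_injective h' (by rw [shiftOut_d h h']; simp)

lemma shiftIn_act {a n m n' m' q : ℤ} (h : n + a = m) (h' : n' + a = m') (hq : n + q = n')
    {s t : T} (x : (X.obj t).X m) (e : (DGCategory.hom (k := k) s t).X q) :
    (X⟦a⟧).act hq (shiftIn X h t x) e =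
      shiftIn X h' s (X.act (show m + q = m' by lia) x e) :=
  shiftOut_injective h' (by rw [shiftOut_act h h']; simp)

lemma shiftIn_map (f : X ⟶ Y) {a n m : ℤ} (h : n + a = m) {t : T} (x : (X.obj t).X m) :
    ((DGMod.app (f⟦a⟧') t).f n).hom (shiftIn X h t x) =
      shiftIn Y h t (((DGMod.app f t).f m).hom x) :=
  shiftOut_injective h (by rw [shiftOut_map]; simp)

lemma shiftFunctorComm_app (a b : ℤ) (t : T) :
    DGMod.app ((shiftFunctorComm (DGMod k T) a b).hom.app X) t =
      (shiftFunctorComm (Cplx k) a b).hom.app (X.obj t) := by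
  rw [shiftFunctorComm_eq _ a b (a + b) rfl, shiftFunctorComm_eq _ a b (a + b) rfl]
  simp only [Iso.trans_hom, Iso.symm_hom, NatTrans.comp_app, DGMod.comp_app]
  congr 1
  simp only [shiftFunctorAdd', Iso.trans_hom, eqToIso.hom, NatTrans.comp_app, DGMod.comp_app,
    eqToHom_app]
  rw [DGMod.eqToHom_app]
  rfl

/-- Interchanging two shifts is a mere relabelling, with no sign. The sign in
`cone.shiftHom_toShift` therefore comes only from the cone. -/
lemma shiftOut_shiftFunctorComm {a b n m l m' : ℤ} (h : n + a = m) (h' : m + b = l)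
    (h₂ : n + b = m') (h₂' : m' + a = l) {t : T} (x : (((X⟦b⟧)⟦a⟧).obj t).X n) :
    shiftOut X h₂' t (shiftOut (X⟦a⟧) h₂ t
      (((DGMod.app ((shiftFunctorComm (DGMod k T) b a).hom.app X) t).f n).hom x)) =
      shiftOut X h' t (shiftOut (X⟦b⟧) h t x) := by
  subst h h' h₂
  rw [shiftFunctorComm_app, CochainComplex.shiftFunctorComm_hom_app_f]
  exact XIsoOfEq_hom_trans_apply (X.obj t) _ h₂' x

end Shift

/-! ### The triangle of a mapping cone -/

namespace cone

variable {X Y : DGMod k T} (f : X ⟶ Y)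

/-- The connecting morphism `cone f ⟶ X⟦1⟧`. -/
def toShift : cone f ⟶ X⟦(1 : ℤ)⟧ :=
  DGMod.homMk (fun t _ => -(shiftIn X rfl t ∘ₗ fst rfl))
    (fun t i j hij x => by
      subst hij
      simp only [LinearMap.neg_apply, LinearMap.comp_apply, map_neg]
      rw [shiftIn_d rfl rfl, fst_d rfl rfl]
      simp)
    (fun x y p q n h m e => by
      simp only [LinearMap.neg_apply, LinearMap.comp_apply, map_neg]
      rw [shiftIn_act rfl rfl, fst_act h rfl rfl])

lemma toShift_apply {t : T} {n m : ℤ} (h : n + 1 = m) (z : ((cone f).obj t).X n) :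
    ((DGMod.app (toShift f) t).f n).hom z = -shiftIn X h t (fst h z) := by
  subst h; rfl

def data : ConeData f (inrHom f) (toShift f) where
  inl := DGHom.mkLin (fun t p q h => inl (by lia))
    (fun _ _ _ _ _ _ _ ha hb _ hc' m e => (act_inl hc' (by lia) (by lia) m e).symm)
  fst := DGHom.mkLin (fun t p q h => fst h) (fun _ _ _ _ _ _ _ ha hb hc _ m e => fst_act ha hb hc m e)
  snd := DGHom.mkLin (fun t p q h =>
      ((Y.obj t).XIsoOfEq ((add_zero p).symm.trans h)).hom.hom ∘ₗ snd t p)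
    (fun _ _ p _ a b c ha hb hc _ m e => by
      obtain rfl : c = a := by lia
      obtain rfl : b = p := by lia
      exact snd_act ha m e)
  inl_fst := DGHom.ext_apply fun t p q h m => by
    rw [DGHom.comp_apply _ _ _ _ rfl (by lia)]
    obtain rfl : q = p := by lia
    simp
  inl_snd := DGHom.ext_apply fun t p q h m => by
    rw [DGHom.comp_apply _ _ _ _ h (by lia)]
    simp
  inr_fst := DGHom.ext_apply fun t p q h m => by
    rw [DGHom.comp_apply _ _ _ _ (add_zero p) (by lia)]
    simp
  inr_snd := DGHom.ext_apply fun t p q h m => by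
    rw [DGHom.comp_apply _ _ _ _ (add_zero p) (by lia)]
    obtain rfl : q = p := by lia
    simp
  total := DGHom.ext_apply fun t p q h m => by
    obtain rfl : q = p := by lia
    simp only [Submodule.coe_add, Pi.add_apply, Cochain.add_v, ModuleCat.hom_add,
      LinearMap.add_apply]
    rw [DGHom.comp_apply _ _ _ _ rfl (by lia), DGHom.comp_apply _ _ _ _ (add_zero q) (by lia)]
    simpa using total rfl m
  δ_inl := DGHom.ext_apply fun t p q h m => by
    obtain rfl : q = p := by lia
    rw [DGHom.δ_apply (by lia) _ t rfl (show q + -1 = q - 1 by lia)]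
    simp [d_inl (show q - 1 + 1 = q by lia) rfl]
  δ_fst := DGHom.ext_apply fun t p q h m => by
    rw [DGHom.δ_apply (by lia) _ t rfl rfl]
    simp [fst_d rfl (show p + 1 + 1 = q by lia), Int.negOnePow_even 2 even_two]
  δ_snd := DGHom.ext_apply fun t p q h m => by
    obtain rfl : q = p + 1 := by lia
    rw [DGHom.δ_apply (by lia) _ t rfl (add_zero p)]
    simp only [Submodule.coe_neg, Pi.neg_apply, Cochain.neg_v, ModuleCat.hom_neg,
      LinearMap.neg_apply]
    rw [DGHom.comp_apply _ _ _ _ rfl (by lia)]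
    simp [snd_d rfl]
  h_eq t n m hm z := by
    subst hm
    simp [toShift_apply f rfl]
    rfl

end cone

lemma DGMod.isIso_of_bijective {M N : DGMod k T} (φ : M ⟶ N)
    (h : ∀ t n, Function.Bijective ((DGMod.app φ t).f n).hom) : IsIso φ := by
  have h1 : ∀ t, IsIso (DGMod.app φ t) := fun t => by
    have : ∀ n, IsIso ((DGMod.app φ t).f n) := fun n =>
      (ConcreteCategory.isIso_iff_bijective ((DGMod.app φ t).f n)).2 (h t n)
    exact HomologicalComplex.Hom.isIso_of_components _
  have h2 : φ = (DGMod.isoMk (fun t => @asIso _ _ _ _ (DGMod.app φ t) (h1 t)) φ.2).hom := rfl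
  rw [h2]
  infer_instance

lemma IsHomotopy.apply {M N : DGMod k T} {h : DGHom (-1) M N} {f g : M ⟶ N} (H : IsHomotopy h f g)
    (t : T) {i j l : ℤ} (hi : i + 1 = j) (hj : j + 1 = l) (x : (M.obj t).X j) :
    ((DGMod.app f t).f j).hom x = ((DGMod.app g t).f j).hom x +
      (((N.obj t).d i j).hom (((h.1 t).v j i (by lia)).hom x) +
        ((h.1 t).v l j (by lia)).hom (((M.obj t).d j l).hom x)) := by
  have h1 := congrArg (fun φ : DGHom 0 M N => ((φ.1 t).v j j (add_zero j)).hom x) H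
  rw [DGHom.δ_apply (by lia) _ t hj (show j + -1 = i by lia)] at h1
  rw [← sub_eq_iff_eq_add']
  simpa using h1

def isoOfHomotopic {M N : DGMod k T} (φ : M ⟶ N) (ψ : N ⟶ M) (h₁ : homotopic (φ ≫ ψ) (𝟙 M))
    (h₂ : homotopic (ψ ≫ φ) (𝟙 N)) : (toHo k T).obj M ≅ (toHo k T).obj N where
  hom := (toHo k T).map φ
  inv := (toHo k T).map ψ
  hom_inv_id := by rw [← Functor.map_comp, toHo_map_eq h₁, CategoryTheory.Functor.map_id]
  inv_hom_id := by rw [← Functor.map_comp, toHo_map_eq h₂, CategoryTheory.Functor.map_id]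

namespace ConeData

variable {X Y Z : DGMod k T} {f : X ⟶ Y} {g : Y ⟶ Z} {h : Z ⟶ X⟦(1 : ℤ)⟧} (D : ConeData f g h)

/-- The projections `fst` and `snd` of an abstract cone are its coordinates. The equations for their
differentials say that the coordinate map is closed, and the remaining relations say that it is
bijective. -/
def toCone : Z ⟶ cone f :=
  DGMod.homMk (fun t n => cone.inl rfl ∘ₗ ((D.fst.1 t).v n (n + 1) rfl).hom +
      cone.inr t n ∘ₗ ((D.snd.1 t).v n n (add_zero n)).hom)
    (fun t i j hij x => by
      subst hij
      have h1 := congrArg (fun φ : DGHom 2 Z X => ((φ.1 t).v i (i + 1 + 1) (by lia)).hom x) D.δ_fst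
      have h2 := congrArg (fun φ : DGHom 1 Z Y => ((φ.1 t).v i (i + 1) rfl).hom x) D.δ_snd
      simp only [Submodule.coe_neg, Pi.neg_apply, Cochain.neg_v, ModuleCat.hom_neg,
        LinearMap.neg_apply] at h1 h2
      rw [DGHom.δ_apply (by lia) _ t rfl rfl] at h1
      rw [DGHom.δ_apply (by lia) _ t rfl (add_zero i), DGHom.comp_apply _ _ _ _ rfl (by lia)] at h2
      simp [Int.negOnePow_even 2 even_two] at h1 h2
      refine cone.ext rfl ?_ ?_
      · rw [cone.fst_d rfl rfl]
        simp
        rw [eq_neg_of_add_eq_zero_left h1, neg_neg]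
      · rw [cone.snd_d rfl]
        simp only [map_add, LinearMap.add_apply]
        simp
        rw [← sub_eq_add_neg] at h2
        rw [← sub_eq_zero, add_sub_assoc, h2, add_neg_cancel])
    (fun x y p q n hn m e => by
      simp only [LinearMap.add_apply, LinearMap.comp_apply]
      rw [D.fst.map_act hn rfl rfl (by lia), D.snd.map_act hn (add_zero p) (add_zero n) hn]
      simp only [map_add, LinearMap.add_apply]
      rw [cone.act_inl hn rfl rfl, cone.act_inr])

lemma toCone_bijective (t : T) (n : ℤ) : Function.Bijective ((DGMod.app D.toCone t).f n).hom := by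
  have happ : ∀ z, ((DGMod.app D.toCone t).f n).hom z =
      cone.inl rfl (((D.fst.1 t).v n (n + 1) rfl).hom z) +
        cone.inr t n (((D.snd.1 t).v n n (add_zero n)).hom z) := fun z => rfl
  constructor
  · refine (injective_iff_map_eq_zero _).2 fun z hz => ?_
    rw [happ] at hz
    have h1 := congrArg (cone.fst rfl) hz
    have h2 := congrArg (cone.snd t n) hz
    simp only [map_add, cone.fst_inl, cone.fst_inr, cone.snd_inl, cone.snd_inr, add_zero,
      zero_add, map_zero] at h1 h2
    have h3 := congrArg (fun φ : DGHom 0 Z Z => ((φ.1 t).v n n (add_zero n)).hom z) D.total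
    simp only [Submodule.coe_add, Pi.add_apply, Cochain.add_v, ModuleCat.hom_add,
      LinearMap.add_apply] at h3
    rw [DGHom.comp_apply _ _ _ _ rfl (by lia), DGHom.comp_apply _ _ _ _ (add_zero n) (by lia),
      h1, h2] at h3
    simpa using h3.symm
  · intro w
    refine ⟨((D.inl.1 t).v (n + 1) n (by lia)).hom (cone.fst rfl w) +
      ((DGMod.app g t).f n).hom (cone.snd t n w), ?_⟩
    have h1 := congrArg (fun φ : DGHom 0 X X =>
      ((φ.1 t).v (n + 1) (n + 1) (add_zero _)).hom (cone.fst rfl w)) D.inl_fst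
    have h2 := congrArg (fun φ : DGHom (-1) X Y =>
      ((φ.1 t).v (n + 1) n (by lia)).hom (cone.fst rfl w)) D.inl_snd
    have h3 := congrArg (fun φ : DGHom 1 Y X =>
      ((φ.1 t).v n (n + 1) rfl).hom (cone.snd t n w)) D.inr_fst
    have h4 := congrArg (fun φ : DGHom 0 Y Y =>
      ((φ.1 t).v n n (add_zero n)).hom (cone.snd t n w)) D.inr_snd
    rw [DGHom.comp_apply _ _ _ _ (show n + 1 + -1 = n by lia) (by lia)] at h1 h2
    rw [DGHom.comp_apply _ _ _ _ (add_zero n) (by lia)] at h3 h4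
    simp at h1 h2 h3 h4
    rw [happ]
    refine cone.ext rfl ?_ ?_
    · simp only [map_add, cone.fst_inl, cone.fst_inr, add_zero, h1, h3]
    · simp only [map_add, cone.snd_inl, cone.snd_inr, zero_add, h2, h4]

instance : IsIso D.toCone := DGMod.isIso_of_bijective _ D.toCone_bijective

lemma g_toCone : g ≫ D.toCone = cone.inrHom f := by
  apply DGMod.hom_ext
  intro t n x
  have h3 := congrArg (fun φ : DGHom 1 Y X =>
    ((φ.1 t).v n (n + 1) rfl).hom x) D.inr_fst
  have h4 := congrArg (fun φ : DGHom 0 Y Y =>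
    ((φ.1 t).v n n (add_zero n)).hom x) D.inr_snd
  rw [DGHom.comp_apply _ _ _ _ (add_zero n) (by lia)] at h3 h4
  simp at h3 h4
  simp [toCone, h3, h4]

lemma toCone_toShift : D.toCone ≫ cone.toShift f = h := by
  apply DGMod.hom_ext
  intro t n x
  have h1 := D.h_eq t n (n + 1) rfl x
  have h2 : ((DGMod.app D.toCone t).f n).hom x =
      cone.inl rfl (((D.fst.1 t).v n (n + 1) rfl).hom x) +
        cone.inr t n (((D.snd.1 t).v n n (add_zero n)).hom x) := rfl
  refine (cone.toShift_apply f rfl _).trans ?_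
  change -(shiftIn X _ t (cone.fst _ (((DGMod.app D.toCone t).f n).hom x))) = _
  rw [h2, map_add, cone.fst_inl, cone.fst_inr, add_zero]
  refine shiftOut_injective (rfl : n + 1 = n + 1) ?_
  rw [map_neg, shiftOut_shiftIn]
  exact h1.symm

end ConeData

open Pretriangulated

/-- The triangle of a mapping cone, in the homotopy category. -/
abbrev cone.triangleh {X Y : DGMod k T} (f : X ⟶ Y) : Triangle (HoMod k T) :=
  Triangle.mk ((toHo k T).map f) ((toHo k T).map (cone.inrHom f))
    ((toHo k T).map (cone.toShift f) ≫ ((toHo k T).commShiftIso (1 : ℤ)).hom.app X)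

/-- Abstract cones are isomorphic to standard ones through `ConeData.toCone`, compatibly with the
other maps of the triangle. The axioms therefore need checking only for standard cones. -/
lemma mem_coneTriangles_iff (τ : Triangle (HoMod k T)) : τ ∈ coneTriangles k T ↔
    ∃ (X Y : DGMod k T) (f : X ⟶ Y), Nonempty (τ ≅ cone.triangleh f) := by
  constructor
  · rintro ⟨X, Y, Z, f, g, h, ⟨D⟩, ⟨e⟩⟩
    refine ⟨X, Y, f, ⟨e ≪≫ Triangle.isoMk _ _ (Iso.refl _) (Iso.refl _)
      ((toHo k T).mapIso (asIso D.toCone)) ?_ ?_ ?_⟩⟩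
    · exact (Category.comp_id ((toHo k T).map f)).trans (Category.id_comp _).symm
    · refine (((toHo k T).map_comp g D.toCone).symm.trans ?_).trans (Category.id_comp _).symm
      rw [D.g_toCone]
      rfl
    · refine (congrArg (_ ≫ ·) (CategoryTheory.Functor.map_id _ _)).trans ((Category.comp_id _).trans ?_)
      refine Eq.trans ?_ (Category.assoc _ _ _)
      refine congrArg (· ≫ _) ?_
      refine Eq.trans ?_ ((toHo k T).map_comp _ _)
      exact congrArg _ D.toCone_toShift.symm
  · rintro ⟨X, Y, f, h⟩
    exact ⟨X, Y, _, f, _, _, ⟨cone.data f⟩, h⟩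

lemma triangleh_mem {X Y : DGMod k T} (f : X ⟶ Y) : cone.triangleh f ∈ coneTriangles k T :=
  (mem_coneTriangles_iff _).2 ⟨X, Y, f, ⟨Iso.refl _⟩⟩

/-! ### The pretriangulated structure on the homotopy category -/

section

open Pretriangulated

@[simp] lemma DGMod.units_smul_app {M N : DGMod k T} (ε : ℤˣ) (φ : M ⟶ N) (t : T) :
    DGMod.app (ε • φ) t = ε • DGMod.app φ t := by
  rcases Int.units_eq_one_or ε with rfl | rfl
  · rw [one_smul, one_smul]
  · rw [Units.neg_smul, Units.neg_smul, one_smul, one_smul, DGMod.neg_app]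

lemma shiftOut_units_smul (X : DGMod k T) {a n m : ℤ} (h : n + a = m) {t : T} (ε : ℤˣ)
    (x : ((X⟦a⟧).obj t).X n) : shiftOut X h t (ε • x) = ε • shiftOut X h t x :=
  LinearMap.map_smul_of_tower _ _ _

/-- A morphism of triangles in the homotopy category from squares commuting up to homotopy. -/
@[simps] def trianglehHom {A B : Triangle (DGMod k T)} (a : A.obj₁ ⟶ B.obj₁) (b : A.obj₂ ⟶ B.obj₂)
    (c : A.obj₃ ⟶ B.obj₃) (h₁ : homotopic (A.mor₁ ≫ b) (a ≫ B.mor₁))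
    (h₂ : homotopic (A.mor₂ ≫ c) (b ≫ B.mor₂))
    (h₃ : homotopic (A.mor₃ ≫ a⟦(1 : ℤ)⟧') (c ≫ B.mor₃)) :
    (toHo k T).mapTriangle.obj A ⟶ (toHo k T).mapTriangle.obj B where
  hom₁ := (toHo k T).map a
  hom₂ := (toHo k T).map b
  hom₃ := (toHo k T).map c
  comm₁ := by
    refine ((toHo k T).map_comp _ _).symm.trans ((toHo_map_eq h₁).trans ((toHo k T).map_comp _ _))
  comm₂ := by
    refine ((toHo k T).map_comp _ _).symm.trans ((toHo_map_eq h₂).trans ((toHo k T).map_comp _ _))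
  comm₃ := by
    have e1 : ((toHo k T).map A.mor₃ ≫ ((toHo k T).commShiftIso (1 : ℤ)).hom.app A.obj₁) ≫
        ((toHo k T).map a)⟦(1 : ℤ)⟧' = (toHo k T).map c ≫ (toHo k T).map B.mor₃ ≫
        ((toHo k T).commShiftIso (1 : ℤ)).hom.app B.obj₁ := by
      rw [Category.assoc, ← (toHo k T).commShiftIso_hom_naturality, ← Category.assoc,
        ← Category.assoc, ← (toHo k T).map_comp, ← (toHo k T).map_comp, toHo_map_eq h₃]
    exact e1

def trianglehIso {A B : Triangle (DGMod k T)} (a : A.obj₁ ⟶ B.obj₁) (b : A.obj₂ ⟶ B.obj₂)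
    (c : A.obj₃ ⟶ B.obj₃) (h₁ : homotopic (A.mor₁ ≫ b) (a ≫ B.mor₁))
    (h₂ : homotopic (A.mor₂ ≫ c) (b ≫ B.mor₂))
    (h₃ : homotopic (A.mor₃ ≫ a⟦(1 : ℤ)⟧') (c ≫ B.mor₃))
    (ha : IsIso ((toHo k T).map a)) (hb : IsIso ((toHo k T).map b))
    (hc : IsIso ((toHo k T).map c)) :
    (toHo k T).mapTriangle.obj A ≅ (toHo k T).mapTriangle.obj B :=
  @asIso _ _ _ _ (trianglehHom a b c h₁ h₂ h₃) (Triangle.isIso_of_isIsos _ ha hb hc)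

lemma isIso_toHo_map_of_homotopic {M N : DGMod k T} (φ : M ⟶ N) (ψ : N ⟶ M)
    (h₁ : homotopic (φ ≫ ψ) (𝟙 M)) (h₂ : homotopic (ψ ≫ φ) (𝟙 N)) :
    IsIso ((toHo k T).map φ) :=
  inferInstanceAs (IsIso (isoOfHomotopic φ ψ h₁ h₂).hom)

lemma homotopic_of_eq {M N : DGMod k T} {φ ψ : M ⟶ N} (h : φ = ψ) : homotopic φ ψ :=
  h ▸ homotopic_refl φ

lemma homotopic_symm {M N : DGMod k T} {φ ψ : M ⟶ N} (h : homotopic φ ψ) : homotopic ψ φ :=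
  Congruence.equivalence.symm h

lemma homotopic_trans {M N : DGMod k T} {φ ψ χ : M ⟶ N} (h : homotopic φ ψ)
    (h' : homotopic ψ χ) : homotopic φ χ :=
  Congruence.equivalence.trans h h'

lemma isIso_toHo_map_id (M : DGMod k T) : IsIso ((toHo k T).map (𝟙 M)) := inferInstance

lemma isIso_toHo_map_units_smul (ε : ℤˣ) (M : DGMod k T) : IsIso ((toHo k T).map (ε • 𝟙 M)) :=
  isIso_toHo_map_of_homotopic _ (ε • 𝟙 M)
    (homotopic_of_eq (by rw [Linear.units_smul_comp, Linear.comp_units_smul, smul_smul,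
      Int.units_mul_self, one_smul, Category.comp_id]))
    (homotopic_of_eq (by rw [Linear.units_smul_comp, Linear.comp_units_smul, smul_smul,
      Int.units_mul_self, one_smul, Category.comp_id]))

/-- The strict triangle of a mapping cone. -/
abbrev cone.triangle {X Y : DGMod k T} (f : X ⟶ Y) : Triangle (DGMod k T) :=
  Triangle.mk f (cone.inrHom f) (cone.toShift f)

/-- The contraction moves the second coordinate into the first. -/
lemma cone.homotopic_id_zero (X : DGMod k T) : homotopic (𝟙 (cone (𝟙 X))) 0 := by
  refine homotopic_of_lin (fun t p q h => cone.inl h ∘ₗ cone.snd t q) ?_ ?_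
  · intro x y p p' q a a' hp ha h h' m e
    simp only [LinearMap.comp_apply]
    rw [cone.snd_act, cone.act_inl h' hp ha]
  · intro t i j l hij hjl x
    refine cone.ext hjl ?_ ?_ <;>
    simp [cone.d_inl hij hjl, cone.snd_d hjl]

lemma cone.isZero_id (X : DGMod k T) : Limits.IsZero ((toHo k T).obj (cone (𝟙 X))) := by
  rw [Limits.IsZero.iff_id_eq_zero]
  refine ((toHo k T).map_id _).symm.trans ((toHo_map_eq (cone.homotopic_id_zero X)).trans ?_)
  exact (toHo k T).map_zero _ _

section Rotate
variable {X Y : DGMod k T} (f : X ⟶ Y)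

/-- The cone of `Y ⟶ cone f` contains a contractible part built from two copies of `Y`; what remains
is the shift of `X`. The sign makes the restriction to `cone f` equal to `cone.toShift f`. -/
def cone.rotateHom : cone (cone.inrHom f) ⟶ X⟦(1 : ℤ)⟧ :=
  DGMod.homMk (fun t n => -(shiftIn X rfl t ∘ₗ cone.fst rfl ∘ₗ cone.snd t n))
    (fun t i j hij x => by
      subst hij
      simp only [LinearMap.neg_apply, LinearMap.comp_apply, map_neg]
      rw [shiftIn_d rfl rfl, cone.snd_d rfl, map_add, cone.fst_d rfl rfl]
      simp)
    (fun x y p q n h m e => by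
      simp only [LinearMap.neg_apply, LinearMap.comp_apply, map_neg]
      rw [shiftIn_act rfl rfl, cone.snd_act, cone.fst_act h rfl rfl])

lemma cone.rotateHom_apply {t : T} {n m : ℤ} (h : n + 1 = m)
    (z : ((cone (cone.inrHom f)).obj t).X n) :
    ((DGMod.app (cone.rotateHom f) t).f n).hom z = -shiftIn X h t (cone.fst h (cone.snd t n z)) := by
  subst h; rfl

/-- The component `f x` in the extra copy of `Y` is forced: without it the map would not commute
with the differentials, since `d (inl x)` has the component `f x`. -/
def cone.rotateInv : X⟦(1 : ℤ)⟧ ⟶ cone (cone.inrHom f) :=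
  DGMod.homMk (fun t n => cone.inl rfl ∘ₗ ((DGMod.app f t).f (n + 1)).hom ∘ₗ shiftOut X rfl t -
      cone.inr t n ∘ₗ cone.inl rfl ∘ₗ shiftOut X rfl t)
    (fun t i j hij x => by
      subst hij
      refine cone.ext rfl ?_ (cone.ext rfl ?_ ?_)
      · rw [cone.fst_d rfl rfl]
        simp [shiftOut_d rfl rfl, d_f_apply]
      · rw [cone.snd_d rfl]
        simp [shiftOut_d rfl rfl, cone.d_inl rfl rfl]
      · rw [cone.snd_d rfl]
        simp [cone.d_inl rfl rfl])
    (fun x y p q n h m e => by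
      simp only [LinearMap.sub_apply, LinearMap.comp_apply, map_sub]
      rw [shiftOut_act rfl rfl, DGMod.app_act, cone.act_inl h rfl rfl, cone.act_inr,
        cone.act_inl h rfl rfl])

lemma cone.rotateInv_apply {t : T} {n m : ℤ} (h : n + 1 = m) (x : ((X⟦(1 : ℤ)⟧).obj t).X n) :
    ((DGMod.app (cone.rotateInv f) t).f n).hom x =
      cone.inl h (((DGMod.app f t).f m).hom (shiftOut X h t x)) -
        cone.inr t n (cone.inl h (shiftOut X h t x)) := by
  subst h; rfl

lemma cone.rotateInv_rotateHom : cone.rotateInv f ≫ cone.rotateHom f = 𝟙 _ := by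
  apply DGMod.hom_ext
  intro t n x
  refine (cone.rotateHom_apply f rfl _).trans ?_
  change -(shiftIn X rfl t (cone.fst rfl (cone.snd t n
    (((DGMod.app (cone.rotateInv f) t).f n).hom x)))) = _
  rw [cone.rotateInv_apply f rfl]
  simp

/-- The homotopy contracts the two copies of `Y` onto each other. -/
lemma cone.rotateHom_rotateInv :
    homotopic (𝟙 (cone (cone.inrHom f))) (cone.rotateHom f ≫ cone.rotateInv f) := by
  refine homotopic_of_lin (fun t p q h => cone.inl h ∘ₗ cone.snd t q ∘ₗ cone.snd t q) ?_ ?_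
  · intro x y p p' q a a' hp ha h h' m e
    simp only [LinearMap.comp_apply]
    rw [cone.snd_act, cone.snd_act, cone.act_inl h' hp ha]
  · intro t i j l hij hjl x
    have h1 : ((DGMod.app (cone.rotateHom f ≫ cone.rotateInv f) t).f j).hom x =
      -(cone.inl hjl (((DGMod.app f t).f l).hom (cone.fst hjl (cone.snd t j x))) -
        cone.inr t j (cone.inl hjl (cone.fst hjl (cone.snd t j x)))) := by
      change ((DGMod.app (cone.rotateInv f) t).f j).hom
        (((DGMod.app (cone.rotateHom f) t).f j).hom x) = _
      rw [cone.rotateHom_apply f hjl, map_neg, cone.rotateInv_apply f hjl]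
      simp
    rw [h1]
    refine cone.ext hjl ?_ (cone.ext hjl ?_ ?_) <;>
    simp [cone.d_inl hij hjl, cone.snd_d hjl] <;> abel

/-- The two maps take different copies of `Y` into account, so they agree only up to the homotopy
that sends an element to its `Y`-coordinate inside `cone f`. -/
lemma cone.rotate_comm₃ :
    homotopic (cone.toShift (cone.inrHom f)) (cone.rotateHom f ≫ (-f⟦(1 : ℤ)⟧')) := by
  refine homotopic_of_lin (fun t p q h => -(shiftIn Y h t ∘ₗ cone.snd t q ∘ₗ cone.snd t q)) ?_ ?_
  · intro x y p p' q a a' hp ha h h' m e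
    simp only [LinearMap.comp_apply, LinearMap.neg_apply, map_neg]
    rw [cone.snd_act, cone.snd_act, shiftIn_act hp ha]
  · intro t i j l hij hjl x
    rw [cone.toShift_apply _ hjl]
    have h1 : ((DGMod.app (cone.rotateHom f ≫ (-f⟦(1 : ℤ)⟧')) t).f j).hom x =
        shiftIn Y hjl t (((DGMod.app f t).f l).hom (cone.fst hjl (cone.snd t j x))) := by
      change -((DGMod.app (f⟦(1 : ℤ)⟧') t).f j).hom
        (((DGMod.app (cone.rotateHom f) t).f j).hom x) = _
      rw [cone.rotateHom_apply f hjl, map_neg, shiftIn_map]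
      simp
    rw [h1]
    refine shiftOut_injective hjl ?_
    simp only [LinearMap.neg_apply, LinearMap.comp_apply, map_neg, map_add, shiftOut_shiftIn]
    rw [shiftIn_d hij hjl, cone.snd_d hjl, map_add, cone.snd_d hjl]
    simp
    abel

def cone.rotateIso : (toHo k T).mapTriangle.obj (cone.triangle f).rotate ≅
    (toHo k T).mapTriangle.obj (cone.triangle (cone.inrHom f)) :=
  (trianglehIso (A := cone.triangle (cone.inrHom f)) (B := (cone.triangle f).rotate)
    (𝟙 _) (𝟙 _) (cone.rotateHom f)
    (homotopic_of_eq ((Category.comp_id _).trans (Category.id_comp _).symm))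
    (homotopic_of_eq ((DGMod.hom_ext fun t n x => by
      refine (cone.rotateHom_apply f rfl _).trans ((?_ : _ = _).trans (cone.toShift_apply f rfl x).symm)
      rfl).trans (Category.id_comp _).symm))
    (homotopic_trans (homotopic_of_eq ((congrArg (_ ≫ ·) (CategoryTheory.Functor.map_id _ _)).trans
      (Category.comp_id _))) (cone.rotate_comm₃ f))
    (isIso_toHo_map_id _) (isIso_toHo_map_id _)
    (isIso_toHo_map_of_homotopic _ (cone.rotateInv f) (homotopic_symm (cone.rotateHom_rotateInv f))
      (homotopic_of_eq (cone.rotateInv_rotateHom f)))).symm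

end Rotate

section Shift
variable {X Y : DGMod k T} (f : X ⟶ Y) (a : ℤ)

/-- Shifting the cone multiplies all of its differential by `(-1)^a`, whereas the cone of the
shifted map has no sign on its `f`-component. The sign on the first coordinate compensates for this.
-/
def cone.shiftLin (t : T) (n : ℤ) :
    (((cone f)⟦a⟧).obj t).X n →ₗ[k] ((cone (f⟦a⟧')).obj t).X n :=
  a.negOnePow • (cone.inl rfl ∘ₗ
      shiftIn X (show n + 1 + a = n + a + 1 by lia) t ∘ₗ cone.fst rfl ∘ₗ shiftOut (cone f) rfl t) +
      cone.inr t n ∘ₗ shiftIn Y rfl t ∘ₗ cone.snd t (n + a) ∘ₗ shiftOut (cone f) rfl t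

lemma cone.fst_shiftLin {t : T} {n m p l : ℤ} (h : n + 1 = m) (hp : n + a = p) (hm : m + a = l)
    (hl : p + 1 = l) (z : (((cone f)⟦a⟧).obj t).X n) :
    cone.fst h (cone.shiftLin f a t n z) =
      a.negOnePow • shiftIn X hm t (cone.fst hl (shiftOut (cone f) hp t z)) := by
  subst h hp hl
  simp [cone.shiftLin]

lemma cone.snd_shiftLin {t : T} {n p : ℤ} (hp : n + a = p) (z : (((cone f)⟦a⟧).obj t).X n) :
    cone.snd t n (cone.shiftLin f a t n z) =
      shiftIn Y hp t (cone.snd t p (shiftOut (cone f) hp t z)) := by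
  subst hp
  simp [cone.shiftLin]

def cone.shiftHom : (cone f)⟦a⟧ ⟶ cone (f⟦a⟧') :=
  DGMod.homMk (cone.shiftLin f a)
    (fun t i j hij x => by
      refine cone.ext rfl ?_ ?_
      · rw [cone.fst_d hij rfl, cone.fst_shiftLin f a hij rfl rfl (by lia),
          cone.fst_shiftLin f a rfl rfl rfl (by lia), shiftOut_d rfl rfl,
          LinearMap.map_smul_of_tower, LinearMap.map_smul_of_tower, LinearMap.map_smul_of_tower,
          shiftIn_d rfl rfl, cone.fst_d (j := j + a) (l := j + 1 + a) (by lia) (by lia)]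
        simp
      · rw [cone.snd_d hij, cone.fst_shiftLin f a hij rfl rfl (by lia),
          cone.snd_shiftLin f a rfl, cone.snd_shiftLin f a rfl, shiftOut_d rfl rfl,
          LinearMap.map_smul_of_tower, LinearMap.map_smul_of_tower, LinearMap.map_smul_of_tower,
          shiftIn_d rfl rfl, cone.snd_d (j := j + a) (by lia), shiftIn_map, map_add, smul_add,
          LinearMap.map_smul_of_tower])
    (fun x y p q n h m e => by
      refine cone.ext rfl ?_ ?_
      · rw [cone.fst_act h rfl rfl, cone.fst_shiftLin f a rfl rfl rfl (by lia),
          cone.fst_shiftLin f a rfl rfl rfl (by lia), shiftOut_act rfl rfl,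
          cone.fst_act (p' := p + 1 + a) (by lia) (by lia) (by lia),
          LinearMap.map_smul_of_tower, LinearMap.smul_apply, shiftIn_act rfl rfl]
      · rw [cone.snd_act, cone.snd_shiftLin f a rfl, cone.snd_shiftLin f a rfl,
          shiftOut_act rfl rfl, cone.snd_act, shiftIn_act rfl rfl])

instance : IsIso (cone.shiftHom f a) := DGMod.isIso_of_bijective _ fun t n => by
  constructor
  · refine (injective_iff_map_eq_zero _).2 fun z hz => ?_
    have h1 := cone.fst_shiftLin f a (t := t) (n := n) rfl rfl rfl (by lia) z
    have h2 := cone.snd_shiftLin f a (t := t) (n := n) rfl z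
    have h3 : cone.shiftLin f a t n z = 0 := hz
    rw [h3, map_zero] at h1 h2
    refine shiftOut_injective rfl (cone.ext (show n + a + 1 = n + 1 + a by lia) ?_ ?_)
    · have := congrArg (shiftOut X rfl t) h1
      rw [shiftOut_units_smul, shiftOut_shiftIn, map_zero, eq_comm, smul_eq_zero_iff_eq] at this
      rw [this, map_zero, map_zero]
    · have := congrArg (shiftOut Y rfl t) h2
      rw [shiftOut_shiftIn, map_zero] at this
      rw [← this, map_zero, map_zero]
  · intro w
    refine ⟨shiftIn (cone f) rfl t (cone.inl (show n + a + 1 = n + 1 + a by lia)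
      (a.negOnePow • shiftOut X rfl t (cone.fst rfl w)) +
        cone.inr t _ (shiftOut Y rfl t (cone.snd t n w))), ?_⟩
    refine cone.ext rfl ?_ ?_
    · refine (cone.fst_shiftLin f a rfl rfl rfl (by lia) _).trans ?_
      simp [smul_smul]
    · refine (cone.snd_shiftLin f a rfl _).trans ?_
      simp

lemma cone.isIso_toHo_map_shiftHom : IsIso ((toHo k T).map (cone.shiftHom f a)) := inferInstance

lemma cone.inrHom_shiftHom : (cone.inrHom f)⟦a⟧' ≫ cone.shiftHom f a = cone.inrHom (f⟦a⟧') := by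
  apply DGMod.hom_ext
  intro t n x
  change cone.shiftLin f a t n (((DGMod.app ((cone.inrHom f)⟦a⟧') t).f n).hom x) = cone.inr t n x
  refine cone.ext rfl ?_ ?_
  · rw [cone.fst_shiftLin f a rfl rfl rfl (by lia), shiftOut_map]
    simp
  · rw [cone.snd_shiftLin f a rfl, shiftOut_map]
    simp

/-- The sign on the first coordinate of `cone.shiftLin` survives here, and is exactly the one that
the shift of a triangle puts on its third morphism. -/
lemma cone.shiftHom_toShift : (cone.toShift f)⟦a⟧' ≫ (shiftFunctorComm (DGMod k T) 1 a).hom.app X =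
    a.negOnePow • (cone.shiftHom f a ≫ cone.toShift (f⟦a⟧')) := by
  apply DGMod.hom_ext
  intro t n x
  have h1 : ((DGMod.app (a.negOnePow • (cone.shiftHom f a ≫ cone.toShift (f⟦a⟧'))) t).f n).hom x =
      -shiftIn (X⟦a⟧) rfl t (shiftIn X rfl t
        (cone.fst (show n + a + 1 = n + 1 + a by lia) (shiftOut (cone f) rfl t x))) := by
    rw [DGMod.units_smul_app]
    change a.negOnePow • ((DGMod.app (cone.toShift (f⟦a⟧')) t).f n).hom (cone.shiftLin f a t n x) = _
    rw [cone.toShift_apply _ rfl, cone.fst_shiftLin f a rfl rfl rfl (by lia),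
      LinearMap.map_smul_of_tower, smul_neg, smul_smul]
    simp
  rw [h1]
  refine shiftOut_injective rfl (shiftOut_injective rfl ?_)
  rw [map_neg, map_neg, shiftOut_shiftIn, shiftOut_shiftIn]
  refine (shiftOut_shiftFunctorComm (X := X) (n := n) rfl (show n + a + 1 = n + 1 + a by lia) rfl rfl
    (((DGMod.app ((cone.toShift f)⟦a⟧') t).f n).hom x)).trans ?_
  rw [shiftOut_map, cone.toShift_apply _ (show n + a + 1 = n + 1 + a by lia)]
  simp

/-- All three maps of a shifted triangle carry the sign `(-1)^a`. Putting it on the second vertex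
removes it from the first two maps; the third is handled by `cone.shiftHom_toShift`. -/
def cone.shiftIso : (toHo k T).mapTriangle.obj ((Triangle.shiftFunctor _ a).obj (cone.triangle f)) ≅
    (toHo k T).mapTriangle.obj (cone.triangle (f⟦a⟧')) :=
  trianglehIso (A := (Triangle.shiftFunctor _ a).obj (cone.triangle f))
    (𝟙 _) (a.negOnePow • 𝟙 _) (cone.shiftHom f a)
    (homotopic_of_eq (show (a.negOnePow • f⟦a⟧') ≫ (a.negOnePow • 𝟙 _) = 𝟙 _ ≫ f⟦a⟧' by
      rw [Linear.units_smul_comp, Linear.comp_units_smul, smul_smul, Int.units_mul_self, one_smul,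
        Category.comp_id, Category.id_comp]))
    (homotopic_of_eq (show (a.negOnePow • (cone.inrHom f)⟦a⟧') ≫ cone.shiftHom f a =
        (a.negOnePow • 𝟙 _) ≫ cone.inrHom (f⟦a⟧') by
      rw [Linear.units_smul_comp, Linear.units_smul_comp, cone.inrHom_shiftHom, Category.id_comp]))
    (homotopic_of_eq (show (a.negOnePow • (cone.toShift f)⟦a⟧' ≫
        (shiftFunctorComm (DGMod k T) 1 a).hom.app X) ≫ (𝟙 (X⟦a⟧))⟦(1 : ℤ)⟧' =
        cone.shiftHom f a ≫ cone.toShift (f⟦a⟧') by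
      rw [cone.shiftHom_toShift, smul_smul, Int.units_mul_self, one_smul,
        CategoryTheory.Functor.map_id]
      exact Category.comp_id _))
    (isIso_toHo_map_id _) (isIso_toHo_map_units_smul _ (Y⟦a⟧)) (cone.isIso_toHo_map_shiftHom f a)

end Shift

section Complete

variable {X₁ Y₁ X₂ Y₂ : DGMod k T} {f₁ : X₁ ⟶ Y₁} {f₂ : X₂ ⟶ Y₂} {a : X₁ ⟶ X₂} {b : Y₁ ⟶ Y₂}
  {h : DGHom (-1) X₁ Y₂} (H : IsHomotopy h (f₁ ≫ b) (a ≫ f₂))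

/-- The map of mapping cones induced by a square commuting up to homotopy. -/
def cone.mapOfHomotopy : cone f₁ ⟶ cone f₂ :=
  DGMod.homMk (fun t n => cone.inl rfl ∘ₗ ((DGMod.app a t).f (n + 1)).hom ∘ₗ cone.fst rfl +
      cone.inr t n ∘ₗ (((DGMod.app b t).f n).hom ∘ₗ cone.snd t n +
        ((h.1 t).v (n + 1) n (by lia)).hom ∘ₗ cone.fst rfl))
    (fun t i j hij x => by
      subst hij
      have h1 := H.apply t rfl rfl (cone.fst rfl x)
      simp only [DGMod.comp_app, HomologicalComplex.comp_f, ModuleCat.hom_comp,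
        LinearMap.comp_apply] at h1
      refine cone.ext rfl ?_ ?_
      · rw [cone.fst_d rfl rfl]
        simp [cone.fst_d rfl rfl, d_f_apply]
      · rw [cone.snd_d rfl]
        simp [cone.fst_d rfl rfl, cone.snd_d rfl, d_f_apply, h1]
        abel)
    (fun x y p q n hn m e => by
      simp only [LinearMap.add_apply, LinearMap.comp_apply, map_add]
      rw [cone.fst_act hn rfl rfl, DGMod.app_act, cone.snd_act, DGMod.app_act,
        h.map_act (b := p) _ (by lia) _ hn, cone.act_inl hn rfl rfl, cone.act_inr, cone.act_inr])

lemma cone.inrHom_mapOfHomotopy : cone.inrHom f₁ ≫ cone.mapOfHomotopy H = b ≫ cone.inrHom f₂ := by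
  apply DGMod.hom_ext
  intro t n x
  have h1 : cone.fst (rfl : n + 1 = n + 1) (cone.inr (f := f₁) t n x) = 0 := cone.fst_inr _ _
  have h2 : cone.snd t n (cone.inr (f := f₁) t n x) = x := cone.snd_inr _ _ _
  refine (?_ : cone.inl rfl (((DGMod.app a t).f (n + 1)).hom (cone.fst rfl (cone.inr t n x))) +
    cone.inr t n (((DGMod.app b t).f n).hom (cone.snd t n (cone.inr t n x)) +
      ((h.1 t).v (n + 1) n (by lia)).hom (cone.fst rfl (cone.inr t n x))) = 
      cone.inr t n (((DGMod.app b t).f n).hom x))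
  rw [h1, h2]
  simp

lemma cone.mapOfHomotopy_toShift :
    cone.toShift f₁ ≫ a⟦(1 : ℤ)⟧' = cone.mapOfHomotopy H ≫ cone.toShift f₂ := by
  apply DGMod.hom_ext
  intro t n x
  refine Eq.trans ?_ (cone.toShift_apply f₂ rfl _).symm
  change ((DGMod.app (a⟦(1 : ℤ)⟧') t).f n).hom (-shiftIn X₁ rfl t (cone.fst rfl x)) =
    -shiftIn X₂ rfl t (cone.fst rfl (cone.inl rfl (((DGMod.app a t).f (n + 1)).hom (cone.fst rfl x)) +
    cone.inr t n (((DGMod.app b t).f n).hom (cone.snd t n x) +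
      ((h.1 t).v (n + 1) n (by lia)).hom (cone.fst rfl x))))
  rw [map_neg, shiftIn_map]
  simp

def cone.trianglehMap : cone.triangleh f₁ ⟶ cone.triangleh f₂ :=
  trianglehHom (A := cone.triangle f₁) (B := cone.triangle f₂) a b (cone.mapOfHomotopy H) ⟨h, H⟩
    (homotopic_of_eq (cone.inrHom_mapOfHomotopy H))
    (homotopic_of_eq (cone.mapOfHomotopy_toShift H))

end Complete

lemma square_conj {C : Type*} [Category* C] {X₁ Y₁ A₁ B₁ A₂ B₂ X₂ Y₂ : C} {φ₁ : X₁ ⟶ Y₁}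
    {i₁ : X₁ ⟶ A₁} {i₂ : Y₁ ⟶ B₁} {m₁ : A₁ ⟶ B₁} {a : A₁ ⟶ A₂} {b : B₁ ⟶ B₂} {m₂ : A₂ ⟶ B₂}
    {j₁ : A₂ ⟶ X₂} {j₂ : B₂ ⟶ Y₂} {φ₂ : X₂ ⟶ Y₂} (h₁ : φ₁ ≫ i₂ = i₁ ≫ m₁)
    (fac : m₁ ≫ b = a ≫ m₂) (h₂ : m₂ ≫ j₂ = j₁ ≫ φ₂) :
    φ₁ ≫ i₂ ≫ b ≫ j₂ = (i₁ ≫ a ≫ j₁) ≫ φ₂ := by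
  rw [reassoc_of% h₁, reassoc_of% fac, h₂, Category.assoc, Category.assoc]

lemma conj_conj {C : Type*} [Category* C] {A A' B B' : C} (e : A ≅ A') (e' : B ≅ B')
    (a : A ⟶ B) : e.hom ≫ (e.inv ≫ a ≫ e'.hom) ≫ e'.inv = a := by
  simp

instance : Limits.HasZeroObject (HoMod k T) := ⟨_, cone.isZero_id (zeroMod k T)⟩

instance : Pretriangulated (HoMod k T) where
  distinguishedTriangles := coneTriangles k T
  isomorphic_distinguished := by
    rintro _ ⟨X, Y, Z, f, g, h, D, ⟨e⟩⟩ _ e'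
    exact ⟨X, Y, Z, f, g, h, D, ⟨e' ≪≫ e⟩⟩
  contractible_distinguished := by
    rintro ⟨X⟩
    refine (mem_coneTriangles_iff _).2 ⟨X, X, 𝟙 X, ⟨?_⟩⟩
    exact Triangle.isoMk _ _ (Iso.refl _) (Iso.refl _) (cone.isZero_id X).isoZero.symm
      (by
        refine (Category.comp_id _).trans (Eq.trans ?_ (Category.id_comp _).symm)
        exact ((toHo k T).map_id X).symm) ((cone.isZero_id X).eq_of_tgt _ _)
        ((Limits.isZero_zero _).eq_of_src _ _)
  distinguished_cocone_triangle := by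
    intro X Y f
    obtain ⟨f, rfl⟩ := (toHo k T).map_surjective (X := X.as) (Y := Y.as) f
    exact ⟨_, _, _, triangleh_mem f⟩
  rotate_distinguished_triangle := by
    have h1 : ∀ τ ∈ coneTriangles k T, τ.rotate ∈ coneTriangles k T := by
      intro τ hτ
      obtain ⟨X, Y, f, ⟨e⟩⟩ := (mem_coneTriangles_iff _).1 hτ
      exact (mem_coneTriangles_iff _).2 ⟨_, _, _, ⟨(rotate _).mapIso e ≪≫
        (toHo k T).mapTriangleRotateIso.app (cone.triangle f) ≪≫ cone.rotateIso f⟩⟩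
    -- Stability under shifts gives the converse half of rotation: the inverse rotation is the
    -- double rotation shifted by `-1`, so it can be expressed by forward rotations.
    have h2 : ∀ τ ∈ coneTriangles k T, ∀ a : ℤ,
        (Triangle.shiftFunctor _ a).obj τ ∈ coneTriangles k T := by
      intro τ hτ a
      obtain ⟨X, Y, f, ⟨e⟩⟩ := (mem_coneTriangles_iff _).1 hτ
      exact (mem_coneTriangles_iff _).2 ⟨_, _, _, ⟨(Triangle.shiftFunctor _ a).mapIso e ≪≫
        ((toHo k T).mapTriangleCommShiftIso a).symm.app (cone.triangle f) ≪≫ cone.shiftIso f a⟩⟩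
    have h3 : ∀ τ ∈ coneTriangles k T, ∀ τ', (τ' ≅ τ) → τ' ∈ coneTriangles k T := by
      rintro _ ⟨X, Y, Z, f, g, h, D, ⟨e⟩⟩ _ e'
      exact ⟨X, Y, Z, f, g, h, D, ⟨e' ≪≫ e⟩⟩
    intro τ
    refine ⟨h1 τ, fun hτ => ?_⟩
    refine h3 _ (h3 _ (h2 _ (h1 _ (h1 _ hτ)) (-1)) _
      ((invRotateIsoRotateRotateShiftFunctorNegOne _).app τ.rotate)) _
      ((triangleRotation _).unitIso.app τ)
  complete_distinguished_triangle_morphism := by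
    intro T₁ T₂ hT₁ hT₂ a b fac
    obtain ⟨X₁, Y₁, f₁, ⟨e₁⟩⟩ := (mem_coneTriangles_iff _).1 hT₁
    obtain ⟨X₂, Y₂, f₂, ⟨e₂⟩⟩ := (mem_coneTriangles_iff _).1 hT₂
    obtain ⟨a', ha'⟩ := (toHo k T).map_surjective (X := X₁) (Y := X₂)
      (e₁.inv.hom₁ ≫ a ≫ e₂.hom.hom₁)
    obtain ⟨b', hb'⟩ := (toHo k T).map_surjective (X := Y₁) (Y := Y₂)
      (e₁.inv.hom₂ ≫ b ≫ e₂.hom.hom₂)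
    -- The square of representatives commutes only up to homotopy, and the chosen homotopy is what
    -- defines the map on cones.
    obtain ⟨h, H⟩ : homotopic (f₁ ≫ b') (a' ≫ f₂) := by
      rw [← toHo_map_eq_iff, (toHo k T).map_comp, (toHo k T).map_comp, ha', hb']
      have c₁ := e₁.inv.comm₁
      have c₂ := e₂.hom.comm₁
      have c₁' : (toHo k T).map f₁ ≫ e₁.inv.hom₂ = e₁.inv.hom₁ ≫ T₁.mor₁ := c₁
      have c₂' : T₂.mor₁ ≫ e₂.hom.hom₂ = e₂.hom.hom₁ ≫ (toHo k T).map f₂ := c₂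
      exact square_conj c₁' fac c₂'
    let γ := e₁.hom ≫ cone.trianglehMap H ≫ e₂.inv
    have g1 : γ.hom₁ = a := by
      change e₁.hom.hom₁ ≫ (toHo k T).map a' ≫ e₂.inv.hom₁ = a
      rw [ha']
      exact conj_conj (Triangle.π₁.mapIso e₁) (Triangle.π₁.mapIso e₂) a
    have g2 : γ.hom₂ = b := by
      change e₁.hom.hom₂ ≫ (toHo k T).map b' ≫ e₂.inv.hom₂ = b
      rw [hb']
      exact conj_conj (Triangle.π₂.mapIso e₁) (Triangle.π₂.mapIso e₂) b
    exact ⟨γ.hom₃, by rw [γ.comm₂, g2], by rw [← γ.comm₃, g1]⟩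

end

/-! ### The octahedral axiom -/

section

open Pretriangulated

section Octahedron

variable {X Y Z : DGMod k T} (f : X ⟶ Y) (g : Y ⟶ Z)

def cone.octU : cone f ⟶ cone (f ≫ g) :=
  DGMod.homMk (fun t n => cone.inl rfl ∘ₗ cone.fst rfl +
      cone.inr t n ∘ₗ ((DGMod.app g t).f n).hom ∘ₗ cone.snd t n)
    (fun t i j hij x => by
      subst hij
      refine cone.ext rfl ?_ ?_
      · rw [cone.fst_d rfl rfl]
        simp [cone.fst_d rfl rfl]
      · rw [cone.snd_d rfl]
        simp [cone.snd_d rfl, d_f_apply])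
    (fun x y p q n hn m e => by
      simp only [LinearMap.add_apply, LinearMap.comp_apply, map_add]
      rw [cone.fst_act hn rfl rfl, cone.snd_act, DGMod.app_act, cone.act_inl hn rfl rfl,
        cone.act_inr])

lemma cone.octU_apply {t : T} {n m : ℤ} (h : n + 1 = m) (x : ((cone f).obj t).X n) :
    ((DGMod.app (cone.octU f g) t).f n).hom x =
      cone.inl h (cone.fst h x) + cone.inr t n (((DGMod.app g t).f n).hom (cone.snd t n x)) := by
  subst h; rfl

def cone.octV : cone (f ≫ g) ⟶ cone g :=
  DGMod.homMk (fun t n => cone.inl rfl ∘ₗ ((DGMod.app f t).f (n + 1)).hom ∘ₗ cone.fst rfl +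
      cone.inr t n ∘ₗ cone.snd t n)
    (fun t i j hij x => by
      subst hij
      refine cone.ext rfl ?_ ?_
      · rw [cone.fst_d rfl rfl]
        simp [cone.fst_d rfl rfl, d_f_apply]
      · rw [cone.snd_d rfl]
        simp [cone.snd_d rfl])
    (fun x y p q n hn m e => by
      simp only [LinearMap.add_apply, LinearMap.comp_apply, map_add]
      rw [cone.fst_act hn rfl rfl, cone.snd_act, DGMod.app_act, cone.act_inl hn rfl rfl,
        cone.act_inr])

lemma cone.octV_apply {t : T} {n m : ℤ} (h : n + 1 = m) (x : ((cone (f ≫ g)).obj t).X n) :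
    ((DGMod.app (cone.octV f g) t).f n).hom x =
      cone.inl h (((DGMod.app f t).f m).hom (cone.fst h x)) + cone.inr t n (cone.snd t n x) := by
  subst h; rfl

/-- The cone of `cone f ⟶ cone (f ≫ g)` consists of two copies of `X`, one of `Y` and one of `Z`.
The copies of `X` cancel, which leaves the cone of `g`. The term with `f` is needed for
compatibility with differentials. -/
def cone.octHom : cone (cone.octU f g) ⟶ cone g :=
  DGMod.homMk (fun t n => cone.inl rfl ∘ₗ (cone.snd t (n + 1) ∘ₗ cone.fst rfl +
      ((DGMod.app f t).f (n + 1)).hom ∘ₗ cone.fst rfl ∘ₗ cone.snd t n) +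
      cone.inr t n ∘ₗ cone.snd t n ∘ₗ cone.snd t n)
    (fun t i j hij x => by
      subst hij
      refine cone.ext rfl ?_ ?_
      · rw [cone.fst_d rfl rfl]
        simp [cone.fst_d rfl rfl, cone.snd_d rfl, d_f_apply, cone.octU_apply f g rfl]
        abel
      · rw [cone.snd_d rfl]
        simp [cone.snd_d rfl, cone.octU_apply f g rfl]
        abel)
    (fun x y p q n hn m e => by
      simp only [LinearMap.add_apply, LinearMap.comp_apply, map_add]
      rw [cone.fst_act hn rfl rfl, cone.snd_act, cone.snd_act, cone.snd_act,
        cone.fst_act hn rfl rfl, DGMod.app_act, cone.act_inl hn rfl rfl, cone.act_inr]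
      rw [cone.act_inl hn rfl rfl])

lemma cone.octHom_apply {t : T} {n m : ℤ} (h : n + 1 = m)
    (x : ((cone (cone.octU f g)).obj t).X n) :
    ((DGMod.app (cone.octHom f g) t).f n).hom x =
      cone.inl h (cone.snd t m (cone.fst h x) +
        ((DGMod.app f t).f m).hom (cone.fst h (cone.snd t n x))) +
      cone.inr t n (cone.snd t n (cone.snd t n x)) := by
  subst h; rfl

def cone.octInv : cone g ⟶ cone (cone.octU f g) :=
  DGMod.homMk (fun t n => cone.inl rfl ∘ₗ cone.inr t (n + 1) ∘ₗ cone.fst rfl +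
      cone.inr t n ∘ₗ cone.inr t n ∘ₗ cone.snd t n)
    (fun t i j hij x => by
      subst hij
      refine cone.ext rfl (cone.ext rfl ?_ ?_) (cone.ext rfl ?_ ?_)
      · rw [cone.fst_d rfl rfl]
        simp [cone.fst_d rfl rfl, cone.d_inr rfl]
      · rw [cone.fst_d rfl rfl]
        simp [cone.fst_d rfl rfl, cone.d_inr rfl]
      · rw [cone.snd_d rfl]
        simp [cone.snd_d rfl, cone.d_inr rfl, cone.octU_apply f g rfl]
      · rw [cone.snd_d rfl]
        simp [cone.snd_d rfl, cone.d_inr rfl, cone.octU_apply f g rfl])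
    (fun x y p q n hn m e => by
      simp only [LinearMap.add_apply, LinearMap.comp_apply, map_add]
      rw [cone.fst_act hn rfl rfl, cone.snd_act, cone.act_inl hn rfl rfl, cone.act_inr,
        cone.act_inr, cone.act_inr])

lemma cone.octInv_apply {t : T} {n m : ℤ} (h : n + 1 = m) (x : ((cone g).obj t).X n) :
    ((DGMod.app (cone.octInv f g) t).f n).hom x = cone.inl h (cone.inr t m (cone.fst h x)) +
      cone.inr t n (cone.inr t n (cone.snd t n x)) := by
  subst h; rfl

lemma cone.octInv_octHom : cone.octInv f g ≫ cone.octHom f g = 𝟙 _ := by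
  apply DGMod.hom_ext
  intro t n x
  refine (cone.octHom_apply f g rfl _).trans ?_
  change cone.inl rfl (cone.snd t (n + 1) (cone.fst rfl (((DGMod.app (cone.octInv f g) t).f n).hom x)) +
        ((DGMod.app f t).f (n + 1)).hom (cone.fst rfl (cone.snd t n
          (((DGMod.app (cone.octInv f g) t).f n).hom x)))) +
      cone.inr t n (cone.snd t n (cone.snd t n (((DGMod.app (cone.octInv f g) t).f n).hom x))) = x
  rw [cone.octInv_apply f g rfl]
  refine cone.ext rfl ?_ ?_ <;> simp

/-- The homotopy moves the copy of `X` in `cone (f ≫ g)` to the one in `cone f`. The other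
composite, `cone.octInv_octHom`, is an identity on the nose. -/
lemma cone.octHom_octInv :
    homotopic (𝟙 (cone (cone.octU f g))) (cone.octHom f g ≫ cone.octInv f g) := by
  refine homotopic_of_lin (fun t p q h => cone.inl h ∘ₗ cone.inl rfl ∘ₗ cone.fst rfl ∘ₗ cone.snd t q)
    ?_ ?_
  · intro x y p p' q a a' hp ha h h' m e
    simp only [LinearMap.comp_apply]
    rw [cone.snd_act, cone.fst_act h rfl rfl, cone.act_inl h' hp ha, cone.act_inl h rfl rfl]
  · intro t i j l hij hjl x
    subst hjl
    have h1 : ((DGMod.app (cone.octHom f g ≫ cone.octInv f g) t).f j).hom x =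
        cone.inl rfl (cone.inr t (j + 1) (cone.snd t (j + 1) (cone.fst rfl x) +
          ((DGMod.app f t).f (j + 1)).hom (cone.fst rfl (cone.snd t j x)))) +
        cone.inr t j (cone.inr t j (cone.snd t j (cone.snd t j x))) := by
      change ((DGMod.app (cone.octInv f g) t).f j).hom
        (((DGMod.app (cone.octHom f g) t).f j).hom x) = _
      rw [cone.octHom_apply f g rfl, cone.octInv_apply f g rfl]
      simp
    rw [h1]
    refine cone.ext rfl (cone.ext rfl ?_ ?_) (cone.ext rfl ?_ ?_) <;>
    simp [cone.d_inl hij rfl, cone.d_inl rfl rfl, cone.snd_d rfl, cone.fst_d rfl rfl,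
      cone.octU_apply f g rfl]

lemma cone.inrHom_octHom : cone.inrHom (cone.octU f g) ≫ cone.octHom f g = cone.octV f g := by
  apply DGMod.hom_ext
  intro t n x
  refine (cone.octHom_apply f g rfl (cone.inr t n x)).trans
    (Eq.trans ?_ (cone.octV_apply f g rfl x).symm)
  simp

/-- Only the last square of the comparison needs a homotopy: the right-hand map lands in the image
of `Y`, whereas the connecting map keeps the `X`-coordinate of `cone f`. -/
lemma cone.oct_comm₃ : homotopic (cone.toShift (cone.octU f g))
    (cone.octHom f g ≫ cone.toShift g ≫ (cone.inrHom f)⟦(1 : ℤ)⟧') := by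
  refine homotopic_of_lin (fun t p q h => -(shiftIn (cone f) h t ∘ₗ cone.inl rfl ∘ₗ cone.fst rfl ∘ₗ
    cone.snd t q)) ?_ ?_
  · intro x y p p' q a a' hp ha h h' m e
    simp only [LinearMap.comp_apply, LinearMap.neg_apply, map_neg]
    rw [cone.snd_act, cone.fst_act h rfl rfl, shiftIn_act hp ha, cone.act_inl h rfl rfl]
  · intro t i j l hij hjl x
    have h1 : ((DGMod.app (cone.octHom f g ≫ cone.toShift g ≫ (cone.inrHom f)⟦(1 : ℤ)⟧') t).f j).hom x =
        -shiftIn (cone f) hjl t (cone.inr t l (cone.snd t l (cone.fst hjl x) +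
          ((DGMod.app f t).f l).hom (cone.fst hjl (cone.snd t j x)))) := by
      change ((DGMod.app ((cone.inrHom f)⟦(1 : ℤ)⟧') t).f j).hom (((DGMod.app (cone.toShift g) t).f j).hom
        (((DGMod.app (cone.octHom f g) t).f j).hom x)) = _
      rw [cone.octHom_apply f g hjl, cone.toShift_apply g hjl, map_neg, shiftIn_map]
      simp
    rw [h1, cone.toShift_apply _ hjl]
    subst hjl
    refine shiftOut_injective rfl ?_
    simp only [LinearMap.neg_apply, LinearMap.comp_apply, map_neg, map_add, shiftOut_shiftIn]
    rw [shiftIn_d hij rfl, shiftOut_shiftIn, cone.snd_d rfl]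
    refine cone.ext rfl ?_ ?_ <;>
    simp [cone.d_inl rfl rfl, cone.fst_d rfl rfl, cone.octU_apply f g rfl]

lemma cone.isIso_toHo_map_octHom : IsIso ((toHo k T).map (cone.octHom f g)) :=
  isIso_toHo_map_of_homotopic _ (cone.octInv f g) (homotopic_symm (cone.octHom_octInv f g))
    (homotopic_of_eq (cone.octInv_octHom f g))

def cone.octIso : cone.triangleh (cone.octU f g) ≅ (toHo k T).mapTriangle.obj
    (Triangle.mk (cone.octU f g) (cone.octV f g) (cone.toShift g ≫ (cone.inrHom f)⟦(1 : ℤ)⟧')) :=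
  trianglehIso (A := cone.triangle (cone.octU f g)) (𝟙 _) (𝟙 _) (cone.octHom f g)
    (homotopic_of_eq ((Category.comp_id _).trans (Category.id_comp _).symm))
    (homotopic_of_eq ((cone.inrHom_octHom f g).trans (Category.id_comp _).symm))
    (homotopic_trans (homotopic_of_eq ((congrArg (_ ≫ ·) (CategoryTheory.Functor.map_id _ _)).trans
      (Category.comp_id _))) (cone.oct_comm₃ f g))
    (isIso_toHo_map_id _) (isIso_toHo_map_id _) (cone.isIso_toHo_map_octHom f g)

lemma cone.inrHom_octU : cone.inrHom f ≫ cone.octU f g = g ≫ cone.inrHom (f ≫ g) := by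
  apply DGMod.hom_ext
  intro t n x
  refine (cone.octU_apply f g rfl (cone.inr t n x)).trans ?_
  rw [cone.fst_inr, cone.snd_inr, map_zero, zero_add]
  rfl

lemma cone.octU_toShift : cone.octU f g ≫ cone.toShift (f ≫ g) = cone.toShift f := by
  apply DGMod.hom_ext
  intro t n x
  refine Eq.trans ?_ (cone.toShift_apply f rfl x).symm
  change ((DGMod.app (cone.toShift (f ≫ g)) t).f n).hom (((DGMod.app (cone.octU f g) t).f n).hom x) = _
  rw [cone.octU_apply f g rfl, cone.toShift_apply _ rfl]
  simp

lemma cone.inrHom_octV : cone.inrHom (f ≫ g) ≫ cone.octV f g = cone.inrHom g := by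
  apply DGMod.hom_ext
  intro t n x
  refine (cone.octV_apply f g rfl (cone.inr t n x)).trans ?_
  rw [cone.fst_inr, cone.snd_inr, map_zero, map_zero, zero_add]
  rfl

lemma cone.toShift_map_eq :
    cone.toShift (f ≫ g) ≫ f⟦(1 : ℤ)⟧' = cone.octV f g ≫ cone.toShift g := by
  apply DGMod.hom_ext
  intro t n x
  change ((DGMod.app (f⟦(1 : ℤ)⟧') t).f n).hom (((DGMod.app (cone.toShift (f ≫ g)) t).f n).hom x) =
    ((DGMod.app (cone.toShift g) t).f n).hom (((DGMod.app (cone.octV f g) t).f n).hom x)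
  rw [cone.octV_apply f g rfl, cone.toShift_apply _ rfl, cone.toShift_apply _ rfl, map_neg,
    shiftIn_map]
  simp

end Octahedron

lemma toHo_comm {A B C D : DGMod k T} {f : A ⟶ B} {g : B ⟶ C} {f' : A ⟶ D} {g' : D ⟶ C}
    (h : f ≫ g = f' ≫ g') : (toHo k T).map f ≫ (toHo k T).map g =
      (toHo k T).map f' ≫ (toHo k T).map g' := by
  rw [← (toHo k T).map_comp, h, (toHo k T).map_comp]

/-- It suffices to find one octahedron for some representatives of the composable maps, so strict
representatives `f` and `g` with their standard cones can be taken. All identities but the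
distinguished triangle then hold strictly. -/
instance : IsTriangulated (HoMod k T) := by
  refine IsTriangulated.mk' fun X₁ X₂ X₃ u v => ?_
  obtain ⟨f, rfl⟩ := (toHo k T).map_surjective (X := X₁.as) (Y := X₂.as) u
  obtain ⟨g, rfl⟩ := (toHo k T).map_surjective (X := X₂.as) (Y := X₃.as) v
  refine ⟨X₁, X₂, X₃, _, _, _, (toHo k T).map f, (toHo k T).map g, Iso.refl _, Iso.refl _,
    Iso.refl _, ?_, ?_, _, _, triangleh_mem f, _, _, triangleh_mem g, _, _,
    triangleh_mem (f ≫ g), ⟨?_⟩⟩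
  · exact (Category.comp_id _).trans (Category.id_comp _).symm
  · exact (Category.comp_id _).trans (Category.id_comp _).symm
  · refine { m₁ := (toHo k T).map (cone.octU f g), m₃ := (toHo k T).map (cone.octV f g),
             comm₁ := toHo_comm (cone.inrHom_octU f g), comm₂ := ?_
             comm₃ := ((toHo k T).map_comp _ _).symm.trans (congrArg _ (cone.inrHom_octV f g))
             comm₄ := ?_, mem := ?_ }
    · refine (Category.assoc _ _ _).symm.trans (congrArg (· ≫ _) ?_)
      exact ((toHo k T).map_comp _ _).symm.trans (congrArg _ (cone.octU_toShift f g))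
    · refine (Category.assoc _ _ _).trans ?_
      refine (congrArg (_ ≫ ·) ((toHo k T).commShiftIso_hom_naturality f (1 : ℤ)).symm).trans ?_
      refine (Category.assoc _ _ _).symm.trans (Eq.trans ?_ (Category.assoc _ _ _))
      exact congrArg (· ≫ _) (toHo_comm (cone.toShift_map_eq f g))
    · have e : ((toHo k T).map (cone.toShift g) ≫ ((toHo k T).commShiftIso (1 : ℤ)).hom.app X₂.as) ≫
          ((toHo k T).map (cone.inrHom f))⟦(1 : ℤ)⟧' =
          (toHo k T).map (cone.toShift g ≫ (cone.inrHom f)⟦(1 : ℤ)⟧') ≫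
            ((toHo k T).commShiftIso (1 : ℤ)).hom.app (cone f) := by
        refine (Category.assoc _ _ _).trans ?_
        refine (congrArg (_ ≫ ·) ((toHo k T).commShiftIso_hom_naturality
          (cone.inrHom f) (1 : ℤ)).symm).trans ?_
        rw [← Category.assoc, ← (toHo k T).map_comp]
      exact (mem_coneTriangles_iff _).2 ⟨_, _, cone.octU f g,
        ⟨eqToIso (congrArg (Triangle.mk ((toHo k T).map (cone.octU f g))
          ((toHo k T).map (cone.octV f g))) e) ≪≫ (cone.octIso f g).symm⟩⟩

end

/-! ### Perfect modules as a triangulated subcategory -/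

section

open Pretriangulated

/-- Subtract from `f` its part over the finitely many summands met by `mor₂ ≫ f`. The difference
vanishes on the second vertex, so it factors through the shift of the first vertex, where
compactness gives another finite set of summands. -/
lemma IsCompactObj.of_distTriang {C : Type*} [Category* C] [Preadditive C] [HasShift C ℤ]
    [Limits.HasZeroObject C] [∀ n : ℤ, (shiftFunctor C n).Additive] [Pretriangulated C]
    (τ : Triangle C) (hτ : τ ∈ distTriang C) (h₁ : IsCompactObj.{u} τ.obj₁)
    (h₂ : IsCompactObj.{u} τ.obj₂) : IsCompactObj.{u} τ.obj₃ := by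
  classical
  intro ι N c hc f
  -- The projections of the coproduct onto its summands, available from the universal property
  -- because zero maps exist.
  let π (i : ι) : c.pt ⟶ N i := Limits.Cofan.IsColimit.desc hc fun j =>
    if h : j = i then eqToHom (by rw [h]) else 0
  have hπ : ∀ i j, c.inj j ≫ π i = if h : j = i then eqToHom (by rw [h]) else 0 :=
    fun i j => Limits.Cofan.IsColimit.fac hc _ _
  obtain ⟨S, g, hg⟩ := h₂ N c hc (τ.mor₂ ≫ f)
  have he : ∀ j ∈ S, c.inj j ≫ ∑ i ∈ S, π i ≫ c.inj i = c.inj j := by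
    intro j hj
    rw [Preadditive.comp_sum, Finset.sum_eq_single j]
    · rw [← Category.assoc, hπ]
      simp
    · intro i _ hij
      rw [← Category.assoc, hπ, dif_neg hij.symm, Limits.zero_comp]
    · exact fun h => (h hj).elim
  -- On the second vertex `f` lives on the summands in `S`, where the truncation to `S` acts as the
  -- identity.
  have h0 : τ.mor₂ ≫ (f - f ≫ ∑ i ∈ S, π i ≫ c.inj i) = 0 := by
    rw [Preadditive.comp_sub, ← Category.assoc, hg, Preadditive.sum_comp, sub_eq_zero]
    refine Finset.sum_congr rfl fun i hi => ?_
    rw [Category.assoc, he i hi]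
  obtain ⟨g', hg'⟩ := Triangle.yoneda_exact₃ τ hτ _ h0
  obtain ⟨S', g'', hg''⟩ := (h₁.shift 1) N c hc g'
  refine ⟨S ∪ S', fun i => (if i ∈ S then f ≫ π i else 0) +
    (if i ∈ S' then τ.mor₃ ≫ g'' i else 0), ?_⟩
  have e1 : ∑ i ∈ S ∪ S', (if i ∈ S then f ≫ π i else 0) ≫ c.inj i = ∑ i ∈ S, (f ≫ π i) ≫ c.inj i := by
    rw [← Finset.sum_subset (Finset.subset_union_left (s₁ := S) (s₂ := S'))]
    · exact Finset.sum_congr rfl fun i hi => by rw [if_pos hi]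
    · intro i _ hi
      rw [if_neg hi, Limits.zero_comp]
  have e2 : ∑ i ∈ S ∪ S', (if i ∈ S' then τ.mor₃ ≫ g'' i else 0) ≫ c.inj i =
      ∑ i ∈ S', (τ.mor₃ ≫ g'' i) ≫ c.inj i := by
    rw [← Finset.sum_subset (Finset.subset_union_right (s₁ := S) (s₂ := S'))]
    · exact Finset.sum_congr rfl fun i hi => by rw [if_pos hi]
    · intro i _ hi
      rw [if_neg hi, Limits.zero_comp]
  simp only [Preadditive.add_comp, Finset.sum_add_distrib]
  rw [e1, e2]
  rw [sub_eq_iff_eq_add] at hg'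
  refine hg'.trans ?_
  rw [hg'', Preadditive.comp_sum, Preadditive.comp_sum, add_comm]
  simp only [Category.assoc]

lemma cone.acyclic_of_isQuasiIso {X Y : DGMod k T} {f : X ⟶ Y} (hf : IsQuasiIso f) (t : T) :
    ((cone f).obj t).Acyclic :=
  coneCplx.acyclic_iff.2 (hf t)

lemma isQuasiIso_id (X : DGMod k T) : IsQuasiIso (𝟙 X) := fun t =>
  inferInstanceAs (QuasiIso (𝟙 (X.obj t)))

/-- The trivial fibration from the cone of the identity to the cone of a trivial fibration. -/
lemma cone.isTrivFib_octU {N N' : DGMod k T} {p : N ⟶ N'} (hp : IsTrivFib p) :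
    IsTrivFib (cone.octU (𝟙 N) p) := by
  constructor
  · intro t
    exact quasiIso_of_acyclic _ (cone.acyclic_of_isQuasiIso (isQuasiIso_id N) t)
      (cone.acyclic_of_isQuasiIso (f := 𝟙 N ≫ p) (by rw [Category.id_comp]; exact hp.1) t)
  · intro t n z
    obtain ⟨y, hy⟩ := hp.2 t n (cone.snd t n z)
    refine ⟨cone.inl rfl (cone.fst rfl z) + cone.inr t n y, ?_⟩
    rw [cone.octU_apply _ _ rfl]
    refine cone.ext rfl ?_ ?_
    · simp
    · simp [hy]

/-- After lifting on `Y`, a lift on the `X`-part must have a prescribed differential, given by the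
lift of `f x`. Such a lift relative to a boundary is the same as a lift of a map from `X⟦1⟧` along
the trivial fibration from the cone of `𝟙 N` to the cone of `p`, and `X⟦1⟧` is cofibrant. -/
lemma IsCofibrant.cone {X Y : DGMod k T} (hX : IsCofibrant X) (hY : IsCofibrant Y) (f : X ⟶ Y) :
    IsCofibrant (cone f) := by
  intro N N' p hp F
  obtain ⟨G, hG⟩ := hY p hp (cone.inrHom f ≫ F)
  have hG' : ∀ (t : T) (n : ℤ) (y : (Y.obj t).X n), ((DGMod.app p t).f n).hom
      (((DGMod.app G t).f n).hom y) = ((DGMod.app F t).f n).hom (cone.inr t n y) := fun t n y =>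
    congrArg (fun φ : Y ⟶ N' => ((DGMod.app φ t).f n).hom y) hG
  -- The first coordinate records the prescribed differential of the lift of `inl x`, the second the
  -- negative of the value to be lifted.
  let a : X⟦(1 : ℤ)⟧ ⟶ DG.cone (𝟙 N ≫ p) := DGMod.homMk
    (fun t n => cone.inl rfl ∘ₗ ((DGMod.app G t).f (n + 1)).hom ∘ₗ ((DGMod.app f t).f (n + 1)).hom ∘ₗ
        shiftOut X rfl t - cone.inr t n ∘ₗ ((DGMod.app F t).f n).hom ∘ₗ cone.inl rfl ∘ₗ shiftOut X rfl t)
    (fun t i j hij x => by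
      subst hij
      refine cone.ext rfl ?_ ?_
      · rw [cone.fst_d rfl rfl]
        simp [shiftOut_d rfl rfl, d_f_apply]
      · rw [cone.snd_d rfl]
        simp [shiftOut_d rfl rfl, d_f_apply, hG', cone.d_inl rfl rfl])
    (fun x y p q n h m e => by
      simp only [LinearMap.sub_apply, LinearMap.comp_apply, map_sub]
      have h1 := (congrArg ((DGMod.app F x).f n).hom (cone.act_inl h rfl rfl
        (shiftOut X rfl y m) e)).symm.trans (DGMod.app_act F h _ e)
      rw [shiftOut_act rfl rfl, DGMod.app_act, DGMod.app_act, cone.act_inl h rfl rfl, cone.act_inr,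
        h1])
  obtain ⟨b, hb⟩ := hX.shift 1 _ (cone.isTrivFib_octU hp) a
  have hb' : ∀ (t : T) (n : ℤ) (x : (X.obj t).X (n + 1)),
      cone.inl rfl (cone.fst (rfl : n + 1 = n + 1) (((DGMod.app b t).f n).hom (shiftIn X rfl t x))) +
        cone.inr t n (((DGMod.app p t).f n).hom (cone.snd t n
          (((DGMod.app b t).f n).hom (shiftIn X rfl t x)))) =
      cone.inl rfl (((DGMod.app G t).f (n + 1)).hom (((DGMod.app f t).f (n + 1)).hom x)) -
        cone.inr t n (((DGMod.app F t).f n).hom (cone.inl rfl x)) := fun t n x => by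
    have h1 := congrArg (fun φ : X⟦(1 : ℤ)⟧ ⟶ DG.cone (𝟙 N ≫ p) =>
      ((DGMod.app φ t).f n).hom (shiftIn X rfl t x)) hb
    refine ((cone.octU_apply (𝟙 N) p rfl _).symm.trans h1).trans ?_
    change cone.inl rfl (((DGMod.app G t).f (n + 1)).hom (((DGMod.app f t).f (n + 1)).hom
      (shiftOut X rfl t (shiftIn X rfl t x)))) - cone.inr t n (((DGMod.app F t).f n).hom
        (cone.inl rfl (shiftOut X rfl t (shiftIn X rfl t x)))) = _
    rw [shiftOut_shiftIn]
  have hb₁ : ∀ (t : T) (n : ℤ) (x : (X.obj t).X (n + 1)), cone.fst (rfl : n + 1 = n + 1)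
      (((DGMod.app b t).f n).hom (shiftIn X rfl t x)) =
        ((DGMod.app G t).f (n + 1)).hom (((DGMod.app f t).f (n + 1)).hom x) := fun t n x => by
    simpa using congrArg (cone.fst rfl) (hb' t n x)
  have hb₂ : ∀ (t : T) (n : ℤ) (x : (X.obj t).X (n + 1)), ((DGMod.app p t).f n).hom (cone.snd t n
      (((DGMod.app b t).f n).hom (shiftIn X rfl t x))) =
        -((DGMod.app F t).f n).hom (cone.inl rfl x) := fun t n x => by
    simpa using congrArg (cone.snd t n) (hb' t n x)
  -- On the `Y`-part the lift is `G`; on the `X`-part it is the negative of the second coordinate of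
  -- `b`, by `hb₂`. The equation `hb₁` makes the two parts compatible with the differential.
  refine ⟨DGMod.homMk (fun t n => ((DGMod.app G t).f n).hom ∘ₗ cone.snd t n -
      cone.snd t n ∘ₗ ((DGMod.app b t).f n).hom ∘ₗ shiftIn X rfl t ∘ₗ cone.fst rfl) ?_ ?_, ?_⟩
  · intro t i j hij x
    subst hij
    simp only [LinearMap.sub_apply, LinearMap.comp_apply, map_sub]
    rw [cone.snd_d rfl, cone.fst_d rfl rfl, map_neg (shiftIn X rfl t)]
    have h1 := shiftIn_d (X := X) (a := 1) (n := i) (n' := i + 1) rfl rfl (t := t) (cone.fst rfl x)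
    rw [Int.negOnePow_one, Units.neg_smul, one_smul, map_neg] at h1
    rw [← h1, ← d_f_apply, cone.snd_d rfl, hb₁]
    simp [d_f_apply]
  · intro x y p q n h m e
    simp only [LinearMap.sub_apply, LinearMap.comp_apply, map_sub]
    rw [cone.fst_act h rfl rfl, cone.snd_act, DGMod.app_act, ← shiftIn_act rfl rfl h, DGMod.app_act,
      cone.snd_act]
  · apply DGMod.hom_ext
    intro t n x
    change ((DGMod.app p t).f n).hom (((DGMod.app G t).f n).hom (cone.snd t n x) -
      cone.snd t n (((DGMod.app b t).f n).hom (shiftIn X rfl t (cone.fst rfl x)))) = _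
    rw [map_sub, hG', hb₂, sub_neg_eq_add, ← map_add, add_comm, cone.total]

/-- Cofibrancy is not invariant under homotopy equivalence, so the third vertex itself need not be
perfect. It is isomorphic to the cone of a representative of the first map, which is cofibrant, and
compactness transfers along the isomorphism. -/
instance : (perf k T).IsTriangulatedClosed₃ where
  ext₃' τ hτ h₁ h₂ := by
    have hc := IsCompactObj.of_distTriang τ hτ h₁.2 h₂.2
    obtain ⟨f, hf⟩ := (toHo k T).map_surjective (X := τ.obj₁.as) (Y := τ.obj₂.as) τ.mor₁
    obtain ⟨e, -⟩ := exists_iso_of_arrow_iso τ (cone.triangleh f) hτ (triangleh_mem f)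
      (Arrow.isoMk (Iso.refl _) (Iso.refl _) (by
        refine (Category.id_comp _).trans (Eq.trans ?_ (Category.comp_id _).symm)
        exact hf))
    let e₃ : τ.obj₃ ≅ (toHo k T).obj (cone f) := Triangle.π₃.mapIso e
    refine ⟨(toHo k T).obj (cone f), ⟨h₁.1.cone h₂.1 f, ?_⟩, ⟨e₃⟩⟩
    intro ι N c hc' F
    obtain ⟨S, g, hg⟩ := hc N c hc' (e₃.hom ≫ F)
    refine ⟨S, fun i => e₃.inv ≫ g i, ?_⟩
    rw [← cancel_epi e₃.hom, hg, Preadditive.comp_sum]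
    simp

instance : (perf k T).IsTriangulated where
  __ := ObjectProperty.IsTriangulatedClosed₂.of_isTriangulatedClosed₃ (P := perf k T)

end

section

open Pretriangulated

/-! ### Dg functors on the homotopy category -/

/-- The closed invertible map `X⟦n⟧ ⟶ X` of degree `n`. -/
def shiftOutHom (X : DGMod k T) (n : ℤ) : DGHom n (X⟦n⟧) X :=
  DGHom.mkLin (fun t _ _ h => shiftOut X h t)
    (fun _ _ _ _ _ _ _ ha hb hc _ m f => shiftOut_act hb hc ha m f)

/-- The closed invertible map `X ⟶ X⟦n⟧` of degree `m = -n`. -/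
def shiftInHom (X : DGMod k T) {n m : ℤ} (h : n + m = 0) : DGHom m X (X⟦n⟧) :=
  DGHom.mkLin (fun t _ _ h' => shiftIn X (by lia) t)
    (fun _ _ _ _ _ _ _ _ _ _ hc' m f => (shiftIn_act (by lia) (by lia) hc' m f).symm)

section Shift

variable {X Y Z : DGMod k T}

lemma shiftInHom_shiftOutHom {n m : ℤ} (h : n + m = 0) :
    (shiftInHom X h).comp (shiftOutHom X n) (by lia) = DGHom.id X :=
  DGHom.ext_apply fun t p q hpq x => by
    obtain rfl : q = p := by lia
    rw [DGHom.comp_apply _ _ _ _ rfl (by lia)]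
    simp [shiftInHom, shiftOutHom]

lemma shiftOutHom_shiftInHom {n m : ℤ} (h : n + m = 0) :
    (shiftOutHom X n).comp (shiftInHom X h) h = DGHom.id (X⟦n⟧) :=
  DGHom.ext_apply fun t p q hpq x => by
    obtain rfl : q = p := by lia
    rw [DGHom.comp_apply _ _ _ _ rfl (by lia)]
    simp [shiftInHom, shiftOutHom]

lemma δ_shiftOutHom {n m : ℤ} (h : n + 1 = m) : (shiftOutHom X n).δ n m = 0 :=
  DGHom.ext_apply fun t p q hpq x => by
    rw [DGHom.δ_apply h _ t rfl rfl]
    simp [shiftOutHom, shiftOut_d (show p + n = _ from rfl) (show p + 1 + n = q by lia), ← h,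
      Int.negOnePow_add, smul_smul]

lemma δ_shiftInHom {n m m' : ℤ} (h : n + m = 0) (hm : m + 1 = m') :
    (shiftInHom X h).δ m m' = 0 :=
  DGHom.ext_apply fun t p q hpq x => by
    rw [DGHom.δ_apply hm _ t rfl rfl]
    have : m.negOnePow = n.negOnePow := by
      rw [Int.negOnePow_eq_iff]; exact ⟨m, by lia⟩
    simp [shiftInHom, shiftIn_d (show p + m + n = p by lia) (show q + n = p + 1 by lia), ← hm,
      Int.negOnePow_add, this]

lemma map_shift_shiftOutHom (f : X ⟶ Y) (n : ℤ) :
    (DGHom.ofHom (f⟦n⟧')).comp (shiftOutHom Y n) (zero_add n) =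
      (shiftOutHom X n).comp (DGHom.ofHom f) (add_zero n) :=
  DGHom.ext_apply fun t p q hpq x => by
    rw [DGHom.comp_apply _ _ _ _ (add_zero p) hpq, DGHom.comp_apply _ _ _ _ hpq (add_zero q)]
    simp [shiftOutHom, shiftOut_map]

lemma hom_ext_shiftOutHom {n : ℤ} {f g : X ⟶ Y⟦n⟧}
    (h : (DGHom.ofHom f).comp (shiftOutHom Y n) (zero_add n) =
      (DGHom.ofHom g).comp (shiftOutHom Y n) (zero_add n)) : f = g := by
  apply DGHom.ofHom_injective
  have := congrArg (fun φ : DGHom n X Y => φ.comp (shiftInHom Y (add_neg_cancel n)) (add_neg_cancel n)) h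
  rwa [DGHom.comp_assoc _ _ _ _ (add_neg_cancel n) _ (add_zero 0),
    DGHom.comp_assoc _ _ _ _ (add_neg_cancel n) _ (add_zero 0), shiftOutHom_shiftInHom,
    DGHom.comp_id, DGHom.comp_id] at this

lemma shiftFunctorZero_inv_app_app (t : T) :
    DGMod.app ((shiftFunctorZero (DGMod k T) ℤ).inv.app X) t =
      (shiftFunctorZero (Cplx k) ℤ).inv.app (X.obj t) := rfl

lemma shiftFunctorAdd_inv_app_app (a b : ℤ) (t : T) :
    DGMod.app ((shiftFunctorAdd (DGMod k T) a b).inv.app X) t =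
      (shiftFunctorAdd (Cplx k) a b).inv.app (X.obj t) := rfl

lemma shiftFunctorZero_inv_shiftOutHom :
    (DGHom.ofHom ((shiftFunctorZero (DGMod k T) ℤ).inv.app X)).comp (shiftOutHom X 0)
      (zero_add 0) = DGHom.id X :=
  DGHom.ext_apply fun t p q hpq x => by
    obtain rfl : q = p := by lia
    rw [DGHom.comp_apply _ _ _ _ (add_zero q) (by lia)]
    rw [DGHom.ofHom_v, shiftFunctorZero_inv_app_app, CochainComplex.shiftFunctorZero_inv_app_f]
    simp [shiftOutHom]
    exact (XIsoOfEq_hom_trans_apply (X.obj t) _ _ x).trans (by simp)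

lemma shiftFunctorAdd_inv_shiftOutHom (a b : ℤ) :
    (DGHom.ofHom ((shiftFunctorAdd (DGMod k T) a b).inv.app X)).comp (shiftOutHom X (a + b))
      (zero_add (a + b)) = (shiftOutHom (X⟦a⟧) b).comp (shiftOutHom X a) (add_comm b a) :=
  DGHom.ext_apply fun t p q hpq x => by
    rw [DGHom.comp_apply _ _ _ _ (add_zero p) hpq,
      DGHom.comp_apply _ _ _ _ rfl (show p + b + a = q by lia)]
    rw [DGHom.ofHom_v, shiftFunctorAdd_inv_app_app, CochainComplex.shiftFunctorAdd_inv_app_f]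
    simp [shiftOutHom]
    exact XIsoOfEq_hom_trans_apply (X.obj t) _ _ x

end Shift

namespace DGFunctor

variable (F : DGFunctor k T)

/-- The action of a dg functor on closed degree `0` maps. -/
def mapHom {X Y : DGMod k T} (f : X ⟶ Y) : F.obj X ⟶ F.obj Y := F.toFunctor.map f

lemma ofHom_mapHom {X Y : DGMod k T} (f : X ⟶ Y) :
    DGHom.ofHom (F.mapHom f) = F.map (DGHom.ofHom f) :=
  DGHom.ofHom_toHom _ (F.map_ofHom_δ f)

lemma mapHom_comp {X Y Z : DGMod k T} (f : X ⟶ Y) (g : Y ⟶ Z) :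
    F.mapHom (f ≫ g) = F.mapHom f ≫ F.mapHom g :=
  F.toFunctor.map_comp f g

lemma mapHom_add {X Y : DGMod k T} (f g : X ⟶ Y) :
    F.mapHom (f + g) = F.mapHom f + F.mapHom g :=
  DGHom.ofHom_injective (by
    rw [F.ofHom_mapHom, _root_.map_add, F.map_add, _root_.map_add, F.ofHom_mapHom, F.ofHom_mapHom])

lemma mapHom_smul {X Y : DGMod k T} (r : k) (f : X ⟶ Y) :
    F.mapHom (r • f) = r • F.mapHom f :=
  DGHom.ofHom_injective (by
    rw [F.ofHom_mapHom, _root_.map_smul, F.map_smul, _root_.map_smul, F.ofHom_mapHom])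

lemma map_zero {X Y : DGMod k T} {n : ℤ} : F.map (0 : DGHom n X Y) = 0 := by
  simpa using F.map_smul (0 : k) (0 : DGHom n X Y)

lemma map_neg {X Y : DGMod k T} {n : ℤ} (φ : DGHom n X Y) : F.map (-φ) = -F.map φ :=
  eq_neg_of_add_eq_zero_left (by rw [← F.map_add, neg_add_cancel, F.map_zero])

/-- The shift `X⟦n⟧` is characterised by a closed invertible map to `X` of degree `n`. A dg functor
preserves such a map, so both sides are shifts of `F.obj X`. -/
def shiftIso (n : ℤ) (X : DGMod k T) : F.obj (X⟦n⟧) ≅ (F.obj X)⟦n⟧ where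
  hom := ((F.map (shiftOutHom X n)).comp (shiftInHom (F.obj X) (add_neg_cancel n))
    (add_neg_cancel n)).toHom (by
      rw [DGHom.δ_comp _ _ _ rfl rfl (zero_add 1), δ_shiftInHom _ rfl, ← F.map_δ rfl,
        δ_shiftOutHom rfl, F.map_zero, DGHom.zero_comp, DGHom.comp_zero, smul_zero, add_zero])
  inv := ((shiftOutHom (F.obj X) n).comp (F.map (shiftInHom X (add_neg_cancel n)))
    (add_neg_cancel n)).toHom (by
      rw [DGHom.δ_comp _ _ _ rfl rfl (zero_add 1), δ_shiftOutHom rfl, ← F.map_δ rfl,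
        δ_shiftInHom _ rfl, F.map_zero, DGHom.zero_comp, DGHom.comp_zero, smul_zero, add_zero])
  hom_inv_id := DGHom.ofHom_injective (by
    rw [DGHom.ofHom_comp, DGHom.ofHom_toHom, DGHom.ofHom_toHom, DGHom.comp_assoc _ _ _ _
      (show -n + 0 = -n by lia) _ (by lia), ← DGHom.comp_assoc _ _ _ (neg_add_cancel n) _ (zero_add (-n)),
      shiftInHom_shiftOutHom, DGHom.id_comp, ← F.map_comp, shiftOutHom_shiftInHom, F.map_id]
    rfl)
  inv_hom_id := DGHom.ofHom_injective (by
    rw [DGHom.ofHom_comp, DGHom.ofHom_toHom, DGHom.ofHom_toHom, DGHom.comp_assoc _ _ _ _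
      (show -n + 0 = -n by lia) _ (by lia), ← DGHom.comp_assoc _ _ _ (neg_add_cancel n) _ (zero_add (-n)),
      ← F.map_comp, shiftInHom_shiftOutHom, F.map_id, DGHom.id_comp, shiftOutHom_shiftInHom]
    rfl)

/-- This equation determines the isomorphism, by `hom_ext_shiftOutHom`. Naturality and the coherence
for zero and sums of shifts are all deduced from it. -/
lemma shiftIso_hom_shiftOutHom (n : ℤ) (X : DGMod k T) :
    (DGHom.ofHom (F.shiftIso n X).hom).comp (shiftOutHom (F.obj X) n) (zero_add n) =
      F.map (shiftOutHom X n) := by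
  rw [shiftIso, DGHom.ofHom_toHom, DGHom.comp_assoc _ _ _ _ (neg_add_cancel n) _ (add_zero n),
    shiftInHom_shiftOutHom, DGHom.comp_id]

lemma shiftIso_naturality (n : ℤ) {X Y : DGMod k T} (f : X ⟶ Y) :
    F.mapHom (f⟦n⟧') ≫ (F.shiftIso n Y).hom = (F.shiftIso n X).hom ≫ (F.mapHom f)⟦n⟧' := by
  apply hom_ext_shiftOutHom
  rw [DGHom.ofHom_comp, DGHom.ofHom_comp, DGHom.comp_assoc _ _ _ _ (zero_add n) _ (zero_add n),
    DGHom.comp_assoc _ _ _ _ (zero_add n) _ (zero_add n), map_shift_shiftOutHom,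
    ← DGHom.comp_assoc _ _ _ (zero_add n) _ (add_zero n), shiftIso_hom_shiftOutHom,
    shiftIso_hom_shiftOutHom, F.ofHom_mapHom, F.ofHom_mapHom, ← F.map_comp, ← F.map_comp,
    map_shift_shiftOutHom]

lemma shiftIso_zero (X : DGMod k T) : (F.shiftIso 0 X).hom =
    F.mapHom ((shiftFunctorZero (DGMod k T) ℤ).hom.app X) ≫
      (shiftFunctorZero (DGMod k T) ℤ).inv.app (F.obj X) := by
  apply hom_ext_shiftOutHom
  rw [shiftIso_hom_shiftOutHom, DGHom.ofHom_comp,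
    DGHom.comp_assoc _ _ _ _ (zero_add 0) _ (zero_add 0), shiftFunctorZero_inv_shiftOutHom,
    F.ofHom_mapHom]
  refine Eq.trans ?_ (DGHom.comp_id _).symm
  refine congrArg F.map ?_
  refine Eq.trans ?_ (DGHom.comp_id _)
  rw [← shiftFunctorZero_inv_shiftOutHom,
    ← DGHom.comp_assoc _ _ _ (zero_add 0) _ (zero_add 0), ← DGHom.ofHom_comp, Iso.hom_inv_id_app,
    DGHom.ofHom_id]
  exact (DGHom.id_comp _).symm

lemma shiftIso_add (a b : ℤ) (X : DGMod k T) : (F.shiftIso (a + b) X).hom =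
    F.mapHom ((shiftFunctorAdd (DGMod k T) a b).hom.app X) ≫ (F.shiftIso b (X⟦a⟧)).hom ≫
      (F.shiftIso a X).hom⟦b⟧' ≫ (shiftFunctorAdd (DGMod k T) a b).inv.app (F.obj X) := by
  apply hom_ext_shiftOutHom
  rw [shiftIso_hom_shiftOutHom, DGHom.ofHom_comp, DGHom.ofHom_comp, DGHom.ofHom_comp,
    DGHom.comp_assoc _ _ _ _ (zero_add _) _ (zero_add _),
    DGHom.comp_assoc _ _ _ _ (zero_add _) _ (zero_add _),
    DGHom.comp_assoc _ _ _ _ (zero_add _) _ (zero_add _),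
    shiftFunctorAdd_inv_shiftOutHom, ← DGHom.comp_assoc _ _ _ (zero_add b) _ (add_comm b a),
    map_shift_shiftOutHom, DGHom.comp_assoc _ _ _ _ (zero_add a) _ (add_comm b a),
    shiftIso_hom_shiftOutHom, ← DGHom.comp_assoc _ _ _ (zero_add b) _ (add_comm b a),
    shiftIso_hom_shiftOutHom, ← F.map_comp, F.ofHom_mapHom, ← F.map_comp]
  congr 1
  rw [← shiftFunctorAdd_inv_shiftOutHom, ← DGHom.comp_assoc _ _ _ (zero_add 0) _ (zero_add (a + b)),
    ← DGHom.ofHom_comp, Iso.hom_inv_id_app, DGHom.ofHom_id, DGHom.id_comp]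

instance : F.toFunctor.CommShift ℤ where
  commShiftIso n := NatIso.ofComponents (F.shiftIso n) (F.shiftIso_naturality n)
  commShiftIso_zero := by
    ext X
    refine (F.shiftIso_zero X).trans ?_
    rw [Functor.CommShift.isoZero_hom_app]
    rfl
  commShiftIso_add a b := by
    ext X
    refine (F.shiftIso_add a b X).trans ?_
    rw [Functor.CommShift.isoAdd_hom_app]
    rfl

instance : F.onHo.CommShift ℤ :=
  inferInstanceAs ((CategoryTheory.Quotient.lift _ (F.toFunctor ⋙ toHo k T) fun _ _ f g h =>
    CategoryTheory.Quotient.sound _ (F.homotopic_map f g h)).CommShift ℤ)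

/-- The connecting map of a cone is, up to sign, its degree `1` projection followed by the
relabelling into the shift. Stated this way, the relation is visibly preserved by `F`. -/
lemma fst_of_coneData {X Y Z : DGMod k T} {f : X ⟶ Y} {g : Y ⟶ Z} {h : Z ⟶ X⟦(1 : ℤ)⟧}
    (D : ConeData f g h) :
    (DGHom.ofHom (F.mapHom h ≫ (F.shiftIso 1 X).hom)).comp
        (shiftOutHom (F.obj X) 1) (zero_add 1) = -F.map D.fst := by
  have h1 : (DGHom.ofHom h).comp (shiftOutHom X 1) (zero_add 1) = -D.fst :=
    DGHom.ext_apply fun t p q hpq x => by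
      rw [DGHom.comp_apply _ _ _ _ (add_zero p) hpq, DGHom.ofHom_v]
      exact D.h_eq t p q hpq x
  rw [DGHom.ofHom_comp, DGHom.comp_assoc _ _ _ _ (zero_add 1) _ (zero_add 1),
    shiftIso_hom_shiftOutHom, F.ofHom_mapHom, ← F.map_comp, h1, F.map_neg]

/-- Dg functors preserve cones. -/
def coneData {X Y Z : DGMod k T} {f : X ⟶ Y} {g : Y ⟶ Z} {h : Z ⟶ X⟦(1 : ℤ)⟧} (D : ConeData f g h) :
    ConeData (F.mapHom f) (F.mapHom g) (F.mapHom h ≫ (F.shiftIso 1 X).hom) where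
  inl := F.map D.inl
  fst := F.map D.fst
  snd := F.map D.snd
  inl_fst := by rw [← F.map_comp, D.inl_fst, F.map_id]
  inl_snd := by rw [← F.map_comp, D.inl_snd, F.map_zero]
  inr_fst := by rw [F.ofHom_mapHom, ← F.map_comp, D.inr_fst, F.map_zero]
  inr_snd := by rw [F.ofHom_mapHom, ← F.map_comp, D.inr_snd, F.map_id]
  total := by rw [F.ofHom_mapHom, ← F.map_comp, ← F.map_comp, ← F.map_add, D.total, F.map_id]
  δ_inl := by rw [← F.map_δ (by lia), D.δ_inl, ← F.mapHom_comp, F.ofHom_mapHom]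
  δ_fst := by rw [← F.map_δ (by lia), D.δ_fst, F.map_zero]
  δ_snd := by rw [← F.map_δ (by lia), D.δ_snd, F.map_neg, F.map_comp, F.ofHom_mapHom]
  h_eq t n m hm z := by
    have h3 := congrArg (fun φ : DGHom 1 (F.obj Z) (F.obj X) => ((φ.1 t).v n m hm).hom z)
      (F.fst_of_coneData D)
    rw [DGHom.comp_apply _ _ _ _ (add_zero n) hm] at h3
    exact h3

instance : F.onHo.Additive where
  map_add {X Y f g} := by
    obtain ⟨f, rfl⟩ := (toHo k T).map_surjective (X := X.as) (Y := Y.as) f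
    obtain ⟨g, rfl⟩ := (toHo k T).map_surjective (X := X.as) (Y := Y.as) g
    exact (congrArg (fun a => (toHo k T).map a) (F.mapHom_add f g)).trans ((toHo k T).map_add)

instance : F.onHo.Linear k where
  map_smul {X Y} f r := by
    obtain ⟨f, rfl⟩ := (toHo k T).map_surjective (X := X.as) (Y := Y.as) f
    exact (congrArg (fun a => (toHo k T).map a) (F.mapHom_smul r f)).trans ((toHo k T).map_smul r _)

instance : F.onHo.IsTriangulated where
  map_distinguished τ hτ := by
    obtain ⟨X, Y, f, ⟨e⟩⟩ := (mem_coneTriangles_iff _).1 hτ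
    -- The image of a standard cone need not be a standard cone, but it carries the abstract cone
    -- data, which is all that the definition of the triangles asks for.
    exact ⟨F.obj X, F.obj Y, F.obj (cone f), _, _, _, ⟨F.coneData (cone.data f)⟩,
      ⟨F.onHo.mapTriangle.mapIso e ≪≫
        (Functor.mapTriangleCompIso (toHo k T) F.onHo).symm.app (cone.triangle f) ≪≫
        (Functor.mapTriangleIso (CategoryTheory.Quotient.lift.isLift _ (F.toFunctor ⋙ toHo k T)
          fun _ _ f g h => CategoryTheory.Quotient.sound _ (F.homotopic_map f g h))).app
            (cone.triangle f) ≪≫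
        (Functor.mapTriangleCompIso F.toFunctor (toHo k T)).app (cone.triangle f)⟩⟩

end DGFunctor

end

section

open Pretriangulated

/-! ### Cofibrant modules in the homotopy category -/

variable (k T) in
/-- The cofibrant modules. -/
def cof : ObjectProperty (HoMod k T) := fun X => IsCofibrant X.as

lemma perf_le_cof : perf k T ≤ cof k T := fun _ h => h.1

instance : (cof k T).IsStableUnderShift ℤ where
  isStableUnderShiftBy n :=
    { le_shift := fun X hX => by
        have : (X⟦n⟧).as = X.as⟦n⟧ :=
          congrArg Quotient.as (Quotient.functor_obj_shift (homotopic (k := k) (T := T)) ℤ X.as n)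
        change IsCofibrant (X⟦n⟧).as
        rw [this]
        exact hX.shift n }

/-- Both sides are acyclic, and the projection of a cone onto its first coordinate is surjective. -/
lemma cone.isTrivFib_toShift (A : DGMod k T) (hA : ∀ t, (A.obj t).Acyclic) :
    IsTrivFib (cone.toShift (𝟙 A)) := by
  refine ⟨fun t => quasiIso_of_acyclic _ (cone.acyclic_of_isQuasiIso (isQuasiIso_id A) t) ?_,
    fun t n z => ⟨-cone.inl rfl (shiftOut A rfl t z), ?_⟩⟩
  · rw [acyclic_iff_elements]
    intro i j l hij hjl z hz
    have hz' := congrArg (shiftOut A (show l + 1 = l + 1 from rfl) t) hz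
    rw [shiftOut_d (show j + 1 = j + 1 from rfl), map_zero] at hz'
    obtain ⟨w, hw⟩ := (acyclic_iff_elements _).1 (hA t) (i := i + 1) (j := j + 1) (l := l + 1)
      (by lia) (by lia) (shiftOut A rfl t z) (by simpa using hz')
    refine ⟨-shiftIn A rfl t w, shiftOut_injective (show j + 1 = j + 1 from rfl) ?_⟩
    rw [map_neg, map_neg, shiftOut_d (show i + 1 = i + 1 from rfl), shiftOut_shiftIn, hw]
    simp
  · rw [cone.toShift_apply _ rfl]
    simp

/-- By cofibrancy the map lifts to the cone of the identity of `A`, which is contractible. -/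
lemma toHo_map_shift_eq_zero_of_acyclic {X A : DGMod k T} (hX : IsCofibrant X)
    (hA : ∀ t, (A.obj t).Acyclic) (f : X ⟶ A⟦(1 : ℤ)⟧) : (toHo k T).map f = 0 := by
  obtain ⟨g, rfl⟩ := hX _ (cone.isTrivFib_toShift A hA) f
  rw [(toHo k T).map_comp, (cone.isZero_id A).eq_of_tgt ((toHo k T).map g) 0, Limits.zero_comp]

lemma toHo_map_eq_zero_of_acyclic {X A : DGMod k T} (hX : IsCofibrant X)
    (hA : ∀ t, (A.obj t).Acyclic) (f : X ⟶ A) : (toHo k T).map f = 0 := by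
  apply (shiftFunctor (HoMod k T) (1 : ℤ)).map_injective
  rw [← cancel_epi (((toHo k T).commShiftIso (1 : ℤ)).hom.app X),
    ← (toHo k T).commShiftIso_hom_naturality f (1 : ℤ),
    toHo_map_shift_eq_zero_of_acyclic (hX.shift 1) hA, Limits.zero_comp]
  refine Eq.trans ?_ (congrArg _ (Functor.map_zero _ _ _).symm)
  exact Limits.comp_zero.symm

lemma cof.hom_eq_zero {X A : HoMod k T} (hX : cof k T X) (hA : ∀ t, (A.as.obj t).Acyclic)
    (f : X ⟶ A) : f = 0 := by
  obtain ⟨f, rfl⟩ := (toHo k T).map_surjective (X := X.as) (Y := A.as) f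
  exact toHo_map_eq_zero_of_acyclic hX hA f

/-- Maps from a cofibrant module in the homotopy category only depend on the target up to
quasi-isomorphism. -/
lemma cof.comp_bijective {X : HoMod k T} (hX : cof k T X) {M N : DGMod k T} {p : M ⟶ N}
    (hp : IsQuasiIso p) :
    Function.Bijective fun f : X ⟶ (toHo k T).obj M => f ≫ (toHo k T).map p := by
  have hC : ∀ t, ((cone p).obj t).Acyclic := cone.acyclic_of_isQuasiIso hp
  constructor
  · intro f g hfg
    have h1 : (f - g) ≫ (toHo k T).map p = 0 := by
      rw [Preadditive.sub_comp]
      exact sub_eq_zero.2 hfg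
    have h2 : (f - g)⟦(1 : ℤ)⟧' ≫ ((toHo k T).map p)⟦(1 : ℤ)⟧' = 0 := by
      rw [← CategoryTheory.Functor.map_comp, h1, Functor.map_zero]
    -- After a shift, a map killed by `p` factors through the cone of `p`. That cone is acyclic, so
    -- it receives only zero from a cofibrant module.
    obtain ⟨h, hh⟩ := Triangle.coyoneda_exact₁ (cone.triangleh p) (triangleh_mem p) _ h2
    rw [cof.hom_eq_zero ((cof k T).le_shift (1 : ℤ) X hX) hC h] at hh
    have h3 : (f - g)⟦(1 : ℤ)⟧' = (0 : X ⟶ _)⟦(1 : ℤ)⟧' :=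
      hh.trans (Limits.zero_comp.trans (Functor.map_zero _ _ _).symm)
    exact sub_eq_zero.1 ((shiftFunctor (HoMod k T) (1 : ℤ)).map_injective h3)
  · intro g
    obtain ⟨f, hf⟩ := Triangle.coyoneda_exact₂ (cone.triangleh p) (triangleh_mem p) g
      (cof.hom_eq_zero hX hC _)
    exact ⟨f, hf.symm⟩

/-- Whitehead's theorem, by the Yoneda argument: surjectivity of composition with `p` on maps from
`N` gives a right inverse, and injectivity on maps from `M` shows that it is also a left inverse. -/
lemma isIso_toHo_map_of_isQuasiIso {M N : DGMod k T} {p : M ⟶ N} (hp : IsQuasiIso p)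
    (hM : IsCofibrant M) (hN : IsCofibrant N) : IsIso ((toHo k T).map p) := by
  have hM' : cof k T ((toHo k T).obj M) := hM
  have hN' : cof k T ((toHo k T).obj N) := hN
  obtain ⟨q, hq⟩ := (hN'.comp_bijective hp).2 (𝟙 _)
  refine ⟨q, (hM'.comp_bijective hp).1 ?_, hq⟩
  change (_ ≫ q) ≫ _ = 𝟙 _ ≫ _
  rw [Category.assoc, Category.id_comp]
  exact (congrArg _ hq).trans (Category.comp_id _)

end

/-! ### Hom complexes over `k` -/

lemma negOnePow_congr {a b : ℤ} (c : ℤ) (h : a = b + 2 * c) : a.negOnePow = b.negOnePow := by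
  rw [h, Int.negOnePow_add, Int.negOnePow_even (2 * c) (even_two_mul c), mul_one]

/-- The complex of `k`-linear maps. -/
def homC (X K : Cplx k) : Cplx k where
  X n := ModuleCat.of k (Cochain X K n)
  d i j := ModuleCat.ofHom (δ_hom k X K i j)
  shape i j h := ModuleCat.hom_ext (LinearMap.ext fun z => δ_shape i j h z)
  d_comp_d' i j l _ _ := ModuleCat.hom_ext (LinearMap.ext fun z => δ_δ i j l z)

namespace homC

variable {X Y K L : Cplx k} {n : ℤ}

/-- Evaluation of a homogeneous map. -/
def ev {p q : ℤ} (h : p + n = q) : (homC X K).X n →ₗ[k] X.X p →ₗ[k] K.X q where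
  toFun φ := (Cochain.v (F := X) (G := K) φ p q h).hom
  map_add' _ _ := rfl
  map_smul' _ _ := rfl

def mk (φ : ∀ p q : ℤ, p + n = q → (X.X p →ₗ[k] K.X q)) : (homC X K).X n :=
  (Cochain.mk fun p q h => ModuleCat.ofHom (φ p q h) : Cochain X K n)

@[simp] lemma ev_mk (φ : ∀ p q : ℤ, p + n = q → (X.X p →ₗ[k] K.X q)) {p q : ℤ} (h : p + n = q) :
    ev h (mk φ) = φ p q h := rfl

lemma ext {φ ψ : (homC X K).X n} (H : ∀ (p q : ℤ) (h : p + n = q) (x : X.X p),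
    ev h φ x = ev h ψ x) : φ = ψ := by
  refine Cochain.ext (F := X) (G := K) _ _ fun p q h => ?_
  exact ModuleCat.hom_ext (LinearMap.ext (H p q h))

lemma ev_d {n' : ℤ} (hn : n + 1 = n') (φ : (homC X K).X n) {p p' q q' : ℤ} (hp : p + 1 = p')
    (hq : p + n = q) (hq' : p + n' = q') (x : X.X p) :
    ev hq' (((homC X K).d n n').hom φ) x = (K.d q q').hom (ev hq φ x) +
      n'.negOnePow • ev (show p' + n = q' by lia) φ ((X.d p p').hom x) := by
  have h := δ_v n n' hn (F := X) (G := K) φ p q' hq' q p' (by lia) hp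
  refine (LinearMap.congr_fun (congrArg ModuleCat.Hom.hom h) x).trans ?_
  simp
  rfl

/-- Postcomposition, in one degree. -/
def postcomp (p : K ⟶ L) (n : ℤ) : (homC X K).X n →ₗ[k] (homC X L).X n where
  toFun φ := mk fun i j h => (p.f j).hom ∘ₗ ev h φ
  map_add' φ ψ := ext fun i j h x => by simp
  map_smul' r φ := ext fun i j h x => by simp

@[simp] lemma ev_postcomp (p : K ⟶ L) (φ : (homC X K).X n) {i j : ℤ} (h : i + n = j) (x : X.X i) :
    ev h (postcomp p n φ) x = (p.f j).hom (ev h φ x) := rfl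

variable (X) in
/-- Postcomposition. -/
def map (p : K ⟶ L) : homC X K ⟶ homC X L where
  f n := ModuleCat.ofHom (postcomp p n)
  comm' i j hij := ModuleCat.hom_ext (LinearMap.ext fun φ => ext fun a b h x => by
    have hij' : i + 1 = j := hij
    change ev h (((homC X L).d i j).hom (postcomp p i φ)) x =
      (p.f b).hom (ev h (((homC X K).d i j).hom φ) x)
    rw [ev_d hij' _ rfl rfl h, ev_d hij' _ rfl rfl h]
    simp [d_f_apply])

@[simp] lemma ev_map (p : K ⟶ L) (φ : (homC X K).X n) {i j : ℤ} (h : i + n = j) (x : X.X i) :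
    ev h (((map X p).f n).hom φ) x = (p.f j).hom (ev h φ x) := rfl

/-- The isomorphism `Hom(X, Hom(Y, K)) ≅ Hom(Y, Hom(X, K))` on elements. -/
def swap (φ : (homC X (homC Y K)).X n) : (homC Y (homC X K)).X n :=
  mk fun p q h =>
    { toFun := fun y => mk fun i j hij => (i * p).negOnePow •
        ((ev (show p + (i + n) = j by lia)).flip y ∘ₗ ev (show i + n = i + n from rfl) φ)
      map_add' := fun y y' => ext fun i j hij x => by simp [smul_add]
      map_smul' := fun r y => ext fun i j hij x => by
        simp only [ev_mk, LinearMap.smul_apply, LinearMap.comp_apply, LinearMap.flip_apply,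
          map_smul, RingHom.id_apply]
        exact smul_comm _ _ _ }

lemma ev_swap (φ : (homC X (homC Y K)).X n) {p q i j a : ℤ} (h : p + n = q) (hij : i + q = j)
    (ha : i + n = a) (ha' : p + a = j) (y : Y.X p) (x : X.X i) :
    ev hij (ev h (swap φ) y) x = (i * p).negOnePow • ev ha' (ev ha φ x) y := by
  subst ha
  rfl

lemma swap_swap (φ : (homC X (homC Y K)).X n) : swap (swap φ) = φ :=
  ext fun i j hij x => ext fun p q hpq y => by
    rw [ev_swap _ hij hpq rfl (by lia), ev_swap _ rfl _ hij hpq, smul_smul, mul_comm p i,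
      Int.units_mul_self, one_smul]

/-- The Koszul sign `(-1)^(|x||y|)` in `swap` is what makes the exchange of the two arguments
commute with the differentials. -/
lemma swap_d {n' : ℤ} (hn : n + 1 = n') (φ : (homC X (homC Y K)).X n) :
    swap (((homC X (homC Y K)).d n n').hom φ) = ((homC Y (homC X K)).d n n').hom (swap φ) :=
  ext fun p q hpq y => ext fun i j hij x => by
    rw [ev_swap _ hpq hij rfl (by lia), ev_d hn _ rfl rfl hpq, ev_d hn _ rfl rfl rfl]
    simp only [map_add, LinearMap.add_apply, LinearMap.map_smul_of_tower, LinearMap.smul_apply]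
    rw [ev_d (X := Y) (n := i + n) (by lia) _ rfl (q := j - 1) (by lia) (by lia),
      ev_d (X := X) (n := p + n) (by lia) _ rfl (q := j - 1) (by lia) (by lia),
      ev_swap _ rfl _ rfl (by lia), ev_swap (i := i) (a := i + n) _ _ _ rfl (by lia),
      ev_swap (i := i + 1) (a := i + n') _ _ _ (by lia) (by lia)]
    simp only [smul_add, smul_smul, LinearMap.map_smul_of_tower, ← Int.negOnePow_add]
    rw [negOnePow_congr 0 (show i * p + (i + n') = n' + i * (p + 1) + 2 * 0 by ring),
      negOnePow_congr p (show q + (i + 1) * p = i * p + n' + 2 * p by rw [← hpq]; ring)]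
    exact add_right_comm _ _ _

lemma swap_map (p : K ⟶ L) (φ : (homC X (homC Y K)).X n) :
    swap (((map X (map Y p)).f n).hom φ) = ((map Y (map X p)).f n).hom (swap φ) :=
  ext fun i j hij y => ext fun a b hab x => by
    rw [ev_swap _ hij hab rfl (by lia)]
    simp only [ev_map]
    rw [ev_swap _ hij hab rfl (by lia), LinearMap.map_smul_of_tower]

/-- A lifting problem for one order of the variables is carried by `swap` to one for the other
order. This matters because in the flatness argument only one of the two variables is cofibrant, and
it is the inner one. -/
lemma isTrivFib_map_map {p : K ⟶ L} (h : IsTrivFibCplx (map X (map Y p))) :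
    IsTrivFibCplx (map Y (map X p)) := by
  rw [isTrivFibCplx_iff] at h ⊢
  intro i j l hij hjl y z hz hzy
  obtain ⟨x, hx, hx'⟩ := h hij hjl (swap y) (swap z)
    (by
      rw [← swap_d hjl, hz]
      exact ext fun _ _ hpq _ => ext fun _ _ hij _ => by
        rw [ev_swap _ hpq hij rfl (by lia)]; simp)
    (by rw [← swap_map, hzy, swap_d hij])
  refine ⟨swap x, ?_, ?_⟩
  · rw [← swap_d hij, hx, swap_swap]
  · rw [← swap_map, hx', swap_swap]

end homC

/-- The cofibrant complexes of the projective model structure. -/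
def IsCofCplx (X : Cplx k) : Prop :=
  ∀ ⦃K L : Cplx k⦄ (p : K ⟶ L), IsTrivFibCplx p → ∀ f : X ⟶ L, ∃ g : X ⟶ K, g ≫ p = f

namespace coneCplx

variable {K L : Cplx k}

def ofIdLin (p : K ⟶ L) (n : ℤ) : (coneCplx (𝟙 K)).X n →ₗ[k] (coneCplx p).X n :=
  inl rfl ∘ₗ fst rfl + inr n ∘ₗ (p.f n).hom ∘ₗ snd n

lemma fst_ofIdLin (p : K ⟶ L) {n m : ℤ} (h : n + 1 = m) (z : (coneCplx (𝟙 K)).X n) :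
    fst h (ofIdLin p n z) = fst h z := by
  subst h; simp [ofIdLin]

lemma snd_ofIdLin (p : K ⟶ L) (n : ℤ) (z : (coneCplx (𝟙 K)).X n) :
    snd n (ofIdLin p n z) = (p.f n).hom (snd n z) := by
  simp [ofIdLin]

/-- The map from the cone of the identity of `K` to the cone of `p : K ⟶ L`. -/
def ofId (p : K ⟶ L) : coneCplx (𝟙 K) ⟶ coneCplx p where
  f n := ModuleCat.ofHom (ofIdLin p n)
  comm' i j hij := ModuleCat.hom_ext (LinearMap.ext fun z => by
    obtain rfl : i + 1 = j := hij
    change ((coneCplx p).d i (i + 1)).hom (ofIdLin p i z) =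
      ofIdLin p (i + 1) (((coneCplx (𝟙 K)).d i (i + 1)).hom z)
    refine ext rfl ?_ ?_
    · rw [fst_d rfl rfl, fst_ofIdLin, fst_ofIdLin, fst_d rfl rfl]
    · rw [snd_d rfl, snd_ofIdLin, snd_ofIdLin, fst_ofIdLin, snd_d rfl, map_add, d_f_apply]
      rfl)

lemma fst_ofId (p : K ⟶ L) {n m : ℤ} (h : n + 1 = m) (z : (coneCplx (𝟙 K)).X n) :
    fst h (((ofId p).f n).hom z) = fst h z := fst_ofIdLin p h z

lemma snd_ofId (p : K ⟶ L) (n : ℤ) (z : (coneCplx (𝟙 K)).X n) :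
    snd n (((ofId p).f n).hom z) = (p.f n).hom (snd n z) := snd_ofIdLin p n z

/-- The cone of an identity is acyclic, as is the cone of the quasi-isomorphism `p`, and
surjectivity is inherited from `p`. -/
lemma isTrivFib_ofId {p : K ⟶ L} (hp : IsTrivFibCplx p) : IsTrivFibCplx (ofId p) := by
  refine ⟨quasiIso_of_acyclic _ (acyclic_iff.2 inferInstance) (acyclic_iff.2 hp.1), fun n z => ?_⟩
  obtain ⟨y, hy⟩ := hp.2 n (snd n z)
  exact ⟨inl rfl (fst rfl z) + inr n y, ext rfl (by rw [fst_ofId]; simp)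
    (by rw [snd_ofId]; simp [hy])⟩

end coneCplx

lemma shift_d_apply (K : Cplx k) (a i j : ℤ) (z : K.X (i + a)) :
    ((K⟦a⟧).d i j).hom z = a.negOnePow • (K.d (i + a) (j + a)).hom z := by
  rw [CochainComplex.shiftFunctor_obj_d']
  rcases Int.units_eq_one_or a.negOnePow with h | h <;> rw [h] <;> simp <;> rfl

/-- Maps out of a cofibrant complex preserve trivial fibrations. -/
lemma IsCofCplx.isTrivFib_map {X K L : Cplx k} (hX : IsCofCplx X) {p : K ⟶ L}
    (hp : IsTrivFibCplx p) : IsTrivFibCplx (homC.map X p) := by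
  rw [isTrivFibCplx_iff]
  intro a b c hab hbc y z hz hzy
  subst hab hbc
  -- Lifting `y` to a map with differential `z` is turned into an ordinary lifting problem: the pair
  -- `(-z, y)` is a chain map from `X` to the `a`-fold shift of the cone of `p`, to be lifted to the
  -- cone of the identity of `K`.
  let F (n : ℤ) : X.X n →ₗ[k] (coneCplx p).X (n + a) :=
    -(coneCplx.inl (f := p) (add_assoc n a 1) ∘ₗ homC.ev rfl z) +
      coneCplx.inr (f := p) (n + a) ∘ₗ homC.ev rfl y
  have hF₁ (n m : ℤ) (h : n + a + 1 = m) (x : X.X n) : coneCplx.fst h (F n x) =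
      -homC.ev (by lia) z x := by
    obtain rfl : m = n + (a + 1) := by lia
    simp [F]
  have hF₂ (n : ℤ) (x : X.X n) : coneCplx.snd (n + a) (F n x) = homC.ev rfl y x := by
    simp [F]
  have hz' (i j l m : ℤ) (hi : i + 1 = j) (hj : i + a + 1 = l) (hm : l + 1 = m) (x : X.X i) :
      (K.d l m).hom (homC.ev (by lia) z x) =
        (a + 1).negOnePow • homC.ev (by lia) z ((X.d i j).hom x) := by
    have := homC.ev_d rfl z hi (show i + (a + 1) = l by lia) (show i + (a + 1 + 1) = m by lia) x
    rw [hz, map_zero, LinearMap.zero_apply] at this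
    rw [eq_neg_of_add_eq_zero_left this.symm, Int.negOnePow_succ (a + 1), Units.neg_smul,
      neg_neg]
  have hy' (i j l : ℤ) (hi : i + 1 = j) (hj : i + a + 1 = l) (x : X.X i) :
      (p.f l).hom (homC.ev (by lia) z x) = (L.d (i + a) l).hom (homC.ev rfl y x) +
        (a + 1).negOnePow • homC.ev (by lia) y ((X.d i j).hom x) := by
    rw [← homC.ev_d rfl y hi rfl (by lia), ← hzy]
    rfl
  obtain ⟨G, hG⟩ := hX _ ((coneCplx.isTrivFib_ofId hp).shift a)
    { f := fun n => ModuleCat.ofHom (F n)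
      comm' := fun i j hij => ModuleCat.hom_ext (LinearMap.ext fun x => by
        obtain rfl : i + 1 = j := hij
        refine (shift_d_apply (coneCplx p) a i (i + 1) (F i x)).trans ?_
        change _ = F (i + 1) ((X.d i (i + 1)).hom x)
        refine coneCplx.ext rfl ?_ ?_
        · rw [LinearMap.map_smul_of_tower, coneCplx.fst_d (j := i + 1 + a) (by lia) rfl, hF₁, hF₁,
            map_neg, neg_neg, hz' i (i + 1) _ _ rfl (by lia) rfl, smul_smul, Int.negOnePow_succ,
            mul_neg, Int.units_mul_self, Units.neg_smul, one_smul]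
        · rw [LinearMap.map_smul_of_tower, coneCplx.snd_d (by lia), hF₁, hF₂, hF₂, map_neg,
            hy' i (i + 1) _ rfl (by lia), Int.negOnePow_succ, neg_add, Units.neg_smul, neg_neg,
            neg_add_cancel_comm, smul_smul, Int.units_mul_self, one_smul]) }
  let g (n : ℤ) : X.X n →ₗ[k] (coneCplx (𝟙 K)).X (n + a) := (G.f n).hom
  have hg (n : ℤ) (x : X.X n) : ((coneCplx.ofId p).f (n + a)).hom (g n x) = F n x :=
    LinearMap.congr_fun (congrArg ModuleCat.Hom.hom (HomologicalComplex.congr_hom hG n)) x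
  have hg₁ (n m : ℤ) (h : n + a + 1 = m) (x : X.X n) : coneCplx.fst h (g n x) =
      -homC.ev (by lia) z x := by
    rw [← hF₁, ← hg, coneCplx.fst_ofId]
  have hg₂ (n : ℤ) (x : X.X n) : (p.f (n + a)).hom (coneCplx.snd (n + a) (g n x)) =
      homC.ev rfl y x := by
    rw [← hF₂, ← hg, coneCplx.snd_ofId]
  have hgd (i : ℤ) (x : X.X i) : a.negOnePow • ((coneCplx (𝟙 K)).d (i + a) (i + 1 + a)).hom (g i x) =
      g (i + 1) ((X.d i (i + 1)).hom x) :=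
    (shift_d_apply (coneCplx (𝟙 K)) a i (i + 1) (g i x)).symm.trans (d_f_apply G i (i + 1) x)
  -- The second coordinate of the lift lies over `y`. That the lift is a chain map forces the
  -- differential of this coordinate to be `z`.
  refine ⟨homC.mk fun i j h => (K.XIsoOfEq h).hom.hom ∘ₗ coneCplx.snd (f := 𝟙 K) (i + a) ∘ₗ g i,
    ?_, ?_⟩
  · refine homC.ext fun i j h x => ?_
    obtain rfl : j = i + 1 + a := by lia
    rw [homC.ev_d rfl _ rfl rfl]
    simp only [homC.ev_mk, LinearMap.comp_apply, ← hgd, LinearMap.map_smul_of_tower]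
    rw [coneCplx.snd_d (by lia), hg₁]
    simp [smul_smul, Int.negOnePow_succ, Int.units_mul_self]
  · refine homC.ext fun i j h x => ?_
    subst h
    rw [homC.ev_map, ← hg₂]
    simp

/-! ### Coinduced modules -/

/-- The action on `Hom(𝒯(s, -), K)`. -/
def coindAct (s : T) (K : Cplx k) {x y : T} {p q n : ℤ} (h : p + q = n) :
    (homC (DGCategory.hom s y) K).X p →ₗ[k] (DGCategory.hom (k := k) x y).X q →ₗ[k]
      (homC (DGCategory.hom s x) K).X n :=
  LinearMap.mk₂ k (fun φ f => homC.mk fun i j hij =>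
      homC.ev (show i + q + p = j by lia) φ ∘ₗ (DGCategory.comp (show i + q = i + q from rfl)).flip f)
    (fun _ _ _ => homC.ext fun _ _ _ _ => by simp) (fun _ _ _ => homC.ext fun _ _ _ _ => by simp)
    (fun _ _ _ => homC.ext fun _ _ _ _ => by simp) (fun _ _ _ => homC.ext fun _ _ _ _ => by simp)

lemma ev_coindAct {s : T} {K : Cplx k} {x y : T} {p q n : ℤ} (h : p + q = n)
    (φ : (homC (DGCategory.hom s y) K).X p) (f : (DGCategory.hom (k := k) x y).X q) {i j a : ℤ}
    (hij : i + n = j) (ha : i + q = a) (ha' : a + p = j) (g : (DGCategory.hom (k := k) s x).X i) :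
    homC.ev hij (coindAct s K h φ f) g = homC.ev ha' φ (DGCategory.comp ha g f) := by
  subst ha; rfl

/-- The right module `t ↦ Hom(𝒯(s, t), K)`. -/
def coind (s : T) (K : Cplx k) : DGMod k T where
  obj t := homC (DGCategory.hom s t) K
  act h := coindAct s K h
  act_id {x p} φ := homC.ext fun i j h g => by
    rw [ev_coindAct _ _ _ _ (add_zero i) h, DGCategory.comp_id]
  act_act {x y z p q r a b n} ha hb hn hn' φ g f := homC.ext fun i j h e => by
    rw [ev_coindAct _ _ _ _ rfl (by lia), ev_coindAct (a := i + b) _ _ _ _ (by lia) (by lia),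
      ev_coindAct (a := i + b) _ _ _ _ rfl (by lia),
      DGCategory.assoc _ (show r + q = b from hb) _ rfl]
  d_act {x y p q p' q' n n'} hp hq hn h φ f := homC.ext fun i j hij e => by
    rw [homC.ev_d hn _ rfl rfl hij, map_add, LinearMap.add_apply, LinearMap.map_smul_of_tower,
      LinearMap.smul_apply, ev_coindAct _ _ _ _ rfl (by lia),
      ev_coindAct (a := i + q') _ _ _ _ (by lia) (by lia),
      ev_coindAct (a := i + q) _ _ _ _ rfl (by lia),
      ev_coindAct (a := i + q') _ _ _ _ rfl (by lia),
      homC.ev_d hp _ (p' := i + q') (q := i + n) (by lia) (by lia) (by lia),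
      DGCategory.d_comp rfl hq (by lia), map_add, LinearMap.map_smul_of_tower, smul_add, smul_smul,
      ← Int.negOnePow_add, negOnePow_congr 0 (show n' = p' + q + 2 * 0 by lia)]
    have : p.negOnePow = -p'.negOnePow := by rw [← hp, Int.negOnePow_succ, neg_neg]
    rw [this, Units.neg_smul]
    abel

namespace coind

variable {s : T} {K L : Cplx k}

/-- Evaluation of an element of a coinduced module. -/
def ev {t : T} {n p q : ℤ} (h : p + n = q) :
    ((coind s K).obj t).X n →ₗ[k] (DGCategory.hom (k := k) s t).X p →ₗ[k] K.X q := homC.ev h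

variable (s) in
def map (p : K ⟶ L) : coind s K ⟶ coind s L :=
  ⟨fun _ => homC.map _ p, fun _ _ _ _ _ _ _ _ => homC.ext fun _ _ _ _ => rfl⟩

@[simp] lemma ev_map (p : K ⟶ L) {t : T} {n : ℤ} (φ : ((coind s K).obj t).X n) {i j : ℤ}
    (h : i + n = j) (g : (DGCategory.hom (k := k) s t).X i) :
    ev h (((DGMod.app (map s p) t).f n).hom φ) g = (p.f j).hom (ev h φ g) := rfl

/-- This is the use of local cofibrancy for modules: a value of the coinduced module is the complex
of maps out of some `𝒯(s, t)`, a cofibrant complex. -/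
lemma isTrivFib_map (hT : IsLocallyCofibrant k T) {p : K ⟶ L} (hp : IsTrivFibCplx p) :
    IsTrivFib (map s p) := by
  rw [isTrivFib_iff]
  intro t
  have h : IsCofCplx (DGCategory.hom (k := k) s t) := fun K L p hp => hT s t p hp.1 hp.2
  exact h.isTrivFib_map hp

variable {X : DGMod k T}

/-- The action map into a coinduced module, in one degree. -/
def liftLin (χ : X.obj s ⟶ K) (t : T) (n : ℤ) :
    (X.obj t).X n →ₗ[k] (homC (DGCategory.hom s t) K).X n where
  toFun x := homC.mk fun i j h => (χ.f j).hom ∘ₗ X.act (show n + i = j by lia) x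
  map_add' _ _ := homC.ext fun _ _ _ _ => by simp
  map_smul' _ _ := homC.ext fun _ _ _ _ => by simp

lemma ev_liftLin (χ : X.obj s ⟶ K) {t : T} {n i j : ℤ} (h : i + n = j) (x : (X.obj t).X n)
    (g : (DGCategory.hom (k := k) s t).X i) :
    homC.ev h (liftLin χ t n x) g = (χ.f j).hom (X.act (show n + i = j by lia) x g) := rfl

lemma liftLin_d (χ : X.obj s ⟶ K) (t : T) {i j : ℤ} (hij : i + 1 = j) (x : (X.obj t).X i) :
    ((homC (DGCategory.hom s t) K).d i j).hom (liftLin χ t i x) =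
      liftLin χ t j (((X.obj t).d i j).hom x) :=
  homC.ext fun a b hab g => by
    rw [homC.ev_d hij (liftLin χ t i x) rfl rfl hab g, ev_liftLin, ev_liftLin, ev_liftLin,
      d_f_apply, X.d_act hij rfl (by lia), map_add, LinearMap.map_smul_of_tower, add_assoc,
      show j.negOnePow = -i.negOnePow by rw [← hij, Int.negOnePow_succ], Units.neg_smul,
      add_neg_cancel, add_zero]

lemma liftLin_act (χ : X.obj s ⟶ K) {x y : T} {p q n : ℤ} (h : p + q = n) (m : (X.obj y).X p)
    (f : (DGCategory.hom (k := k) x y).X q) :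
    liftLin χ x n (X.act h m f) = coindAct s K h (liftLin χ y p m) f :=
  homC.ext fun a b hab g => by
    rw [ev_coindAct _ _ _ _ rfl (by lia), ev_liftLin, ev_liftLin, X.act_act h rfl _ (by lia)]

/-- Module maps into a coinduced module from maps of complexes. -/
def lift (χ : X.obj s ⟶ K) : X ⟶ coind s K :=
  DGMod.homMk (liftLin χ) (fun t _ _ hij x => liftLin_d χ t hij x)
    (fun _ _ _ _ _ h m f => liftLin_act χ h m f)

lemma ev_lift (χ : X.obj s ⟶ K) {t : T} {n i j : ℤ} (h : i + n = j) (x : (X.obj t).X n)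
    (g : (DGCategory.hom (k := k) s t).X i) :
    ev h (((DGMod.app (lift χ) t).f n).hom x) g =
      (χ.f j).hom (X.act (show n + i = j by lia) x g) := rfl

/-- The map of complexes given by a module map into a coinduced module. -/
def desc (Ψ : X ⟶ coind s K) : X.obj s ⟶ K where
  f n := ModuleCat.ofHom ((ev (zero_add n)).flip (DGCategory.id s) ∘ₗ ((DGMod.app Ψ s).f n).hom)
  comm' i j hij := ModuleCat.hom_ext (LinearMap.ext fun x => by
    have hij' : i + 1 = j := hij
    change (K.d i j).hom (ev (zero_add i) (((DGMod.app Ψ s).f i).hom x) (DGCategory.id s)) =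
      ev (zero_add j) (((DGMod.app Ψ s).f j).hom (((X.obj s).d i j).hom x)) (DGCategory.id s)
    rw [← d_f_apply]
    refine Eq.trans ?_ (homC.ev_d hij' (((DGMod.app Ψ s).f i).hom x : (homC _ K).X i) rfl
      (zero_add i) (zero_add j) (DGCategory.id s)).symm
    rw [show ((DGCategory.hom s s).d 0 (0 + 1)).hom (DGCategory.id s) = 0 from DGCategory.d_id s]
    simp
    rfl)

lemma desc_f (Ψ : X ⟶ coind s K) (n : ℤ) (x : (X.obj s).X n) :
    ((desc Ψ).f n).hom x = ev (zero_add n) (((DGMod.app Ψ s).f n).hom x) (DGCategory.id s) := rfl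

/-- Coinduction is right adjoint to evaluation at `s`. For lifting problems it is enough to know
that `desc` undoes `lift` and is compatible with postcomposition. -/
lemma desc_lift (χ : X.obj s ⟶ K) : desc (lift χ) = χ := by
  ext n x
  rw [desc_f, ev_lift, X.act_id]

lemma desc_comp_map (Ψ : X ⟶ coind s K) (p : K ⟶ L) : desc (Ψ ≫ map s p) = desc Ψ ≫ p := by
  ext n x
  rfl

end coind

/-- The values of cofibrant modules are cofibrant complexes. -/
lemma IsCofibrant.isCofCplx (hT : IsLocallyCofibrant k T) {X : DGMod k T} (hX : IsCofibrant X)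
    (s : T) : IsCofCplx (X.obj s) := by
  intro K L p hp f
  -- The lifting problem at `s` is moved along the adjunction to one of modules. Evaluation
  -- preserves cofibrant objects because its right adjoint preserves trivial fibrations.
  obtain ⟨g, hg⟩ := hX _ (coind.isTrivFib_map (s := s) hT hp) (coind.lift f)
  exact ⟨coind.desc g, by rw [← coind.desc_comp_map, hg, coind.desc_lift]⟩

lemma negOnePow_congr_neg {a b : ℤ} (c : ℤ) (h : a = b + 1 + 2 * c) :
    a.negOnePow = -b.negOnePow := by
  rw [negOnePow_congr c h, Int.negOnePow_succ]

/-! ### Modules and bimodules of `k`-linear maps -/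

section

variable (V : Cplx k) (N : DGMod k T)

/-- The right action on `Hom(V, N)`: `(φ f)(v) = (-1)^(|f||v|) φ(v) f`. -/
def homModAct {x y : T} {p q n : ℤ} (h : p + q = n) :
    (homC V (N.obj y)).X p →ₗ[k] (DGCategory.hom (k := k) x y).X q →ₗ[k]
      (homC V (N.obj x)).X n :=
  LinearMap.mk₂ k (fun φ f => homC.mk fun i j hij => (q * i).negOnePow •
      ((N.act (show i + p + q = j by lia)).flip f ∘ₗ homC.ev rfl φ))
    (fun _ _ _ => homC.ext fun _ _ _ _ => by simp) (fun _ _ _ => homC.ext fun _ _ _ _ => by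
      simp only [homC.ev_mk, LinearMap.smul_apply, LinearMap.comp_apply, LinearMap.flip_apply,
        map_smul]
      exact smul_comm _ _ _)
    (fun _ _ _ => homC.ext fun _ _ _ _ => by simp) (fun _ _ _ => homC.ext fun _ _ _ _ => by
      simp only [homC.ev_mk, LinearMap.smul_apply, LinearMap.comp_apply, LinearMap.flip_apply,
        map_smul]
      exact smul_comm _ _ _)

variable {V N}

lemma ev_homModAct {x y : T} {p q n : ℤ} (h : p + q = n) (φ : (homC V (N.obj y)).X p)
    (f : (DGCategory.hom (k := k) x y).X q) {i j a : ℤ} (hij : i + n = j) (ha : i + p = a)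
    (ha' : a + q = j) (v : V.X i) :
    homC.ev hij (homModAct V N h φ f) v = (q * i).negOnePow • N.act ha' (homC.ev ha φ v) f := by
  subst ha; rfl

variable (V N) in
/-- The right module of `k`-linear maps from `V` to `N`. -/
def homMod : DGMod k T where
  obj t := homC V (N.obj t)
  act h := homModAct V N h
  act_id {x p} φ := homC.ext fun i j h v => by
    rw [ev_homModAct _ _ _ _ h (by lia), N.act_id]
    simp
  act_act {x y z p q r a b n} ha hb hn hn' φ g f := homC.ext fun i j h v => by
    rw [ev_homModAct _ _ _ _ (show i + a = i + a from rfl) (by lia),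
      ev_homModAct _ _ _ _ rfl (by lia),
      ev_homModAct _ _ _ _ rfl (by lia), LinearMap.map_smul_of_tower, LinearMap.smul_apply,
      N.act_act _ hb _ (by lia), smul_smul, ← Int.negOnePow_add,
      negOnePow_congr 0 (show r * i + q * i = b * i + 2 * 0 by rw [← hb]; ring)]
  d_act {x y p q p' q' n n'} hp hq hn h φ f := homC.ext fun i j hij v => by
    rw [homC.ev_d hn _ rfl rfl hij, map_add, LinearMap.add_apply, LinearMap.map_smul_of_tower,
      LinearMap.smul_apply, ev_homModAct _ _ _ _ (show i + p = i + p from rfl) (by lia),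
      ev_homModAct _ _ _ _ (show i + p' = i + p' from rfl) (by lia),
      ev_homModAct (a := i + p') _ _ _ _ (by lia) (by lia),
      ev_homModAct _ _ _ _ (show i + p = i + p from rfl) (by lia),
      homC.ev_d hp _ rfl rfl rfl, LinearMap.map_smul_of_tower,
      N.d_act (p' := i + p') (by lia) hq (by lia)]
    simp only [map_add, LinearMap.map_smul_of_tower, smul_add, smul_smul, LinearMap.add_apply,
      LinearMap.smul_apply, ← Int.negOnePow_add]
    rw [negOnePow_congr q (show n' + q * (i + 1) = q * i + p' + 2 * q by lia),
      negOnePow_congr 0 (show q * i + (i + p) = p + q' * i + 2 * 0 by rw [← hq]; ring)]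
    exact add_right_comm _ _ _

end

namespace homMod

variable {V : Cplx k} {N N' : DGMod k T}

lemma map_homModAct (p : N ⟶ N') {x y : T} {a b n : ℤ} (h : a + b = n)
    (φ : (homC V (N.obj y)).X a) (f : (DGCategory.hom (k := k) x y).X b) :
    ((homC.map V (DGMod.app p x)).f n).hom (homModAct V N h φ f) =
      homModAct V N' h (((homC.map V (DGMod.app p y)).f a).hom φ) f :=
  homC.ext fun i j hij v => by
    rw [homC.ev_map, ev_homModAct _ _ _ _ rfl (by lia), ev_homModAct _ _ _ _ rfl (by lia),
      homC.ev_map, LinearMap.map_smul_of_tower, DGMod.app_act]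

variable (V) in
/-- Postcomposition. -/
def map (p : N ⟶ N') : homMod V N ⟶ homMod V N' :=
  ⟨fun t => homC.map V (DGMod.app p t), fun _ _ _ _ _ h φ f => map_homModAct p h φ f⟩

/-- Both trivial fibrations and the modules `Hom(V, -)` are computed one value at a time, so
cofibrancy of the complex `V` suffices. -/
lemma isTrivFib_map (hV : IsCofCplx V) {p : N ⟶ N'} (hp : IsTrivFib p) :
    IsTrivFib (map V p) := by
  rw [isTrivFib_iff] at hp ⊢
  exact fun t => hV.isTrivFib_map (hp t)

end homMod

section

variable (X N : DGMod k T)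

/-- The left action on `Hom(X, N)`: `(f φ)(x) = (-1)^(|f|(|φ|+|x|)) φ(x f)`. -/
def homBimodAct (x y t : T) {n a b : ℤ} (h : a + n = b) :
    (DGCategory.hom (k := k) x y).X n →ₗ[k] (homC (X.obj x) (N.obj t)).X a →ₗ[k]
      (homC (X.obj y) (N.obj t)).X b :=
  LinearMap.mk₂ k (fun f φ => homC.mk fun i j hij => (n * (a + i)).negOnePow •
      (homC.ev (show i + n + a = j by lia) φ ∘ₗ (X.act rfl).flip f))
    (fun _ _ _ => homC.ext fun _ _ _ _ => by simp) (fun _ _ _ => homC.ext fun _ _ _ _ => by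
      simp only [homC.ev_mk, LinearMap.smul_apply, LinearMap.comp_apply, LinearMap.flip_apply,
        map_smul]
      exact smul_comm _ _ _)
    (fun _ _ _ => homC.ext fun _ _ _ _ => by simp) (fun _ _ _ => homC.ext fun _ _ _ _ => by
      simp only [homC.ev_mk, LinearMap.smul_apply, LinearMap.comp_apply, LinearMap.flip_apply,
        map_smul]
      exact smul_comm _ _ _)

variable {X N}

lemma ev_homBimodAct {x y t : T} {n a b : ℤ} (h : a + n = b)
    (f : (DGCategory.hom (k := k) x y).X n) (φ : (homC (X.obj x) (N.obj t)).X a)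
    {i j c : ℤ} (hij : i + b = j) (hc : i + n = c) (hc' : c + a = j) (m : (X.obj y).X i) :
    homC.ev hij (homBimodAct X N x y t h f φ) m =
      (n * (a + i)).negOnePow • homC.ev hc' φ (X.act hc m f) := by
  subst hc; rfl

lemma homBimodAct_homModAct {x y t t' : T} {n p q a b c : ℤ} (ha : p + q = a) (hb : p + n = b)
    (hc : a + n = c) (hc' : b + q = c) (f : (DGCategory.hom (k := k) x y).X n)
    (φ : (homC (X.obj x) (N.obj t)).X p) (g : (DGCategory.hom (k := k) t' t).X q) :
    homBimodAct X N x y t' hc f (homModAct (X.obj x) N ha φ g) =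
      homModAct (X.obj y) N hc' (homBimodAct X N x y t hb f φ) g :=
  homC.ext fun i j h m => by
    rw [ev_homBimodAct _ _ _ _ rfl (by lia), ev_homModAct _ _ _ _ (show i + n + p = i + b by lia)
      (by lia), ev_homModAct _ _ _ _ rfl (by lia), ev_homBimodAct _ _ _ _ rfl (by lia),
      LinearMap.map_smul_of_tower, LinearMap.smul_apply, smul_smul, smul_smul,
      ← Int.negOnePow_add, ← Int.negOnePow_add,
      negOnePow_congr (n * q) (show n * (a + i) + q * (i + n) = q * i + n * (p + i) + 2 * (n * q) by
        rw [← ha]; ring)]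

lemma homBimodAct_id {x t : T} {a : ℤ} (h : a + 0 = a) (φ : (homC (X.obj x) (N.obj t)).X a) :
    homBimodAct X N x x t h (DGCategory.id x) φ = φ :=
  homC.ext fun i j h m => by
    rw [ev_homBimodAct _ _ _ _ (add_zero i) h, X.act_id]
    simp

lemma homBimodAct_comp {x y z t : T} {p q n a b c : ℤ} (h : p + q = n) (hb : a + p = b)
    (hc : b + q = c) (hc' : a + n = c) (f : (DGCategory.hom (k := k) x y).X p)
    (g : (DGCategory.hom (k := k) y z).X q) (φ : (homC (X.obj x) (N.obj t)).X a) :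
    homBimodAct X N x z t hc' (DGCategory.comp h f g) φ =
      homBimodAct X N y z t hc g (homBimodAct X N x y t hb f φ) :=
  homC.ext fun i j hij m => by
    rw [ev_homBimodAct _ _ _ _ rfl (by lia), ev_homBimodAct _ _ _ _ rfl (by lia),
      ev_homBimodAct _ _ _ _ (show i + q + p = i + n by lia) (by lia), smul_smul,
      ← Int.negOnePow_add, X.act_act _ h _ (by lia),
      negOnePow_congr (-(q * p)) (show n * (a + i) = q * (b + i) + p * (a + (i + q)) +
        2 * -(q * p) by rw [← h, ← hb]; ring)]

lemma d_homBimodAct {x y t : T} {n n' a a' b b' : ℤ} (hn : n + 1 = n') (ha : a + 1 = a')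
    (hb : b + 1 = b') (h : a + n = b) (f : (DGCategory.hom (k := k) x y).X n)
    (φ : (homC (X.obj x) (N.obj t)).X a) :
    homBimodAct X N x y t (show a + n' = b' by lia) (((DGCategory.hom x y).d n n').hom f) φ =
      ((homC (X.obj y) (N.obj t)).d b b').hom (homBimodAct X N x y t h f φ) +
        n'.negOnePow • homBimodAct X N x y t (show a' + n = b' by lia) f
          (((homC (X.obj x) (N.obj t)).d a a').hom φ) :=
  homC.ext fun i j hij m => by
    rw [ev_homBimodAct _ _ _ _ rfl (by lia), map_add, LinearMap.add_apply,
      LinearMap.map_smul_of_tower, LinearMap.smul_apply, homC.ev_d hb _ rfl rfl hij,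
      ev_homBimodAct _ _ _ _ (show i + n = i + n from rfl) (by lia),
      ev_homBimodAct _ _ _ _ (show i + 1 + n = i + n' by lia) (by lia),
      ev_homBimodAct _ _ _ _ (show i + n = i + n from rfl) (by lia),
      homC.ev_d ha _ (p' := i + n') (q := i + b) (by lia) (by lia) (by lia),
      X.d_act rfl hn (by lia)]
    simp only [map_add, LinearMap.map_smul_of_tower, smul_add, smul_smul, ← Int.negOnePow_add]
    rw [negOnePow_congr_neg n (show n' + n * (a' + i) = n * (a + i) + 1 + 2 * n by
        rw [← hn, ← ha]; ring),
      negOnePow_congr_neg 0 (show n' + (n * (a' + i) + a') = b' + n * (a + (i + 1)) + 1 + 2 * 0 by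
        rw [← hn, ← ha, ← hb, ← h]; ring),
      negOnePow_congr (n + 1) (show n' + (n * (a' + i) + (a' + i)) =
        n' * (a + i) + 2 * (n + 1) by rw [← hn, ← ha]; ring)]
    simp only [Units.neg_smul]
    abel

variable (X N) in
/-- The left action of a morphism of `𝒯` on the modules `Hom(X, N)`. -/
def homBimodMap (x y : T) {n : ℤ} (f : (DGCategory.hom (k := k) x y).X n) :
    DGHom n (homMod (X.obj x) N) (homMod (X.obj y) N) :=
  DGHom.mkLin (fun t _ _ h => homBimodAct X N x y t h f)
    (fun _ _ _ _ _ _ _ ha hb hc hc' φ g => homBimodAct_homModAct ha hb hc hc' f φ g)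

variable (X N) in
/-- The bimodule of `k`-linear maps from `X` to `N`. -/
def homBimod : Bimod k T where
  obj s := homMod (X.obj s) N
  map {x y n} :=
    { toFun := fun f => homBimodMap X N x y f
      map_add' := fun f g => DGHom.ext_apply fun t p q hpq φ =>
        LinearMap.congr_fun (map_add (homBimodAct X N x y t hpq) f g) φ
      map_smul' := fun r f => DGHom.ext_apply fun t p q hpq φ =>
        LinearMap.congr_fun (map_smul (homBimodAct X N x y t hpq) r f) φ }
  map_id x := DGHom.ext_apply fun t p q hpq φ => by
    obtain rfl : q = p := by lia
    exact (homBimodAct_id hpq φ).trans (by simp; rfl)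
  map_comp {x y z p q n} h f g := DGHom.ext_apply fun t i j hij φ => by
    rw [DGHom.comp_apply _ _ _ _ rfl (by lia)]
    exact homBimodAct_comp h rfl (by lia) hij f g φ
  map_d {x y n n'} h f := DGHom.ext_apply fun t p q hpq φ => by
    rw [DGHom.δ_apply h _ _ rfl rfl]
    exact d_homBimodAct h rfl (by lia) rfl f φ

end

namespace homMod

variable (V : Cplx k) {N N' N'' : DGMod k T}

/-- Postcomposition with a graded morphism, in one degree. -/
def postLin {n : ℤ} (ψ : DGHom n N N') (t : T) (p q : ℤ) (h : p + n = q) :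
    (homC V (N.obj t)).X p →ₗ[k] (homC V (N'.obj t)).X q where
  toFun φ := homC.mk fun i j hij =>
    ((ψ.1 t).v (i + p) j (by lia)).hom ∘ₗ homC.ev rfl φ
  map_add' _ _ := homC.ext fun _ _ _ _ => by simp
  map_smul' _ _ := homC.ext fun _ _ _ _ => by simp

variable {V}

lemma ev_postLin {n : ℤ} (ψ : DGHom n N N') {t : T} {p q i j a : ℤ} (h : p + n = q)
    (hij : i + q = j) (ha : i + p = a) (ha' : a + n = j) (φ : (homC V (N.obj t)).X p) (v : V.X i) :
    homC.ev hij (postLin V ψ t p q h φ) v = ((ψ.1 t).v a j ha').hom (homC.ev ha φ v) := by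
  subst ha; rfl

lemma postLin_homModAct {n : ℤ} (ψ : DGHom n N N') {x y : T} {p q a b c : ℤ} (ha : p + q = a)
    (hb : p + n = b) (hc : a + n = c) (hc' : b + q = c) (φ : (homC V (N.obj y)).X p)
    (f : (DGCategory.hom (k := k) x y).X q) :
    postLin V ψ x a c hc (homModAct V N ha φ f) =
      homModAct V N' hc' (postLin V ψ y p b hb φ) f :=
  homC.ext fun i j h v => by
    rw [ev_postLin (a := i + a) _ _ _ rfl (by lia), ev_homModAct _ _ _ _ rfl (by lia),
      ev_homModAct _ _ _ _ rfl (by lia), ev_postLin _ _ _ rfl (by lia),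
      LinearMap.map_smul_of_tower, ψ.map_act]

lemma postLin_comp {p q n : ℤ} (ψ : DGHom p N N') (χ : DGHom q N' N'') (h : p + q = n) {t : T}
    {a b c : ℤ} (hab : a + p = b) (hbc : b + q = c) (hac : a + n = c) (φ : (homC V (N.obj t)).X a) :
    postLin V (ψ.comp χ h) t a c hac φ = postLin V χ t b c hbc (postLin V ψ t a b hab φ) :=
  homC.ext fun i j h v => by
    rw [ev_postLin _ _ _ rfl (by lia), ev_postLin _ _ _ rfl (by lia), ev_postLin _ _ _ rfl (by lia),
      DGHom.comp_apply]

lemma postLin_id {t : T} {a : ℤ} (h : a + 0 = a) (φ : (homC V (N.obj t)).X a) :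
    postLin V (DGHom.id N) t a a h φ = φ :=
  homC.ext fun i j h v => by
    rw [ev_postLin _ _ _ h (by lia)]
    simp

lemma postLin_δ {n n' : ℤ} (hn : n + 1 = n') (ψ : DGHom n N N') {t : T} {a a' b c : ℤ}
    (ha : a + 1 = a') (hb : a + n = b) (hc : a + n' = c) (φ : (homC V (N.obj t)).X a) :
    postLin V (ψ.δ n n') t a c hc φ = ((homC V (N'.obj t)).d b c).hom (postLin V ψ t a b hb φ) +
      n'.negOnePow • postLin V ψ t a' c (by lia) (((homC V (N.obj t)).d a a').hom φ) :=
  homC.ext fun i j h v => by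
    rw [ev_postLin _ _ _ rfl (by lia), DGHom.δ_apply (b := i + b) hn _ _ rfl (by lia), map_add, LinearMap.add_apply,
      LinearMap.map_smul_of_tower, LinearMap.smul_apply, homC.ev_d (by lia) _ rfl rfl h,
      ev_postLin _ _ _ rfl (by lia), ev_postLin (a := i + a + 1) _ _ _ (by lia) (by lia),
      ev_postLin (a := i + a + 1) _ _ _ (by lia) (by lia),
      homC.ev_d ha _ rfl rfl (by lia)]
    simp only [map_add, LinearMap.map_smul_of_tower, smul_add, smul_smul, ← Int.negOnePow_add]
    rw [negOnePow_congr_neg 0 (show n' + a' = c + 1 + 2 * 0 by lia), Units.neg_smul]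
    abel

variable (V) in
/-- Postcomposition with a graded morphism. -/
def post {n : ℤ} (ψ : DGHom n N N') : DGHom n (homMod V N) (homMod V N') :=
  DGHom.mkLin (postLin V ψ)
    (fun _ _ _ _ _ _ _ ha hb hc hc' φ f => postLin_homModAct ψ ha hb hc hc' φ f)

lemma post_add {n : ℤ} (ψ χ : DGHom n N N') : post V (ψ + χ) = post V ψ + post V χ :=
  DGHom.ext_apply fun _ _ _ _ _ => homC.ext fun _ _ _ _ => rfl

lemma post_smul {n : ℤ} (r : k) (ψ : DGHom n N N') : post V (r • ψ) = r • post V ψ :=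
  DGHom.ext_apply fun _ _ _ _ _ => homC.ext fun _ _ _ _ => rfl

lemma post_id : post V (DGHom.id N) = DGHom.id (homMod V N) :=
  DGHom.ext_apply fun t p q h φ => by
    obtain rfl : q = p := by lia
    exact (postLin_id h φ).trans (by simp; rfl)

lemma post_comp {p q n : ℤ} (ψ : DGHom p N N') (χ : DGHom q N' N'') (h : p + q = n) :
    post V (ψ.comp χ h) = (post V ψ).comp (post V χ) h :=
  DGHom.ext_apply fun t i j hij φ => by
    rw [DGHom.comp_apply _ _ _ _ rfl (by lia)]
    exact postLin_comp ψ χ h rfl (by lia) hij φ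

lemma post_δ {n n' : ℤ} (h : n + 1 = n') (ψ : DGHom n N N') :
    post V (ψ.δ n n') = (post V ψ).δ n n' :=
  DGHom.ext_apply fun t i j hij φ => by
    rw [DGHom.δ_apply h _ _ rfl rfl]
    exact postLin_δ h ψ rfl rfl hij φ

lemma post_ofHom (p : N ⟶ N') : post V (DGHom.ofHom p) = DGHom.ofHom (map V p) :=
  DGHom.ext_apply fun t i j hij φ => by
    obtain rfl : j = i := by lia
    refine homC.ext fun a b hab v => ?_
    refine (ev_postLin (DGHom.ofHom p) hij hab hab (add_zero b) φ v).trans ?_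
    rw [DGHom.ofHom_v, DGHom.ofHom_v]
    rfl

end homMod

namespace homBimod

variable {X N N' N'' : DGMod k T}

/-- The left action precomposes with the action on `X`, so it commutes with postcomposition up to
the Koszul sign of interchanging `ψ` and `f`. This sign is the one in the definition of a graded
bimodule morphism. -/
lemma postLin_homBimodAct {n : ℤ} (ψ : DGHom n N N') {x y t : T} {q m a b b' c : ℤ}
    (h : q + n = m) (ha : a + q = b) (hb : b + n = c) (ha' : a + n = b') (hb' : b' + q = c)
    (f : (DGCategory.hom (k := k) x y).X q) (φ : (homC (X.obj x) (N.obj t)).X a) :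
    homMod.postLin (X.obj y) ψ t b c hb (homBimodAct X N x y t ha f φ) =
      (n * q).negOnePow • homBimodAct X N' x y t hb' f (homMod.postLin (X.obj x) ψ t a b' ha' φ) :=
  homC.ext fun i j hij v => by
    rw [homMod.ev_postLin _ _ _ rfl (by lia), ev_homBimodAct _ _ _ _ rfl (by lia),
      LinearMap.map_smul_of_tower, LinearMap.map_smul_of_tower, LinearMap.smul_apply,
      ev_homBimodAct _ _ _ _ rfl (by lia), homMod.ev_postLin (a := i + b) _ _ _ (by lia) (by lia),
      smul_smul, ← Int.negOnePow_add,
      negOnePow_congr (-(n * q)) (show q * (a + i) = n * q + q * (b' + i) + 2 * -(n * q) by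
        rw [← ha']; ring)]

lemma homBimodMap_comp_post {n : ℤ} (ψ : DGHom n N N') {x y : T} {q m : ℤ} (h : q + n = m)
    (f : (DGCategory.hom (k := k) x y).X q) :
    (homBimodMap X N x y f).comp (homMod.post (X.obj y) ψ) h =
      (n * q).negOnePow • (homMod.post (X.obj x) ψ).comp (homBimodMap X N' x y f)
        (show n + q = m by lia) :=
  DGHom.ext_apply fun t i j hij φ => by
    rw [DGHom.comp_apply _ _ _ _ rfl (by lia), DGHom.units_smul_v]
    refine Eq.trans ?_ (congrArg ((n * q).negOnePow • ·) (DGHom.comp_apply (homMod.post (X.obj x) ψ)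
      (homBimodMap X N' x y f) _ _ rfl (show i + n + q = j by lia) hij φ).symm)
    exact postLin_homBimodAct ψ h rfl (by lia) rfl (by lia) f φ

variable (X) in
/-- Postcomposition with a graded morphism. -/
def post {n : ℤ} (ψ : DGHom n N N') : BimodHom n (homBimod X N) (homBimod X N') :=
  ⟨fun s => homMod.post (X.obj s) ψ, fun _ _ _ _ h f => homBimodMap_comp_post ψ h f⟩

lemma homBimodMap_comp_map (p : N ⟶ N') {x y : T} {q : ℤ} (f : (DGCategory.hom (k := k) x y).X q) :
    (homBimodMap X N x y f).comp (DGHom.ofHom (homMod.map (X.obj y) p)) (add_zero q) =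
      (DGHom.ofHom (homMod.map (X.obj x) p)).comp (homBimodMap X N' x y f) (zero_add q) := by
  rw [← homMod.post_ofHom, ← homMod.post_ofHom, homBimodMap_comp_post, zero_mul,
    Int.negOnePow_zero, one_smul]

variable (X) in
/-- Postcomposition. -/
def map (p : N ⟶ N') : Bimod.Hom (homBimod X N) (homBimod X N') where
  app s := homMod.map (X.obj s) p
  naturality _ _ _ f := homBimodMap_comp_map p f

end homBimod

/-- The 2-fold bimodule of `k`-linear maps from a module to a bimodule. -/
def homBimod2 (Y : DGMod k T) (C : Bimod k T) : Bimod2 k T where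
  obj s := homBimod Y (C.obj s)
  map :=
    { toFun := fun f => homBimod.post Y (C.map f)
      map_add' := fun f g => Subtype.ext (funext fun s => by
        rw [map_add]; exact homMod.post_add _ _)
      map_smul' := fun r f => Subtype.ext (funext fun s => by
        rw [map_smul]; exact homMod.post_smul _ _) }
  map_id x := Subtype.ext (funext fun s => by
    refine Eq.trans (congrArg (homMod.post (Y.obj s)) (C.map_id x)) homMod.post_id)
  map_comp h f g := Subtype.ext (funext fun s =>
    (congrArg (homMod.post (Y.obj s)) (C.map_comp h f g)).trans (homMod.post_comp _ _ h))
  map_d h f := Subtype.ext (funext fun s =>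
    (congrArg (homMod.post (Y.obj s)) (C.map_d h f)).trans (homMod.post_δ h _))

def homBimod2.map (Y : DGMod k T) {C C' : Bimod k T} (p : Bimod.Hom C C') :
    Bimod2.Hom (homBimod2 Y C) (homBimod2 Y C') where
  app s := homBimod.map Y (p.app s)
  naturality x y q f t := by
    change (homMod.post (Y.obj t) (C.map f)).comp (DGHom.ofHom (homMod.map _ (p.app y))) _ =
      (DGHom.ofHom (homMod.map _ (p.app x))).comp (homMod.post (Y.obj t) (C'.map f)) _
    rw [← homMod.post_ofHom, ← homMod.post_ofHom, ← homMod.post_comp, ← homMod.post_comp,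
      p.naturality]

namespace homBimod

variable {X N N' : DGMod k T} {B : Bimod k T}

/-- The map `b ↦ (x ↦ (-1)^(|b||x|) Θ(x ⊗ b))`, in one degree. -/
def liftLin (Θ : tensor X B ⟶ N) (s t : T) (n : ℤ) :
    ((B.obj s).obj t).X n →ₗ[k] (homC (X.obj s) (N.obj t)).X n where
  toFun b := homC.mk fun i j h => (n * i).negOnePow •
    (((DGMod.app Θ t).f j).hom ∘ₗ (tin h).flip b)
  map_add' _ _ := homC.ext fun _ _ _ _ => by simp
  map_smul' _ _ := homC.ext fun _ _ _ _ => by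
    simp only [homC.ev_mk, LinearMap.smul_apply, LinearMap.comp_apply, LinearMap.flip_apply,
      map_smul, RingHom.id_apply]
    exact smul_comm _ _ _

lemma ev_liftLin (Θ : tensor X B ⟶ N) {s t : T} {n i j : ℤ} (h : i + n = j)
    (b : ((B.obj s).obj t).X n) (x : (X.obj s).X i) :
    homC.ev h (liftLin Θ s t n b) x =
      (n * i).negOnePow • ((DGMod.app Θ t).f j).hom (tin h x b) := rfl

lemma liftLin_d (Θ : tensor X B ⟶ N) (s t : T) {n n' : ℤ} (hn : n + 1 = n')
    (b : ((B.obj s).obj t).X n) :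
    ((homC (X.obj s) (N.obj t)).d n n').hom (liftLin Θ s t n b) =
      liftLin Θ s t n' ((((B.obj s).obj t).d n n').hom b) :=
  homC.ext fun i j h x => by
    rw [homC.ev_d hn _ rfl rfl h, ev_liftLin, ev_liftLin, ev_liftLin,
      LinearMap.map_smul_of_tower, d_f_apply, tin_d (by lia) rfl hn, map_add,
      LinearMap.map_smul_of_tower, smul_add, smul_smul, smul_smul, ← Int.negOnePow_add,
      ← Int.negOnePow_add, negOnePow_congr_neg n (show n' + n * (i + 1) = n * i + 1 + 2 * n by
        rw [← hn]; ring), negOnePow_congr 0 (show n * i + i = n' * i + 2 * 0 by rw [← hn]; ring),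
      Units.neg_smul]
    exact add_neg_cancel_comm _ _

lemma liftLin_act (Θ : tensor X B ⟶ N) (s : T) {t t' : T} {p q n : ℤ} (h : p + q = n)
    (b : ((B.obj s).obj t).X p) (g : (DGCategory.hom (k := k) t' t).X q) :
    liftLin Θ s t' n ((B.obj s).act h b g) =
      homModAct (X.obj s) N h (liftLin Θ s t p b) g :=
  homC.ext fun i j hij x => by
    rw [ev_homModAct _ _ _ _ rfl (by lia), ev_liftLin, ev_liftLin, LinearMap.map_smul_of_tower,
      LinearMap.smul_apply, smul_smul, ← Int.negOnePow_add, ← DGMod.app_act,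
      act_tin _ _ h, negOnePow_congr 0 (show n * i = q * i + p * i + 2 * 0 by rw [← h]; ring)]

lemma liftLin_map (Θ : tensor X B ⟶ N) {x y t : T} {p q n : ℤ} (h : p + q = n)
    (f : (DGCategory.hom (k := k) x y).X q) (b : ((B.obj x).obj t).X p) :
    liftLin Θ y t n ((((B.map f).1 t).v p n h).hom b) =
      homBimodAct X N x y t h f (liftLin Θ x t p b) :=
  homC.ext fun i j hij m => by
    rw [ev_homBimodAct _ _ _ _ rfl (by lia), ev_liftLin, ev_liftLin, smul_smul,
      ← Int.negOnePow_add, tin_act rfl h _ hij,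
      negOnePow_congr (p * q) (show q * (p + i) + p * (i + q) = n * i + 2 * (p * q) by
        rw [← h]; ring)]

/-- The components of `homBimod.lift`. -/
def liftApp (Θ : tensor X B ⟶ N) (s : T) : B.obj s ⟶ homMod (X.obj s) N :=
  DGMod.homMk (N := homMod (X.obj s) N) (liftLin Θ s) (fun t _ _ hij b => liftLin_d Θ s t hij b)
    (fun _ _ _ _ _ h b g => liftLin_act Θ s h b g)

lemma liftApp_app (Θ : tensor X B ⟶ N) (s t : T) (n : ℤ) (b : ((B.obj s).obj t).X n) :
    ((DGMod.app (liftApp Θ s) t).f n).hom b = liftLin Θ s t n b := rfl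

lemma liftApp_naturality (Θ : tensor X B ⟶ N) {x y : T} {q : ℤ}
    (f : (DGCategory.hom (k := k) x y).X q) :
    (B.map f).comp (DGHom.ofHom (liftApp Θ y)) (add_zero q) =
      (DGHom.ofHom (liftApp Θ x)).comp (homBimodMap X N x y f) (zero_add q) :=
  DGHom.ext_apply fun t i j hij b => by
    rw [DGHom.comp_apply _ _ _ _ hij (add_zero j), DGHom.comp_apply _ _ _ _ (add_zero i) hij,
      DGHom.ofHom_v, DGHom.ofHom_v, liftApp_app, liftApp_app]
    exact liftLin_map Θ hij f b

/-- The bimodule map `B ⟶ Hom(X, N)` corresponding to a module map `X ⊗ B ⟶ N`. -/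
def lift (Θ : tensor X B ⟶ N) : Bimod.Hom B (homBimod X N) where
  app s := liftApp Θ s
  naturality _ _ _ f := liftApp_naturality Θ f

/-- The values of a bimodule map into `Hom(X, N)`. -/
def lin (θ : Bimod.Hom B (homBimod X N)) (s t : T) (n : ℤ) :
    ((B.obj s).obj t).X n →ₗ[k] (homC (X.obj s) (N.obj t)).X n :=
  ((DGMod.app (θ.app s) t).f n).hom

lemma lin_d (θ : Bimod.Hom B (homBimod X N)) (s t : T) (n n' : ℤ) (b : ((B.obj s).obj t).X n) :
    ((homC (X.obj s) (N.obj t)).d n n').hom (lin θ s t n b) =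
      lin θ s t n' ((((B.obj s).obj t).d n n').hom b) :=
  d_f_apply (DGMod.app (θ.app s) t) n n' b

lemma lin_act (θ : Bimod.Hom B (homBimod X N)) (s : T) {t t' : T} {p q n : ℤ} (h : p + q = n)
    (b : ((B.obj s).obj t).X p) (g : (DGCategory.hom (k := k) t' t).X q) :
    lin θ s t' n ((B.obj s).act h b g) = homModAct (X.obj s) N h (lin θ s t p b) g :=
  DGMod.app_act (θ.app s) h b g

lemma lin_map (θ : Bimod.Hom B (homBimod X N)) {x y t : T} {p q n : ℤ} (h : p + q = n)
    (f : (DGCategory.hom (k := k) x y).X q) (b : ((B.obj x).obj t).X p) :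
    lin θ y t n ((((B.map f).1 t).v p n h).hom b) =
      homBimodAct X N x y t h f (lin θ x t p b) := by
  have H := congrArg (fun φ : DGHom q (B.obj x) (homMod (X.obj y) N) => ((φ.1 t).v p n h).hom b)
    (θ.naturality f)
  refine Eq.trans ?_ (H.trans ?_)
  · refine Eq.trans ?_ (DGHom.comp_apply (B.map f) (DGHom.ofHom (θ.app y)) (add_zero q) t h
      (add_zero n) h b).symm
    rw [DGHom.ofHom_v]
    rfl
  · refine (DGHom.comp_apply (DGHom.ofHom (θ.app x)) ((homBimod X N).map f) (zero_add q) t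
      (add_zero p) h h b).trans ?_
    rw [DGHom.ofHom_v]
    rfl

/-- The underlying graded map of `homBimod.desc`. -/
def descHom (θ : Bimod.Hom B (homBimod X N)) : DGHom 0 (tensor X B) N :=
  tensorLift (fun t s a b q h => (a * b).negOnePow •
      (homC.ev (show a + b = q by lia) ∘ₗ lin θ s t b).flip)
    (by
      intro t s s' p q r a b c ha hb hc hc' x f m
      simp only [LinearMap.smul_apply, LinearMap.flip_apply, LinearMap.comp_apply]
      rw [lin_map, ev_homBimodAct _ _ _ _ ha (by lia), smul_smul, ← Int.negOnePow_add,
        negOnePow_congr (p * q) (show p * b + q * (r + p) = a * r + 2 * (p * q) by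
          rw [← hb, ← ha]; ring)])
    (by
      intro t t' s a b q b' c c' hb hc hc' x m f
      simp only [LinearMap.smul_apply, LinearMap.flip_apply, LinearMap.comp_apply]
      rw [lin_act _ _ hb, ev_homModAct _ _ _ _ (show a + b = c by lia) (by lia),
        LinearMap.map_smul_of_tower, LinearMap.smul_apply, smul_smul, ← Int.negOnePow_add,
        negOnePow_congr (a * q) (show a * b' + q * a = a * b + 2 * (a * q) by rw [← hb]; ring)])

lemma descHom_tin (θ : Bimod.Hom B (homBimod X N)) {s t : T} {a b p : ℤ} (hab : a + b = p)
    (h : p + 0 = p) (x : (X.obj s).X a) (m : ((B.obj s).obj t).X b) :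
    (((descHom θ).1 t).v p p h).hom (tin hab x m) =
      (a * b).negOnePow • homC.ev hab (lin θ s t b m) x := by
  rw [descHom, tensorLift_tin]
  rfl

lemma δ_descHom (θ : Bimod.Hom B (homBimod X N)) : (descHom θ).δ 0 1 = 0 :=
  tensor_hom_ext fun t s p q a b hpq hab x m => by
    rw [DGHom.δ_apply (by lia) _ _ hpq (add_zero p), tin_d hpq rfl rfl, map_add,
      LinearMap.map_smul_of_tower, descHom_tin, descHom_tin, descHom_tin,
      LinearMap.map_smul_of_tower, ← lin_d, homC.ev_d rfl _ rfl hab]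
    simp only [smul_add, smul_smul, ← Int.negOnePow_add]
    rw [negOnePow_congr_neg a (show 1 + (a + a * (b + 1)) = a * b + 1 + 2 * a by ring),
      negOnePow_congr_neg a (show 1 + (a + (a * (b + 1) + (b + 1))) =
        1 + (a + 1) * b + 1 + 2 * a by ring), Units.neg_smul, Units.neg_smul]
    refine Eq.trans ?_ (show (0 : (N.obj t).X q) = _ by simp)
    abel

/-- The module map `X ⊗ B ⟶ N` corresponding to a bimodule map `B ⟶ Hom(X, N)`. -/
def desc (θ : Bimod.Hom B (homBimod X N)) : tensor X B ⟶ N :=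
  (descHom θ).toHom (δ_descHom θ)

lemma desc_tin (θ : Bimod.Hom B (homBimod X N)) {s t : T} {a b p : ℤ} (hab : a + b = p)
    (x : (X.obj s).X a) (m : ((B.obj s).obj t).X b) :
    ((DGMod.app (desc θ) t).f p).hom (tin hab x m) =
      (a * b).negOnePow • homC.ev hab (lin θ s t b m) x := by
  rw [← descHom_tin θ hab (add_zero p), ← DGHom.ofHom_toHom (descHom θ) (δ_descHom θ),
    DGHom.ofHom_v]
  rfl

lemma tensor_ext_hom {Θ Θ' : tensor X B ⟶ N}
    (h : ∀ (t s : T) (p a b : ℤ) (hab : a + b = p) (x : (X.obj s).X a)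
      (m : ((B.obj s).obj t).X b), ((DGMod.app Θ t).f p).hom (tin hab x m) =
        ((DGMod.app Θ' t).f p).hom (tin hab x m)) : Θ = Θ' :=
  DGHom.ofHom_injective (tensor_hom_ext fun t s p q a b hpq hab x m => by
    obtain rfl : q = p := by lia
    rw [DGHom.ofHom_v, DGHom.ofHom_v, h])

/-- The sign `(-1)^(|x||b|)` occurs once in `lift` and once in `desc`, hence cancels. Only
components are compared, since that is how lifts of bimodule maps are specified. -/
lemma desc_eq_of_app_eq {θ : Bimod.Hom B (homBimod X N)} {Θ : tensor X B ⟶ N}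
    (h : ∀ s, θ.app s = (lift Θ).app s) : desc θ = Θ :=
  tensor_ext_hom fun t s p a b hab x m => by
    have : lin θ s t b m = liftLin Θ s t b m :=
      congrArg (fun φ : B.obj s ⟶ homMod (X.obj s) N => ((DGMod.app φ t).f b).hom m) (h s)
    rw [desc_tin, this, ev_liftLin, smul_smul, ← Int.negOnePow_add,
      negOnePow_congr (a * b) (show a * b + b * a = 0 + 2 * (a * b) by ring),
      Int.negOnePow_zero, one_smul]

/-- Naturality of the adjunction in `N`: it turns a lift among the bimodules `Hom(X, -)` into a lift
among modules. -/
lemma desc_comp (θ : Bimod.Hom B (homBimod X N)) (p : N ⟶ N')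
    (θ' : Bimod.Hom B (homBimod X N')) (h : ∀ s, θ.app s ≫ (map X p).app s = θ'.app s) :
    desc θ ≫ p = desc θ' :=
  tensor_ext_hom fun t s i a b hab x m => by
    have : lin θ' s t b m = ((homC.map (X.obj s) (DGMod.app p t)).f b).hom (lin θ s t b m) :=
      (congrArg (fun φ : B.obj s ⟶ homMod (X.obj s) N' => ((DGMod.app φ t).f b).hom m) (h s)).symm
    rw [desc_tin, this, homC.ev_map]
    refine (congrArg ((DGMod.app p t).f i).hom (desc_tin θ hab x m)).trans ?_
    rw [LinearMap.map_smul_of_tower]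

end homBimod

/-- Tensor products of cofibrant modules with cofibrant bimodules are cofibrant. -/
lemma IsCofibrant.tensor (hT : IsLocallyCofibrant k T) {X : DGMod k T} {B : Bimod k T}
    (hX : IsCofibrant X) (hB : B.IsCofibrant) : IsCofibrant (tensor X B) := by
  intro N N' p hp Θ
  -- By adjunction, a lift of `X ⊗ B ⟶ N'` along `p` is a lift of `B ⟶ Hom(X, N')` along `Hom(X,
  -- p)`. The latter is a trivial fibration because the values of `X` are cofibrant complexes.
  obtain ⟨θ, hθ⟩ := hB (homBimod.map X p)
    (fun s => homMod.isTrivFib_map (hX.isCofCplx hT s) hp) (homBimod.lift Θ)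
  exact ⟨homBimod.desc θ, (homBimod.desc_comp θ p _ hθ).trans
    (homBimod.desc_eq_of_app_eq fun _ => rfl)⟩

namespace homBimod2

variable {Y : DGMod k T} {C C' : Bimod k T} {Γ : Bimod2 k T}

/-- The components of a bimodule map `Y ⊗ Γ ⟶ C`. -/
def sndApp (Θ : Bimod.Hom (tensSnd Γ Y) C) (x : T) : tensor Y (Γ.obj x) ⟶ C.obj x := Θ.app x

/-- The components of a map `Γ ⟶ Hom(Y, C)`. -/
def fstApp (θ : Bimod2.Hom Γ (homBimod2 Y C)) (x : T) :
    Bimod.Hom (Γ.obj x) (homBimod Y (C.obj x)) := θ.app x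

/-- The components of a map `Γ ⟶ Hom(Y, C)` as module maps. -/
def fstModApp (θ : Bimod2.Hom Γ (homBimod2 Y C)) (x s : T) :
    (Γ.obj x).obj s ⟶ homMod (Y.obj s) (C.obj x) := (θ.app x).app s

lemma sndApp_naturality (Θ : Bimod.Hom (tensSnd Γ Y) C) {x y : T} {q : ℤ}
    (f : (DGCategory.hom (k := k) x y).X q) :
    (tensorMapRight Y (Γ.map f)).comp (DGHom.ofHom (sndApp Θ y)) (add_zero q) =
      (DGHom.ofHom (sndApp Θ x)).comp (C.map f) (zero_add q) := Θ.naturality f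

lemma fstApp_naturality (θ : Bimod2.Hom Γ (homBimod2 Y C)) {x y : T} {q : ℤ}
    (f : (DGCategory.hom (k := k) x y).X q) (s : T) :
    ((Γ.map f).1 s).comp (DGHom.ofHom (fstModApp θ y s)) (add_zero q) =
      (DGHom.ofHom (fstModApp θ x s)).comp (homMod.post (Y.obj s) (C.map f)) (zero_add q) :=
  θ.naturality f s

/-- Naturality for the first left action, read on elements; the sign arises from moving `f` past
`v`. -/
lemma naturality_tin (Θ : Bimod.Hom (tensSnd Γ Y) C) {x y t s : T} {q i p n a b : ℤ}
    (hi : i + p = a) (hn : p + q = n) (hb : a + q = b) (hb' : i + n = b)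
    (f : (DGCategory.hom (k := k) x y).X q) (v : (Y.obj s).X i)
    (γ : (((Γ.obj x).obj s).obj t).X p) :
    (q * i).negOnePow • ((DGMod.app (sndApp Θ y) t).f b).hom
        (tin hb' v (((((Γ.map f).1 s).1 t).v p n hn).hom γ)) =
      (((C.map f).1 t).v a b hb).hom
        (((DGMod.app (sndApp Θ x) t).f a).hom (tin hi v γ)) := by
  have H := congrArg (fun φ : DGHom q (tensor Y (Γ.obj x)) (C.obj y) => ((φ.1 t).v a b hb).hom
    (tin hi v γ)) (sndApp_naturality Θ f)
  rw [DGHom.comp_apply _ _ _ _ hb (add_zero b), DGHom.comp_apply _ _ _ _ (add_zero a) hb,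
    tensorMapRight_tin _ _ _ hn, LinearMap.map_smul_of_tower, DGHom.ofHom_v, DGHom.ofHom_v] at H
  exact H

lemma lift_naturality (Θ : Bimod.Hom (tensSnd Γ Y) C) {x y : T} {q : ℤ}
    (f : (DGCategory.hom (k := k) x y).X q) (s : T) :
    ((Γ.map f).1 s).comp (DGHom.ofHom (homBimod.liftApp (sndApp Θ y) s)) (add_zero q) =
      (DGHom.ofHom (homBimod.liftApp (sndApp Θ x) s)).comp (homMod.post (Y.obj s) (C.map f))
        (zero_add q) :=
  DGHom.ext_apply fun t i j hij γ => by
    rw [DGHom.comp_apply _ _ _ _ hij (add_zero j), DGHom.comp_apply _ _ _ _ (add_zero i) hij,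
      DGHom.ofHom_v, DGHom.ofHom_v, homBimod.liftApp_app, homBimod.liftApp_app]
    refine homC.ext fun a b hab v => ?_
    rw [homBimod.ev_liftLin]
    refine Eq.trans ?_ (homMod.ev_postLin (V := Y.obj s) (C.map f) hij hab rfl (by lia)
      (homBimod.liftLin (sndApp Θ x) s t i γ) v).symm
    rw [homBimod.ev_liftLin, LinearMap.map_smul_of_tower,
      ← naturality_tin Θ rfl hij (by lia) hab, smul_smul, ← Int.negOnePow_add]
    rw [negOnePow_congr 0 (show j * a = i * a + q * a + 2 * 0 by rw [← hij]; ring)]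

/-- The map `Γ ⟶ Hom(Y, C)` corresponding to a bimodule map `Y ⊗ Γ ⟶ C`. -/
def lift (Θ : Bimod.Hom (tensSnd Γ Y) C) : Bimod2.Hom Γ (homBimod2 Y C) where
  app s := homBimod.lift (sndApp Θ s)
  naturality _ _ _ f s := lift_naturality Θ f s

lemma lin_map (θ : Bimod2.Hom Γ (homBimod2 Y C)) {x y s t : T} {p q n : ℤ} (h : p + q = n)
    (f : (DGCategory.hom (k := k) x y).X q) (γ : (((Γ.obj x).obj s).obj t).X p) :
    homBimod.lin (fstApp θ y) s t n (((((Γ.map f).1 s).1 t).v p n h).hom γ) =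
      homMod.postLin (Y.obj s) (C.map f) t p n h (homBimod.lin (fstApp θ x) s t p γ) := by
  have H := congrArg (fun φ : DGHom q ((Γ.obj x).obj s) (homMod (Y.obj s) (C.obj y)) =>
    ((φ.1 t).v p n h).hom γ) (fstApp_naturality θ f s)
  refine Eq.trans ?_ (H.trans ?_)
  · refine Eq.trans ?_ (DGHom.comp_apply ((Γ.map f).1 s) (DGHom.ofHom (fstModApp θ y s))
      (add_zero q) t h (add_zero n) h γ).symm
    rw [DGHom.ofHom_v]
    rfl
  · refine (DGHom.comp_apply (DGHom.ofHom (fstModApp θ x s))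
      (homMod.post (Y.obj s) (C.map f)) (zero_add q) t (add_zero p) h h γ).trans ?_
    rw [DGHom.ofHom_v]
    rfl

lemma desc_naturality (θ : Bimod2.Hom Γ (homBimod2 Y C)) {x y : T} {q : ℤ}
    (f : (DGCategory.hom (k := k) x y).X q) :
    (tensorMapRight Y (Γ.map f)).comp (DGHom.ofHom (homBimod.desc (fstApp θ y))) (add_zero q) =
      (DGHom.ofHom (homBimod.desc (fstApp θ x))).comp (C.map f) (zero_add q) :=
  tensor_hom_ext fun t s i j a b hij hab v γ => by
    rw [DGHom.comp_apply _ _ _ _ hij (add_zero j), DGHom.comp_apply _ _ _ _ (add_zero i) hij,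
      DGHom.ofHom_v, DGHom.ofHom_v, tensorMapRight_tin _ _ _ rfl, LinearMap.map_smul_of_tower,
      homBimod.desc_tin, homBimod.desc_tin, lin_map, homMod.ev_postLin _ _ _ hab hij,
      LinearMap.map_smul_of_tower, smul_smul, ← Int.negOnePow_add,
      negOnePow_congr (q * a) (show q * a + a * (b + q) = a * b + 2 * (q * a) by ring)]

/-- The bimodule map `Y ⊗ Γ ⟶ C` corresponding to a map `Γ ⟶ Hom(Y, C)`. -/
def desc (θ : Bimod2.Hom Γ (homBimod2 Y C)) : Bimod.Hom (tensSnd Γ Y) C where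
  app s := homBimod.desc (fstApp θ s)
  naturality _ _ _ f := desc_naturality θ f

end homBimod2

/-- The same adjunction argument as for modules, one level up: maps from `Y ⊗ Γ` to a bimodule `C`
are maps from `Γ` to the 2-fold bimodule `Hom(Y, C)`, and `Hom` out of the cofibrant complexes
`Y(t)` preserves trivial fibrations. -/
lemma Bimod2.IsCofibrant.tensSnd (hT : IsLocallyCofibrant k T) {Γ : Bimod2 k T} {Y : DGMod k T}
    (hΓ : Γ.IsCofibrant) (hY : DG.IsCofibrant Y) : (tensSnd Γ Y).IsCofibrant := by
  intro C C' p hp Θ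
  obtain ⟨θ, hθ⟩ := hΓ (homBimod2.map Y p)
    (fun s t => homMod.isTrivFib_map (hY.isCofCplx hT t) (hp s)) (homBimod2.lift Θ)
  exact ⟨homBimod2.desc θ, fun s => (homBimod.desc_comp (θ.app s) (p.app s) _ (hθ s)).trans
    (homBimod.desc_eq_of_app_eq fun _ => rfl)⟩

lemma Bimod2.IsCofibrant.prod (hT : IsLocallyCofibrant k T) {Γ : Bimod2 k T} {X Y : DGMod k T}
    (hΓ : Γ.IsCofibrant) (hX : DG.IsCofibrant X) (hY : DG.IsCofibrant Y) :
    DG.IsCofibrant (Γ.prod X Y) :=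
  hX.tensor hT (hΓ.tensSnd hT hY)

/-! ### Flatness of cofibrant bimodules -/

section

/-- By exactness, the cokernel of the incoming differential embeds in the next term by the outgoing
one, and a map from a submodule to an injective module extends. -/
lemma exists_extension_of_acyclic {V : Cplx k} (hV : V.Acyclic) {i j l : ℤ} (hij : i + 1 = j)
    (hjl : j + 1 = l) {J : ModuleCat.{u} k} [Injective J] (g : V.X j →ₗ[k] J)
    (hg : ∀ x, g ((V.d i j).hom x) = 0) :
    ∃ w : V.X l →ₗ[k] J, ∀ x, w ((V.d j l).hom x) = g x := by
  have hS : (V.sc' i j l).Exact := by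
    rw [← V.exactAt_iff' i j l (by simp; lia) (by simpa)]
    exact hV j
  have hg' : (V.sc' i j l).f ≫ ModuleCat.ofHom g = 0 := ModuleCat.hom_ext (LinearMap.ext hg)
  exact ⟨(hS.descToInjective _ hg').hom, fun x =>
    LinearMap.congr_fun (congrArg ModuleCat.Hom.hom (hS.comp_descToInjective _ hg')) x⟩

variable {V K L : Cplx k}

/-- Complexes of maps from an acyclic complex to an injective module in one degree are acyclic. -/
lemma homC.acyclic_of_injective (hV : V.Acyclic) {j : ℤ} [Injective (K.X j)]
    (hK : ∀ q, q ≠ j → ∀ x : K.X q, x = 0) : (homC V K).Acyclic := by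
  rw [acyclic_iff_elements]
  intro a b c hab hbc φ hφ
  -- A map of degree `b` into a complex concentrated in degree `j` has a single component, on `V.X
  -- (j - b)`; being a cocycle means that this component kills boundaries.
  have h0 : ∀ x, homC.ev (show j - b + b = j by lia) φ ((V.d (j - b - 1) (j - b)).hom x) = 0 := by
    intro x
    have := homC.ev_d hbc φ (p := j - b - 1) (p' := j - b) (q := j - 1) (q' := j)
      (by lia) (by lia) (by lia) x
    rw [hφ, hK (j - 1) (by lia) (homC.ev _ φ x), map_zero, map_zero, LinearMap.zero_apply,
      zero_add] at this
    rcases Int.units_eq_one_or c.negOnePow with h | h <;> rw [h] at this <;>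
      simpa using this.symm
  obtain ⟨w, hw⟩ := exists_extension_of_acyclic hV (i := j - b - 1) (j := j - b) (l := j - b + 1)
    (by lia) rfl _ h0
  -- The sign cancels the `(-1)^b` with which the differential of `V` enters the differential of a
  -- map of degree `b - 1`.
  refine ⟨homC.mk fun p q h => if h' : p = j - b + 1 then b.negOnePow •
    ((K.XIsoOfEq (show j = q by lia)).hom.hom ∘ₗ w ∘ₗ (V.XIsoOfEq h').hom.hom) else 0, ?_⟩
  refine homC.ext fun p q h x => ?_
  by_cases hq : q = j
  · subst hq
    obtain rfl : p = q - b := by lia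
    rw [homC.ev_d hab _ rfl (show q - b + a = q - 1 by lia) (by lia), homC.ev_mk, homC.ev_mk,
      dif_neg (by lia), dif_pos rfl]
    simp [smul_smul, Int.units_mul_self, hw]
  · exact (hK q hq _).trans (hK q hq _).symm

/-- Postcomposition with the contraction `inl ∘ snd` of the cone turns a cocycle into a primitive of
it, whatever the complex `V` is. -/
lemma homC.acyclic_coneCplx_id : (homC V (coneCplx (𝟙 L))).Acyclic := by
  rw [acyclic_iff_elements]
  intro a b c hab hbc φ hφ
  refine ⟨homC.mk fun p q h => coneCplx.inl (f := 𝟙 L) (show q + 1 = p + b by lia) ∘ₗ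
    coneCplx.snd (f := 𝟙 L) (p + b) ∘ₗ homC.ev rfl φ, ?_⟩
  refine homC.ext fun p q h x => ?_
  obtain rfl : q = p + b := by lia
  have := homC.ev_d hbc φ (p' := p + 1) (q' := p + b + 1) rfl h (by lia) x
  rw [hφ, map_zero, LinearMap.zero_apply] at this
  have h2 := congrArg (coneCplx.snd (f := 𝟙 L) (p + b + 1)) this
  rw [map_zero, map_add, coneCplx.snd_d rfl, LinearMap.map_smul_of_tower] at h2
  rw [homC.ev_d hab _ rfl (show p + a = p + b - 1 by lia) (by lia)]
  simp only [homC.ev_mk, LinearMap.comp_apply]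
  refine coneCplx.ext rfl ?_ ?_
  · rw [map_add, coneCplx.fst_d (j := p + b) (by lia) rfl, LinearMap.map_smul_of_tower,
      coneCplx.fst_inl]
    have key : ∀ (m : ℤ) (hm : m = p + b + 1) (y : V.X (p + 1)),
        coneCplx.fst (f := 𝟙 L) (show p + b + 1 = p + b + 1 from rfl)
          (coneCplx.inl (f := 𝟙 L) (show p + b + 1 = m from hm.symm)
          (coneCplx.snd (f := 𝟙 L) m (homC.ev (by lia) φ y))) =
        coneCplx.snd (f := 𝟙 L) (p + b + 1) (homC.ev (by lia) φ y) := by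
      rintro _ rfl y
      rw [coneCplx.fst_inl]
    rw [key (p + 1 + b) (add_right_comm p 1 b), show b.negOnePow = -c.negOnePow by rw [← hbc, Int.negOnePow_succ, neg_neg],
      Units.neg_smul]
    rw [HomologicalComplex.id_f, ModuleCat.hom_id, LinearMap.id_apply] at h2
    exact (neg_add _ _).symm.trans (eq_neg_of_add_eq_zero_left
      ((add_assoc _ _ _).symm.trans h2.symm)).symm
  · rw [map_add, coneCplx.snd_d (by lia), LinearMap.map_smul_of_tower,
      coneCplx.fst_inl]
    simp

/-- The projection of a cone to the shift. -/
def coneCplx.toShift (L : Cplx k) : coneCplx (𝟙 L) ⟶ L⟦(1 : ℤ)⟧ where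
  f n := ModuleCat.ofHom (coneCplx.fst (f := 𝟙 L) (show n + 1 = n + 1 from rfl))
  comm' i j hij := ModuleCat.hom_ext (LinearMap.ext fun z => by
    obtain rfl : i + 1 = j := hij
    refine (shift_d_apply L 1 i (i + 1) _).trans ?_
    rw [Int.negOnePow_one, Units.neg_smul, one_smul]
    exact (coneCplx.fst_d rfl rfl z).symm)

lemma coneCplx.toShift_f (L : Cplx k) (n : ℤ) (z : (coneCplx (𝟙 L)).X n) :
    ((coneCplx.toShift L).f n).hom z = coneCplx.fst (f := 𝟙 L) (show n + 1 = n + 1 from rfl) z := rfl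

/-- The source is always acyclic and the target is acyclic by assumption. Surjectivity holds because
the projection of the cone is split by `inl` in each degree, so `V` need not be cofibrant. -/
lemma homC.isTrivFib_map_toShift (h : (homC V (L⟦(1 : ℤ)⟧)).Acyclic) :
    IsTrivFibCplx (homC.map V (coneCplx.toShift L)) := by
  refine ⟨quasiIso_of_acyclic _ homC.acyclic_coneCplx_id h, fun n φ => ?_⟩
  refine ⟨homC.mk fun p q h => coneCplx.inl (f := 𝟙 L) (show q + 1 = q + 1 from rfl) ∘ₗ
    homC.ev h φ, homC.ext fun p q h x => ?_⟩
  rw [homC.ev_map, coneCplx.toShift_f]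
  exact coneCplx.fst_inl (f := 𝟙 L) rfl (homC.ev h φ x : L.X (q + 1))

end

/-- Maps from `A ⊗ B` to a complex `L⟦1⟧` extend over the cone of `L`, if `B` is cofibrant. -/
lemma exists_lift_of_acyclic (hT : IsLocallyCofibrant k T) {A : DGMod k T} {B : Bimod k T}
    (hB : B.IsCofibrant) {L : Cplx k} (hL : ∀ s, (homC (A.obj s) (L⟦(1 : ℤ)⟧)).Acyclic) (t : T)
    (χ : (tensor A B).obj t ⟶ L⟦(1 : ℤ)⟧) :
    ∃ χ' : (tensor A B).obj t ⟶ coneCplx (𝟙 L), χ' ≫ coneCplx.toShift L = χ := by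
  -- Both adjunctions together turn `χ` into a bimodule map from `B` to `Hom(A, coind t (L⟦1⟧))`. To
  -- lift it one needs a trivial fibration on `Hom(A(s), Hom(𝒯(t, x), -))`, where nothing is known
  -- about cofibrancy of `A(s)`. After exchanging the variables the outer one is the cofibrant
  -- complex `𝒯(t, x)`, and the inner map is a trivial fibration by the acyclicity assumption.
  obtain ⟨θ, hθ⟩ := hB (homBimod.map A (coind.map t (coneCplx.toShift L)))
    (fun s => (isTrivFib_iff (homMod.map (A.obj s) (coind.map t (coneCplx.toShift L)))).2
      fun x => homC.isTrivFib_map_map (IsCofCplx.isTrivFib_map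
        (X := DGCategory.hom (k := k) t x) (fun K L p hp => hT t x p hp.1 hp.2)
        (homC.isTrivFib_map_toShift (hL s))))
    (homBimod.lift (coind.lift χ))
  refine ⟨coind.desc (homBimod.desc θ), ?_⟩
  rw [← coind.desc_comp_map, homBimod.desc_comp θ _ _ hθ,
    homBimod.desc_eq_of_app_eq fun _ => rfl, coind.desc_lift]

/-- A map to a complex concentrated in one degree. -/
def toOneDegree {M K : Cplx k} {j : ℤ} (hK : ∀ q, q ≠ j → ∀ x : K.X q, x = 0)
    (g : M.X j →ₗ[k] K.X j) (hg : ∀ i, i + 1 = j → ∀ x, g ((M.d i j).hom x) = 0) : M ⟶ K where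
  f n := if h : n = j then
    (M.XIsoOfEq h).hom ≫ ModuleCat.ofHom g ≫ (K.XIsoOfEq h).inv else 0
  comm' a b hab := ModuleCat.hom_ext (LinearMap.ext fun x => by
    have hab' : a + 1 = b := hab
    by_cases hb : b = j
    · subst hb
      simp [dif_neg (show a ≠ b by lia), hg a hab']
    · exact (hK b hb _).trans (hK b hb _).symm)

lemma toOneDegree_f {M K : Cplx k} {j : ℤ} (hK : ∀ q, q ≠ j → ∀ x : K.X q, x = 0)
    (g : M.X j →ₗ[k] K.X j) (hg : ∀ i, i + 1 = j → ∀ x, g ((M.d i j).hom x) = 0) (x : M.X j) :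
    ((toOneDegree hK g hg).f j).hom x = g x := by
  simp [toOneDegree]

/-- The complex `L` has an injective module containing `E` in degree `j + 1`, so that its shift sits
in degree `j`. -/
lemma exists_oneDegree (j : ℤ) (E : ModuleCat.{u} k) :
    ∃ (L : Cplx k) (g : E →ₗ[k] (L⟦(1 : ℤ)⟧).X j), Function.Injective g ∧
      Injective ((L⟦(1 : ℤ)⟧).X j) ∧ ∀ q, q ≠ j → ∀ x : (L⟦(1 : ℤ)⟧).X q, x = 0 := by
  let L : Cplx k := (HomologicalComplex.single (ModuleCat.{u} k) (ComplexShape.up ℤ) (j + 1)).obj (Injective.under E)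
  let e : Injective.under E ≅ (L⟦(1 : ℤ)⟧).X j :=
    (HomologicalComplex.singleObjXIsoOfEq (ComplexShape.up ℤ) (j + 1) (Injective.under E) (j + 1) rfl).symm
  refine ⟨L, (Injective.ι E ≫ e.hom).hom, (ModuleCat.mono_iff_injective _).1 inferInstance,
    Injective.of_iso e inferInstance, fun q hq x => ?_⟩
  have h : Limits.IsZero (L.X (q + 1)) :=
    HomologicalComplex.isZero_single_obj_X _ _ _ _ (by lia)
  have := ModuleCat.subsingleton_of_isZero h
  exact Subsingleton.elim (α := L.X (q + 1)) _ _

/-- Cofibrant bimodules are flat. -/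
lemma Bimod.IsCofibrant.acyclic_tensor (hT : IsLocallyCofibrant k T) {A : DGMod k T}
    {B : Bimod k T} (hB : B.IsCofibrant) (hA : ∀ s, (A.obj s).Acyclic) (t : T) :
    ((tensor A B).obj t).Acyclic := by
  rw [acyclic_iff_elements]
  intro i j l hij hjl z hz
  -- The injective module contains the cokernel of the differential into degree `j`. The map from
  -- degree `j` to it kills boundaries, so it is a map of complexes to a complex in one degree, and
  -- it detects whether `z` is a boundary.
  obtain ⟨L, g, hg, hJ, hK⟩ := exists_oneDegree j (ModuleCat.of k
    (((tensor A B).obj t).X j ⧸ LinearMap.range (((tensor A B).obj t).d i j).hom))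
  obtain ⟨χ, hχ⟩ := exists_lift_of_acyclic hT hB
    (fun s => homC.acyclic_of_injective (hA s) hK) t (toOneDegree hK (g ∘ₗ Submodule.mkQ _)
      (fun i' hi' x => by
        obtain rfl : i' = i := by lia
        rw [LinearMap.comp_apply, Submodule.mkQ_apply,
          (Submodule.Quotient.mk_eq_zero _).2 (LinearMap.mem_range_self _ x), map_zero]))
  -- The detecting map factors through an acyclic complex, in which the image of the cocycle `z` is
  -- a boundary. Boundaries vanish in a complex concentrated in one degree, so `z` is sent to zero.
  obtain ⟨w, hw⟩ := (acyclic_iff_elements _).1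
    (coneCplx.acyclic_iff.2 (inferInstanceAs (QuasiIso (𝟙 L)))) hij hjl ((χ.f j).hom z)
    (by rw [d_f_apply, hz, map_zero])
  have h1 : g (Submodule.mkQ _ z) = 0 := by
    have h2 := toOneDegree_f hK (g ∘ₗ Submodule.mkQ _) (fun i' hi' x => by
        obtain rfl : i' = i := by lia
        rw [LinearMap.comp_apply, Submodule.mkQ_apply,
          (Submodule.Quotient.mk_eq_zero _).2 (LinearMap.mem_range_self _ x), map_zero]) z
    rw [← hχ] at h2
    refine h2.symm.trans ?_
    change ((coneCplx.toShift L).f j).hom ((χ.f j).hom z) = 0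
    rw [← hw, ← d_f_apply, hK i (by lia) (((coneCplx.toShift L).f i).hom w), map_zero]
  obtain ⟨w, hw⟩ := (Submodule.Quotient.mk_eq_zero _).1 (hg (h1.trans (map_zero g).symm))
  exact ⟨w, hw⟩

lemma isQuasiIso_of_isIso {M N : DGMod k T} (f : M ⟶ N) [IsIso f] : IsQuasiIso f := fun t => by
  have : IsIso (DGMod.app f t) := ⟨DGMod.app (inv f) t,
    by rw [← DGMod.comp_app, IsIso.hom_inv_id, DGMod.id_app],
    by rw [← DGMod.comp_app, IsIso.inv_hom_id, DGMod.id_app]⟩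
  infer_instance

/-- Tensor products with cofibrant bimodules preserve quasi-isomorphisms. -/
lemma Bimod.IsCofibrant.isQuasiIso_map (hT : IsLocallyCofibrant k T) {B : Bimod k T}
    (hB : B.IsCofibrant) {X X' : DGMod k T} {f : X ⟶ X'} (hf : IsQuasiIso f) :
    IsQuasiIso ((tens B).toFunctor.map f) := by
  intro t
  -- The dg functor carries the cone of `f` to a cone of `f ⊗ B`. The former is acyclic and stays so
  -- by flatness, hence the standard cone of `f ⊗ B` is acyclic too.
  let D := (tens B).coneData (cone.data f)
  have h1 : ((tensor (cone f) B).obj t).Acyclic :=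
    hB.acyclic_tensor hT (cone.acyclic_of_isQuasiIso hf) t
  refine coneCplx.acyclic_iff.1 ?_
  have h2 : QuasiIso (DGMod.app D.toCone t) := isQuasiIso_of_isIso _ t
  exact fun i => (exactAt_iff_of_quasiIsoAt (DGMod.app D.toCone t) i).1 (h1 i)

/-! ### Tensor products with non-invertible coherence maps -/

section

/-- A tensor product on a category whose coherence maps need not be invertible. -/
structure LaxTensor (C : Type*) [Category* C] where
  obj : C → C → C
  wl (X : C) {Y Y' : C} (g : Y ⟶ Y') : obj X Y ⟶ obj X Y'
  wr {X X' : C} (f : X ⟶ X') (Y : C) : obj X Y ⟶ obj X' Y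
  wl_id (X Y : C) : wl X (𝟙 Y) = 𝟙 (obj X Y)
  wl_comp (X : C) {Y Y' Y'' : C} (g : Y ⟶ Y') (h : Y' ⟶ Y'') : wl X (g ≫ h) = wl X g ≫ wl X h
  wr_id (X Y : C) : wr (𝟙 X) Y = 𝟙 (obj X Y)
  wr_comp {X X' X'' : C} (f : X ⟶ X') (g : X' ⟶ X'') (Y : C) : wr (f ≫ g) Y = wr f Y ≫ wr g Y
  exchange {X X' Y Y' : C} (f : X ⟶ X') (g : Y ⟶ Y') : wl X g ≫ wr f Y' = wr f Y ≫ wl X' g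
  U : C
  α (X Y Z : C) : obj X (obj Y Z) ⟶ obj (obj X Y) Z
  α_nat₁ {X X' : C} (f : X ⟶ X') (Y Z : C) :
    wr f (obj Y Z) ≫ α X' Y Z = α X Y Z ≫ wr (wr f Y) Z
  α_nat₂ (X : C) {Y Y' : C} (f : Y ⟶ Y') (Z : C) :
    wl X (wr f Z) ≫ α X Y' Z = α X Y Z ≫ wr (wl X f) Z
  α_nat₃ (X Y : C) {Z Z' : C} (f : Z ⟶ Z') :
    wl X (wl Y f) ≫ α X Y Z' = α X Y Z ≫ wl (obj X Y) f
  ℓ (X : C) : obj U X ⟶ X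
  ℓ_nat {X Y : C} (f : X ⟶ Y) : wl U f ≫ ℓ Y = ℓ X ≫ f
  r (X : C) : obj X U ⟶ X
  r_nat {X Y : C} (f : X ⟶ Y) : wr f U ≫ r Y = r X ≫ f
  c (X Y : C) : obj X Y ⟶ obj Y X
  c_nat₁ {X X' : C} (f : X ⟶ X') (Y : C) : wr f Y ≫ c X' Y = c X Y ≫ wl Y f
  c_nat₂ (X : C) {Y Y' : C} (g : Y ⟶ Y') : wl X g ≫ c X Y' = c X Y ≫ wr g X
  pentagon (X Y Z V : C) : α X Y (obj Z V) ≫ α (obj X Y) Z V =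
    wl X (α Y Z V) ≫ α X (obj Y Z) V ≫ wr (α X Y Z) V
  triangle (X Y : C) : α X U Y ≫ wr (r X) Y = wl X (ℓ Y)
  unit_symmetry (X : C) : c X U ≫ ℓ X = r X
  hexagon (X Y Z : C) : wl Y (c X Z) ≫ α Y Z X ≫ c (obj Y Z) X ≫ α X Y Z =
    α Y X Z ≫ wr (c Y X) Z

/-- A class of objects on which the coherence maps of a tensor product are invertible, and a
replacement of the unit in this class. -/
structure LaxTensor.Core {C : Type*} [Category* C] (W : LaxTensor C) (P : ObjectProperty C) where
  obj_mem {X Y : C} (hX : P X) (hY : P Y) : P (W.obj X Y)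
  isIso_α {X Y Z : C} (hX : P X) (hY : P Y) (hZ : P Z) : IsIso (W.α X Y Z)
  symmetry {X Y : C} (hX : P X) (hY : P Y) : W.c X Y ≫ W.c Y X = 𝟙 _
  Q : C
  Q_mem : P Q
  e : Q ⟶ W.U
  isIso_ℓ {X : C} (hX : P X) : IsIso (W.wr e X ≫ W.ℓ X)

namespace LaxTensor

variable {C : Type*} [Category* C] (W : LaxTensor C)

def wlIso (X : C) {Y Y' : C} (g : Y ≅ Y') : W.obj X Y ≅ W.obj X Y' where
  hom := W.wl X g.hom
  inv := W.wl X g.inv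
  hom_inv_id := by rw [← W.wl_comp, g.hom_inv_id, W.wl_id]
  inv_hom_id := by rw [← W.wl_comp, g.inv_hom_id, W.wl_id]

def wrIso {X X' : C} (f : X ≅ X') (Y : C) : W.obj X Y ≅ W.obj X' Y where
  hom := W.wr f.hom Y
  inv := W.wr f.inv Y
  hom_inv_id := by rw [← W.wr_comp, f.hom_inv_id, W.wr_id]
  inv_hom_id := by rw [← W.wr_comp, f.inv_hom_id, W.wr_id]

/-- The tensor product of two morphisms. -/
def th {X X' Y Y' : C} (f : X ⟶ X') (g : Y ⟶ Y') : W.obj X Y ⟶ W.obj X' Y' :=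
  W.wr f Y ≫ W.wl X' g

/-- The joint naturality required of an associator, assembled from naturality in each variable. -/
lemma th_nat_α {X X' Y Y' Z Z' : C} (f : X ⟶ X') (g : Y ⟶ Y') (h : Z ⟶ Z') :
    W.th f (W.th g h) ≫ W.α X' Y' Z' = W.α X Y Z ≫ W.th (W.th f g) h := by
  simp only [th, W.wl_comp, W.wr_comp, Category.assoc]
  rw [W.α_nat₃, reassoc_of% (W.α_nat₂ X' g Z), reassoc_of% (W.α_nat₁ f Y Z)]

namespace Core

variable {W} {P : ObjectProperty C} (A : W.Core P)

/-- The inverse of `α`. -/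
def assoc {X Y Z : C} (hX : P X) (hY : P Y) (hZ : P Z) :
    W.obj (W.obj X Y) Z ≅ W.obj X (W.obj Y Z) :=
  have := A.isIso_α hX hY hZ
  (asIso (W.α X Y Z)).symm

lemma assoc_inv {X Y Z : C} (hX : P X) (hY : P Y) (hZ : P Z) :
    (A.assoc hX hY hZ).inv = W.α X Y Z := rfl

def braid {X Y : C} (hX : P X) (hY : P Y) : W.obj X Y ≅ W.obj Y X where
  hom := W.c X Y
  inv := W.c Y X
  hom_inv_id := A.symmetry hX hY
  inv_hom_id := A.symmetry hY hX

def leftU {X : C} (hX : P X) : W.obj A.Q X ≅ X :=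
  have := A.isIso_ℓ hX
  asIso (W.wr A.e X ≫ W.ℓ X)

lemma leftU_hom {X : C} (hX : P X) : (A.leftU hX).hom = W.wr A.e X ≫ W.ℓ X := rfl

/-- This reduces the right unitor to the left one, so invertibility of the resolved left unitor is
the only condition that `Core` imposes on the units. -/
lemma braid_leftU_hom {X : C} (hX : P X) :
    W.c X A.Q ≫ (A.leftU hX).hom = W.wl X A.e ≫ W.r X := by
  rw [leftU_hom, ← reassoc_of% (W.c_nat₂ X A.e), W.unit_symmetry]

def rightU {X : C} (hX : P X) : W.obj X A.Q ≅ X where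
  hom := W.wl X A.e ≫ W.r X
  inv := (A.leftU hX).inv ≫ W.c A.Q X
  hom_inv_id := by
    rw [← A.braid_leftU_hom hX, Category.assoc, Iso.hom_inv_id_assoc, A.symmetry hX A.Q_mem]
  inv_hom_id := by
    rw [← A.braid_leftU_hom hX, Category.assoc, reassoc_of% (A.symmetry A.Q_mem hX),
      Iso.inv_hom_id]

/-- The full subcategory of the objects on which the coherence maps are invertible. -/
def Cat (_ : W.Core P) : Type _ := P.FullSubcategory

instance : Category A.Cat := inferInstanceAs (Category P.FullSubcategory)

instance : MonoidalCategory A.Cat where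
  tensorObj X Y := ⟨W.obj X.1 Y.1, A.obj_mem X.2 Y.2⟩
  whiskerLeft X _ _ g := ObjectProperty.homMk (W.wl X.1 g.hom)
  whiskerRight f Y := ObjectProperty.homMk (W.wr f.hom Y.1)
  tensorUnit := ⟨A.Q, A.Q_mem⟩
  associator X Y Z := P.isoMk (A.assoc X.2 Y.2 Z.2)
  leftUnitor X := P.isoMk (A.leftU X.2)
  rightUnitor X := P.isoMk (A.rightU X.2)
  tensorHom_def _ _ := rfl
  id_tensorHom_id X Y := P.hom_ext (by
    change W.wr (𝟙 _) _ ≫ W.wl _ (𝟙 _) = 𝟙 _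
    rw [W.wr_id, W.wl_id, Category.id_comp])
  tensorHom_comp_tensorHom f₁ f₂ g₁ g₂ := P.hom_ext (by
    change (W.wr f₁.hom _ ≫ W.wl _ f₂.hom) ≫ W.wr g₁.hom _ ≫ W.wl _ g₂.hom =
      W.wr (f₁.hom ≫ g₁.hom) _ ≫ W.wl _ (f₂.hom ≫ g₂.hom)
    rw [W.wr_comp, W.wl_comp, Category.assoc, Category.assoc, reassoc_of% (W.exchange g₁.hom f₂.hom)])
  whiskerLeft_id X Y := P.hom_ext (W.wl_id _ _)
  id_whiskerRight X Y := P.hom_ext (W.wr_id _ _)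
  associator_naturality {X₁ X₂ X₃ Y₁ Y₂ Y₃} f g h := P.hom_ext (by
    change W.th (W.th f.hom g.hom) h.hom ≫ (A.assoc Y₁.2 Y₂.2 Y₃.2).hom =
      (A.assoc X₁.2 X₂.2 X₃.2).hom ≫ W.th f.hom (W.th g.hom h.hom)
    rw [← Iso.eq_comp_inv, Category.assoc, ← Iso.inv_comp_eq, assoc_inv, assoc_inv, W.th_nat_α])
  leftUnitor_naturality {X Y} f := P.hom_ext (by
    change W.wl _ f.hom ≫ W.wr _ _ ≫ W.ℓ _ = (W.wr _ _ ≫ W.ℓ _) ≫ f.hom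
    rw [reassoc_of% (W.exchange A.e f.hom), W.ℓ_nat, Category.assoc])
  rightUnitor_naturality {X Y} f := P.hom_ext (by
    change W.wr f.hom _ ≫ W.wl _ _ ≫ W.r _ = (W.wl _ _ ≫ W.r _) ≫ f.hom
    rw [← reassoc_of% (W.exchange f.hom A.e), W.r_nat, Category.assoc])
  pentagon X₁ X₂ X₃ X₄ := P.hom_ext (by
    -- The pentagon of `W` is written for `α`, which is the inverse of the associator. Both sides
    -- are made into isomorphisms so that the equation can be inverted.
    have h := congrArg Iso.hom (Iso.ext (W.pentagon X₁.1 X₂.1 X₃.1 X₄.1) :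
      (A.assoc X₁.2 X₂.2 (A.obj_mem X₃.2 X₄.2)).symm ≪≫
        (A.assoc (A.obj_mem X₁.2 X₂.2) X₃.2 X₄.2).symm =
      W.wlIso X₁.1 (A.assoc X₂.2 X₃.2 X₄.2).symm ≪≫
        (A.assoc X₁.2 (A.obj_mem X₂.2 X₃.2) X₄.2).symm ≪≫
          W.wrIso (A.assoc X₁.2 X₂.2 X₃.2).symm X₄.1)
    have h := congrArg Iso.inv (Iso.ext h)
    exact (Category.assoc _ _ _).symm.trans h.symm)
  triangle X Y := P.hom_ext (by
    change (A.assoc X.2 A.Q_mem Y.2).hom ≫ W.wl _ (W.wr _ _ ≫ W.ℓ _) = W.wr (W.wl _ _ ≫ W.r _) _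
    rw [← Iso.eq_inv_comp, assoc_inv, W.wl_comp, W.wr_comp, ← W.triangle,
      reassoc_of% (W.α_nat₂ X.1 A.e Y.1)])

instance : SymmetricCategory A.Cat where
  braiding X Y := P.isoMk (A.braid X.2 Y.2)
  braiding_naturality_right X _ _ g := P.hom_ext (W.c_nat₂ X.1 g.hom)
  braiding_naturality_left f Y := P.hom_ext (W.c_nat₁ f.hom Y.1)
  hexagon_forward X Y Z := P.hom_ext (by
    change (A.assoc X.2 Y.2 Z.2).hom ≫ W.c _ _ ≫ (A.assoc Y.2 Z.2 X.2).hom =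
      W.wr (W.c _ _) _ ≫ (A.assoc Y.2 X.2 Z.2).hom ≫ W.wl _ (W.c _ _)
    -- Inverting the given hexagon yields the forward one, except that the last braiding stands on
    -- the other side of the equation; symmetry of the braiding moves it across.
    have h := congrArg Iso.inv (Iso.ext (W.hexagon X.1 Y.1 Z.1) :
      W.wlIso Y.1 (A.braid X.2 Z.2) ≪≫ (A.assoc Y.2 Z.2 X.2).symm ≪≫
        A.braid (A.obj_mem Y.2 Z.2) X.2 ≪≫ (A.assoc X.2 Y.2 Z.2).symm =
      (A.assoc Y.2 X.2 Z.2).symm ≪≫ W.wrIso (A.braid Y.2 X.2) Z.1)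
    change (((A.assoc X.2 Y.2 Z.2).hom ≫ W.c _ _) ≫ (A.assoc Y.2 Z.2 X.2).hom) ≫
      W.wl _ (W.c _ _) = W.wr (W.c _ _) _ ≫ (A.assoc Y.2 X.2 Z.2).hom at h
    rw [← Category.assoc (W.wr _ _), ← h, Category.assoc, Category.assoc, Category.assoc,
      ← W.wl_comp, A.symmetry Z.2 X.2, W.wl_id, Category.comp_id])
  hexagon_reverse X Y Z := P.hom_ext (by
    change W.α _ _ _ ≫ W.c _ _ ≫ W.α _ _ _ = W.wl _ (W.c _ _) ≫ W.α _ _ _ ≫ W.wr (W.c _ _) _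
    -- The reverse hexagon already involves inverse associators, so the given one applies directly
    -- after one pair of mutually inverse braidings has been cancelled.
    rw [← W.hexagon, ← reassoc_of% (W.wl_comp X.1 (W.c Y.1 Z.1)), A.symmetry Y.2 Z.2, W.wl_id,
      Category.id_comp])
  symmetry X Y := P.hom_ext (A.symmetry X.2 Y.2)

end Core

end LaxTensor

end

/-! ### The tensor product on the homotopy category -/

section

variable {X Y Z : HoMod k T}

/-- The homotopy class of a morphism. -/
def hoMk (f : X.as ⟶ Y.as) : X ⟶ Y := (toHo k T).map f

lemma hoMk_surjective (f : X ⟶ Y) : ∃ g : X.as ⟶ Y.as, hoMk g = f :=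
  (toHo k T).map_surjective (X := X.as) (Y := Y.as) f

lemma hoMk_comp (f : X.as ⟶ Y.as) (g : Y.as ⟶ Z.as) : hoMk f ≫ hoMk g = hoMk (f ≫ g) :=
  ((toHo k T).map_comp f g).symm

lemma hoMk_square {Y' : HoMod k T} {f : X.as ⟶ Y.as} {g : Y.as ⟶ Z.as} {f' : X.as ⟶ Y'.as}
    {g' : Y'.as ⟶ Z.as} (h : f ≫ g = f' ≫ g') : hoMk f ≫ hoMk g = hoMk f' ≫ hoMk g' := by
  rw [hoMk_comp, hoMk_comp, h]

lemma hoMk_id (X : HoMod k T) : hoMk (𝟙 X.as) = 𝟙 X := (toHo k T).map_id X.as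

lemma hoMk_eq {f g : X.as ⟶ Y.as} (h : homotopic f g) : hoMk f = hoMk g := toHo_map_eq h

lemma hoMk_eq_of_isHomotopy {f g : X.as ⟶ Y.as} {h : DGHom (-1) X.as Y.as}
    (H : IsHomotopy h f g) : hoMk f = hoMk g := toHo_map_eq ⟨h, H⟩

lemma isIso_hoMk {f : X.as ⟶ Y.as} (hf : IsQuasiIso f) (hX : cof k T X) (hY : cof k T Y) :
    IsIso (hoMk f) := isIso_toHo_map_of_isQuasiIso hf hX hY

end

lemma IsNat.mapHom_comp {F G : DGFunctor k T} {η : ∀ X, F.obj X ⟶ G.obj X}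
    (h : IsNat F G η) {X Y : DGMod k T} (f : X ⟶ Y) :
    F.mapHom f ≫ η Y = η X ≫ G.mapHom f :=
  DGHom.ofHom_injective (by
    rw [DGHom.ofHom_comp, DGHom.ofHom_comp, F.ofHom_mapHom, G.ofHom_mapHom]
    simpa using h (add_zero 0) (DGHom.ofHom f))

lemma DGFunctor.comp_mapHom (F G : DGFunctor k T) {X Y : DGMod k T} (f : X ⟶ Y) :
    (F.comp G).mapHom f = G.mapHom (F.mapHom f) :=
  DGHom.ofHom_injective (((F.comp G).ofHom_mapHom f).trans
    ((congrArg G.map (F.ofHom_mapHom f)).symm.trans (G.ofHom_mapHom (F.mapHom f)).symm))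

lemma DGFunctor.id_mapHom {X Y : DGMod k T} (f : X ⟶ Y) :
    (DGFunctor.id (k := k) (T := T)).mapHom f = f :=
  DGHom.ofHom_injective (DGFunctor.ofHom_mapHom _ f)

lemma IsNat.comp_mapHom_comp {F G H : DGFunctor k T}
    {η : ∀ X, (F.comp G).obj X ⟶ H.obj X} (h : IsNat (F.comp G) H η) {X Y : DGMod k T}
    (f : X ⟶ Y) : G.mapHom (F.mapHom f) ≫ η Y = η X ≫ H.mapHom f :=
  (congrArg (· ≫ η Y) (F.comp_mapHom G f)).symm.trans (h.mapHom_comp f)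

lemma IsNat.mapHom_comp_comp {F H K : DGFunctor k T}
    {η : ∀ X, F.obj X ⟶ (H.comp K).obj X} (h : IsNat F (H.comp K) η) {X Y : DGMod k T}
    (f : X ⟶ Y) : F.mapHom f ≫ η Y = η X ≫ K.mapHom (H.mapHom f) :=
  (h.mapHom_comp f).trans (congrArg (η X ≫ ·) (H.comp_mapHom K f))

lemma IsNat.comp_mapHom_comp_comp {F G H K : DGFunctor k T}
    {η : ∀ X, (F.comp G).obj X ⟶ (H.comp K).obj X} (h : IsNat (F.comp G) (H.comp K) η)
    {X Y : DGMod k T} (f : X ⟶ Y) :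
    G.mapHom (F.mapHom f) ≫ η Y = η X ≫ K.mapHom (H.mapHom f) :=
  h.comp_mapHom_comp f |>.trans (congrArg (η X ≫ ·) (H.comp_mapHom K f))

/-- The functor on the homotopy category induced by a dg functor. -/
def DGFunctor.hoMap (F : DGFunctor k T) {X Y : HoMod k T} (f : X ⟶ Y) :
    (⟨F.obj X.as⟩ : HoMod k T) ⟶ ⟨F.obj Y.as⟩ := F.onHo.map f

lemma DGFunctor.hoMap_id (F : DGFunctor k T) (X : HoMod k T) : F.hoMap (𝟙 X) = 𝟙 _ :=
  F.onHo.map_id X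

lemma DGFunctor.hoMap_comp (F : DGFunctor k T) {X Y Z : HoMod k T} (f : X ⟶ Y) (g : Y ⟶ Z) :
    F.hoMap (f ≫ g) = F.hoMap f ≫ F.hoMap g :=
  F.onHo.map_comp f g

namespace Bimod2

variable (Γ : Bimod2 k T)

def mapR (X : DGMod k T) {Y Y' : DGMod k T} (g : Y ⟶ Y') : Γ.prod X Y ⟶ Γ.prod X Y' :=
  (Γ.prodR X).mapHom g

def mapL {X X' : DGMod k T} (f : X ⟶ X') (Y : DGMod k T) : Γ.prod X Y ⟶ Γ.prod X' Y :=
  (Γ.prodL Y).mapHom f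

/-- For graded maps the two functorialities commute up to the sign `(-1)^(|f||g|)`, which is trivial
in degree `0`. -/
lemma mapR_comp_mapL {X X' Y Y' : DGMod k T} (f : X ⟶ X') (g : Y ⟶ Y') :
    Γ.mapR X g ≫ Γ.mapL f Y' = Γ.mapL f Y ≫ Γ.mapR X' g := by
  refine DGHom.ofHom_injective ((DGHom.ofHom_comp _ _).trans
    (Eq.trans ?_ (DGHom.ofHom_comp _ _).symm))
  have h1 : DGHom.ofHom (Γ.mapR X g) = tensorMapRight X (tensSndMap Γ (DGHom.ofHom g)) :=
    (Γ.prodR X).ofHom_mapHom g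
  have h2 : DGHom.ofHom (Γ.mapR X' g) = tensorMapRight X' (tensSndMap Γ (DGHom.ofHom g)) :=
    (Γ.prodR X').ofHom_mapHom g
  have h3 : DGHom.ofHom (Γ.mapL f Y) = tensorMapLeft (tensSnd Γ Y) (DGHom.ofHom f) :=
    (Γ.prodL Y).ofHom_mapHom f
  have h4 : DGHom.ofHom (Γ.mapL f Y') = tensorMapLeft (tensSnd Γ Y') (DGHom.ofHom f) :=
    (Γ.prodL Y').ofHom_mapHom f
  rw [h1, h2, h3, h4]
  refine (tensorMapLeft_comp_right (DGHom.ofHom f) (tensSndMap Γ (DGHom.ofHom g))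
    (add_zero 0)).trans ?_
  rw [zero_mul, Int.negOnePow_zero, one_smul]
  rfl

def hoR (X : HoMod k T) {Y Y' : HoMod k T} (g : Y ⟶ Y') :
    (⟨Γ.prod X.as Y.as⟩ : HoMod k T) ⟶ ⟨Γ.prod X.as Y'.as⟩ := (Γ.prodR X.as).hoMap g

def hoL {X X' : HoMod k T} (f : X ⟶ X') (Y : HoMod k T) :
    (⟨Γ.prod X.as Y.as⟩ : HoMod k T) ⟶ ⟨Γ.prod X'.as Y.as⟩ := (Γ.prodL Y.as).hoMap f

end Bimod2

namespace PseudoDGTensorStructure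

variable (S : PseudoDGTensorStructure k T)

section

variable {X X' Y Y' Z Z' : DGMod k T}

lemma α_mapL (f : X ⟶ X') (Y Z : DGMod k T) :
    S.Γ.mapL f (S.Γ.prod Y Z) ≫ S.α X' Y Z = S.α X Y Z ≫ S.Γ.mapL (S.Γ.mapL f Y) Z :=
  (S.α_nat₁ Y Z).mapHom_comp_comp f

lemma α_mapR_mapL (X : DGMod k T) (f : Y ⟶ Y') (Z : DGMod k T) :
    S.Γ.mapR X (S.Γ.mapL f Z) ≫ S.α X Y' Z = S.α X Y Z ≫ S.Γ.mapL (S.Γ.mapR X f) Z :=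
  (S.α_nat₂ X Z).comp_mapHom_comp_comp f

lemma α_mapR (X Y : DGMod k T) (f : Z ⟶ Z') :
    S.Γ.mapR X (S.Γ.mapR Y f) ≫ S.α X Y Z' = S.α X Y Z ≫ S.Γ.mapR (S.Γ.prod X Y) f :=
  (S.α_nat₃ X Y).comp_mapHom_comp f

lemma ℓ_mapR (f : X ⟶ X') : S.Γ.mapR S.U f ≫ S.ℓ X' = S.ℓ X ≫ f :=
  (S.ℓ_nat.mapHom_comp f).trans (congrArg (S.ℓ X ≫ ·) (DGFunctor.id_mapHom f))

lemma r_mapL (f : X ⟶ X') : S.Γ.mapL f S.U ≫ S.r X' = S.r X ≫ f :=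
  (S.r_nat.mapHom_comp f).trans (congrArg (S.r X ≫ ·) (DGFunctor.id_mapHom f))

lemma c_mapL (f : X ⟶ X') (Y : DGMod k T) :
    S.Γ.mapL f Y ≫ S.c X' Y = S.c X Y ≫ S.Γ.mapR Y f :=
  (S.c_nat₁ Y).mapHom_comp f

lemma c_mapR (X : DGMod k T) (g : Y ⟶ Y') :
    S.Γ.mapR X g ≫ S.c X Y' = S.c X Y ≫ S.Γ.mapL g X :=
  (S.c_nat₂ X).mapHom_comp g

end

/-- The tensor product on the homotopy category. -/
def laxTensor : LaxTensor (HoMod k T) where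
  obj X Y := ⟨S.Γ.prod X.as Y.as⟩
  wl X _ _ g := S.Γ.hoR X g
  wr f Y := S.Γ.hoL f Y
  wl_id X Y := (S.Γ.prodR X.as).hoMap_id Y
  wl_comp X _ _ _ g h := (S.Γ.prodR X.as).hoMap_comp g h
  wr_id X Y := (S.Γ.prodL Y.as).hoMap_id X
  wr_comp f g Y := (S.Γ.prodL Y.as).hoMap_comp f g
  exchange f g := by
    obtain ⟨f, rfl⟩ := hoMk_surjective f
    obtain ⟨g, rfl⟩ := hoMk_surjective g
    exact hoMk_square (S.Γ.mapR_comp_mapL f g)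
  U := ⟨S.U⟩
  α X Y Z := hoMk (S.α X.as Y.as Z.as)
  α_nat₁ f Y Z := by
    obtain ⟨f, rfl⟩ := hoMk_surjective f
    exact hoMk_square (S.α_mapL f Y.as Z.as)
  α_nat₂ X _ _ f Z := by
    obtain ⟨f, rfl⟩ := hoMk_surjective f
    exact hoMk_square (S.α_mapR_mapL X.as f Z.as)
  α_nat₃ X Y Z Z' f := by
    obtain ⟨f, rfl⟩ := hoMk_surjective f
    exact hoMk_square (S.α_mapR X.as Y.as f)
  ℓ X := hoMk (S.ℓ X.as)
  ℓ_nat {X Y} f := by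
    obtain ⟨f, rfl⟩ := hoMk_surjective f
    exact hoMk_square (S.ℓ_mapR f)
  r X := hoMk (S.r X.as)
  r_nat {X Y} f := by
    obtain ⟨f, rfl⟩ := hoMk_surjective f
    exact hoMk_square (S.r_mapL f)
  c X Y := hoMk (S.c X.as Y.as)
  c_nat₁ f Y := by
    obtain ⟨f, rfl⟩ := hoMk_surjective f
    exact hoMk_square (S.c_mapL f Y.as)
  c_nat₂ X _ _ g := by
    obtain ⟨g, rfl⟩ := hoMk_surjective g
    exact hoMk_square (S.c_mapR X.as g)
  pentagon X Y Z V := by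
    obtain ⟨η, -, -, -, -, h⟩ := S.pentagon
    exact hoMk_eq_of_isHomotopy (h X.as Y.as Z.as V.as)
  triangle X Y := by
    obtain ⟨η, -, -, h⟩ := S.triangle
    exact hoMk_eq_of_isHomotopy (h X.as Y.as)
  unit_symmetry X := by
    obtain ⟨η, -, h⟩ := S.unit_symmetry
    exact hoMk_eq_of_isHomotopy (h X.as)
  hexagon X Y Z := by
    obtain ⟨η, -, -, -, h⟩ := S.hexagon
    exact hoMk_eq_of_isHomotopy (h X.as Y.as Z.as)

variable {S}

lemma isQuasiIso_comp {M N P : DGMod k T} {f : M ⟶ N} {g : N ⟶ P} (hf : IsQuasiIso f)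
    (hg : IsQuasiIso g) : IsQuasiIso (f ≫ g) := fun t => by
  have := hf t
  have := hg t
  rw [DGMod.comp_app]
  infer_instance

/-- The homotopy category of cofibrant modules is monoidal. -/
def IsPerfect.core (hT : IsLocallyCofibrant k T) (hS : S.IsPerfect) :
    S.laxTensor.Core (cof k T) where
  obj_mem hX hY := hS.cofibrant.prod hT hX hY
  isIso_α {X Y Z} hX hY hZ := isIso_hoMk (S.α_iso _ _ _ hX hY hZ)
    (hS.cofibrant.prod hT hX (hS.cofibrant.prod hT hY hZ))
    (hS.cofibrant.prod hT (hS.cofibrant.prod hT hX hY) hZ)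
  symmetry {X Y} hX hY := (hoMk_comp _ _).trans
    ((hoMk_eq (S.symmetry _ _ hX hY)).trans (hoMk_id _))
  Q := ⟨hS.unit.choose⟩
  Q_mem := hS.unit.choose_spec.choose_spec.1.1
  e := hoMk hS.unit.choose_spec.choose
  isIso_ℓ {X} hX := by
    -- The unit `U` need not be cofibrant, so its resolution is not known to be invertible in the
    -- homotopy category. Flatness of the bimodule `X ⊗ Γ` still makes its product with `X` a
    -- quasi-isomorphism; composed with `ℓ` this becomes one between cofibrant modules.
    have h1 : IsQuasiIso (S.Γ.mapL hS.unit.choose_spec.choose X.as) :=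
      (hS.cofibrant.tensSnd hT hX).isQuasiIso_map hT hS.unit.choose_spec.choose_spec.2
    have h2 := isIso_hoMk (X := ⟨S.Γ.prod hS.unit.choose X.as⟩) (Y := X)
      (isQuasiIso_comp h1 (S.ℓ_iso X.as hX))
      (hS.cofibrant.prod hT hS.unit.choose_spec.choose_spec.1.1 hX) hX
    exact h2

end PseudoDGTensorStructure

/-! ### Pulling back symmetric monoidal structures along fully faithful functors -/

section

open MonoidalCategory

/-- Tensor products in the essential image of a functor. -/
structure TensorReplacement {E D : Type*} [Category* E] [Category* D] [MonoidalCategory D]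
    (F : E ⥤ D) where
  obj : E → E → E
  iso (X Y : E) : F.obj (obj X Y) ≅ F.obj X ⊗ F.obj Y
  one : E
  unitIso : F.obj one ≅ 𝟙_ D

namespace TensorReplacement

variable {E D : Type*} [Category* E] [Category* D] [MonoidalCategory D] {F : E ⥤ D}
  (R : TensorReplacement F) [F.Full] [F.Faithful]

-- Each structure map is the preimage of the corresponding map of `D`, conjugated by the comparison
-- isomorphisms. The axioms hold because they hold after applying the faithful functor `F`.
@[reducible]
def monoidalStruct : MonoidalCategoryStruct E where
  tensorObj := R.obj
  whiskerLeft X _ _ g := F.preimage ((R.iso _ _).hom ≫ F.obj X ◁ F.map g ≫ (R.iso _ _).inv)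
  whiskerRight f Y := F.preimage ((R.iso _ _).hom ≫ F.map f ▷ F.obj Y ≫ (R.iso _ _).inv)
  tensorHom f g := F.preimage ((R.iso _ _).hom ≫ (F.map f ⊗ₘ F.map g) ≫ (R.iso _ _).inv)
  tensorUnit := R.one
  associator _ _ _ := F.preimageIso (R.iso _ _ ≪≫ (R.iso _ _ ⊗ᵢ Iso.refl _) ≪≫ α_ _ _ _ ≪≫
    (Iso.refl _ ⊗ᵢ (R.iso _ _).symm) ≪≫ (R.iso _ _).symm)
  leftUnitor _ := F.preimageIso (R.iso _ _ ≪≫ (R.unitIso ⊗ᵢ Iso.refl _) ≪≫ λ_ _)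
  rightUnitor _ := F.preimageIso (R.iso _ _ ≪≫ (Iso.refl _ ⊗ᵢ R.unitIso) ≪≫ ρ_ _)

@[reducible]
def inducingData :
    letI := R.monoidalStruct
    Monoidal.InducingFunctorData F :=
  letI := R.monoidalStruct
  { μIso := fun X Y => (R.iso X Y).symm
    whiskerLeft_eq := fun _ _ _ _ => F.map_preimage _
    whiskerRight_eq := fun _ _ => F.map_preimage _
    tensorHom_eq := fun _ _ => F.map_preimage _
    εIso := R.unitIso.symm
    associator_eq := fun _ _ _ => (F.map_preimage _).trans (by simp; rfl)
    leftUnitor_eq := fun _ => (F.map_preimage _).trans (by simp; rfl)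
    rightUnitor_eq := fun _ => (F.map_preimage _).trans (by simp; rfl) }

@[reducible]
def monoidal : MonoidalCategory E :=
  letI := R.monoidalStruct
  Monoidal.induced F R.inducingData

@[reducible]
def functorMonoidal :
    letI := R.monoidal
    F.Monoidal :=
  letI := R.monoidalStruct
  Monoidal.fromInducedMonoidal F R.inducingData

lemma map_whiskerLeft (X : E) {Y Y' : E} (g : Y ⟶ Y') :
    F.map (R.monoidal.whiskerLeft X g) ≫ (R.iso X Y').hom =
      (R.iso X Y).hom ≫ F.obj X ◁ F.map g := by
  rw [show F.map (R.monoidal.whiskerLeft X g) = _ from F.map_preimage _, Category.assoc,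
    Category.assoc, Iso.inv_hom_id, Category.comp_id]

lemma map_whiskerRight {X X' : E} (f : X ⟶ X') (Y : E) :
    F.map (R.monoidal.whiskerRight f Y) ≫ (R.iso X' Y).hom =
      (R.iso X Y).hom ≫ F.map f ▷ F.obj Y := by
  rw [show F.map (R.monoidal.whiskerRight f Y) = _ from F.map_preimage _, Category.assoc,
    Category.assoc, Iso.inv_hom_id, Category.comp_id]

lemma map_associator_inv (X Y Z : E) :
    F.map (R.monoidal.associator X Y Z).inv ≫ (R.iso (R.obj X Y) Z).hom ≫
      (R.iso X Y).hom ▷ F.obj Z =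
    (R.iso X (R.obj Y Z)).hom ≫ F.obj X ◁ (R.iso Y Z).hom ≫ (α_ _ _ _).inv := by
  rw [show F.map (R.monoidal.associator X Y Z).inv = _ from F.map_preimage _]
  simp

lemma map_leftUnitor_hom (X : E) : F.map (R.monoidal.leftUnitor X).hom =
    (R.iso R.one X).hom ≫ R.unitIso.hom ▷ F.obj X ≫ (λ_ _).hom :=
  (F.map_preimage _).trans (by simp)

lemma map_rightUnitor_hom (X : E) : F.map (R.monoidal.rightUnitor X).hom =
    (R.iso X R.one).hom ≫ F.obj X ◁ R.unitIso.hom ≫ (ρ_ _).hom :=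
  (F.map_preimage _).trans (by simp)

variable [SymmetricCategory D]

@[reducible]
def braided : letI := R.monoidal; BraidedCategory E :=
  letI := R.monoidal
  letI := R.functorMonoidal
  BraidedCategory.ofFaithful F
    (fun X Y => F.preimageIso (R.iso X Y ≪≫ β_ _ _ ≪≫ (R.iso Y X).symm))
    (fun X Y => by
      rw [Functor.preimageIso_hom, F.map_preimage]
      change (R.iso X Y).inv ≫ (R.iso X Y).hom ≫ _ ≫ (R.iso Y X).inv = _ ≫ (R.iso Y X).inv
      rw [Iso.inv_hom_id_assoc])

@[reducible]
def symmetric : letI := R.monoidal; SymmetricCategory E :=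
  letI := R.monoidal
  letI := R.braided
  { symmetry := fun X Y => F.map_injective (by
      rw [F.map_comp, F.map_id]
      change F.map (F.preimage _) ≫ F.map (F.preimage _) = _
      rw [F.map_preimage, F.map_preimage]
      change ((R.iso X Y).hom ≫ _ ≫ (R.iso Y X).inv) ≫ (R.iso Y X).hom ≫ _ ≫ (R.iso X Y).inv = _
      simp
      rfl) }

lemma map_braiding_hom (X Y : E) : F.map (R.symmetric.braiding X Y).hom ≫ (R.iso Y X).hom =
    (R.iso X Y).hom ≫ (β_ (F.obj X) (F.obj Y)).hom := by
  rw [show F.map (R.symmetric.braiding X Y).hom = _ from F.map_preimage _]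
  simp

end TensorReplacement

end

/-! ### The induced tensor triangulated category -/

section

open MonoidalCategory Pretriangulated

/-- A functor between full triangulated subcategories which is the restriction of a triangulated
functor is triangulated. -/
lemma exists_isTriangulated_of_iso {C : Type*} [Category* C] [Preadditive C] [HasShift C ℤ]
    [Limits.HasZeroObject C] [∀ n : ℤ, (shiftFunctor C n).Additive] [Pretriangulated C]
    (P : ObjectProperty C) [P.IsTriangulated] (K : C ⥤ C) [K.CommShift ℤ] [K.IsTriangulated]
    (G : P.FullSubcategory ⥤ P.FullSubcategory) (e : G ⋙ P.ι ≅ P.ι ⋙ K) :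
    ∃ _ : G.CommShift ℤ, G.IsTriangulated := by
  let i : G.CommShift ℤ := Functor.CommShift.ofComp e ℤ
  have := Functor.CommShift.ofComp_compatibility e ℤ
  exact ⟨i, (Functor.isTriangulated_iff_comp_right e).2 inferInstance⟩

lemma toHo_map_comp₃ {X Y Z V : DGMod k T} (f : X ⟶ Y) (g : Y ⟶ Z) (h : Z ⟶ V) :
    (toHo k T).map (f ≫ g ≫ h) = (toHo k T).map f ≫ (toHo k T).map g ≫ (toHo k T).map h := by
  rw [(toHo k T).map_comp, (toHo k T).map_comp]

namespace PseudoDGTensorStructure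

variable {S : PseudoDGTensorStructure k T}

namespace IsPerfect

variable (hT : IsLocallyCofibrant k T) (hS : S.IsPerfect)

/-- The inclusion of the perfect modules into the cofibrant modules. -/
def incl : H0pe k T ⥤ (hS.core hT).Cat := ObjectProperty.ιOfLE perf_le_cof

instance : (hS.incl hT).Full :=
  inferInstanceAs (ObjectProperty.ιOfLE (perf_le_cof (k := k) (T := T))).Full

instance : (hS.incl hT).Faithful :=
  inferInstanceAs (ObjectProperty.ιOfLE (perf_le_cof (k := k) (T := T))).Faithful

/-- A perfect replacement of a tensor product. -/
def prodObj (X Y : H0pe k T) : H0pe k T :=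
  ⟨⟨(hS.prod X.mod Y.mod X.property Y.property).choose⟩,
    (hS.prod X.mod Y.mod X.property Y.property).choose_spec.choose_spec.1⟩

def prodMap (X Y : H0pe k T) : (hS.prodObj X Y).mod ⟶ S.Γ.prod X.mod Y.mod :=
  (hS.prod X.mod Y.mod X.property Y.property).choose_spec.choose

lemma isQuasiIso_prodMap (X Y : H0pe k T) : IsQuasiIso (hS.prodMap X Y) :=
  (hS.prod X.mod Y.mod X.property Y.property).choose_spec.choose_spec.2

/-- A perfect replacement of the unit. -/
def unitObj : H0pe k T :=
  ⟨⟨hS.unit.choose⟩, hS.unit.choose_spec.choose_spec.1⟩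

def unitMap : hS.unitObj.mod ⟶ S.U := hS.unit.choose_spec.choose

lemma isQuasiIso_unitMap : IsQuasiIso hS.unitMap := hS.unit.choose_spec.choose_spec.2

/-- The chosen resolution is a quasi-isomorphism between cofibrant modules. Thus products of perfect
modules are perfect up to isomorphism in the homotopy category, as required for the pullback of the
structure. -/
def prodIso (X Y : H0pe k T) : (hS.prodObj X Y).obj ≅ (⟨S.Γ.prod X.mod Y.mod⟩ : HoMod k T) :=
  have : IsIso (hoMk (X := (hS.prodObj X Y).obj) (Y := ⟨S.Γ.prod X.mod Y.mod⟩) (hS.prodMap X Y)) :=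
    isIso_hoMk (hS.isQuasiIso_prodMap X Y) (hS.prodObj X Y).property.1
      (hS.cofibrant.prod hT X.property.1 Y.property.1)
  asIso (hoMk (X := (hS.prodObj X Y).obj) (Y := ⟨S.Γ.prod X.mod Y.mod⟩) (hS.prodMap X Y))

/-- The unit chosen for the cofibrant modules is already a perfect module, and the same choice is
made here, so the unit comparison is an identity. -/
def replacement : TensorReplacement (hS.incl hT) where
  obj := hS.prodObj
  iso X Y := (cof k T).isoMk (hS.prodIso hT X Y)
  one := hS.unitObj
  unitIso := (cof k T).isoMk (Iso.refl _)

lemma whiskerLeft_eq (X : H0pe k T) {Y Y' : H0pe k T} (g : Y ⟶ Y') :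
    H0pe.cls ((hS.replacement hT).monoidal.whiskerLeft X g) ≫ (hS.prodIso hT X Y').hom =
      (hS.prodIso hT X Y).hom ≫ (S.Γ.prodR X.mod).onHo.map (H0pe.cls g) := by
  have h := congrArg (fun f => InducedCategory.Hom.hom f) ((hS.replacement hT).map_whiskerLeft X g)
  exact h

lemma whiskerRight_eq {X X' : H0pe k T} (f : X ⟶ X') (Y : H0pe k T) :
    H0pe.cls ((hS.replacement hT).monoidal.whiskerRight f Y) ≫ (hS.prodIso hT X' Y).hom =
      (hS.prodIso hT X Y).hom ≫ (S.Γ.prodL Y.mod).onHo.map (H0pe.cls f) := by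
  have h := congrArg (fun f => InducedCategory.Hom.hom f) ((hS.replacement hT).map_whiskerRight f Y)
  exact h

/-- After inclusion in the homotopy category of all modules, tensoring becomes the functor of a dg
functor. Additivity, linearity and exactness are inherited through this isomorphism and its
counterpart for the other variable. -/
def tensorLeftIso (X : H0pe k T) :
    letI := (hS.replacement hT).monoidal
    tensorLeft X ⋙ (perf k T).ι ≅ (perf k T).ι ⋙ (S.Γ.prodR X.mod).onHo :=
  letI := (hS.replacement hT).monoidal
  NatIso.ofComponents (fun Y => hS.prodIso hT X Y) (fun g => hS.whiskerLeft_eq hT X g)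

def tensorRightIso (Y : H0pe k T) :
    letI := (hS.replacement hT).monoidal
    tensorRight Y ⋙ (perf k T).ι ≅ (perf k T).ι ⋙ (S.Γ.prodL Y.mod).onHo :=
  letI := (hS.replacement hT).monoidal
  NatIso.ofComponents (fun X => hS.prodIso hT X Y) (fun f => hS.whiskerRight_eq hT f Y)

lemma additive_tensorLeft (X : H0pe k T) :
    letI := (hS.replacement hT).monoidal
    (tensorLeft X).Additive := by
  let _ := (hS.replacement hT).monoidal
  have := Functor.additive_of_iso (hS.tensorLeftIso hT X).symm
  exact Functor.additive_of_comp_faithful _ (perf k T).ι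

lemma additive_tensorRight (X : H0pe k T) :
    letI := (hS.replacement hT).monoidal
    (tensorRight X).Additive := by
  let _ := (hS.replacement hT).monoidal
  have := Functor.additive_of_iso (hS.tensorRightIso hT X).symm
  exact Functor.additive_of_comp_faithful _ (perf k T).ι

lemma linear_tensorLeft (X : H0pe k T) :
    letI := (hS.replacement hT).monoidal
    (tensorLeft X).Linear k := by
  let _ := (hS.replacement hT).monoidal
  have := Functor.linear_of_iso k (hS.tensorLeftIso hT X).symm
  exact ⟨fun f r => (perf k T).ι.map_injective (((tensorLeft X ⋙ (perf k T).ι).map_smul r f).trans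
    ((perf k T).ι.map_smul r ((tensorLeft X).map f)).symm)⟩

lemma linear_tensorRight (X : H0pe k T) :
    letI := (hS.replacement hT).monoidal
    (tensorRight X).Linear k := by
  let _ := (hS.replacement hT).monoidal
  have := Functor.linear_of_iso k (hS.tensorRightIso hT X).symm
  exact ⟨fun f r => (perf k T).ι.map_injective (((tensorRight X ⋙ (perf k T).ι).map_smul r f).trans
    ((perf k T).ι.map_smul r ((tensorRight X).map f)).symm)⟩

lemma monoidalPreadditive :
    letI := (hS.replacement hT).monoidal
    MonoidalPreadditive (H0pe k T) :=
  letI := (hS.replacement hT).monoidal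
  have := hS.additive_tensorLeft hT
  have := hS.additive_tensorRight hT
  { whiskerLeft_zero := fun {X _ _} => (tensorLeft X).map_zero _ _
    zero_whiskerRight := fun {X _ _} => (tensorRight X).map_zero _ _
    whiskerLeft_add := fun {X _ _} _ _ => (tensorLeft X).map_add
    add_whiskerRight := fun {X _ _} _ _ => (tensorRight X).map_add }

lemma monoidalLinear :
    letI := (hS.replacement hT).monoidal
    haveI := hS.monoidalPreadditive hT
    MonoidalLinear k (H0pe k T) :=
  letI := (hS.replacement hT).monoidal
  haveI := hS.monoidalPreadditive hT
  have := hS.linear_tensorLeft hT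
  have := hS.linear_tensorRight hT
  { whiskerLeft_smul := fun X _ _ r f => (tensorLeft X).map_smul r f
    smul_whiskerRight := fun r _ _ f X => (tensorRight X).map_smul r f }

lemma exact_tensorLeft (X : H0pe k T) :
    letI := (hS.replacement hT).monoidal
    ∃ _ : (tensorLeft X).CommShift ℤ, (tensorLeft X).IsTriangulated :=
  exists_isTriangulated_of_iso (perf k T) _ _ (hS.tensorLeftIso hT X)

lemma exact_tensorRight (X : H0pe k T) :
    letI := (hS.replacement hT).monoidal
    ∃ _ : (tensorRight X).CommShift ℤ, (tensorRight X).IsTriangulated :=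
  exists_isTriangulated_of_iso (perf k T) _ _ (hS.tensorRightIso hT X)

lemma associator_inv_eq (X Y Z : H0pe k T) :
    (toHo k T).map (hS.prodMap X (hS.prodObj Y Z)) ≫
      (toHo k T).map ((S.Γ.prodR X.mod).toFunctor.map (hS.prodMap Y Z)) ≫
        (toHo k T).map (S.α X.mod Y.mod Z.mod) =
    H0pe.cls ((hS.replacement hT).monoidal.associator X Y Z).inv ≫
      (toHo k T).map (hS.prodMap (hS.prodObj X Y) Z) ≫
        (toHo k T).map ((S.Γ.prodL Z.mod).toFunctor.map (hS.prodMap X Y)) := by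
  have h := congrArg (fun f => InducedCategory.Hom.hom f)
    ((hS.replacement hT).map_associator_inv X Y Z)
  exact h.symm

lemma leftUnitor_hom_eq (X : H0pe k T) :
    (toHo k T).map (hS.prodMap hS.unitObj X) ≫
      (toHo k T).map ((S.Γ.prodL X.mod).toFunctor.map hS.unitMap) ≫
        (toHo k T).map (S.ℓ X.mod) =
    H0pe.cls ((hS.replacement hT).monoidal.leftUnitor X).hom := by
  have h₀ := (hS.replacement hT).map_leftUnitor_hom X
  -- With an identity as unit comparison this factor drops out, and what is left is the left unitor
  -- of the cofibrant modules.
  have e : (hS.replacement hT).unitIso.hom ▷ (hS.incl hT).obj X = 𝟙 _ := id_whiskerRight _ _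
  have h := congrArg (fun f => InducedCategory.Hom.hom f)
    (h₀.trans (congrArg (_ ≫ ·) ((congrArg (· ≫ _) e).trans (Category.id_comp _))))
  exact h.symm

lemma rightUnitor_hom_eq (X : H0pe k T) :
    (toHo k T).map (hS.prodMap X hS.unitObj) ≫
      (toHo k T).map ((S.Γ.prodR X.mod).toFunctor.map hS.unitMap) ≫
        (toHo k T).map (S.r X.mod) =
    H0pe.cls ((hS.replacement hT).monoidal.rightUnitor X).hom := by
  have h₀ := (hS.replacement hT).map_rightUnitor_hom X
  have e : (hS.incl hT).obj X ◁ (hS.replacement hT).unitIso.hom = 𝟙 _ := whiskerLeft_id _ _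
  have h := congrArg (fun f => InducedCategory.Hom.hom f)
    (h₀.trans (congrArg (_ ≫ ·) ((congrArg (· ≫ _) e).trans (Category.id_comp _))))
  exact h.symm

lemma braiding_hom_eq (X Y : H0pe k T) :
    (toHo k T).map (hS.prodMap X Y) ≫ (toHo k T).map (S.c X.mod Y.mod) =
      H0pe.cls ((hS.replacement hT).symmetric.braiding X Y).hom ≫
        (toHo k T).map (hS.prodMap Y X) := by
  have h := congrArg (fun f => InducedCategory.Hom.hom f)
    ((hS.replacement hT).map_braiding_hom X Y)
  exact h.symm

/-- The induced tensor triangulated structure on the homotopy category of perfect modules. -/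
def ttc : InducedTTC S where
  pretri := inferInstance
  distinguished_eq := rfl
  isTriangulated := inferInstance
  monoidal := (hS.replacement hT).monoidal
  symmetric := (hS.replacement hT).symmetric
  preadditive := hS.monoidalPreadditive hT
  linear := hS.monoidalLinear hT
  exact_left := hS.exact_tensorLeft hT
  exact_right := hS.exact_tensorRight hT
  κ := hS.prodMap
  κ_iso := hS.isQuasiIso_prodMap
  κ_nat₁ φ Y := (hS.whiskerRight_eq hT φ Y).symm
  κ_nat₂ X _ _ ψ := (hS.whiskerLeft_eq hT X ψ).symm
  κ₁ := hS.unitMap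
  κ₁_iso := hS.isQuasiIso_unitMap
  associator_eq X Y Z := (toHo_map_comp₃ _ _ _).trans
    ((hS.associator_inv_eq hT X Y Z).trans (congrArg (_ ≫ ·) ((toHo k T).map_comp _ _).symm))
  leftUnitor_eq X := (toHo_map_comp₃ _ _ _).trans (hS.leftUnitor_hom_eq hT X)
  rightUnitor_eq X := (toHo_map_comp₃ _ _ _).trans (hS.rightUnitor_hom_eq hT X)
  braiding_eq X Y := ((toHo k T).map_comp _ _).trans (hS.braiding_hom_eq hT X Y)

end IsPerfect

end PseudoDGTensorStructure

end

/-! ### Monoidal functors from tensor functors with non-invertible structure maps -/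

section

open MonoidalCategory

section

variable {C₁ C₂ C₃ C₄ : Type*} [Category* C₁] [Category* C₂] [Category* C₃] [Category* C₄]
  {F : C₁ ⥤ C₂} {F' : C₂ ⥤ C₄} {G : C₁ ⥤ C₃} {G' : C₃ ⥤ C₄} (θ : F ⋙ F' ≅ G ⋙ G')

/-- The components of an isomorphism between composite functors. -/
def cmp (X : C₁) : F'.obj (F.obj X) ≅ G'.obj (G.obj X) := θ.app X

lemma cmp_naturality {X Y : C₁} (f : X ⟶ Y) :
    F'.map (F.map f) ≫ (cmp θ Y).hom = (cmp θ X).hom ≫ G'.map (G.map f) :=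
  θ.hom.naturality f

end

namespace LaxTensor

variable {C : Type*} [Category* C]

/-- A symmetric monoidal category over `C` whose tensor product is identified with `W`. -/
structure Realization (W : LaxTensor C) {E : Type*} [Category* E] [MonoidalCategory E]
    [SymmetricCategory E] (I : E ⥤ C) where
  κ (X Y : E) : I.obj (X ⊗ Y) ⟶ W.obj (I.obj X) (I.obj Y)
  isIso_κ (X Y : E) : IsIso (κ X Y)
  κ_nat₁ {X X' : E} (f : X ⟶ X') (Y : E) :
    I.map (f ▷ Y) ≫ κ X' Y = κ X Y ≫ W.wr (I.map f) (I.obj Y)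
  κ_nat₂ (X : E) {Y Y' : E} (g : Y ⟶ Y') :
    I.map (X ◁ g) ≫ κ X Y' = κ X Y ≫ W.wl (I.obj X) (I.map g)
  κ₁ : I.obj (𝟙_ E) ⟶ W.U
  associator_eq (X Y Z : E) :
    I.map (α_ X Y Z).inv ≫ κ (X ⊗ Y) Z ≫ W.wr (κ X Y) (I.obj Z) =
      κ X (Y ⊗ Z) ≫ W.wl (I.obj X) (κ Y Z) ≫ W.α _ _ _
  leftUnitor_eq (X : E) : I.map (λ_ X).hom = κ (𝟙_ E) X ≫ W.wr κ₁ (I.obj X) ≫ W.ℓ _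
  rightUnitor_eq (X : E) : I.map (ρ_ X).hom = κ X (𝟙_ E) ≫ W.wl (I.obj X) κ₁ ≫ W.r _
  braiding_eq (X Y : E) : I.map (β_ X Y).hom ≫ κ Y X = κ X Y ≫ W.c _ _

/-- A functor compatible with two tensor products. -/
structure TensorFunctor (W W' : LaxTensor C) (Ψ : C ⥤ C) where
  φ (X Y : C) : W'.obj (Ψ.obj X) (Ψ.obj Y) ⟶ Ψ.obj (W.obj X Y)
  φ_nat₁ {X X' : C} (f : X ⟶ X') (Y : C) :
    W'.wr (Ψ.map f) (Ψ.obj Y) ≫ φ X' Y = φ X Y ≫ Ψ.map (W.wr f Y)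
  φ_nat₂ (X : C) {Y Y' : C} (g : Y ⟶ Y') :
    W'.wl (Ψ.obj X) (Ψ.map g) ≫ φ X Y' = φ X Y ≫ Ψ.map (W.wl X g)
  u : W'.U ⟶ Ψ.obj W.U
  unit (X : C) : W'.wr u (Ψ.obj X) ≫ φ W.U X ≫ Ψ.map (W.ℓ X) = W'.ℓ (Ψ.obj X)
  symmetry (X Y : C) : φ X Y ≫ Ψ.map (W.c X Y) = W'.c _ _ ≫ φ Y X
  associativity (X Y Z : C) : W'.α _ _ _ ≫ W'.wr (φ X Y) (Ψ.obj Z) ≫ φ (W.obj X Y) Z =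
    W'.wl (Ψ.obj X) (φ Y Z) ≫ φ X (W.obj Y Z) ≫ Ψ.map (W.α X Y Z)

namespace TensorFunctor

variable {W W' : LaxTensor C} {Ψ : C ⥤ C} (H : W.TensorFunctor W' Ψ)

/-- Compatibility with the right unit follows from that with the left unit, because the braiding
exchanges the two unitors on both sides and `φ` respects the braidings. -/
lemma unit_right (X : C) :
    W'.wl (Ψ.obj X) H.u ≫ H.φ X W.U ≫ Ψ.map (W.r X) = W'.r (Ψ.obj X) := by
  rw [← W.unit_symmetry, Ψ.map_comp, reassoc_of% (H.symmetry X W.U),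
    reassoc_of% (W'.c_nat₂ (Ψ.obj X) H.u), H.unit, W'.unit_symmetry]

variable {E E' : Type*} [Category* E] [MonoidalCategory E] [SymmetricCategory E]
  [Category* E'] [MonoidalCategory E'] [SymmetricCategory E'] {I : E ⥤ C} {J : E' ⥤ C}
  (A : W.Realization I) (B : W'.Realization J) {G : E ⥤ E'}
  (θ : G ⋙ J ≅ I ⋙ Ψ)

/-- The image of a tensor product in terms of the tensor products of the images. -/
def source (X Y : E) : J.obj (G.obj X ⊗ G.obj Y) ⟶ Ψ.obj (W.obj (I.obj X) (I.obj Y)) :=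
  B.κ _ _ ≫ W'.wr (cmp θ X).hom _ ≫ W'.wl _ (cmp θ Y).hom ≫ H.φ _ _

lemma whiskerRight_source {P : E'} {X : E} (m : P ⟶ G.obj X) (Y : E) :
    J.map (m ▷ G.obj Y) ≫ H.source B θ X Y =
      B.κ _ _ ≫ W'.wr (J.map m ≫ (cmp θ X).hom) _ ≫ W'.wl _ (cmp θ Y).hom ≫ H.φ _ _ := by
  rw [source, reassoc_of% (B.κ_nat₁ m (G.obj Y)), W'.wr_comp, Category.assoc]

lemma whiskerLeft_source {P : E'} (X : E) {Y : E} (m : P ⟶ G.obj Y) :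
    J.map (G.obj X ◁ m) ≫ H.source B θ X Y =
      B.κ _ _ ≫ W'.wr (cmp θ X).hom _ ≫ W'.wl _ (J.map m ≫ (cmp θ Y).hom) ≫ H.φ _ _ := by
  rw [source, reassoc_of% (B.κ_nat₂ (G.obj X) m), W'.wl_comp, Category.assoc,
    reassoc_of% (W'.exchange (cmp θ X).hom (J.map m))]

lemma source_comp_wr {X : E} {Z : C} (g : I.obj X ⟶ Z) (Y : E) :
    H.source B θ X Y ≫ Ψ.map (W.wr g (I.obj Y)) =
      B.κ _ _ ≫ W'.wr ((cmp θ X).hom ≫ Ψ.map g) _ ≫ W'.wl _ (cmp θ Y).hom ≫ H.φ _ _ := by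
  rw [source, W'.wr_comp]
  simp only [Category.assoc]
  rw [← H.φ_nat₁, reassoc_of% (W'.exchange (Ψ.map g) (cmp θ Y).hom)]

lemma source_comp_wl (X : E) {Y : E} {Z : C} (g : I.obj Y ⟶ Z) :
    H.source B θ X Y ≫ Ψ.map (W.wl (I.obj X) g) =
      B.κ _ _ ≫ W'.wr (cmp θ X).hom _ ≫ W'.wl _ ((cmp θ Y).hom ≫ Ψ.map g) ≫ H.φ _ _ := by
  rw [source, W'.wl_comp]
  simp only [Category.assoc]
  rw [← H.φ_nat₂]

/-- The associativity axiom of `φ`, transported through the identification of the tensor product of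
`E'` with `W'`. The identifications `θ` are moved past `α` by its naturality in each of the three
variables. -/
lemma source_associativity (X Y Z : E) :
    J.map (α_ (G.obj X) (G.obj Y) (G.obj Z)).inv ≫
      B.κ _ _ ≫ W'.wr (H.source B θ X Y) _ ≫ W'.wl _ (cmp θ Z).hom ≫ H.φ _ _ =
    B.κ _ _ ≫ W'.wr (cmp θ X).hom _ ≫ W'.wl _ (H.source B θ Y Z) ≫ H.φ _ _ ≫
      Ψ.map (W.α _ _ _) := by
  simp only [source, W'.wr_comp, W'.wl_comp, Category.assoc]
  rw [reassoc_of% (B.associator_eq (G.obj X) (G.obj Y) (G.obj Z)),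
    ← reassoc_of% (W'.exchange (H.φ (I.obj X) (I.obj Y)) (cmp θ Z).hom),
    ← reassoc_of% (W'.α_nat₁ (cmp θ X).hom (J.obj (G.obj Y)) (J.obj (G.obj Z))),
    ← reassoc_of% (W'.α_nat₂ (Ψ.obj (I.obj X)) (cmp θ Y).hom (J.obj (G.obj Z))),
    ← reassoc_of% (W'.α_nat₃ (Ψ.obj (I.obj X)) (Ψ.obj (I.obj Y)) (cmp θ Z).hom),
    H.associativity, reassoc_of% (W'.exchange (cmp θ X).hom (B.κ (G.obj Y) (G.obj Z)))]

/-- The image of a tensor product. -/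
def target (X Y : E) : J.obj (G.obj (X ⊗ Y)) ≅ Ψ.obj (W.obj (I.obj X) (I.obj Y)) :=
  have := A.isIso_κ X Y
  cmp θ (X ⊗ Y) ≪≫ Ψ.mapIso (asIso (A.κ X Y))

lemma target_hom (X Y : E) : (target A θ X Y).hom = (cmp θ (X ⊗ Y)).hom ≫ Ψ.map (A.κ X Y) := rfl

lemma target_naturality_left {X X' : E} (f : X ⟶ X') (Y : E) :
    J.map (G.map (f ▷ Y)) ≫ (target A θ X' Y).hom =
      (target A θ X Y).hom ≫ Ψ.map (W.wr (I.map f) (I.obj Y)) := by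
  rw [target_hom, target_hom, reassoc_of% (cmp_naturality θ (f ▷ Y)), Category.assoc, ← Ψ.map_comp,
    ← Ψ.map_comp, A.κ_nat₁]

lemma target_naturality_right (X : E) {Y Y' : E} (g : Y ⟶ Y') :
    J.map (G.map (X ◁ g)) ≫ (target A θ X Y').hom =
      (target A θ X Y).hom ≫ Ψ.map (W.wl (I.obj X) (I.map g)) := by
  rw [target_hom, target_hom, reassoc_of% (cmp_naturality θ (X ◁ g)), Category.assoc,
    ← Ψ.map_comp, ← Ψ.map_comp, A.κ_nat₂]

variable [J.Full] [J.Faithful] (hφ : ∀ X Y : E, IsIso (H.φ (I.obj X) (I.obj Y)))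

/-- The structure isomorphism of the monoidal functor. -/
def muIso (X Y : E) : G.obj X ⊗ G.obj Y ≅ G.obj (X ⊗ Y) :=
  have := hφ X Y
  have := B.isIso_κ (G.obj X) (G.obj Y)
  J.preimageIso ((asIso (B.κ _ _) ≪≫ W'.wrIso (cmp θ X) _ ≪≫ W'.wlIso _ (cmp θ Y) ≪≫
    asIso (H.φ (I.obj X) (I.obj Y))) ≪≫ (target A θ X Y).symm)

/-- The defining property of the structure map. As `J` is faithful and `target` is invertible, each
monoidal axiom becomes an identity between composites of `source`, to be checked in `C`. -/
lemma map_muIso_hom (X Y : E) :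
    J.map (H.muIso A B θ hφ X Y).hom ≫ (target A θ X Y).hom = H.source B θ X Y := by
  rw [muIso, Functor.preimageIso_hom, J.map_preimage]
  rw [Iso.trans_hom, Category.assoc, Iso.symm_hom, Iso.inv_hom_id, Category.comp_id]
  rfl

lemma muIso_naturality_left {X X' : E} (f : X ⟶ X') (Y : E) :
    G.map f ▷ G.obj Y ≫ (H.muIso A B θ hφ X' Y).hom =
      (H.muIso A B θ hφ X Y).hom ≫ G.map (f ▷ Y) := by
  refine J.map_injective ((cancel_mono (target A θ X' Y).hom).1 ?_)
  rw [J.map_comp, J.map_comp, Category.assoc, Category.assoc, map_muIso_hom,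
    target_naturality_left, reassoc_of% (H.map_muIso_hom A B θ hφ X Y), whiskerRight_source,
    source_comp_wr, cmp_naturality]

lemma muIso_naturality_right (X : E) {Y Y' : E} (g : Y ⟶ Y') :
    G.obj X ◁ G.map g ≫ (H.muIso A B θ hφ X Y').hom =
      (H.muIso A B θ hφ X Y).hom ≫ G.map (X ◁ g) := by
  refine J.map_injective ((cancel_mono (target A θ X Y').hom).1 ?_)
  rw [J.map_comp, J.map_comp, Category.assoc, Category.assoc, map_muIso_hom,
    target_naturality_right, reassoc_of% (H.map_muIso_hom A B θ hφ X Y), whiskerLeft_source,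
    source_comp_wl, cmp_naturality]

/-- Iterating the structure map involves an inverse of `target`. Composing with the identification
`A.κ` cancels it, so that only the maps from `source` remain. -/
lemma source_comp_wr_κ (X Y Z : E) :
    J.map ((H.muIso A B θ hφ X Y).hom ▷ G.obj Z) ≫ H.source B θ (X ⊗ Y) Z ≫
      Ψ.map (W.wr (A.κ X Y) (I.obj Z)) =
    B.κ _ _ ≫ W'.wr (H.source B θ X Y) _ ≫ W'.wl _ (cmp θ Z).hom ≫ H.φ _ _ := by
  rw [source_comp_wr, ← target_hom, reassoc_of% (B.κ_nat₁ (H.muIso A B θ hφ X Y).hom (G.obj Z)),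
    ← reassoc_of% (W'.wr_comp (J.map (H.muIso A B θ hφ X Y).hom) (target A θ X Y).hom),
    map_muIso_hom]

lemma source_comp_wl_κ (X Y Z : E) :
    J.map (G.obj X ◁ (H.muIso A B θ hφ Y Z).hom) ≫ H.source B θ X (Y ⊗ Z) ≫
      Ψ.map (W.wl (I.obj X) (A.κ Y Z)) =
    B.κ _ _ ≫ W'.wr (cmp θ X).hom _ ≫ W'.wl _ (H.source B θ Y Z) ≫ H.φ _ _ := by
  rw [source_comp_wl, ← target_hom, reassoc_of% (B.κ_nat₂ (G.obj X) (H.muIso A B θ hφ Y Z).hom),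
    reassoc_of% (W'.exchange (cmp θ X).hom (J.map (H.muIso A B θ hφ Y Z).hom)),
    ← reassoc_of% (W'.wl_comp (Ψ.obj (I.obj X)) (J.map (H.muIso A B θ hφ Y Z).hom)
      (target A θ Y Z).hom), map_muIso_hom]

lemma muIso_associativity (X Y Z : E) :
    (H.muIso A B θ hφ X Y).hom ▷ G.obj Z ≫ (H.muIso A B θ hφ (X ⊗ Y) Z).hom ≫
      G.map (α_ X Y Z).hom =
    (α_ (G.obj X) (G.obj Y) (G.obj Z)).hom ≫ G.obj X ◁ (H.muIso A B θ hφ Y Z).hom ≫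
      (H.muIso A B θ hφ X (Y ⊗ Z)).hom := by
  have := A.isIso_κ X Y
  -- The hypotheses are phrased in terms of `α`, which corresponds to inverse associators, so
  -- associativity is first proved in the inverted form.
  have h : (α_ (G.obj X) (G.obj Y) (G.obj Z)).inv ≫ (H.muIso A B θ hφ X Y).hom ▷ G.obj Z ≫
      (H.muIso A B θ hφ (X ⊗ Y) Z).hom = G.obj X ◁ (H.muIso A B θ hφ Y Z).hom ≫
      (H.muIso A B θ hφ X (Y ⊗ Z)).hom ≫ G.map (α_ X Y Z).inv := by
    -- Both sides are compared in the image of the triple product for `W`; the map to it is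
    -- invertible, since `A.κ` is.
    refine J.map_injective ((cancel_mono ((target A θ (X ⊗ Y) Z).hom ≫
      (Ψ.mapIso (W.wrIso (asIso (A.κ X Y)) (I.obj Z))).hom)).1 ?_)
    change _ ≫ _ ≫ Ψ.map (W.wr (A.κ X Y) (I.obj Z)) = _ ≫ _ ≫ Ψ.map (W.wr (A.κ X Y) (I.obj Z))
    simp only [J.map_comp, Category.assoc]
    rw [reassoc_of% (H.map_muIso_hom A B θ hφ (X ⊗ Y) Z), source_comp_wr_κ, source_associativity,
      target_hom, Category.assoc, reassoc_of% (cmp_naturality θ (α_ X Y Z).inv), ← Ψ.map_comp,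
      ← Ψ.map_comp, A.associator_eq, Ψ.map_comp, Ψ.map_comp,
      ← reassoc_of% (target_hom A θ X (Y ⊗ Z)),
      reassoc_of% (H.map_muIso_hom A B θ hφ X (Y ⊗ Z)),
      reassoc_of% (H.source_comp_wl_κ A B θ hφ X Y Z)]
  rw [← Iso.inv_comp_eq, ← Category.assoc, ← Category.assoc, ← cancel_mono (G.map (α_ X Y Z).inv)]
  simp only [Category.assoc, ← G.map_comp, Iso.hom_inv_id, G.map_id, Category.comp_id]
  exact h

variable (ε : 𝟙_ E' ≅ G.obj (𝟙_ E))

/-- By `hε` the unit isomorphism is a lift of `u`, so the composite on the right involves exactly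
the terms of the unit axiom of `H`, which collapse to the left unitor of `W'`. -/
lemma muIso_left_unitality
    (hε : J.map ε.hom ≫ (cmp θ (𝟙_ E)).hom ≫ Ψ.map A.κ₁ = B.κ₁ ≫ H.u) (X : E) :
    (λ_ (G.obj X)).hom = ε.hom ▷ G.obj X ≫ (H.muIso A B θ hφ (𝟙_ E) X).hom ≫
      G.map (λ_ X).hom := by
  refine J.map_injective ((cancel_mono (cmp θ X).hom).1 ?_)
  simp only [J.map_comp, Category.assoc]
  rw [cmp_naturality, A.leftUnitor_eq, Ψ.map_comp, Ψ.map_comp,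
    ← reassoc_of% (target_hom A θ (𝟙_ E) X), reassoc_of% (H.map_muIso_hom A B θ hφ (𝟙_ E) X),
    reassoc_of% (H.source_comp_wr B θ A.κ₁ X), reassoc_of% (B.κ_nat₁ ε.hom (G.obj X)),
    ← reassoc_of% (W'.wr_comp (J.map ε.hom)), hε, B.leftUnitor_eq, W'.wr_comp, Category.assoc,
    Category.assoc, Category.assoc, ← W'.ℓ_nat, ← reassoc_of% (W'.exchange H.u (cmp θ X).hom),
    H.unit, ← reassoc_of% (W'.exchange B.κ₁ (cmp θ X).hom)]

lemma muIso_right_unitality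
    (hε : J.map ε.hom ≫ (cmp θ (𝟙_ E)).hom ≫ Ψ.map A.κ₁ = B.κ₁ ≫ H.u) (X : E) :
    (ρ_ (G.obj X)).hom = G.obj X ◁ ε.hom ≫ (H.muIso A B θ hφ X (𝟙_ E)).hom ≫
      G.map (ρ_ X).hom := by
  refine J.map_injective ((cancel_mono (cmp θ X).hom).1 ?_)
  simp only [J.map_comp, Category.assoc]
  rw [cmp_naturality, A.rightUnitor_eq, Ψ.map_comp, Ψ.map_comp,
    ← reassoc_of% (target_hom A θ X (𝟙_ E)), reassoc_of% (H.map_muIso_hom A B θ hφ X (𝟙_ E)),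
    reassoc_of% (H.source_comp_wl B θ X A.κ₁), reassoc_of% (B.κ_nat₂ (G.obj X) ε.hom),
    reassoc_of% (W'.exchange (cmp θ X).hom (J.map ε.hom)),
    ← reassoc_of% (W'.wl_comp (Ψ.obj (I.obj X)) (J.map ε.hom)), hε, B.rightUnitor_eq, W'.wl_comp,
    Category.assoc, Category.assoc, Category.assoc, ← W'.r_nat, H.unit_right,
    reassoc_of% (W'.exchange (cmp θ X).hom B.κ₁)]

lemma muIso_braiding (X Y : E) :
    (H.muIso A B θ hφ X Y).hom ≫ G.map (β_ X Y).hom =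
      (β_ (G.obj X) (G.obj Y)).hom ≫ (H.muIso A B θ hφ Y X).hom := by
  refine J.map_injective ((cancel_mono (target A θ Y X).hom).1 ?_)
  simp only [J.map_comp, Category.assoc]
  rw [map_muIso_hom, target_hom, reassoc_of% (cmp_naturality θ (β_ X Y).hom), ← Ψ.map_comp,
    A.braiding_eq, Ψ.map_comp, ← reassoc_of% (target_hom A θ X Y),
    reassoc_of% (H.map_muIso_hom A B θ hφ X Y), source, source, reassoc_of% (B.braiding_eq),
    Category.assoc, Category.assoc, Category.assoc, H.symmetry,
    reassoc_of% (W'.c_nat₂), reassoc_of% (W'.c_nat₁), reassoc_of% (W'.exchange)]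

/-- The functor `G` is symmetric monoidal. -/
@[reducible]
def braided (hε : J.map ε.hom ≫ (cmp θ (𝟙_ E)).hom ≫ Ψ.map A.κ₁ = B.κ₁ ≫ H.u) :
    G.Braided where
  toMonoidal := Functor.CoreMonoidal.toMonoidal
    { εIso := ε
      μIso := H.muIso A B θ hφ
      μIso_hom_natural_left := H.muIso_naturality_left A B θ hφ
      μIso_hom_natural_right := fun X g => H.muIso_naturality_right A B θ hφ X g
      associativity := H.muIso_associativity A B θ hφ
      left_unitality := H.muIso_left_unitality A B θ hφ ε hε
      right_unitality := H.muIso_right_unitality A B θ hφ ε hε }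
  braided := H.muIso_braiding A B θ hφ

end TensorFunctor

end LaxTensor

end

/-! ### The induced tensor triangulated functor -/

section

open MonoidalCategory Pretriangulated

namespace PseudoDGTensorFunctor

variable {S S' : PseudoDGTensorStructure k T} (F : PseudoDGTensorFunctor S S')

section

variable {X X' Y Y' : DGMod k T}

def tmap (f : X ⟶ X') : tensor X F.Φ ⟶ tensor X' F.Φ := (tens F.Φ).mapHom f

lemma f_mapL (f : X ⟶ X') (Y : DGMod k T) :
    S'.Γ.mapL (F.tmap f) (tensor Y F.Φ) ≫ F.f X' Y = F.f X Y ≫ F.tmap (S.Γ.mapL f Y) :=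
  ((congrArg (· ≫ F.f X' Y) (DGFunctor.comp_mapHom (tens F.Φ) (S'.Γ.prodL _) f)).symm.trans
    ((F.f_nat₁ Y).mapHom_comp f)).trans (congrArg (F.f X Y ≫ ·)
      (DGFunctor.comp_mapHom (S.Γ.prodL Y) (tens F.Φ) f))

lemma f_mapR (X : DGMod k T) (g : Y ⟶ Y') :
    S'.Γ.mapR (tensor X F.Φ) (F.tmap g) ≫ F.f X Y' = F.f X Y ≫ F.tmap (S.Γ.mapR X g) :=
  ((congrArg (· ≫ F.f X Y') (DGFunctor.comp_mapHom (tens F.Φ) (S'.Γ.prodR _) g)).symm.trans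
    ((F.f_nat₂ X).mapHom_comp g)).trans (congrArg (F.f X Y ≫ ·)
      (DGFunctor.comp_mapHom (S.Γ.prodR X) (tens F.Φ) g))

end

/-- The functor on the homotopy category given by `Φ`. -/
def tensorFunctor : S.laxTensor.TensorFunctor S'.laxTensor (tens F.Φ).onHo where
  φ X Y := hoMk (F.f X.as Y.as)
  φ_nat₁ f Y := by
    obtain ⟨f, rfl⟩ := hoMk_surjective f
    exact hoMk_square (F.f_mapL f Y.as)
  φ_nat₂ X _ _ g := by
    obtain ⟨g, rfl⟩ := hoMk_surjective g
    exact hoMk_square (F.f_mapR X.as g)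
  u := hoMk F.u
  unit X := by
    obtain ⟨w, -, h⟩ := F.unit
    exact hoMk_eq_of_isHomotopy (h X.as)
  symmetry X Y := by
    obtain ⟨w, -, -, h⟩ := F.symmetry
    exact hoMk_eq_of_isHomotopy (h X.as Y.as)
  associativity X Y Z := by
    obtain ⟨w, -, -, -, h⟩ := F.associativity
    exact hoMk_eq_of_isHomotopy (h X.as Y.as Z.as)

end PseudoDGTensorFunctor

namespace InducedTTC

variable {S S' : PseudoDGTensorStructure k T} (A : InducedTTC S)

def incl : A.Cat ⥤ HoMod k T := (perf k T).ι

instance : A.incl.Full := inferInstanceAs (perf k T).ι.Full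

instance : A.incl.Faithful := inferInstanceAs (perf k T).ι.Faithful

instance : A.incl.Additive := inferInstanceAs (perf k T).ι.Additive

instance : A.incl.Linear k := inferInstanceAs ((perf k T).ι.Linear k)

/-- The unit. -/
def unit : A.Cat := 𝟙_ A.Cat

lemma incl_mem (X : A.Cat) : cof k T (A.incl.obj X) :=
  (ObjectProperty.FullSubcategory.property (P := perf k T) X).1

lemma incl_associator_inv (X Y Z : A.Cat) :
    A.incl.map (α_ X Y Z).inv ≫ (toHo k T).map (A.κ (X ⊗ Y : A.Cat) Z) ≫
      (toHo k T).map ((S.Γ.prodL Z.mod).toFunctor.map (A.κ X Y)) =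
    (toHo k T).map (A.κ X (Y ⊗ Z : A.Cat)) ≫
      (toHo k T).map ((S.Γ.prodR X.mod).toFunctor.map (A.κ Y Z)) ≫
        (toHo k T).map (S.α X.mod Y.mod Z.mod) :=
  ((congrArg (_ ≫ ·) ((toHo k T).map_comp _ _)).symm.trans (A.associator_eq X Y Z).symm).trans
    (toHo_map_comp₃ _ _ _)

lemma incl_leftUnitor_hom (X : A.Cat) : A.incl.map (λ_ X).hom =
    (toHo k T).map (A.κ (𝟙_ A.Cat) X) ≫
      (toHo k T).map ((S.Γ.prodL X.mod).toFunctor.map A.κ₁) ≫ (toHo k T).map (S.ℓ X.mod) :=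
  (A.leftUnitor_eq X).symm.trans (toHo_map_comp₃ _ _ _)

lemma incl_rightUnitor_hom (X : A.Cat) : A.incl.map (ρ_ X).hom =
    (toHo k T).map (A.κ X (𝟙_ A.Cat)) ≫
      (toHo k T).map ((S.Γ.prodR X.mod).toFunctor.map A.κ₁) ≫ (toHo k T).map (S.r X.mod) :=
  (A.rightUnitor_eq X).symm.trans (toHo_map_comp₃ _ _ _)

lemma incl_braiding_hom (X Y : A.Cat) : A.incl.map (β_ X Y).hom ≫ (toHo k T).map (A.κ Y X) =
    (toHo k T).map (A.κ X Y) ≫ (toHo k T).map (S.c X.mod Y.mod) :=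
  (A.braiding_eq X Y).symm.trans ((toHo k T).map_comp _ _)

/-- The identification of the tensor product with `S`. -/
def realization (hT : IsLocallyCofibrant k T) (hS : S.IsPerfect) :
    S.laxTensor.Realization A.incl where
  κ X Y := hoMk (A.κ X Y)
  isIso_κ X Y := isIso_hoMk (A.κ_iso X Y) (A.incl_mem (X ⊗ Y))
    (hS.cofibrant.prod hT (A.incl_mem X) (A.incl_mem Y))
  κ_nat₁ f Y := (A.κ_nat₁ f Y).symm
  κ_nat₂ X _ _ g := (A.κ_nat₂ X g).symm
  κ₁ := hoMk A.κ₁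
  associator_eq := A.incl_associator_inv
  leftUnitor_eq := A.incl_leftUnitor_hom
  rightUnitor_eq := A.incl_rightUnitor_hom
  braiding_eq := A.incl_braiding_hom

end InducedTTC

namespace PseudoDGTensorFunctor

variable {S S' : PseudoDGTensorStructure k T} (F : PseudoDGTensorFunctor S S')
  (A : InducedTTC S) (B : InducedTTC S')

/-- A perfect replacement of `X ⊗ Φ`. -/
def tensObj (X : A.Cat) : B.Cat :=
  (⟨⟨(F.perfect X.mod X.property).choose⟩,
    (F.perfect X.mod X.property).choose_spec.choose_spec.1⟩ : H0pe k T)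

def tensMap (X : A.Cat) : (F.tensObj A B X).mod ⟶ tensor X.mod F.Φ :=
  (F.perfect X.mod X.property).choose_spec.choose

lemma isQuasiIso_tensMap (X : A.Cat) : IsQuasiIso (F.tensMap A B X) :=
  (F.perfect X.mod X.property).choose_spec.choose_spec.2

variable (hT : IsLocallyCofibrant k T)

def tensIso (X : A.Cat) : B.incl.obj (F.tensObj A B X) ≅ (tens F.Φ).onHo.obj (A.incl.obj X) :=
  have : IsIso (hoMk (X := B.incl.obj (F.tensObj A B X))
      (Y := (tens F.Φ).onHo.obj (A.incl.obj X)) (F.tensMap A B X)) :=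
    isIso_hoMk (F.isQuasiIso_tensMap A B X) (B.incl_mem _)
      (IsCofibrant.tensor hT (A.incl_mem X) F.cofibrant)
  asIso (hoMk (X := B.incl.obj (F.tensObj A B X))
    (Y := (tens F.Φ).onHo.obj (A.incl.obj X)) (F.tensMap A B X))

/-- The functor induced by `Φ` on perfect modules. -/
def functor : A.Cat ⥤ B.Cat where
  obj := F.tensObj A B
  map {X Y} f := B.incl.preimage ((F.tensIso A B hT X).hom ≫
    (tens F.Φ).onHo.map (A.incl.map f) ≫ (F.tensIso A B hT Y).inv)
  map_id X := B.incl.map_injective (by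
    rw [B.incl.map_preimage]
    simp)
  map_comp f g := B.incl.map_injective (by
    simp only [CategoryTheory.Functor.map_comp, B.incl.map_preimage, Category.assoc,
      Iso.inv_hom_id_assoc])

/-- The functor is the restriction of `- ⊗ Φ` up to resolutions, and inherits additivity, linearity
and exactness along this isomorphism. -/
def functorIso : F.functor A B hT ⋙ B.incl ≅ A.incl ⋙ (tens F.Φ).onHo :=
  NatIso.ofComponents (F.tensIso A B hT) (fun {X Y} f => by
    refine (congrArg (· ≫ _) (B.incl.map_preimage _)).trans ?_
    simp
    rfl)

lemma functor_additive : (F.functor A B hT).Additive := by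
  have := Functor.additive_of_iso (F.functorIso A B hT).symm
  exact Functor.additive_of_comp_faithful _ B.incl

lemma functor_linear : (F.functor A B hT).Linear k := by
  have := Functor.linear_of_iso k (F.functorIso A B hT).symm
  exact ⟨fun f r => B.incl.map_injective (((F.functor A B hT ⋙ B.incl).map_smul r f).trans
    (B.incl.map_smul r ((F.functor A B hT).map f)).symm)⟩

lemma functor_isTriangulated :
    ∃ _ : (F.functor A B hT).CommShift ℤ, (F.functor A B hT).IsTriangulated := by
  have h := exists_isTriangulated_of_iso (perf k T) _ (F.functor A B hT) (F.functorIso A B hT)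
  obtain ⟨c, h⟩ := h
  let c' : (F.functor A B hT).CommShift ℤ := c
  -- The triangulations of `A` and `B` are arbitrary as data, but both have the mapping cone
  -- triangles as distinguished triangles, so exactness for the standard triangulation carries over.
  exact ⟨c', ⟨fun τ hτ => (Set.ext_iff.1 B.distinguished_eq _).2
    (h.map_distinguished τ ((Set.ext_iff.1 A.distinguished_eq τ).1 hτ))⟩⟩

/-- The map `f` is a quasi-isomorphism here, and source and target are cofibrant because all the
bimodules involved are. -/
lemma isIso_φ (hT : IsLocallyCofibrant k T) (hS : S.IsPerfect) (hS' : S'.IsPerfect) (X Y : A.Cat) :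
    IsIso (F.tensorFunctor.φ (A.incl.obj X) (A.incl.obj Y)) :=
  isIso_hoMk (F.f_iso _ _ (A.incl_mem X) (A.incl_mem Y))
    (hS'.cofibrant.prod hT (IsCofibrant.tensor hT (A.incl_mem X) F.cofibrant)
      (IsCofibrant.tensor hT (A.incl_mem Y) F.cofibrant))
    (IsCofibrant.tensor hT (hS.cofibrant.prod hT (A.incl_mem X) (A.incl_mem Y)) F.cofibrant)

/-- The unit of `B` as a resolution of `U ⊗ Φ`. -/
def resB : B.unit.mod ⟶ tensor S.U F.Φ := B.κ₁ ≫ F.u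

/-- The image of the unit of `A` as a resolution of `U ⊗ Φ`. -/
def resA : (F.tensObj A B A.unit).mod ⟶ tensor S.U F.Φ :=
  F.tensMap A B A.unit ≫ F.tmap A.κ₁

/-- Both `resA` and `resB` are quasi-isomorphisms from perfect modules to `U ⊗ Φ`; for `resA` this
uses flatness of `Φ`. The target need not be cofibrant, so neither map can simply be inverted, but
each source has the same maps into the other source as into `U ⊗ Φ`, which makes resolutions unique
up to unique isomorphism. -/
lemma exists_unitIso (hT : IsLocallyCofibrant k T) : ∃ ε : B.unit ≅ F.tensObj A B A.unit,
    B.incl.map ε.hom ≫ (toHo k T).map (F.resA A B) = (toHo k T).map (F.resB B) := by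
  have hA : IsQuasiIso (F.resA A B) := PseudoDGTensorStructure.isQuasiIso_comp (F.isQuasiIso_tensMap A B _)
    (Bimod.IsCofibrant.isQuasiIso_map hT F.cofibrant A.κ₁_iso)
  have hB : IsQuasiIso (F.resB B) := PseudoDGTensorStructure.isQuasiIso_comp B.κ₁_iso F.u_iso
  obtain ⟨a, ha⟩ := (cof.comp_bijective (B.incl_mem B.unit) hA).2 ((toHo k T).map (F.resB B))
  obtain ⟨b, hb⟩ := (cof.comp_bijective (B.incl_mem (F.tensObj A B A.unit)) hB).2
    ((toHo k T).map (F.resA A B))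
  -- Both composites are compatible with the resolutions, hence are identities by uniqueness of
  -- lifts.
  have hab : a ≫ b = 𝟙 _ := (cof.comp_bijective (B.incl_mem B.unit) hB).1
    (((Category.assoc _ _ _).trans ((congrArg (a ≫ ·) hb).trans ha)).trans
      (Category.id_comp _).symm)
  have hba : b ≫ a = 𝟙 _ := (cof.comp_bijective (B.incl_mem (F.tensObj A B A.unit)) hA).1
    (((Category.assoc _ _ _).trans ((congrArg (b ≫ ·) ha).trans hb)).trans
      (Category.id_comp _).symm)
  exact ⟨B.incl.preimageIso ⟨a, b, hab, hba⟩,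
    (congrArg (· ≫ _) (B.incl.map_preimage _)).trans ha⟩

end PseudoDGTensorFunctor

end

/-! ### Assembly of the tensor triangulated functor -/

section

open MonoidalCategory

namespace PseudoDGTensorFunctor

variable {S S' : PseudoDGTensorStructure k T} (F : PseudoDGTensorFunctor S S')
  (A : InducedTTC S) (B : InducedTTC S') (hT : IsLocallyCofibrant k T)

/-- The unit isomorphism of the functor induced by `Φ`. -/
def unitIso : 𝟙_ B.Cat ≅ (F.functor A B hT).obj (𝟙_ A.Cat) := (F.exists_unitIso A B hT).choose

lemma map_unitIso_hom : B.incl.map (F.unitIso A B hT).hom ≫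
    (toHo k T).map (F.resA A B) = (toHo k T).map (F.resB B) :=
  (F.exists_unitIso A B hT).choose_spec

variable (hS : S.IsPerfect) (hS' : S'.IsPerfect)

/-- The compatibility of the unit isomorphism with the two resolutions, in the form required by
`TensorFunctor.braided`. -/
lemma unitIso_compatibility : B.incl.map (F.unitIso A B hT).hom ≫
    (cmp (F.functorIso A B hT) (𝟙_ A.Cat)).hom ≫
      (tens F.Φ).onHo.map (A.realization hT hS).κ₁ =
    (B.realization hT hS').κ₁ ≫ F.tensorFunctor.u :=
  (congrArg (_ ≫ ·) ((toHo k T).map_comp _ _)).symm.trans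
    ((F.map_unitIso_hom A B hT).trans ((toHo k T).map_comp _ _))

/-- The tensor triangulated functor induced by a pseudo dg tensor functor. -/
def ttFunctor : InducedTTFunctor F A B where
  functor := F.functor A B hT
  additive := F.functor_additive A B hT
  linear := F.functor_linear A B hT
  commShift := (F.functor_isTriangulated A B hT).choose
  isTriangulated := (F.functor_isTriangulated A B hT).choose_spec
  braided := F.tensorFunctor.braided (A.realization hT hS) (B.realization hT hS')
    (F.functorIso A B hT) (F.isIso_φ A hT hS hS') (F.unitIso A B hT)
    (F.unitIso_compatibility A B hT hS hS')
  θ := F.tensMap A B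
  θ_iso := F.isQuasiIso_tensMap A B
  θ_nat f := (cmp_naturality (F.functorIso A B hT) f).symm
  μ_eq X Y := by
    have h := F.tensorFunctor.map_muIso_hom (A.realization hT hS) (B.realization hT hS')
      (F.functorIso A B hT) (F.isIso_φ A hT hS hS') X Y
    refine (((toHo k T).map_comp _ _).trans (congrArg (_ ≫ ·) (((toHo k T).map_comp _ _).trans
      (congrArg (_ ≫ ·) ((toHo k T).map_comp _ _))))).trans (h.symm.trans ?_)
    exact congrArg (_ ≫ ·) ((toHo k T).map_comp _ _).symm
  ε_eq := (F.map_unitIso_hom A B hT).symm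

end PseudoDGTensorFunctor

end

end

end DG

theorem mainTheorem5 {k : Type u} [CommRing k] {T : Type u} [DG.DGCategory k T]
    (hT : DG.IsLocallyCofibrant k T) (S S' : DG.PseudoDGTensorStructure k T)
    (hS : S.IsPerfect) (hS' : S'.IsPerfect) (F : DG.PseudoDGTensorFunctor S S') :
    Nonempty (DG.InducedTTC S) ∧ Nonempty (DG.InducedTTC S') ∧
      ∀ (A : DG.InducedTTC S) (B : DG.InducedTTC S'),
        Nonempty (DG.InducedTTFunctor F A B) :=
  ⟨⟨hS.ttc hT⟩, ⟨hS'.ttc hT⟩, fun A B => ⟨F.ttFunctor A B hT hS hS'⟩⟩
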